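/- Let $F$ be a non-archimedean local field with normalized valuation $v$, ring of integers $\mathcal O_F$, residue field of cardinality $q$ and uniformizer $\varpi$. Let $E/F$ be a separable quadratic field extension, with conjugation $a\mapsto\bar a$, norm $\mathrm{Nm}$, normalized valuation $v_E$, normalized absolute value $|\cdot|_E$ and maximal ideal $\mathfrak p_E$. Let $\eta$ be the quadratic character of $F^\times$ with kernel $\mathrm{Nm}(E^\times)$, $\Omega$ a continuous character of $E^\times$ with values in $\mathbb C^\times$, and $\omega=\Omega|_{F^\times}$. Fix Haar measures on $F^\times$ and $E^\times$, and give quotients the quotient measures. Let $\varepsilon_0=\varpi$ if $E/F$ is unramified, and let $\varepsilon_0\in\mathcal O_F^\times\setminus\mathrm{Nm}(E^\times)$ if $E/F$ is ramified. Let $\{\varepsilon,\varepsilon'\}=\{1,\varepsilon_0\}$ (in either order). For $\epsilon\in\{\varepsilon,\varepsilon'\}$ let $G_\epsilon=\left\{\begin{pmatrix}a&b\epsilon\\ \bar b&\bar a\end{pmatrix}\right\}\subset \mathrm{GL}_2(E)$ be the unit group of the quaternion algebra $E\oplus Ej$, $j^2=\epsilon$, $jz=\bar zj$. Let $Z_\epsilon\cong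 F^\times$ be its center, $T_\epsilon\cong E^\times$ its diagonal torus, $K_\epsilon=G_\epsilon\cap\mathrm{GL}_2(\mathcal O_E)$, and $K_{\epsilon,n}\subset K_\epsilon$ the subgroup of matrices congruent to $1$ modulo $\mathfrak p_E^n$. For $g=a+bj$ put $\mathrm{inv}'(g)=\epsilon\,\mathrm{Nm}(b)/\det g$. For $x=\epsilon\,\mathrm{Nm}(b)\neq1$ with $b\in E^\times$ put $\delta(x)=1+bj$. For a function $\phi$ on $G_\epsilon$ (or on $G_\epsilon\setminus T_\epsilon$) put $$\mathcal O(x,\phi)=\int_{T_\epsilon/Z_\epsilon}\int_{T_\epsilon}\phi(t_1^{-1}\delta(x)t_2)\,\Omega(t_1)\Omega^{-1}(t_2)\,dt_2\,dt_1 .$$ Let $\mathcal S$ be the space of invertible Hermitian $2\times2$ matrices over $E$, $w=\begin{pmatrix}0&1\\1&0\end{pmatrix}$, and $H_0\subset G=\mathrm{GL}_2(E)$ the stabilizer of $w$ under $g\cdot s=gs\bar g^t$, with a Haar measure. For $f\in C_c^\infty(G)$ let $\Phi_f\in C_c^\infty(\mathcal S)$ be supported on $G\cdot w$ with $\Phi_f(gw\bar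 g^t)=\int_{H_0}f(gh)\,dh$. For $x\in F^\times\setminus\{1\}$ and $s\in\mathbb C$ let $$\mathcal O(s,x,\Phi_f)=\int_{E^\times}\int_{F^\times}\Phi_f\begin{pmatrix}za\bar ax&za\\ z\bar a&z\end{pmatrix}\eta\omega^{-1}(z)\,\Omega^{-1}(a)\,|a|_E^s\,dz\,da ,$$ and let $\mathcal O'(0,x,\Phi_f)$ be its derivative in $s$ at $s=0$. We say that $f$ purely matches $f_\varepsilon\in C_c^\infty(G_\varepsilon)$ if $\mathcal O(0,x,\Phi_f)=\mathcal O(x,f_\varepsilon)$ for $x\in\varepsilon\mathrm{Nm}(E^\times)\setminus\{1\}$ and $\mathcal O(0,x,\Phi_f)=0$ for $x\in\varepsilon'\mathrm{Nm}(E^\times)\setminus\{1\}$. For an open compact subgroup $U\subset K_\varepsilon$ let $G_{\varepsilon',0}=\{g\in G_{\varepsilon'}:\det g\in\det U\}$. A special multiplicity function of level $U$ is a function $m$ on $G_{\varepsilon'}\setminus T_{\varepsilon'}$, supported on $G_{\varepsilon',0}\setminus T_{\varepsilon'}$, such that: (a) there is an open compact subgroup $U'\subset G_{\varepsilon',0}$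 with $U'\cap T_{\varepsilon'}=U\cap T_\varepsilon$ in $E^\times$ such that $m(g)-\frac{v(\mathrm{inv}'(g))}{2}1_{U'}(g)$ extends to a locally constant function on $G_{\varepsilon',0}$; (b) if $\varepsilon'\ne1$, then $m(g)\neq0$ only if $\det g\in\det U$; (c) if $\varepsilon'=1$, then $m(g)\ne0$ only if $g\in K_{\varepsilon'}$. For $x\in\varepsilon'\mathrm{Nm}(E^\times)\setminus\{1\}$ put $i(\delta(x),1_U)=\mathcal O(x,m)$. **(1)** For all sufficiently large integers $n$ (depending on the data fixed in the first paragraph), with $U=K_{\varepsilon,n}$, the following holds. There exists $f\in C_c^\infty(G)$ that purely matches $1_U$. For every such $f$ and every special multiplicity function $m$ of level $U$, there is $\bar f\in C_c^\infty(G_{\varepsilon'})$ such that for all $x\in\varepsilon'\mathrm{Nm}(E^\times)\setminus\{1\}$ the integral $i(\delta(x),1_U)$ converges absolutely, $\mathcal O(s,x,\Phi_f)$ is complex differentiable at $s=0$, and $$2\,i(\delta(x),1_U)\cdot(-\log q)=\mathcal O'(0,x,\Phi_f)+\mathcal O(x,\bar f).$$ **(2)** Let $\varepsilon=\varepsilon_0$,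 $\varepsilon'=1$, and assume $\Omega(\varpi)=1$. For all sufficiently large $n$, put $U=K_{\varepsilon,n}\varpi^{\mathbb Z}$ and $\Xi=U\cap Z_\varepsilon$. Let $\mathcal O_\Xi$ be defined like $\mathcal O$ with the inner integral over $T_\epsilon/\Xi$, and define pure matching with $1_U\in C_c^\infty(G_\varepsilon/\Xi)$ using $\mathcal O_\Xi(x,1_U)$. There exists $f\in C_c^\infty(G)$ that purely matches $1_U$. Let $f$ be any such function, and let $m$ be any $\Xi$-invariant function on $G_{\varepsilon'}\setminus T_{\varepsilon'}$ that vanishes outside a compact-modulo-center subgroup of $G_{\varepsilon',0}$ and satisfies (a) with "compact" replaced by "compact modulo the center". Then there is $\bar f\in C_c^\infty(G_{\varepsilon'}/\Xi)$ such that for all $x\in\varepsilon'\mathrm{Nm}(E^\times)\setminus\{1\}$ the integral $i(\delta(x),1_U):=\mathcal O_\Xi(x,m)$ converges absolutely, $\mathcal O(s,x,\Phi_f)$ is complex differentiable at $s=0$, and $$2\,i(\delta(x),1_U)\cdot(-\log q)=\mathcal O'(0,x,\Phi_f)+\mathcal O_\Xi(x,\bar f).$$ -/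

import Mathlib

open ValuativeRel Matrix MeasureTheory
open scoped MatrixGroups

namespace ArithMatching

noncomputable section

/-! ### Local fields -/

section LocalField

variable {K : Type*} [Field K] [ValuativeRel K] [TopologicalSpace K]
  [IsNonarchimedeanLocalField K]

/-- The discrete valuation of a non-archimedean local field, normalized so that uniformizers have
valuation `1` (only used at nonzero elements). -/
def ord (x : K) : ℤ :=
  -WithZero.log (IsNonarchimedeanLocalField.valueGroupWithZeroIsoInt K (valuation K x))

variable (K) in
/-- The cardinality `q_K` of the residue field. -/
def resCard : ℕ := Nat.card 𝓀[K]

/-- The normalized absolute value `|x|_K = q_K ^ (-v_K(x))` (only used at nonzero elements). -/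
def normAbs (x : K) : ℝ := (resCard K : ℝ) ^ (-ord x)

variable (K) in
/-- The `n`-th power of the maximal ideal of the ring of integers. -/
def maxPow (n : ℕ) : Set K := {x | x = 0 ∨ (n : ℤ) ≤ ord x}

end LocalField

/-! ### Smooth functions -/

/-- `C_c^∞(X)`: locally constant complex functions of compact support. -/
def IsSmoothCompact {X : Type*} [TopologicalSpace X] (f : X → ℂ) : Prop :=
  IsLocallyConstant f ∧ HasCompactSupport f

/-! ### Quadratic extensions -/

section Quadratic

variable (F E : Type*) [Field F] [Field E] [Algebra F E] [Algebra.IsQuadraticExtension F E]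
  [Algebra.IsSeparable F E]

theorem exists_conj : ∃ τ : E ≃ₐ[F] E, τ ≠ 1 := by
  have h : Nat.card (E ≃ₐ[F] E) = 2 := by
    rw [IsGalois.card_aut_eq_finrank, Algebra.IsQuadraticExtension.finrank_eq_two]
  have : Nontrivial (E ≃ₐ[F] E) := by
    have : Finite (E ≃ₐ[F] E) := Nat.finite_of_card_ne_zero (by omega)
    exact Finite.one_lt_card_iff_nontrivial.mp (by omega)
  exact exists_ne 1

/-- The nontrivial automorphism `a ↦ ā` of `E` over `F`. -/
def conj : E ≃ₐ[F] E := (exists_conj F E).choose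

theorem conj_ne_one : conj F E ≠ 1 := (exists_conj F E).choose_spec

theorem conj_conj (a : E) : conj F E (conj F E a) = a := by
  have h : Nat.card (E ≃ₐ[F] E) = 2 := by
    rw [IsGalois.card_aut_eq_finrank, Algebra.IsQuadraticExtension.finrank_eq_two]
  have h2 : conj F E ^ 2 = 1 := by rw [← h]; exact pow_card_eq_one'
  have h3 := congrArg (fun τ : E ≃ₐ[F] E => τ a) h2
  simpa [pow_two] using h3

theorem norm_eq_mul_conj (a : E) : algebraMap F E (Algebra.norm F a) = a * conj F E a := by
  classical
  have hc : Fintype.card (E ≃ₐ[F] E) = 2 := by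
    rw [← Nat.card_eq_fintype_card, IsGalois.card_aut_eq_finrank,
      Algebra.IsQuadraticExtension.finrank_eq_two]
  have hu : (Finset.univ : Finset (E ≃ₐ[F] E)) = {1, conj F E} := by
    symm
    apply Finset.eq_univ_of_card
    rw [hc, Finset.card_pair (conj_ne_one F E).symm]
  rw [Algebra.norm_eq_prod_automorphisms, hu, Finset.prod_pair (conj_ne_one F E).symm]
  rfl

open Classical in
/-- The quadratic character `η` of `Fˣ` attached to `E/F`: it is `1` on norms from `Eˣ` and `-1` on
the other elements. -/
def eta (z : Fˣ) : ℂ := if ∃ a : Eˣ, Algebra.norm F (a : E) = z then 1 else -1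

/-- The inclusion of `Fˣ` into `Eˣ`. -/
def incl : Fˣ →* Eˣ := Units.map (algebraMap F E).toMonoidHom

/-! ### The groups `G_ε` -/

/-- `G_ε`: the unit group of the quaternion algebra `E ⊕ E j`, `j² = ε`, `j z = z̄ j`, realized in
`GL₂(E)` by `a + b j ↦ [a, bε; b̄, ā]`. -/
def quat (ε : Fˣ) : Subgroup (GL (Fin 2) E) where
  carrier := {g | g.val 1 1 = conj F E (g.val 0 0) ∧
    g.val 0 1 = conj F E (g.val 1 0) * algebraMap F E ε}
  one_mem' := by simp
  mul_mem' := by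
    rintro g h ⟨hg1, hg2⟩ ⟨hh1, hh2⟩
    constructor
    · simp only [Units.val_mul, Matrix.mul_apply, Fin.sum_univ_two, hg1, hg2, hh1, hh2, map_add,
        map_mul, conj_conj, AlgEquiv.commutes]
      ring
    · simp only [Units.val_mul, Matrix.mul_apply, Fin.sum_univ_two, hg1, hg2, hh1, hh2, map_add,
        map_mul, conj_conj]
      ring
  inv_mem' := by
    rintro g ⟨hg1, hg2⟩
    have hg0 : g.val 0 0 = conj F E (g.val 1 1) := by rw [hg1, conj_conj]
    have hd : conj F E g.val.det = g.val.det := by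
      rw [Matrix.det_fin_two, hg1, hg2]
      simp only [map_sub, map_mul, conj_conj, AlgEquiv.commutes]
      ring
    have hi : ∀ i j, (g⁻¹).val i j = (g.val.det)⁻¹ * g.val.adjugate i j := by
      intro i j
      rw [Matrix.coe_units_inv, Matrix.inv_def]
      simp [Ring.inverse_eq_inv']
    constructor
    · rw [hi, hi, map_mul, map_inv₀, hd, Matrix.adjugate_fin_two]
      simp [hg0]
    · rw [hi, hi, map_mul, map_inv₀, hd, Matrix.adjugate_fin_two]
      simp [hg2]
      ring

variable {F E}

/-- The element `a + b j` of `G_ε`, where `Nm a - Nm b · ε ≠ 0`. -/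
def mkQuat (ε : Fˣ) (a b : E) (h : Algebra.norm F a - Algebra.norm F b * ε ≠ 0) : quat F E ε :=
  ⟨Matrix.GeneralLinearGroup.mkOfDetNeZero
    !![a, b * algebraMap F E ε; conj F E b, conj F E a] (by
      have := (map_ne_zero (algebraMap F E)).mpr h
      rw [map_sub, map_mul, norm_eq_mul_conj, norm_eq_mul_conj] at this
      rw [Matrix.det_fin_two_of]
      intro h0
      exact this (by rw [← h0]; ring)), by
    constructor <;> simp [Matrix.GeneralLinearGroup.mkOfDetNeZero, conj_conj]⟩

/-- The torus `T_ε ≅ Eˣ` in `G_ε`: the element `diag(t, t̄)`. -/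
def torus (ε : Fˣ) (t : Eˣ) : quat F E ε :=
  mkQuat ε (t : E) 0 (by simp)

/-- The subset `T_ε` of `G_ε`. -/
def torusSet (ε : Fˣ) : Set (quat F E ε) := Set.range (torus ε)

/-- The element of the center `Z_ε ≅ Fˣ` of `G_ε` given by `z`. -/
def central (ε : Fˣ) (z : Fˣ) : quat F E ε := torus ε (incl F E z)

/-- `δ(x) = 1 + b j` for `x = ε Nm(b) ≠ 1`. -/
def delta (ε : Fˣ) (b : Eˣ) (h : (ε : F) * Algebra.norm F (b : E) ≠ 1) : quat F E ε :=
  mkQuat ε 1 (b : E) (by rw [map_one, mul_comm]; exact sub_ne_zero.mpr h.symm)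

/-- The invariant `inv'(a + b j) = ε Nm(b) / Nm(a + b j)`, where `Nm(a + b j) = Nm a - ε Nm b`.
Recall that `a` and `b̄` are the entries in the first column. -/
def invPrime {ε : Fˣ} (g : quat F E ε) : F :=
  ε * Algebra.norm F (g.val.val 1 0) /
    (Algebra.norm F (g.val.val 0 0) - ε * Algebra.norm F (g.val.val 1 0))

/-- `{g ∈ G_ε' : det g ∈ det U}` for a subset `U` of `G_ε`. -/
def detSet {ε : Fˣ} (ε' : Fˣ) (U : Set (quat F E ε)) : Set (quat F E ε') :=
  {g | ∃ u ∈ U, g.val.val.det = u.val.val.det}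

/-- A subset of `G_ε` is compact modulo the center (up to taking closures). -/
def IsCompactModCenter [TopologicalSpace E] {ε : Fˣ} (S : Set (quat F E ε)) : Prop :=
  ∃ Q : Set (quat F E ε), IsCompact Q ∧ ∀ g ∈ S, ∃ z : Fˣ, central ε z * g ∈ Q

/-- `C_c^∞(G_ε / Ξ)` for `Ξ ⊆ Z_ε ≅ Fˣ`: locally constant `Ξ`-invariant functions whose support is
compact modulo `Ξ`. -/
def IsSmoothCompactMod [TopologicalSpace E] {ε : Fˣ} (Ξ : Set Fˣ) (f : quat F E ε → ℂ) : Prop :=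
  IsLocallyConstant f ∧ (∀ z ∈ Ξ, ∀ g, f (central ε z * g) = f g) ∧
    ∃ Q : Set (quat F E ε), IsCompact Q ∧ ∀ g, f g ≠ 0 → ∃ z ∈ Ξ, central ε z * g ∈ Q

/-- `{z ∈ Fˣ : z ∈ U}`, the intersection of `U` with the center. -/
def centralPart {ε : Fˣ} (U : Set (quat F E ε)) : Set Fˣ := {z | central ε z ∈ U}

end Quadratic

/-! ### Compact subgroups and special multiplicity functions -/

section Multiplicity

variable {F E : Type*} [Field F] [ValuativeRel F] [TopologicalSpace F]
  [IsNonarchimedeanLocalField F] [Field E] [ValuativeRel E] [TopologicalSpace E]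
  [IsNonarchimedeanLocalField E] [Algebra F E] [Algebra.IsQuadraticExtension F E]
  [Algebra.IsSeparable F E]

variable (E) in
/-- The fixed representative `ε₀` of the nontrivial class of `Fˣ / Nm(Eˣ)`: it is the uniformizer
`ϖ` if `E/F` is unramified (that is, if `ϖ` is also a uniformizer of `E`), and a unit which is not a
norm if `E/F` is ramified. -/
def IsNonNormRep (ϖ ε₀ : Fˣ) : Prop :=
  (ord (algebraMap F E ϖ) = 1 → ε₀ = ϖ) ∧
  (ord (algebraMap F E ϖ) ≠ 1 →
    ord (ε₀ : F) = 0 ∧ ¬ ∃ a : Eˣ, Algebra.norm F (a : E) = ε₀)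

variable (E) in
/-- The maximal compact subgroup `K_ε = G_ε ∩ GL₂(O_E)`. -/
def maxCompact (ε : Fˣ) : Set (quat F E ε) :=
  {g | ∀ i j, g.val.val i j ∈ 𝒪[E] ∧ (g⁻¹).val.val i j ∈ 𝒪[E]}

variable (E) in
/-- The principal subgroup `K_{ε,n}` of `K_ε`: matrices congruent to `1` modulo `p_E ^ n`. -/
def principal (ε : Fˣ) (n : ℕ) : Set (quat F E ε) :=
  {g | g ∈ maxCompact E ε ∧ ∀ i j, g.val.val i j - (1 : Matrix (Fin 2) (Fin 2) E) i j ∈ maxPow E n}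

variable (E) in
/-- The subgroup `K_{ε,n} ϖ^ℤ`. -/
def principalMod (ϖ ε : Fˣ) (n : ℕ) : Set (quat F E ε) :=
  {g | ∃ k : ℤ, ∃ u ∈ principal E ε n, g = u * central ε (ϖ ^ k)}

/-- The logarithmic singularity: outside `T_ε'`, the function
`m(g) - v(inv'(g)) / 2 · 1_{U'}(g)` on `{g : det g ∈ det U}` extends to a locally constant function
on that set. Here `v` is the normalized valuation of `F`. -/
def HasLogSingularity {ε ε' : Fˣ} (U : Set (quat F E ε)) (U' : Subgroup (quat F E ε'))
    (m : quat F E ε' → ℂ) : Prop :=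
  ∃ φ : detSet ε' U → ℂ, IsLocallyConstant φ ∧
    ∀ g : detSet ε' U, g.val ∉ torusSet ε' →
      φ g = m g - (ord (invPrime g.val) : ℂ) / 2 * (U' : Set (quat F E ε')).indicator 1 g.val

/-- Special multiplicity functions of level `U ⊆ K_ε` on `G_ε' - T_ε'`. They are represented by
functions on `G_ε'`, whose values on `T_ε'` are arbitrary and never used. -/
structure IsSpecialMultiplicity {ε : Fˣ} (ε' : Fˣ) (U : Set (quat F E ε))
    (m : quat F E ε' → ℂ) : Prop where
  support : ∀ g, g ∉ torusSet ε' → m g ≠ 0 → g ∈ detSet ε' U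
  singularity : ∃ U' : Subgroup (quat F E ε'),
    IsOpen (U' : Set (quat F E ε')) ∧ IsCompact (U' : Set (quat F E ε')) ∧
    (U' : Set (quat F E ε')) ⊆ detSet ε' U ∧
    (∀ t : Eˣ, torus ε' t ∈ U' ↔ torus ε t ∈ U) ∧
    HasLogSingularity U U' m
  det_mem : ε' ≠ 1 → ∀ g, g ∉ torusSet ε' → m g ≠ 0 → g ∈ detSet ε' U
  mem_maxCompact : ε' = 1 → ∀ g, g ∉ torusSet ε' → m g ≠ 0 → g ∈ maxCompact E ε'

/-- The variant modulo the center: multiplicity functions of level `U = K_{ε,n} ϖ^ℤ` on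
`G_ε' - T_ε'`, invariant under `Ξ = U ∩ Z_ε`. Again the values on `T_ε'` are never used. -/
structure IsSpecialMultiplicityMod {ε : Fˣ} (ε' : Fˣ) (U : Set (quat F E ε))
    (m : quat F E ε' → ℂ) : Prop where
  invariant : ∀ z ∈ centralPart U, ∀ g, g ∉ torusSet ε' → m (central ε' z * g) = m g
  support : ∃ C : Subgroup (quat F E ε'), IsCompactModCenter (C : Set (quat F E ε')) ∧
    (C : Set (quat F E ε')) ⊆ detSet ε' U ∧ ∀ g, g ∉ torusSet ε' → m g ≠ 0 → g ∈ C
  singularity : ∃ U' : Subgroup (quat F E ε'),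
    IsOpen (U' : Set (quat F E ε')) ∧ IsCompactModCenter (U' : Set (quat F E ε')) ∧
    (U' : Set (quat F E ε')) ⊆ detSet ε' U ∧
    (∀ t : Eˣ, torus ε' t ∈ U' ↔ torus ε t ∈ U) ∧
    HasLogSingularity U U' m

end Multiplicity

/-! ### Orbital integrals -/

section OrbitalIntegrals

variable {F E : Type*} [Field F] [ValuativeRel F] [TopologicalSpace F]
  [IsNonarchimedeanLocalField F] [MeasurableSpace F]
  [Field E] [ValuativeRel E] [TopologicalSpace E]
  [IsNonarchimedeanLocalField E] [MeasurableSpace E] [Algebra F E]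
  [Algebra.IsQuadraticExtension F E] [Algebra.IsSeparable F E]

variable (F E) in
/-- `{t ∈ Eˣ : v_F(Nm t) ∈ {0, 1}}`, a compact open set of representatives of `Eˣ / ϖ^ℤ` for every
uniformizer `ϖ` of `F`. -/
def fundDom : Set Eˣ := {t | ord (Algebra.norm F (t : E)) = 0 ∨ ord (Algebra.norm F (t : E)) = 1}

/-- The integral `∫_{Eˣ/Ξ} φ` for the quotient of the Haar measure `μE` of `Eˣ` by the restriction
to `Ξ` of the Haar measure `μF` of `Fˣ`. Here `Ξ` is an open subgroup of `Fˣ` containing a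
uniformizer, and `φ` is a `Ξ`-invariant function on `Eˣ`. For every `t`, the set of the `z ∈ Ξ` with
`t z ∈ fundDom` is a translate of `Ξ ∩ O_Fˣ`, so the integral of `φ` over `fundDom` is
`vol(Ξ ∩ O_Fˣ)` times its integral over the quotient. -/
def quotInt (μF : Measure Fˣ) (μE : Measure Eˣ) (Ξ : Set Fˣ) (φ : Eˣ → ℂ) : ℂ :=
  ((μF.real {z | z ∈ Ξ ∧ ord (z : F) = 0} : ℝ) : ℂ)⁻¹ * ∫ t in fundDom F E, φ t ∂μE

/-- The integrand `(h₁, h₂) ↦ f(h₁⁻¹ δ h₂) Ω(h₁) Ω⁻¹(h₂)` of toric orbital integrals. -/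
def orbIntegrand (Ω : Eˣ →* ℂˣ) {ε : Fˣ} (δ : quat F E ε) (f : quat F E ε → ℂ) (h₁ h₂ : Eˣ) : ℂ :=
  f ((torus ε h₁)⁻¹ * δ * torus ε h₂) * (Ω h₁ : ℂ) * ((Ω h₂)⁻¹ : ℂˣ)

/-- `∫_{T/Z} ∫_T f(h₁⁻¹ δ h₂) Ω(h₁) Ω⁻¹(h₂) dh₂ dh₁`. This is the orbital integral `O(δ, f)` for
`f ∈ C_c^∞(G_ε)`, and the arithmetic orbital integral `i(δ, 1_U)` when `f` is a multiplicity
function of level `U`. -/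
def orbInt (μF : Measure Fˣ) (μE : Measure Eˣ) (Ω : Eˣ →* ℂˣ) {ε : Fˣ} (δ : quat F E ε)
    (f : quat F E ε → ℂ) : ℂ :=
  quotInt μF μE Set.univ fun h₁ => ∫ h₂ : Eˣ, orbIntegrand Ω δ f h₁ h₂ ∂μE

/-- `∫_{T/Z} ∫_{T/Ξ} f(h₁⁻¹ δ h₂) Ω(h₁) Ω⁻¹(h₂) dh₂ dh₁`. This is the orbital integral `O_Ξ(δ, f)`
for `f ∈ C_c^∞(G_ε / Ξ)`, and the arithmetic orbital integral `i(δ, 1_U)` when `f` is a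
`Ξ`-invariant multiplicity function of level `U`. -/
def orbIntMod (μF : Measure Fˣ) (μE : Measure Eˣ) (Ω : Eˣ →* ℂˣ) (Ξ : Set Fˣ) {ε : Fˣ}
    (δ : quat F E ε) (f : quat F E ε → ℂ) : ℂ :=
  quotInt μF μE Set.univ fun h₁ => quotInt μF μE Ξ fun h₂ => orbIntegrand Ω δ f h₁ h₂

end OrbitalIntegrals

/-! ### The Hermitian side -/

section Hermitian

variable (F E : Type*) [Field F] [Field E] [Algebra F E] [Algebra.IsQuadraticExtension F E]
  [Algebra.IsSeparable F E]

/-- The Galois conjugate of the transpose. -/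
def conjTr (g : Matrix (Fin 2) (Fin 2) E) : Matrix (Fin 2) (Fin 2) E := (g.map (conj F E))ᵀ

theorem conjTr_mul (g h : Matrix (Fin 2) (Fin 2) E) :
    conjTr F E (g * h) = conjTr F E h * conjTr F E g := by
  simp [conjTr, Matrix.map_mul, Matrix.transpose_mul]

theorem conjTr_one : conjTr F E 1 = 1 := by
  simp [conjTr, Matrix.map_one]

/-- The Hermitian matrix `w`. -/
def wMat : Matrix (Fin 2) (Fin 2) E := !![0, 1; 1, 0]

/-- The unitary group `H₀` of `w`, the stabilizer of `w` for the action `g · s = g s ḡᵗ`. -/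
def unitaryW : Subgroup (GL (Fin 2) E) where
  carrier := {g | g.val * wMat E * conjTr F E g.val = wMat E}
  one_mem' := by simp [conjTr_one]
  mul_mem' := by
    intro g h hg hh
    simp only [Set.mem_ofPred_eq, Units.val_mul, conjTr_mul] at *
    calc g.val * h.val * wMat E * (conjTr F E h.val * conjTr F E g.val)
        = g.val * (h.val * wMat E * conjTr F E h.val) * conjTr F E g.val := by
          simp only [Matrix.mul_assoc]
      _ = wMat E := by rw [hh, hg]
  inv_mem' := by
    intro g hg
    simp only [Set.mem_ofPred_eq] at *
    have h1 : conjTr F E g.val * conjTr F E (g⁻¹).val = 1 := by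
      rw [← conjTr_mul, Units.inv_mul, conjTr_one]
    calc (g⁻¹).val * wMat E * conjTr F E (g⁻¹).val
        = (g⁻¹).val * (g.val * wMat E * conjTr F E g.val) * conjTr F E (g⁻¹).val := by rw [hg]
      _ = ((g⁻¹).val * g.val) * wMat E * (conjTr F E g.val * conjTr F E (g⁻¹).val) := by
          simp only [Matrix.mul_assoc]
      _ = wMat E := by rw [h1, Units.inv_mul]; simp

variable {F E}

open Classical in
/-- The function `Φ_f` on Hermitian matrices: it is supported on the orbit of `w`, and its value at
`g w ḡᵗ` is `∫_{H₀} f(g h) dh` (independent of `g` because the measure is invariant). It is written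
here as a function on all matrices, extended by zero. -/
def hermFun [MeasurableSpace (unitaryW F E)] (μH : Measure (unitaryW F E)) (f : GL (Fin 2) E → ℂ)
    (s : Matrix (Fin 2) (Fin 2) E) : ℂ :=
  if hs : ∃ g : GL (Fin 2) E, g.val * wMat E * conjTr F E g.val = s then
    ∫ h : unitaryW F E, f (hs.choose * h.val) ∂μH
  else 0

variable [ValuativeRel E] [TopologicalSpace E] [IsNonarchimedeanLocalField E]
  [MeasurableSpace F] [MeasurableSpace E]

/-- The orbital integral `O(s, x, Φ)` with `s`-variable: the integral over `a ∈ Eˣ` and `z ∈ Fˣ` of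
`Φ(z diag(a,1) γ(x) diag(ā,1)) η(z) ω⁻¹(z) Ω⁻¹(a) |a|_E ^ s`, where `γ(x) = [x, 1; 1, 1]` and `ω` is
the restriction of `Ω` to `Fˣ`. -/
def hermOrb (μF : Measure Fˣ) (μE : Measure Eˣ) (Ω : Eˣ →* ℂˣ)
    (Φ : Matrix (Fin 2) (Fin 2) E → ℂ) (x : F) (s : ℂ) : ℂ :=
  ∫ a : Eˣ, ∫ z : Fˣ,
    Φ (algebraMap F E z •
        (!![(a : E), 0; 0, 1] * !![algebraMap F E x, 1; 1, 1] * !![conj F E a, 0; 0, 1])) *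
      (eta F E z * ((Ω (incl F E z))⁻¹ : ℂˣ)) * ((Ω a)⁻¹ : ℂˣ) * ((normAbs (a : E) : ℂ) ^ s) ∂μF ∂μE

variable [ValuativeRel F] [TopologicalSpace F] [IsNonarchimedeanLocalField F]
  [MeasurableSpace (unitaryW F E)]

/-- `f ∈ C_c^∞(GL₂(E))` purely matches `f_ε ∈ C_c^∞(G_ε)`: the orbital integrals of `Φ_f` agree with
those of `f_ε` on the norm class of `ε`, and vanish on the other class, that of `ε'`. -/
def PurelyMatches (μF : Measure Fˣ) (μE : Measure Eˣ) (μH : Measure (unitaryW F E))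
    (Ω : Eˣ →* ℂˣ) {ε : Fˣ} (ε' : Fˣ) (f : GL (Fin 2) E → ℂ) (fε : quat F E ε → ℂ) : Prop :=
  (∀ (b : Eˣ) (h : (ε : F) * Algebra.norm F (b : E) ≠ 1),
    hermOrb μF μE Ω (hermFun μH f) ((ε : F) * Algebra.norm F (b : E)) 0 =
      orbInt μF μE Ω (delta ε b h) fε) ∧
  ∀ b : Eˣ, (ε' : F) * Algebra.norm F (b : E) ≠ 1 →
    hermOrb μF μE Ω (hermFun μH f) ((ε' : F) * Algebra.norm F (b : E)) 0 = 0

/-- The same for `f_ε ∈ C_c^∞(G_ε / Ξ)`, with `O_Ξ` in place of `O`. -/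
def PurelyMatchesMod (μF : Measure Fˣ) (μE : Measure Eˣ) (μH : Measure (unitaryW F E))
    (Ω : Eˣ →* ℂˣ) (Ξ : Set Fˣ) {ε : Fˣ} (ε' : Fˣ) (f : GL (Fin 2) E → ℂ)
    (fε : quat F E ε → ℂ) : Prop :=
  (∀ (b : Eˣ) (h : (ε : F) * Algebra.norm F (b : E) ≠ 1),
    hermOrb μF μE Ω (hermFun μH f) ((ε : F) * Algebra.norm F (b : E)) 0 =
      orbIntMod μF μE Ω Ξ (delta ε b h) fε) ∧
  ∀ b : Eˣ, (ε' : F) * Algebra.norm F (b : E) ≠ 1 →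
    hermOrb μF μE Ω (hermFun μH f) ((ε' : F) * Algebra.norm F (b : E)) 0 = 0

end Hermitian

end

end ArithMatching

set_option linter.unusedSectionVars false

/-! Write Φ(α, β, γ) for the value of Φ_f at the Hermitian matrix [α, β; β̄, γ], and X = Nm(c)x. The
substitution c = za turns the Hermitian orbital integral into the integral over c ∈ Eˣ, z ∈ Fˣ of
Φ(X/z, c, z) η(z) Ω⁻¹(c) q^(-s(v(Nm c) - 2v(z))) (`hermOrb_eq_hermInt`). On the class of ε' the
value at s = 0 vanishes, so a multiple of it by v(x) may be added to the derivative. Hence the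
derivative is -log q times the integral with weight v(X) - 2v(z), a weight that is odd under z ↦ X/z
(`hermOrb_hasDerivAt`).

The heart is the behavior as x → 0. For fixed c and large v(X) the integral over z has three ranges:
small v(z), where α may be replaced by 0, giving a constant A; v(z) close to v(X), where γ may be
replaced by 0, giving η(X)B; and a middle range, where only Φ(0, c, 0) and a sum of integrals of η
over shells occur. Without weight the total is A + η(X)B + middle. With the odd weight it grows
linearly in v(X), and oddness flips the sign of the B-term: the slope is the unweighted integral on
the opposite norm class (`pairInt_sub`). So, for x → 0 in the class of ε', the weighted integral is
κ v(x) + constant, where κ is the value near 0 of the unweighted integral on the class of ε. Pure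
matching identifies κ with the orbital integral of 1_U near 0, which is vol(T/Z) vol(U ∩ T) in part
(1).

On the quaternion side inv' equals x/(1 - x) along the whole orbit of δ(x). Near x = 0 the
arithmetic orbital integral is therefore (v(x)/2) vol(T/Z) vol(U' ∩ T) plus the orbital integral of
a smooth function (`exists_orbInt_log`). Since U' ∩ T = U ∩ T, the logarithms on the two sides
cancel. The remaining contribution of the derivative is a locally constant function of b, where x =
ε' Nm(b). It is constant near x = 0, zero near x = 1 because Φ_f has compact support in the
invertible matrices, and a multiple of Ω(b) for large x. Every such function is an orbital integral
(`exists_bump`, `exists_bump_infty`, `exists_orbInt_hermInt`), and `exists_arith_matching` combines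
the two sides.

A purely matching f comes from an explicit test function `hermTest`, whose integral over z lives on
two shells with contributions that add up on the class of ε and cancel on that of ε'
(`pairInt_hermTest`). It has the form Φ_f because the orbit map has an explicit section near it
(`exists_section`, `exists_lift`).

The arithmetic of E/F enters through the multiplicativity of η, obtained from a comparison of
indices in the style of the Herbrand quotient (`norm_relIndex_le`, `unit_norms`), and through the
alternative that η integrates to zero over the units or equals (-1)^v (`shell_eta_dichotomy`). An
element τ of trace 1 and the equation ts² - s + 1 = 0, solvable for t in the maximal ideal, treat
all residue characteristics alike.

For part (2), functions invariant under ϖ are determined by their restriction to the elements with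
v(det) ∈ {0, 1}. `orbIntMod_eq` rewrites orbital integrals modulo Ξ as ordinary ones of this
restriction, up to the factor vol(Ξ ∩ O_Fˣ)⁻¹. The compact case is applied there, and
`exists_folding` and `periodize` carry the resulting function back. -/

namespace ArithMatching

/-! ### Valuations and balls of a local field -/

section Ball

open scoped WithZero

variable {K : Type*} [Field K] [ValuativeRel K] [TopologicalSpace K]
  [IsNonarchimedeanLocalField K]

variable (K) in
/-- The valuation with values in `ℤᵐ⁰`. -/
noncomputable def intVal : Valuation K ℤᵐ⁰ :=
  (valuation K).map
    { toFun := IsNonarchimedeanLocalField.valueGroupWithZeroIsoInt K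
      map_zero' := map_zero _
      map_one' := map_one _
      map_mul' := map_mul _ }
    (IsNonarchimedeanLocalField.valueGroupWithZeroIsoInt K).strictMono.monotone

theorem intVal_eq_exp {x : K} (hx : x ≠ 0) : intVal K x = WithZero.exp (-ord x) := by
  have h : intVal K x ≠ 0 := (Valuation.ne_zero_iff _).mpr hx
  have : ord x = -WithZero.log (intVal K x) := rfl
  rw [this, neg_neg, WithZero.exp_log h]

theorem ord_mul {x y : K} (hx : x ≠ 0) (hy : y ≠ 0) : ord (x * y) = ord x + ord y := by
  have hz := intVal_eq_exp (mul_ne_zero hx hy)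
  rw [map_mul, intVal_eq_exp hx, intVal_eq_exp hy, ← WithZero.exp_add, WithZero.exp_inj] at hz
  linarith

@[simp] theorem ord_zero : ord (0 : K) = 0 := by
  have : ord (0 : K) = -WithZero.log (intVal K 0) := rfl
  rw [this]; simp

@[simp] theorem ord_one : ord (1 : K) = 0 := by
  have := ord_mul (one_ne_zero (α := K)) one_ne_zero
  rw [mul_one] at this
  linarith

theorem ord_inv (x : K) : ord x⁻¹ = -ord x := by
  by_cases hx : x = 0
  · simp [hx]
  have := ord_mul hx (inv_ne_zero hx)
  rw [mul_inv_cancel₀ hx, ord_one] at this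
  linarith

theorem ord_div {x y : K} (hx : x ≠ 0) (hy : y ≠ 0) : ord (x / y) = ord x - ord y := by
  rw [div_eq_mul_inv, ord_mul hx (inv_ne_zero hy), ord_inv, sub_eq_add_neg]

theorem ord_pow {x : K} (n : ℕ) (hx : x ≠ 0) : ord (x ^ n) = n * ord x := by
  induction n with
  | zero => simp
  | succ n ih => rw [pow_succ, ord_mul (pow_ne_zero _ hx) hx, ih]; push_cast; ring

theorem ord_zpow {x : K} (n : ℤ) (hx : x ≠ 0) : ord (x ^ n) = n * ord x := by
  cases n with
  | ofNat n => simpa using ord_pow n hx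
  | negSucc n => rw [zpow_negSucc, ord_inv, ord_pow _ hx, Int.negSucc_eq]; push_cast; ring

@[simp] theorem ord_neg (x : K) : ord (-x) = ord x := by
  have h (x : K) : ord x = -WithZero.log (intVal K x) := rfl
  rw [h, h, Valuation.map_neg]

theorem unit_ord_mul (x y : Kˣ) : ord ((x * y : Kˣ) : K) = ord (x : K) + ord (y : K) := by
  rw [Units.val_mul, ord_mul x.ne_zero y.ne_zero]

theorem unit_ord_inv (x : Kˣ) : ord ((x⁻¹ : Kˣ) : K) = -ord (x : K) := by
  rw [Units.val_inv_eq_inv_val, ord_inv]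

theorem unit_ord_zpow (x : Kˣ) (n : ℤ) : ord ((x ^ n : Kˣ) : K) = n * ord (x : K) := by
  rw [Units.val_zpow_eq_zpow_val, ord_zpow n x.ne_zero]

theorem le_ord_iff {x : K} (n : ℤ) : (x = 0 ∨ n ≤ ord x) ↔ intVal K x ≤ WithZero.exp (-n) := by
  by_cases hx : x = 0
  · simp [hx]
  · rw [intVal_eq_exp hx, WithZero.exp_le_exp]; simp [hx]

variable (K) in
/-- The fractional ideal of elements of valuation at least `n`. -/
def ball (n : ℤ) : AddSubgroup K where
  carrier := {x | x = 0 ∨ n ≤ ord x}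
  zero_mem' := Or.inl rfl
  add_mem' := by
    intro x y hx hy
    simp only [Set.mem_ofPred_eq, le_ord_iff] at *
    exact (Valuation.map_add _ _ _).trans (max_le hx hy)
  neg_mem' := by
    intro x hx
    simpa only [Set.mem_ofPred_eq, ord_neg, neg_eq_zero] using hx

theorem mem_ball {n : ℤ} {x : K} : x ∈ ball K n ↔ x = 0 ∨ n ≤ ord x := Iff.rfl

theorem mem_ball_of_ne {n : ℤ} {x : K} (hx : x ≠ 0) : x ∈ ball K n ↔ n ≤ ord x := by
  simp [mem_ball, hx]

theorem mem_ball_unit {n : ℤ} {x : Kˣ} : (x : K) ∈ ball K n ↔ n ≤ ord (x : K) :=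
  mem_ball_of_ne x.ne_zero

theorem ball_anti {m n : ℤ} (h : m ≤ n) : ball K n ≤ ball K m := by
  rintro x (hx | hx)
  · exact Or.inl hx
  · exact Or.inr (h.trans hx)

theorem ball_mono {m n : ℤ} {x : K} (hx : x ∈ ball K n) (h : m ≤ n) : x ∈ ball K m :=
  ball_anti h hx

theorem self_mem_ball (x : K) : x ∈ ball K (ord x) := Or.inr le_rfl

theorem one_mem_ball : (1 : K) ∈ ball K 0 := Or.inr (by simp)

theorem mul_mem_ball {m n : ℤ} {x y : K} (hx : x ∈ ball K m) (hy : y ∈ ball K n) :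
    x * y ∈ ball K (m + n) := by
  by_cases hx0 : x = 0
  · simp [hx0, (ball K _).zero_mem]
  by_cases hy0 : y = 0
  · simp [hy0, (ball K _).zero_mem]
  rw [mem_ball_of_ne hx0] at hx
  rw [mem_ball_of_ne hy0] at hy
  rw [mem_ball_of_ne (mul_ne_zero hx0 hy0), ord_mul hx0 hy0]
  linarith

theorem mul_mem_ball' {m n k : ℤ} {x y : K} (hx : x ∈ ball K m) (hy : y ∈ ball K n)
    (h : k ≤ m + n) : x * y ∈ ball K k := ball_mono (mul_mem_ball hx hy) h

theorem mul_mem_ball_iff {x y : K} (hx : x ≠ 0) (n : ℤ) :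
    x * y ∈ ball K n ↔ y ∈ ball K (n - ord x) := by
  by_cases hy : y = 0
  · simp [hy, (ball K _).zero_mem]
  · rw [mem_ball_of_ne (mul_ne_zero hx hy), mem_ball_of_ne hy, ord_mul hx hy]
    constructor <;> intro h <;> linarith

theorem ne_zero_of_ord_lt {x : K} {n : ℤ} (h : x ∉ ball K n) : x ≠ 0 := by
  rintro rfl; exact h (ball K n).zero_mem

theorem add_ne_zero_of_mem {x y : K} (hx : x ≠ 0) (hy : y ∈ ball K (ord x + 1)) : x + y ≠ 0 := by
  intro h
  have h1 : y = -x := by linear_combination h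
  rw [h1, mem_ball_of_ne (neg_ne_zero.mpr hx), ord_neg] at hy
  linarith

theorem ord_add_eq {x y : K} (hx : x ≠ 0) (hy : y ∈ ball K (ord x + 1)) :
    ord (x + y) = ord x := by
  have h0 := add_ne_zero_of_mem hx hy
  apply le_antisymm
  · by_contra! h
    have h1 : x + y ∈ ball K (ord x + 1) := Or.inr h
    have h2 : x ∈ ball K (ord x + 1) := by simpa using (ball K _).sub_mem h1 hy
    rw [mem_ball_of_ne hx] at h2
    linarith
  · have : x + y ∈ ball K (ord x) :=
      (ball K _).add_mem (self_mem_ball x) (ball_mono hy (by linarith))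
    rwa [mem_ball_of_ne h0] at this

theorem ord_one_add {t : K} (ht : t ∈ ball K 1) : ord (1 + t) = 0 := by
  rw [ord_add_eq one_ne_zero (by simpa using ht), ord_one]

theorem one_add_ne_zero {t : K} (ht : t ∈ ball K 1) : 1 + t ≠ 0 :=
  add_ne_zero_of_mem one_ne_zero (by simpa using ht)

theorem mem_integer_iff {x : K} : x ∈ 𝒪[K] ↔ x ∈ ball K 0 := by
  rw [Valuation.mem_integer_iff, mem_ball, le_ord_iff, neg_zero, WithZero.exp_zero]
  have : intVal K x = IsNonarchimedeanLocalField.valueGroupWithZeroIsoInt K (valuation K x) := rfl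
  rw [this, ← map_one (IsNonarchimedeanLocalField.valueGroupWithZeroIsoInt K)]
  exact ((IsNonarchimedeanLocalField.valueGroupWithZeroIsoInt K).strictMono.le_iff_le).symm

variable (K) in
theorem exists_ord_eq (n : ℤ) : ∃ x : Kˣ, ord (x : K) = n := by
  obtain ⟨x, hx⟩ := ValuativeRel.valuation_surjective
    ((IsNonarchimedeanLocalField.valueGroupWithZeroIsoInt K).symm (WithZero.exp (-n)))
  have h0 : x ≠ 0 := by
    rintro rfl
    rw [map_zero] at hx
    have := congrArg (IsNonarchimedeanLocalField.valueGroupWithZeroIsoInt K) hx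
    rw [map_zero, OrderMonoidIso.apply_symm_apply] at this
    exact WithZero.exp_ne_zero this.symm
  refine ⟨Units.mk0 x h0, ?_⟩
  simp [ord, hx]

variable (K) in
theorem hasBasis_nhds_zero : (nhds (0 : K)).HasBasis (fun _ : ℤ => True) fun n => (ball K n : Set K) := by
  constructor
  intro s
  rw [IsValuativeTopology.mem_nhds_iff]
  simp only [zero_add, Set.image_id', true_and]
  constructor
  · rintro ⟨γ, hγ⟩
    have hγ0 : IsNonarchimedeanLocalField.valueGroupWithZeroIsoInt K γ ≠ 0 := by simp
    refine ⟨1 - WithZero.log (IsNonarchimedeanLocalField.valueGroupWithZeroIsoInt K γ),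
      fun x hx => hγ ?_⟩
    have h1 : intVal K x < IsNonarchimedeanLocalField.valueGroupWithZeroIsoInt K γ := by
      refine ((le_ord_iff _).mp hx).trans_lt ?_
      conv_rhs => rw [← WithZero.exp_log hγ0]
      rw [WithZero.exp_lt_exp]
      linarith
    exact (IsNonarchimedeanLocalField.valueGroupWithZeroIsoInt K).strictMono.lt_iff_lt.mp h1
  · rintro ⟨n, hn⟩
    refine ⟨Units.mk0 ((IsNonarchimedeanLocalField.valueGroupWithZeroIsoInt K).symm
      (WithZero.exp (-n))) (by simp), fun x hx => hn ?_⟩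
    have h1 : intVal K x < WithZero.exp (-n) := by
      have := (IsNonarchimedeanLocalField.valueGroupWithZeroIsoInt K).strictMono.lt_iff_lt.mpr hx
      rwa [Units.val_mk0, OrderMonoidIso.apply_symm_apply] at this
    exact (le_ord_iff n).mpr h1.le

variable (K) in
theorem ball_mem_nhds (n : ℤ) : (ball K n : Set K) ∈ nhds (0 : K) :=
  (hasBasis_nhds_zero K).mem_of_mem trivial

variable (K) in
theorem isOpen_ball (n : ℤ) : IsOpen (ball K n : Set K) :=
  AddSubgroup.isOpen_of_mem_nhds _ (ball_mem_nhds K n)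

variable (K) in
theorem isClosed_ball (n : ℤ) : IsClosed (ball K n : Set K) :=
  AddSubgroup.isClosed_of_isOpen _ (isOpen_ball K n)

variable (K) in
theorem isCompact_ball (n : ℤ) : IsCompact (ball K n : Set K) := by
  convert IsNonarchimedeanLocalField.isCompact_closedBall K
    ((IsNonarchimedeanLocalField.valueGroupWithZeroIsoInt K).symm (WithZero.exp (-n))) using 1
  ext x
  refine (le_ord_iff n).trans ?_
  rw [Set.mem_ofPred_eq, ← (IsNonarchimedeanLocalField.valueGroupWithZeroIsoInt K).strictMono.le_iff_le]
  rw [OrderMonoidIso.apply_symm_apply]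
  rfl

theorem exists_mem_ball (x : K) : ∃ n : ℕ, x ∈ ball K (-n) :=
  ⟨(ord x).natAbs, Or.inr (by omega)⟩

theorem _root_.IsCompact.exists_subset_ball {S : Set K} (hS : IsCompact S) :
    ∃ n : ℕ, S ⊆ ball K (-n) := by
  obtain ⟨n, hn⟩ := hS.elim_directed_cover (fun n : ℕ => (ball K (-n) : Set K))
    (fun n => isOpen_ball K _) (fun x _ => Set.mem_iUnion.mpr (exists_mem_ball x))
    (by
      intro a b
      exact ⟨max a b, ball_anti (by simp), ball_anti (by simp)⟩)
  exact ⟨n, hn⟩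

theorem eventually_sub_mem_ball (x : K) (n : ℤ) : ∀ᶠ y in nhds x, y - x ∈ ball K n := by
  have : Filter.Tendsto (fun y => y - x) (nhds x) (nhds 0) := by
    have h : Continuous fun y : K => y - x := by fun_prop
    simpa using h.tendsto x
  exact this (ball_mem_nhds K n)

theorem eventually_ord_eq {x : K} (hx : x ≠ 0) : ∀ᶠ y in nhds x, ord y = ord x := by
  filter_upwards [eventually_sub_mem_ball x (ord x + 1)] with y hy
  simpa using ord_add_eq hx hy

variable (K) in
theorem t2Space_localField : T2Space K := by
  refine IsTopologicalAddGroup.t2Space_of_zero_sep fun x hx => ?_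
  refine ⟨ball K (ord x + 1), ball_mem_nhds K _, fun h => ?_⟩
  rw [SetLike.mem_coe, mem_ball_of_ne hx] at h
  linarith

instance : T2Space K := t2Space_localField K

variable (K) in
-- The balls `ball K (-n)` exhaust the field by compact sets, and the balls around 0 give a
-- countable neighborhood basis, so the additive group is pseudometrizable and separable. This is
-- what makes product measures on the unit groups behave.
theorem secondCountable : SecondCountableTopology K := by
  have h1 : SigmaCompactSpace K := by
    refine ⟨⟨fun n : ℕ => (ball K (-n) : Set K), fun n => isCompact_ball K _, ?_⟩⟩
    ext x
    simpa using exists_mem_ball x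
  let := IsTopologicalAddGroup.rightUniformSpace K
  have := isUniformAddGroup_of_addCommGroup (G := K)
  have h3 : (nhds (0 : K)).IsCountablyGenerated :=
    (hasBasis_nhds_zero K).isCountablyGenerated
  have h2 : (_root_.uniformity K).IsCountablyGenerated :=
    IsUniformAddGroup.uniformity_countably_generated
  let := UniformSpace.pseudoMetricSpace K
  have : TopologicalSpace.SeparableSpace K := inferInstance
  exact UniformSpace.secondCountable_of_separable K

end Ball

/-! ### The multiplicative group of a local field -/

section UnitsOfField

variable {K : Type*} [Field K] [ValuativeRel K] [TopologicalSpace K]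
  [IsNonarchimedeanLocalField K]

variable (K) in
/-- The congruence subgroup `1 + 𝔭 ^ n` (for `n ≥ 1`) of the units. -/
def oneUnits (n : ℕ) : Subgroup Kˣ where
  carrier := {u | (u : K) - 1 ∈ ball K n ∧ ord (u : K) = 0}
  one_mem' := by simp [(ball K n).zero_mem]
  mul_mem' := by
    rintro a b ⟨ha, ha'⟩ ⟨hb, hb'⟩
    refine ⟨?_, by rw [unit_ord_mul, ha', hb', add_zero]⟩
    have h1 : (a : K) * (b - 1) ∈ ball K n :=
      mul_mem_ball' (m := 0) (Or.inr ha'.ge) hb (by simp)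
    have h2 := (ball K n).add_mem h1 ha
    rw [Units.val_mul]
    convert h2 using 1
    ring
  inv_mem' := by
    rintro a ⟨ha, ha'⟩
    refine ⟨?_, by rw [unit_ord_inv, ha', neg_zero]⟩
    have h1 : ((a⁻¹ : Kˣ) : K) * (a - 1) ∈ ball K n :=
      mul_mem_ball' (m := 0) (Or.inr (by rw [unit_ord_inv, ha', neg_zero])) ha (by simp)
    have h2 := (ball K n).neg_mem h1
    convert h2 using 1
    rw [mul_sub, Units.inv_mul]
    ring

theorem mem_oneUnits_of_one_le {n : ℕ} (hn : 1 ≤ n) {u : Kˣ} :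
    u ∈ oneUnits K n ↔ (u : K) - 1 ∈ ball K n := by
  refine ⟨fun h => h.1, fun h => ⟨h, ?_⟩⟩
  have := ord_one_add (ball_mono h (by exact_mod_cast hn : (1 : ℤ) ≤ n))
  simpa using this

theorem oneUnits_anti {m n : ℕ} (h : m ≤ n) : oneUnits K n ≤ oneUnits K m :=
  fun _ hu => ⟨ball_mono hu.1 (by exact_mod_cast h), hu.2⟩

theorem ord_eq_zero_of_mem {n : ℕ} {u : Kˣ} (h : u ∈ oneUnits K n) : ord (u : K) = 0 := h.2

/-- The element `1 + t` for `t` in the maximal ideal. -/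
noncomputable def oneAdd (t : K) (ht : t ∈ ball K 1) : Kˣ := Units.mk0 (1 + t) (one_add_ne_zero ht)

theorem eventually_div_mem_oneUnits (x : Kˣ) (n : ℕ) :
    ∀ᶠ y in nhds x, x⁻¹ * y ∈ oneUnits K n := by
  have h : Filter.Tendsto (fun y : Kˣ => (y : K)) (nhds x) (nhds (x : K)) :=
    Units.continuous_val.tendsto x
  filter_upwards [h.eventually (eventually_sub_mem_ball (x : K) (max n 1 + ord (x : K)))] with y hy
  rw [← SetLike.mem_coe]
  refine oneUnits_anti (le_max_left n 1) ((mem_oneUnits_of_one_le (le_max_right n 1)).mpr ?_)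
  have e : ((x⁻¹ * y : Kˣ) : K) - 1 = ((x⁻¹ : Kˣ) : K) * (y - x) := by
    rw [Units.val_mul, mul_sub, Units.inv_mul]
  rw [e]
  refine mul_mem_ball' (self_mem_ball _) hy ?_
  rw [unit_ord_inv]
  push_cast
  linarith

/-- Functions on `Kˣ` invariant under a congruence subgroup are locally constant. -/
theorem isLocallyConstant_of_oneUnits {X : Type*} {h : Kˣ → X} (n : ℕ)
    (hh : ∀ x, ∀ u ∈ oneUnits K n, h (x * u) = h x) : IsLocallyConstant h := by
  rw [IsLocallyConstant.iff_eventually_eq]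
  intro x
  filter_upwards [eventually_div_mem_oneUnits x n] with y hy
  have := hh x _ hy
  rwa [mul_inv_cancel_left] at this

theorem isLocallyConstant_ord : IsLocallyConstant fun x : Kˣ => ord (x : K) :=
  isLocallyConstant_of_oneUnits 0 fun x u hu => by
    rw [unit_ord_mul, ord_eq_zero_of_mem hu, add_zero]

variable (K) in
theorem isOpen_oneUnits (n : ℕ) : IsOpen (oneUnits K n : Set Kˣ) := by
  apply Subgroup.isOpen_of_mem_nhds _ (g := 1)
  have := eventually_div_mem_oneUnits (1 : Kˣ) n
  simpa using! this

variable (K) in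
/-- The units with valuation in a finite interval form a compact set. -/
theorem isCompact_shells (a b : ℤ) : IsCompact {x : Kˣ | a ≤ ord (x : K) ∧ ord (x : K) ≤ b} := by
  rw [Units.isEmbedding_val₀.isCompact_iff]
  convert (isCompact_ball K a).diff (isOpen_ball K (b + 1)) using 1
  ext x
  constructor
  · rintro ⟨u, ⟨h1, h2⟩, rfl⟩
    refine ⟨mem_ball_unit.mpr h1, fun h => ?_⟩
    rw [SetLike.mem_coe, mem_ball_unit] at h
    linarith
  · rintro ⟨h1, h2⟩
    have h0 : x ≠ 0 := ne_zero_of_ord_lt h2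
    rw [SetLike.mem_coe, mem_ball_of_ne h0] at h1 h2
    exact ⟨Units.mk0 x h0, ⟨h1, by simpa using Int.lt_add_one_iff.mp (not_le.mp h2)⟩, rfl⟩

variable (K) in
theorem isClosed_oneUnits (n : ℕ) : IsClosed (oneUnits K n : Set Kˣ) :=
  Subgroup.isClosed_of_isOpen _ (isOpen_oneUnits K n)

variable (K) in
theorem isCompact_oneUnits (n : ℕ) : IsCompact (oneUnits K n : Set Kˣ) :=
  (isCompact_shells K 0 0).of_isClosed_subset (isClosed_oneUnits K n) fun _ hu =>
    ⟨hu.2.ge, hu.2.le⟩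

theorem exists_ord_bound {S : Set Kˣ} (hS : IsCompact S) :
    ∃ M : ℕ, ∀ x ∈ S, -(M : ℤ) ≤ ord (x : K) ∧ ord (x : K) ≤ M := by
  have h1 : (fun x : Kˣ => ord (x : K)) '' S |>.Finite :=
    (hS.image isLocallyConstant_ord.continuous).finite_of_discrete
  obtain ⟨M, hM⟩ := (h1.image Int.natAbs).bddAbove
  refine ⟨M, fun x hx => ?_⟩
  have := hM ⟨_, ⟨x, hx, rfl⟩, rfl⟩
  dsimp only at this
  omega

/-- A continuous character is trivial on a small congruence subgroup: `ℂˣ` has no small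
subgroups. -/
theorem exists_trivial_on_oneUnits (Ω : Kˣ →* ℂˣ) (hΩ : Continuous Ω) :
    ∃ n : ℕ, 1 ≤ n ∧ ∀ u ∈ oneUnits K n, Ω u = 1 := by
  have hc : Continuous fun u : Kˣ => (Ω u : ℂ) := Units.continuous_val.comp hΩ
  have h1 : ∀ᶠ u in nhds (1 : Kˣ), ‖(Ω u : ℂ) - 1‖ < 1 / 2 := by
    have : Filter.Tendsto (fun u : Kˣ => ‖(Ω u : ℂ) - 1‖) (nhds 1) (nhds 0) := by
      have h : Continuous fun u : Kˣ => ‖(Ω u : ℂ) - 1‖ := by fun_prop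
      simpa using h.tendsto 1
    exact this.eventually_lt_const (by norm_num)
  have h2 : Filter.Tendsto (fun t : K => t) (nhds 0) (nhds 0) := Filter.tendsto_id
  have h3 : (nhds (1 : Kˣ)) = Filter.comap (fun u : Kˣ => (u : K) - 1) (nhds 0) := by
    rw [Units.isEmbedding_val₀.nhds_eq_comap]
    have : nhds ((1 : Kˣ) : K) = Filter.comap (fun x => x - 1) (nhds (0 : K)) := by
      have := (Homeomorph.subRight (1 : K)).isEmbedding.nhds_eq_comap 1
      simpa using this
    rw [this, Filter.comap_comap]
    rfl
  rw [h3, ((hasBasis_nhds_zero K).comap _).eventually_iff] at h1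
  obtain ⟨m, -, hm⟩ := h1
  refine ⟨max m.toNat 1, le_max_right _ _, fun u hu => ?_⟩
  have hp : ∀ k : ℕ, ‖(Ω (u ^ k) : ℂ) - 1‖ < 1 / 2 := fun k =>
    hm (ball_mono ((oneUnits K _).pow_mem hu k).1 (by simp))
  -- No small subgroups: if |w - 1| < 1/2 then |w + 1| ≥ 3/2, so squaring moves w away from 1 by a
  -- factor at least 3/2. Iterating leaves the disc unless w = 1.
  have hg : ∀ k : ℕ, (3 / 2 : ℝ) ^ k * ‖(Ω u : ℂ) - 1‖ ≤ ‖(Ω (u ^ 2 ^ k) : ℂ) - 1‖ := by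
    intro k
    induction k with
    | zero => simp
    | succ k ih =>
      set w : ℂ := (Ω (u ^ 2 ^ k) : ℂ) with hw
      have e : (Ω (u ^ 2 ^ (k + 1)) : ℂ) - 1 = (w - 1) * (w + 1) := by
        rw [hw, pow_succ 2, pow_mul, map_pow Ω (u ^ 2 ^ k), Units.val_pow_eq_pow_val]; ring
      have h4 : (3 / 2 : ℝ) ≤ ‖w + 1‖ := by
        have h5 : (2 : ℂ) = (w + 1) - (w - 1) := by ring
        have h6 : ‖(2 : ℂ)‖ ≤ ‖w + 1‖ + ‖w - 1‖ := by rw [h5]; exact norm_sub_le _ _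
        have h7 := hp (2 ^ k)
        rw [Complex.norm_ofNat] at h6
        linarith
      rw [e, norm_mul, pow_succ]
      nlinarith [norm_nonneg (w - 1), norm_nonneg (w + 1)]
  by_contra hne
  have hpos : 0 < ‖(Ω u : ℂ) - 1‖ := by
    rw [norm_pos_iff, sub_ne_zero]
    exact fun h => hne (Units.ext h)
  obtain ⟨k, hk⟩ := pow_unbounded_of_one_lt (1 / ‖(Ω u : ℂ) - 1‖) (by norm_num : (1 : ℝ) < 3 / 2)
  rw [div_lt_iff₀ hpos] at hk
  have := (hg k).trans_lt (hp _)
  linarith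

variable (K) in
theorem secondCountable_units : SecondCountableTopology Kˣ := by
  have := secondCountable K
  exact Units.isEmbedding_val₀.secondCountableTopology

variable (K) in
theorem borelSpace_units [MeasurableSpace K] [BorelSpace K] : BorelSpace Kˣ := by
  constructor
  have h := @borel_comap Kˣ K Units.val inferInstance
  rw [← Units.isEmbedding_val₀.eq_induced, ← BorelSpace.measurable_eq (α := K)] at h
  exact h.symm

instance [MeasurableSpace K] [BorelSpace K] : BorelSpace Kˣ := borelSpace_units K

instance : SecondCountableTopology Kˣ := secondCountable_units K

/-! ### Indices of balls -/

theorem mem_maximalIdeal_iff (x : 𝒪[K]) : x ∈ 𝓂[K] ↔ (x : K) ∈ ball K 1 := by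
  rw [IsLocalRing.mem_maximalIdeal, mem_nonunits_iff]
  have hx := mem_integer_iff.mp x.2
  constructor
  · intro h
    by_contra h1
    have h0 := ne_zero_of_ord_lt h1
    rw [mem_ball_of_ne h0] at h1 hx
    refine h (IsUnit.of_mul_eq_one ⟨(x : K)⁻¹, mem_integer_iff.mpr ?_⟩ ?_)
    · exact Or.inr (by rw [ord_inv]; omega)
    · ext; simp [h0]
  · rintro h ⟨u, rfl⟩
    have h1 : ((u : 𝒪[K]) : K) * ((u⁻¹ : 𝒪[K]ˣ) : 𝒪[K]) = 1 := by
      exact_mod_cast congrArg Subtype.val (Units.mul_inv u)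
    have h2 := mul_mem_ball h (mem_integer_iff.mp ((u⁻¹ : 𝒪[K]ˣ) : 𝒪[K]).2)
    rw [h1, mem_ball_of_ne one_ne_zero, ord_one] at h2
    omega

variable (K) in
theorem relIndex_ball_one : (ball K 1).relIndex (ball K 0) = resCard K := by
  let f : ball K 0 →+ 𝓀[K] :=
    { toFun := fun x => IsLocalRing.residue 𝒪[K] ⟨x, mem_integer_iff.mpr x.2⟩
      map_zero' := map_zero (IsLocalRing.residue 𝒪[K])
      map_add' := fun x y => map_add (IsLocalRing.residue 𝒪[K]) ⟨x, mem_integer_iff.mpr x.2⟩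
        ⟨y, mem_integer_iff.mpr y.2⟩ }
  have hker : f.ker = (ball K 1).addSubgroupOf (ball K 0) := by
    ext x
    rw [AddMonoidHom.mem_ker, AddSubgroup.mem_addSubgroupOf]
    change IsLocalRing.residue 𝒪[K] _ = 0 ↔ _
    rw [IsLocalRing.residue_eq_zero_iff, mem_maximalIdeal_iff]
  have hsurj : Function.Surjective f := by
    intro y
    obtain ⟨x, rfl⟩ := IsLocalRing.residue_surjective y
    exact ⟨⟨x, mem_integer_iff.mp x.2⟩, rfl⟩
  rw [AddSubgroup.relIndex, ← hker, AddSubgroup.index_ker, AddMonoidHom.range_eq_top.mpr hsurj,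
    resCard]
  exact Nat.card_congr AddSubgroup.topEquiv.toEquiv

theorem map_mulLeft_ball (x : Kˣ) (n : ℤ) :
    (ball K n).map (AddMonoidHom.mulLeft (x : K)) = ball K (n + ord (x : K)) := by
  ext y
  constructor
  · rintro ⟨z, hz, rfl⟩
    exact mul_mem_ball' (self_mem_ball (x : K)) hz (by linarith)
  · intro hy
    refine ⟨(x : K)⁻¹ * y, mul_mem_ball' (self_mem_ball _) hy ?_, ?_⟩
    · rw [ord_inv]; linarith
    · simp

theorem relIndex_map_mulLeft {R : Type*} [Field R] (x : Rˣ) (A B : AddSubgroup R) :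
    (A.map (AddMonoidHom.mulLeft (x : R))).relIndex (B.map (AddMonoidHom.mulLeft (x : R))) =
      A.relIndex B :=
  AddSubgroup.relIndex_map_map_of_injective _ _ (mul_right_injective₀ x.ne_zero)

variable (K) in
theorem relIndex_ball_succ (n : ℤ) : (ball K (n + 1)).relIndex (ball K n) = resCard K := by
  obtain ⟨x, hx⟩ := exists_ord_eq K n
  rw [← relIndex_ball_one K, ← relIndex_map_mulLeft x (ball K 1), map_mulLeft_ball,
    map_mulLeft_ball, hx, zero_add, add_comm]

variable (K) in
theorem relIndex_ball_add (n : ℤ) (k : ℕ) :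
    (ball K (n + k)).relIndex (ball K n) = resCard K ^ k := by
  induction k with
  | zero => simp
  | succ k ih =>
    rw [pow_succ', ← ih, ← relIndex_ball_succ K (n + k)]
    push_cast
    rw [← add_assoc]
    exact (AddSubgroup.relIndex_mul_relIndex _ _ _ (ball_anti (by omega)) (ball_anti (by omega))).symm

variable (K) in
theorem one_lt_resCard : 1 < resCard K := Finite.one_lt_card

end UnitsOfField

/-! ### A quadratic equation over a local field -/

section Hensel

variable {K : Type*} [Field K] [ValuativeRel K] [TopologicalSpace K]
  [IsNonarchimedeanLocalField K]

/-- With s = 1/Y the equation becomes Y² - Y + t = 0, which has the simple root 1 modulo the maximal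
ideal, so Hensel's lemma applies in every residue characteristic. This single equation yields the
norms near 1, the invariance of the valuation under conjugation and the section of the Hermitian
orbit map. -/
theorem exists_quadratic_root {t : K} (ht : t ∈ ball K 1) :
    ∃ s : K, ord s = 0 ∧ s ≠ 0 ∧ t * s ^ 2 - s + 1 = 0 := by
  let := IsTopologicalAddGroup.rightUniformSpace K
  have := isUniformAddGroup_of_addCommGroup (G := K)
  let T : 𝒪[K] := ⟨t, mem_integer_iff.mpr (ball_mono ht (by norm_num))⟩
  have hT : T ∈ 𝓂[K] := (mem_maximalIdeal_iff T).mpr ht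
  obtain ⟨Y, hY, hY1⟩ := HenselianRing.is_henselian (R := 𝒪[K]) (I := 𝓂[K])
    (Polynomial.X ^ 2 - Polynomial.X + Polynomial.C T) (by
      have : (Polynomial.X ^ 2 - Polynomial.X + Polynomial.C T : Polynomial 𝒪[K]) =
        Polynomial.X ^ 2 + (-Polynomial.X + Polynomial.C T) := by ring
      rw [this]
      apply Polynomial.monic_X_pow_add
      refine (Polynomial.degree_add_le _ _).trans_lt (max_lt ?_ ?_)
      · rw [Polynomial.degree_neg, Polynomial.degree_X]; norm_num
      · exact Polynomial.degree_C_le.trans_lt (by norm_num)) 1 (by simpa using hT) (by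
      have : Polynomial.eval 1 (Polynomial.derivative
          (Polynomial.X ^ 2 - Polynomial.X + Polynomial.C T : Polynomial 𝒪[K])) = 1 := by
        simp
      rw [this]
      simp)
  rw [mem_maximalIdeal_iff] at hY1
  have hy : ((Y : K) - 1) ∈ ball K 1 := by simpa using hY1
  have h0 : (Y : K) ≠ 0 := by simpa using one_add_ne_zero hy
  have h1 : ord (Y : K) = 0 := by simpa using ord_one_add hy
  have h2 : (Y : K) ^ 2 - Y + t = 0 := by
    have := congrArg Subtype.val hY.eq_zero
    simpa [T] using this
  refine ⟨(Y : K)⁻¹, by rw [ord_inv, h1, neg_zero], inv_ne_zero h0, ?_⟩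
  field_simp
  linear_combination h2

end Hensel

/-! ### Quadratic extensions -/

section QuadraticAlgebra

variable {F E : Type*} [Field F] [Field E] [Algebra F E] [Algebra.IsQuadraticExtension F E]
  [Algebra.IsSeparable F E]

theorem algebraMap_trace (a : E) : algebraMap F E (Algebra.trace F E a) = a + conj F E a := by
  classical
  have hc : Fintype.card (E ≃ₐ[F] E) = 2 := by
    rw [← Nat.card_eq_fintype_card, IsGalois.card_aut_eq_finrank,
      Algebra.IsQuadraticExtension.finrank_eq_two]
  have hu : (Finset.univ : Finset (E ≃ₐ[F] E)) = {1, conj F E} := by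
    symm
    apply Finset.eq_univ_of_card
    rw [hc, Finset.card_pair (conj_ne_one F E).symm]
  rw [trace_eq_sum_automorphisms, hu, Finset.sum_pair (conj_ne_one F E).symm]
  rfl

theorem exists_of_conj_eq {a : E} (h : conj F E a = a) : ∃ z : F, algebraMap F E z = a := by
  have hc : Nat.card (E ≃ₐ[F] E) = 2 := by
    rw [IsGalois.card_aut_eq_finrank, Algebra.IsQuadraticExtension.finrank_eq_two]
  have := (IsGalois.mem_range_algebraMap_iff_fixed (F := F) a).mpr fun f => by
    by_cases hf : f = 1
    · simp [hf]
    by_cases hf' : f = conj F E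
    · rw [hf', h]
    classical
    have h3 : ({1, conj F E, f} : Finset (E ≃ₐ[F] E)).card = 3 := by
      rw [Finset.card_eq_three]
      exact ⟨1, conj F E, f, (conj_ne_one F E).symm, Ne.symm hf, Ne.symm hf', rfl⟩
    have := Finset.card_le_univ ({1, conj F E, f} : Finset (E ≃ₐ[F] E))
    rw [h3, ← Nat.card_eq_fintype_card, hc] at this
    omega
  exact this

variable (F E) in
theorem exists_conj_ne : ∃ a : E, conj F E a ≠ a := by
  by_contra! h
  exact conj_ne_one F E (AlgEquiv.ext h)

variable (F E) in
-- An element a moved by conjugation can be divided by its trace when that is nonzero. If the trace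
-- is 0, then 2 ≠ 0 (otherwise a would be fixed) and (1 + a)/2 works.
theorem exists_trace_one : ∃ τ : E, τ + conj F E τ = 1 ∧ τ ≠ conj F E τ := by
  obtain ⟨a, ha⟩ := exists_conj_ne F E
  by_cases h : a + conj F E a = 0
  · have h1 : conj F E a = -a := by linear_combination h
    have h2 : (2 : E) ≠ 0 := by
      intro h2
      apply ha
      linear_combination h1 - a * h2
    refine ⟨(1 + a) / 2, ?_, ?_⟩
    · rw [map_div₀, map_add, map_one, map_ofNat, h1]; field_simp; ring
    · rw [map_div₀, map_add, map_one, map_ofNat, h1]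
      intro h3
      field_simp at h3
      apply ha
      rw [h1]
      linear_combination -h3
  · have hc : conj F E (a + conj F E a) = a + conj F E a := by
      rw [map_add, conj_conj, add_comm]
    refine ⟨a / (a + conj F E a), ?_, ?_⟩
    · rw [map_div₀, hc]; field_simp
    · rw [map_div₀, hc]
      intro h3
      field_simp at h3
      exact ha h3.symm

variable (F E) in
/-- An element of trace `1` that is not in the base field. -/
noncomputable def trOne : E := (exists_trace_one F E).choose

variable (F E) in
theorem trOne_add : trOne F E + conj F E (trOne F E) = 1 := (exists_trace_one F E).choose_spec.1

variable (F E) in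
theorem trOne_ne : trOne F E ≠ conj F E (trOne F E) := (exists_trace_one F E).choose_spec.2

variable (F E) in
theorem conj_trOne : conj F E (trOne F E) = 1 - trOne F E := by
  linear_combination trOne_add F E

theorem trace_trOne_mul (z : F) : Algebra.trace F E (trOne F E * algebraMap F E z) = z := by
  apply (algebraMap F E).injective
  rw [algebraMap_trace, map_mul, AlgEquiv.commutes, ← add_mul, trOne_add, one_mul]

theorem norm_algebraMap_eq (z : F) : Algebra.norm F (algebraMap F E z) = z ^ 2 := by
  rw [Algebra.norm_algebraMap, Algebra.IsQuadraticExtension.finrank_eq_two]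

theorem norm_conj (a : E) : Algebra.norm F (conj F E a) = Algebra.norm F a := by
  apply (algebraMap F E).injective
  rw [norm_eq_mul_conj, norm_eq_mul_conj, conj_conj, mul_comm]

theorem norm_ne_zero {a : E} (ha : a ≠ 0) : Algebra.norm F a ≠ 0 := by
  intro h
  have := norm_eq_mul_conj F E a
  rw [h, map_zero] at this
  exact mul_ne_zero ha ((map_ne_zero _).mpr ha) this.symm

/-- Hilbert 90. -/
theorem exists_eq_mul_conj {u : E} (hu : u * conj F E u = 1) :
    ∃ w : E, w ≠ 0 ∧ w = u * conj F E w := by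
  by_cases h : 1 + u = 0
  -- The usual solution 1 + u vanishes here; τ - τ̄ is a nonzero element negated by conjugation.
  · have h1 : u = -1 := by linear_combination h
    refine ⟨trOne F E - conj F E (trOne F E), sub_ne_zero.mpr (trOne_ne F E), ?_⟩
    rw [map_sub, conj_conj, h1]; ring
  · refine ⟨1 + u, h, ?_⟩
    rw [map_add, map_one, mul_add, hu]; ring

theorem norm_one_add_trOne (s : F) : Algebra.norm F (1 + algebraMap F E s * trOne F E) =
    1 + s + s ^ 2 * Algebra.norm F (trOne F E) := by
  apply (algebraMap F E).injective
  rw [norm_eq_mul_conj]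
  simp only [map_add, map_mul, map_one, AlgEquiv.commutes, map_pow, norm_eq_mul_conj]
  linear_combination (algebraMap F E s) * trOne_add F E

end QuadraticAlgebra

/-! ### Valuations in a quadratic extension: ramification, conjugation, norms near 1 -/

section QuadraticLocal

variable {F E : Type*} [Field F] [ValuativeRel F] [TopologicalSpace F]
  [IsNonarchimedeanLocalField F] [Field E] [ValuativeRel E] [TopologicalSpace E]
  [IsNonarchimedeanLocalField E] [Algebra F E] [ValuativeExtension F E]

variable (F E) in
/-- The ramification index. -/
noncomputable def ramIdx : ℤ := ord (algebraMap F E ((exists_ord_eq F 1).choose : F))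

theorem mem_ball_zero_iff_vle {K : Type*} [Field K] [ValuativeRel K] [TopologicalSpace K]
    [IsNonarchimedeanLocalField K] (x : K) : x ∈ ball K 0 ↔ x ≤ᵥ 1 := by
  rw [← mem_integer_iff, Valuation.mem_integer_iff,
    Valuation.Compatible.vle_iff_le (v := valuation K), map_one]

theorem algebraMap_mem_ball_zero (x : F) : algebraMap F E x ∈ ball E 0 ↔ x ∈ ball F 0 := by
  rw [mem_ball_zero_iff_vle, mem_ball_zero_iff_vle, ← map_one (algebraMap F E),
    ValuativeExtension.vle_iff_vle]

theorem ord_algebraMap_unit {x : F} (hx : x ≠ 0) (h : ord x = 0) : ord (algebraMap F E x) = 0 := by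
  have hx' : algebraMap F E x ≠ 0 := (map_ne_zero _).mpr hx
  have h1 := (algebraMap_mem_ball_zero (E := E) x).mpr (Or.inr h.ge)
  have h2 := (algebraMap_mem_ball_zero (E := E) x⁻¹).mpr (Or.inr (by rw [ord_inv, h, neg_zero]))
  rw [map_inv₀, mem_ball_of_ne (inv_ne_zero hx'), ord_inv] at h2
  rw [mem_ball_of_ne hx'] at h1
  linarith

theorem ord_algebraMap {x : F} (hx : x ≠ 0) : ord (algebraMap F E x) = ramIdx F E * ord x := by
  set p : Fˣ := (exists_ord_eq F 1).choose
  have hp : ord (p : F) = 1 := (exists_ord_eq F 1).choose_spec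
  have h1 : ord (x / (p : F) ^ ord x) = 0 := by
    rw [ord_div hx (zpow_ne_zero _ p.ne_zero), ord_zpow _ p.ne_zero, hp]; ring
  have h2 := ord_algebraMap_unit (E := E) (div_ne_zero hx (zpow_ne_zero _ p.ne_zero)) h1
  have h3 : algebraMap F E (p : F) ≠ 0 := (map_ne_zero _).mpr p.ne_zero
  rw [map_div₀, map_zpow₀, ord_div ((map_ne_zero _).mpr hx) (zpow_ne_zero _ h3),
    ord_zpow _ h3] at h2
  have : ramIdx F E = ord (algebraMap F E (p : F)) := rfl
  rw [this]
  linarith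

variable (F E) in
theorem ramIdx_pos : 1 ≤ ramIdx F E := by
  obtain ⟨p, hp⟩ := exists_ord_eq F (-1)
  have h := (algebraMap_mem_ball_zero (E := E) (p : F)).not
  rw [mem_ball_unit, mem_ball_of_ne ((map_ne_zero _).mpr p.ne_zero), ord_algebraMap p.ne_zero,
    hp] at h
  have := h.mpr (by norm_num)
  linarith

theorem algebraMap_mem_ball {x : F} {n : ℤ} (hx : x ∈ ball F n) :
    algebraMap F E x ∈ ball E (ramIdx F E * n) := by
  rcases hx with rfl | hx
  · simp [(ball E _).zero_mem]
  by_cases h0 : x = 0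
  · simp [h0, (ball E _).zero_mem]
  refine Or.inr ?_
  rw [ord_algebraMap h0]
  exact mul_le_mul_of_nonneg_left hx (by linarith [ramIdx_pos F E])

theorem algebraMap_mem_ball_iff {x : F} {n : ℤ} :
    algebraMap F E x ∈ ball E (ramIdx F E * n) ↔ x ∈ ball F n := by
  refine ⟨fun h => ?_, algebraMap_mem_ball⟩
  by_cases h0 : x = 0
  · exact Or.inl h0
  rw [mem_ball_of_ne ((map_ne_zero _).mpr h0), ord_algebraMap h0] at h
  exact Or.inr (le_of_mul_le_mul_left h (by linarith [ramIdx_pos F E]))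

theorem algebraMap_mem_ball' {x : F} {n : ℕ} (hx : x ∈ ball F n) : algebraMap F E x ∈ ball E n := by
  refine ball_mono (algebraMap_mem_ball hx) ?_
  nlinarith [ramIdx_pos F E]

variable (F E) in
-- Valuations are multiplied by the ramification index, so the balls of E cut out balls of F.
-- Continuity of norm and trace can thus be tested after embedding F into E.
theorem isInducing_algebraMap : Topology.IsInducing (algebraMap F E) := by
  rw [Topology.isInducing_iff_nhds]
  intro x
  have h1 : nhds x = Filter.comap (fun y => y - x) (nhds 0) := by
    simpa using (Homeomorph.subRight x).isInducing.nhds_eq_comap x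
  have h2 : nhds (algebraMap F E x) = Filter.comap (fun y => y - algebraMap F E x) (nhds 0) := by
    simpa using (Homeomorph.subRight (algebraMap F E x)).isInducing.nhds_eq_comap (algebraMap F E x)
  rw [h1, h2, Filter.comap_comap]
  have h3 : ((fun y => y - algebraMap F E x) ∘ algebraMap F E) =
      algebraMap F E ∘ (fun y => y - x) := by ext y; simp
  rw [h3, ← Filter.comap_comap]
  congr 1
  apply ((hasBasis_nhds_zero F)).ext ((hasBasis_nhds_zero E).comap _)
  · intro n _
    exact ⟨ramIdx F E * n, trivial, fun y hy => algebraMap_mem_ball_iff.mp hy⟩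
  · intro n _
    refine ⟨n.natAbs, trivial, fun y hy => ball_mono (algebraMap_mem_ball' hy) (by omega)⟩

variable (F E) in
theorem continuous_algebraMap_local : Continuous (algebraMap F E) := (isInducing_algebraMap F E).continuous

variable [Algebra.IsQuadraticExtension F E] [Algebra.IsSeparable F E]

/-- If v(ā) < v(a), the Newton polygon of X² - Tr(a)X + Nm(a) has two slopes, so the polynomial
splits over F by `exists_quadratic_root`. Then a or ā lies in F, so a = ā, contradicting the
inequality of valuations. -/
theorem mem_ball_conj_of_le {a : E} (ha : a ≠ 0) : ord a ≤ ord (conj F E a) := by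
  by_contra! h
  have ha' : conj F E a ≠ 0 := (map_ne_zero _).mpr ha
  have hs : ord (conj F E a + a) = ord (conj F E a) := ord_add_eq ha' (Or.inr (by omega))
  have hs0 : conj F E a + a ≠ 0 := add_ne_zero_of_mem ha' (Or.inr (by omega))
  have hT := algebraMap_trace (F := F) a
  have hN := norm_eq_mul_conj F E a
  have hT0 : Algebra.trace F E a ≠ 0 := by
    intro h0
    rw [h0, map_zero, add_comm] at hT
    exact hs0 hT.symm
  obtain ⟨s, -, hs1, hs2⟩ := exists_quadratic_root
    (t := Algebra.norm F a / Algebra.trace F E a ^ 2) (by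
      have hN0 := norm_ne_zero (F := F) ha
      refine Or.inr ?_
      have h1 : ord (algebraMap F E (Algebra.norm F a / Algebra.trace F E a ^ 2)) =
          ord a - ord (conj F E a) := by
        rw [map_div₀, map_pow, hN, hT, add_comm a, ord_div (mul_ne_zero ha ha') (pow_ne_zero _ hs0),
          ord_mul ha ha', ord_pow _ hs0, hs]
        push_cast; ring
      rw [ord_algebraMap (div_ne_zero hN0 (pow_ne_zero _ hT0))] at h1
      by_contra! h2
      nlinarith [ramIdx_pos F E])
  set y : F := Algebra.norm F a / Algebra.trace F E a * s with hy
  have hroot : y ^ 2 - Algebra.trace F E a * y + Algebra.norm F a = 0 := by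
    rw [hy]
    field_simp at hs2 ⊢
    linear_combination (Algebra.norm F a) * hs2
  have h2 := congrArg (algebraMap F E) hroot
  rw [map_add, map_sub, map_mul, map_pow, hT, hN, map_zero] at h2
  have h3 : (algebraMap F E y - a) * (algebraMap F E y - conj F E a) = 0 := by
    linear_combination h2
  rcases mul_eq_zero.mp h3 with h4 | h4
  · have : a = algebraMap F E y := by linear_combination -h4
    rw [this, AlgEquiv.commutes] at h
    exact lt_irrefl _ h
  · have h5 : conj F E a = algebraMap F E y := by linear_combination -h4
    have h6 : a = algebraMap F E y := by rw [← conj_conj F E a, h5, AlgEquiv.commutes]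
    rw [h5, ← h6] at h
    exact lt_irrefl _ h

@[simp] theorem ord_conj (a : E) : ord (conj F E a) = ord a := by
  by_cases ha : a = 0
  · simp [ha]
  have ha' : conj F E a ≠ 0 := (map_ne_zero _).mpr ha
  have := mem_ball_conj_of_le (F := F) ha'
  rw [conj_conj] at this
  exact le_antisymm this (mem_ball_conj_of_le ha)

theorem conj_mem_ball {a : E} {n : ℤ} : conj F E a ∈ ball E n ↔ a ∈ ball E n := by
  simp [mem_ball]

variable (F E) in
theorem continuous_conj : Continuous (conj F E) := by
  have : ContinuousAt (conj F E : E →+ E) 0 := by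
    rw [ContinuousAt, map_zero, (hasBasis_nhds_zero E).tendsto_iff (hasBasis_nhds_zero E)]
    exact fun n _ => ⟨n, trivial, fun x hx => conj_mem_ball.mpr hx⟩
  exact continuous_of_continuousAt_zero (conj F E : E →+ E) this

variable (F E) in
theorem continuous_norm_local : Continuous (Algebra.norm F : E → F) := by
  rw [(isInducing_algebraMap F E).continuous_iff]
  have : (algebraMap F E) ∘ (Algebra.norm F) = fun a => a * conj F E a := by
    ext a; exact norm_eq_mul_conj F E a
  rw [this]
  exact continuous_id.mul (continuous_conj F E)

variable (F E) in
theorem continuous_trace_local : Continuous (Algebra.trace F E) := by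
  rw [(isInducing_algebraMap F E).continuous_iff]
  have : (algebraMap F E) ∘ (Algebra.trace F E) = fun a => a + conj F E a := by
    ext a; exact algebraMap_trace a
  rw [this]
  exact continuous_id.add (continuous_conj F E)

theorem ramIdx_mul_ord_norm {a : E} (ha : a ≠ 0) :
    ramIdx F E * ord (Algebra.norm F a) = 2 * ord a := by
  rw [← ord_algebraMap (norm_ne_zero ha), norm_eq_mul_conj,
    ord_mul ha ((map_ne_zero _).mpr ha), ord_conj]
  ring

variable (F E) in
theorem ramIdx_eq : ramIdx F E = 1 ∨ ramIdx F E = 2 := by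
  obtain ⟨p, hp⟩ := exists_ord_eq E 1
  have := ramIdx_mul_ord_norm (F := F) p.ne_zero
  rw [hp, mul_one] at this
  have h1 := ramIdx_pos F E
  have h2 : ramIdx F E ≤ 2 := Int.le_of_dvd (by norm_num) ⟨_, this.symm⟩
  omega

/-- Elements close to `1` are norms of elements close to `1`. -/
theorem exists_norm_eq_one_add {t : F} {n : ℕ}
    (ht : t ∈ ball F n) (ht' : t * Algebra.norm F (trOne F E) ∈ ball F 1) :
    ∃ s ∈ ball F n, Algebra.norm F (1 + algebraMap F E s * trOne F E) = 1 + t := by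
  -- With ν = Nm(τ), Nm(1 + tsτ) = 1 + ts + t²s²ν, and this is 1 + t once (-tν)s² - s + 1 = 0.
  obtain ⟨s, hs, -, hs'⟩ := exists_quadratic_root
    (t := -(t * Algebra.norm F (trOne F E))) ((ball F 1).neg_mem ht')
  refine ⟨t * s, mul_mem_ball' (n := 0) ht (Or.inr hs.ge) (by simp), ?_⟩
  rw [norm_one_add_trOne]
  linear_combination -t * hs'

end QuadraticLocal

/-! ### An index inequality for a group with involution -/

section HerbrandIndex

variable {G : Type*} [CommGroup G]

/-- If the norm is surjective onto the invariants of a stable subgroup of finite index, then the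
norm index is at most the index of the elements `u / σ u` in the kernel of the norm. -/
theorem norm_relIndex_le {σ : G →* G} (hσ : ∀ g, σ (σ g) = g) {N f : G →* G}
    (hN : ∀ g, N g = g * σ g) (hf : ∀ g, f g = g / σ g) (V : Subgroup G)
    (hVσ : ∀ v ∈ V, σ v ∈ V) (hV : ∀ v ∈ V, σ v = v → ∃ w ∈ V, N w = v)
    (hfin : V.index ≠ 0) (hy : f.range.relIndex N.ker ≠ 0) :
    N.range.relIndex f.ker ≠ 0 ∧ N.range.relIndex f.ker ≤ f.range.relIndex N.ker := by
  have hB (g : G) : g ∈ f.ker ↔ σ g = g := by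
    rw [MonoidHom.mem_ker, hf, div_eq_one, eq_comm]
  have hNB : N.range ≤ f.ker := by
    rintro _ ⟨g, rfl⟩
    rw [hB, hN, map_mul, hσ, mul_comm]
  have hfA : f.range ≤ N.ker := by
    rintro _ ⟨g, rfl⟩
    rw [MonoidHom.mem_ker, hN, hf, map_div, hσ, div_mul_div_cancel, div_self']
  have hVN : V.map N = V ⊓ f.ker := by
    ext v
    constructor
    · rintro ⟨w, hw, rfl⟩
      refine ⟨?_, hNB ⟨w, rfl⟩⟩
      rw [hN]
      exact V.mul_mem hw (hVσ w hw)
    · rintro ⟨h1, h2⟩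
      obtain ⟨w, hw, e⟩ := hV v h1 ((hB v).mp h2)
      exact ⟨w, hw, e⟩
  have hVf : V.map f ≤ V ⊓ N.ker := by
    rintro _ ⟨w, hw, rfl⟩
    refine ⟨?_, hfA ⟨w, rfl⟩⟩
    rw [hf]
    exact V.div_mem hw (hVσ w hw)
  -- For any endomorphism h, the index of V is the product of the indices of its traces on the
  -- kernel and on the image of h. Applying this to both the norm and g ↦ g/σ(g) is the computation
  -- of a Herbrand quotient.
  have key (h : G →* G) : V.index = V.relIndex h.ker * (V.map h).relIndex h.range := by
    have h1 := Subgroup.relIndex_map_map h V ⊤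
    rw [← MonoidHom.range_eq_map, top_sup_eq, Subgroup.relIndex_top_right] at h1
    rw [h1, ← Subgroup.relIndex_sup_left (K := V) (H := h.ker)]
    exact (Subgroup.relIndex_mul_index le_sup_left).symm
  have eN := key N
  have ef := key f
  -- Here surjectivity of the norm onto the invariants of V enters: N(V) is all of V ∩ ker f. For f
  -- only the inclusion f(V) ⊆ V ∩ ker N is available, which is why the result is an inequality.
  have c1 : V.relIndex f.ker = (V.map N).relIndex N.range * N.range.relIndex f.ker := by
    rw [Subgroup.relIndex_mul_relIndex _ _ _ (by rintro _ ⟨g, -, rfl⟩; exact ⟨g, rfl⟩) hNB, hVN,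
      Subgroup.inf_relIndex_right]
  have c2 : (V.map f).relIndex N.ker = (V.map f).relIndex f.range * f.range.relIndex N.ker :=
    (Subgroup.relIndex_mul_relIndex _ _ _ (by rintro _ ⟨g, -, rfl⟩; exact ⟨g, rfl⟩) hfA).symm
  have hvf : (V.map f).relIndex f.range ≠ 0 := fun h => hfin (by rw [ef, h, mul_zero])
  have hB0 : V.relIndex f.ker ≠ 0 := fun h => hfin (by rw [ef, h, zero_mul])
  have c3 : V.relIndex N.ker ≤ (V.map f).relIndex N.ker := by
    rw [← Subgroup.inf_relIndex_right]
    exact Subgroup.relIndex_le_of_le_left hVf (by rw [c2]; exact mul_ne_zero hvf hy)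
  refine ⟨fun h => hB0 (by rw [c1, h, mul_zero]), ?_⟩
  have e1 : V.index * N.range.relIndex f.ker = V.relIndex N.ker * V.relIndex f.ker := by
    rw [eN, c1]; ring
  have e2 : V.index * f.range.relIndex N.ker = (V.map f).relIndex N.ker * V.relIndex f.ker := by
    rw [ef, c2]; ring
  refine Nat.le_of_mul_le_mul_left ?_ (Nat.pos_of_ne_zero hfin)
  rw [e1, e2]
  exact Nat.mul_le_mul_right _ c3

end HerbrandIndex

section QuadraticLattice

variable {F E : Type*} [Field F] [ValuativeRel F] [TopologicalSpace F]
  [IsNonarchimedeanLocalField F] [Field E] [ValuativeRel E] [TopologicalSpace E]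
  [IsNonarchimedeanLocalField E] [Algebra F E] [ValuativeExtension F E]
  [Algebra.IsQuadraticExtension F E] [Algebra.IsSeparable F E]

/-! ### The lattices spanned by a normal basis -/

variable (F E) in
/-- The first coordinate with respect to the basis `τ, τ̄`, where `τ = trOne F E`. -/
noncomputable def coordU : E →+ F :=
  (Algebra.trace F E).toAddMonoidHom.comp
    (AddMonoidHom.mulRight (trOne F E / (trOne F E - conj F E (trOne F E))))

variable (F E) in
/-- The second coordinate with respect to the basis `τ, τ̄`. -/
noncomputable def coordV : E →+ F :=
  (Algebra.trace F E).toAddMonoidHom.comp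
    (AddMonoidHom.mulRight (conj F E (trOne F E) / (conj F E (trOne F E) - trOne F E)))

theorem coordU_apply (x : E) : algebraMap F E (coordU F E x) =
    (x * trOne F E - conj F E x * conj F E (trOne F E)) /
      (trOne F E - conj F E (trOne F E)) := by
  have hd := sub_ne_zero.mpr (trOne_ne F E)
  have hd' := sub_ne_zero.mpr (trOne_ne F E).symm
  change algebraMap F E (Algebra.trace F E (x * _)) = _
  rw [algebraMap_trace, map_mul, map_div₀, map_sub, conj_conj]
  field_simp
  ring

theorem coordV_eq (x : E) : coordV F E x = coordU F E (conj F E x) := by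
  have hd := sub_ne_zero.mpr (trOne_ne F E)
  have hd' := sub_ne_zero.mpr (trOne_ne F E).symm
  apply (algebraMap F E).injective
  rw [coordU_apply, conj_conj]
  change algebraMap F E (Algebra.trace F E (x * _)) = _
  rw [algebraMap_trace, map_mul, map_div₀, map_sub, conj_conj]
  field_simp
  ring

theorem eq_coord (x : E) : x = algebraMap F E (coordU F E x) * trOne F E +
    algebraMap F E (coordV F E x) * conj F E (trOne F E) := by
  have hd := sub_ne_zero.mpr (trOne_ne F E)
  rw [coordV_eq, coordU_apply, coordU_apply, conj_conj]
  field_simp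
  linear_combination (-x * (trOne F E - conj F E (trOne F E))) * trOne_add F E

theorem coordU_lin (s t : F) : coordU F E (algebraMap F E s * trOne F E +
    algebraMap F E t * conj F E (trOne F E)) = s := by
  have hd := sub_ne_zero.mpr (trOne_ne F E)
  apply (algebraMap F E).injective
  rw [coordU_apply]
  simp only [map_add, map_mul, AlgEquiv.commutes, conj_conj]
  field_simp
  linear_combination (algebraMap F E s * (trOne F E - conj F E (trOne F E))) * trOne_add F E

theorem coordV_lin (s t : F) : coordV F E (algebraMap F E s * trOne F E +
    algebraMap F E t * conj F E (trOne F E)) = t := by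
  rw [coordV_eq]
  rw [map_add (conj F E), map_mul (conj F E), map_mul (conj F E), AlgEquiv.commutes,
    AlgEquiv.commutes, conj_conj, add_comm, coordU_lin]

variable (F E) in
/-- The lattice `𝔭 ^ m τ + 𝔭 ^ n τ̄`. -/
noncomputable def lattice (m n : ℤ) : AddSubgroup E :=
  (ball F m).comap (coordU F E) ⊓ (ball F n).comap (coordV F E)

theorem mem_lattice {m n : ℤ} {x : E} :
    x ∈ lattice F E m n ↔ coordU F E x ∈ ball F m ∧ coordV F E x ∈ ball F n := Iff.rfl

theorem conj_mem_lattice {n : ℤ} {x : E} (hx : x ∈ lattice F E n n) :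
    conj F E x ∈ lattice F E n n := by
  refine ⟨?_, ?_⟩
  · change coordU F E (conj F E x) ∈ ball F n
    rw [← coordV_eq]
    exact hx.2
  · change coordV F E (conj F E x) ∈ ball F n
    rw [coordV_eq, conj_conj]
    exact hx.1

theorem lin_mem_lattice {m n : ℤ} {s t : F} (hs : s ∈ ball F m) (ht : t ∈ ball F n) :
    algebraMap F E s * trOne F E + algebraMap F E t * conj F E (trOne F E) ∈ lattice F E m n := by
  rw [mem_lattice, coordU_lin, coordV_lin]
  exact ⟨hs, ht⟩

theorem algebraMap_mem_lattice_iff {n : ℤ} {c : F} :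
    algebraMap F E c ∈ lattice F E n n ↔ c ∈ ball F n := by
  have : algebraMap F E c = algebraMap F E c * trOne F E +
      algebraMap F E c * conj F E (trOne F E) := by
    rw [← mul_add, trOne_add, mul_one]
  rw [this, mem_lattice, coordU_lin, coordV_lin, and_self]

variable (F E) in
theorem exists_ball_le_lattice (n : ℤ) : ∃ a : ℕ, ball E a ≤ lattice F E n n := by
  have hd := sub_ne_zero.mpr (trOne_ne F E)
  set d := trOne F E - conj F E (trOne F E)
  have key : ∀ a : ℤ, ramIdx F E * n + ord d - ord (trOne F E) ≤ a →
      ∀ x ∈ ball E a, coordU F E x ∈ ball F n := by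
    intro a ha x hx
    rw [← algebraMap_mem_ball_iff (E := E), coordU_apply, div_eq_mul_inv]
    refine mul_mem_ball' (m := a + ord (trOne F E)) ?_ (self_mem_ball _) ?_
    · exact (ball E _).sub_mem (mul_mem_ball hx (self_mem_ball _))
        (mul_mem_ball (conj_mem_ball.mpr hx) (conj_mem_ball.mpr (self_mem_ball _)))
    · rw [ord_inv]; linarith
  refine ⟨(ramIdx F E * n + ord d - ord (trOne F E)).natAbs, fun x hx => ?_⟩
  rw [mem_lattice, coordV_eq]
  exact ⟨key _ (by omega) x hx, key _ (by omega) _ (conj_mem_ball.mpr hx)⟩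

theorem lattice_le_ball (n : ℤ) :
    lattice F E n n ≤ ball E (ramIdx F E * n + ord (trOne F E)) := by
  rintro x ⟨h1, h2⟩
  rw [eq_coord (F := F) x]
  exact (ball E _).add_mem (mul_mem_ball (algebraMap_mem_ball h1) (self_mem_ball _))
    (mul_mem_ball (algebraMap_mem_ball h2) (conj_mem_ball.mpr (self_mem_ball _)))

/-- With ν = Nm(τ) the relations ττ̄ = ν, τ² = τ - ν and τ̄² = τ̄ - ν bring only the factor ν into
the coordinates of a product. For n ≥ -v(ν) the factor 𝔭ⁿ gained in multiplication absorbs it. -/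
theorem mul_mem_lattice {n : ℤ} (hn : 0 ≤ n) (hn' : -ord (Algebra.norm F (trOne F E)) ≤ n) {x y : E}
    (hx : x ∈ lattice F E n n) (hy : y ∈ lattice F E n n) : x * y ∈ lattice F E n n := by
  set ν : F := Algebra.norm F (trOne F E) with hν
  have h0 := norm_eq_mul_conj F E (trOne F E)
  have h1 := trOne_add F E
  set s := coordU F E x
  set t := coordV F E x
  set s' := coordU F E y
  set t' := coordV F E y
  have e : x * y = algebraMap F E (s * s' + ν * (s * t' + t * s' - s * s' - t * t')) * trOne F E +
      algebraMap F E (t * t' + ν * (s * t' + t * s' - s * s' - t * t')) *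
        conj F E (trOne F E) := by
    rw [eq_coord (F := F) x, eq_coord (F := F) y]
    simp only [map_add, map_mul, map_sub]
    rw [hν, h0]
    have h2 : conj F E (trOne F E) = 1 - trOne F E := conj_trOne F E
    rw [h2]
    ring
  have hss := mul_mem_ball hx.1 hy.1
  have hst := mul_mem_ball hx.1 hy.2
  have hts := mul_mem_ball hx.2 hy.1
  have htt := mul_mem_ball hx.2 hy.2
  have hc : ν * (s * t' + t * s' - s * s' - t * t') ∈ ball F n :=
    mul_mem_ball' (self_mem_ball ν)
      ((ball F _).sub_mem ((ball F _).sub_mem ((ball F _).add_mem hst hts) hss) htt) (by linarith)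
  rw [e]
  exact lin_mem_lattice ((ball F n).add_mem (ball_mono hss (by linarith)) hc)
    ((ball F n).add_mem (ball_mono htt (by linarith)) hc)

theorem map_coordU_lattice (m n : ℤ) : (lattice F E m n).map (coordU F E) = ball F m := by
  ext s
  constructor
  · rintro ⟨x, hx, rfl⟩; exact hx.1
  · intro hs
    exact ⟨_, lin_mem_lattice hs (ball F n).zero_mem, coordU_lin s 0⟩

theorem map_coordV_lattice (m n : ℤ) : (lattice F E m n).map (coordV F E) = ball F n := by
  ext s
  constructor
  · rintro ⟨x, hx, rfl⟩; exact hx.2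
  · intro hs
    exact ⟨_, lin_mem_lattice (ball F m).zero_mem hs, coordV_lin 0 s⟩

variable (F E) in
theorem relIndex_lattice (n : ℤ) :
    (lattice F E (n + 1) (n + 1)).relIndex (lattice F E n n) = resCard F ^ 2 := by
  have h1 : (lattice F E (n + 1) n).relIndex (lattice F E n n) = resCard F := by
    have : lattice F E (n + 1) n = (ball F (n + 1)).comap (coordU F E) ⊓ lattice F E n n := by
      ext x
      simp only [AddSubgroup.mem_inf, AddSubgroup.mem_comap, mem_lattice]
      exact ⟨fun h => ⟨h.1, ball_mono h.1 (by linarith), h.2⟩, fun h => ⟨h.1, h.2.2⟩⟩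
    rw [this, AddSubgroup.inf_relIndex_right, AddSubgroup.relIndex_comap, map_coordU_lattice,
      relIndex_ball_succ]
  have h2 : (lattice F E (n + 1) (n + 1)).relIndex (lattice F E (n + 1) n) = resCard F := by
    have : lattice F E (n + 1) (n + 1) =
        (ball F (n + 1)).comap (coordV F E) ⊓ lattice F E (n + 1) n := by
      ext x
      simp only [AddSubgroup.mem_inf, AddSubgroup.mem_comap, mem_lattice]
      exact ⟨fun h => ⟨h.2, h.1, ball_mono h.2 (by linarith)⟩, fun h => ⟨h.2.1, h.1⟩⟩
    rw [this, AddSubgroup.inf_relIndex_right, AddSubgroup.relIndex_comap, map_coordV_lattice,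
      relIndex_ball_succ]
  rw [← AddSubgroup.relIndex_mul_relIndex _ (lattice F E (n + 1) n) _, h1, h2, pow_two]
  · exact fun x hx => ⟨hx.1, ball_mono hx.2 (by linarith)⟩
  · exact fun x hx => ⟨ball_mono hx.1 (by linarith), hx.2⟩

theorem map_mulLeft_lattice (x : Fˣ) (n : ℤ) :
    (lattice F E n n).map (AddMonoidHom.mulLeft ((incl F E x : Eˣ) : E)) =
      lattice F E (n + ord (x : F)) (n + ord (x : F)) := by
  have hU (c : F) (y : E) : coordU F E (algebraMap F E c * y) = c * coordU F E y := by
    conv_lhs => rw [eq_coord (F := F) y, mul_add, ← mul_assoc, ← mul_assoc, ← map_mul, ← map_mul]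
    rw [coordU_lin]
  have hV (c : F) (y : E) : coordV F E (algebraMap F E c * y) = c * coordV F E y := by
    conv_lhs => rw [eq_coord (F := F) y, mul_add, ← mul_assoc, ← mul_assoc, ← map_mul, ← map_mul]
    rw [coordV_lin]
  have hx : ((incl F E x : Eˣ) : E) = algebraMap F E x := rfl
  rw [hx]
  ext y
  constructor
  · rintro ⟨z, hz, rfl⟩
    change algebraMap F E x * z ∈ _
    rw [mem_lattice, hU, hV, mul_mem_ball_iff x.ne_zero, mul_mem_ball_iff x.ne_zero]
    simpa using mem_lattice.mp hz
  · intro hy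
    refine ⟨algebraMap F E ((x : F)⁻¹) * y, ?_, ?_⟩
    · rw [SetLike.mem_coe, mem_lattice, hU, hV, mul_mem_ball_iff (inv_ne_zero x.ne_zero),
        mul_mem_ball_iff (inv_ne_zero x.ne_zero), ord_inv, sub_neg_eq_add]
      exact hy
    · change algebraMap F E x * (algebraMap F E ((x : F)⁻¹) * y) = y
      rw [← mul_assoc, ← map_mul, mul_inv_cancel₀ x.ne_zero, map_one, one_mul]

variable (F E) in
/-- The fundamental identity `e f = 2`, in terms of residue cardinalities. -/
theorem resCard_pow_ramIdx : resCard E ^ (ramIdx F E).toNat = resCard F ^ 2 := by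
  obtain ⟨a, ha⟩ := exists_ball_le_lattice F E 0
  obtain ⟨p, hp⟩ := exists_ord_eq F 1
  have h1 : ord ((incl F E p : Eˣ) : E) = ramIdx F E := by
    have := ord_algebraMap (E := E) p.ne_zero
    rw [hp, mul_one] at this
    exact this
  have e1 := map_mulLeft_lattice (E := E) p 0
  have e2 := map_mulLeft_ball (incl F E p) a
  rw [hp, zero_add] at e1
  rw [h1] at e2
  have h3 := relIndex_map_mulLeft (incl F E p) (ball E a) (lattice F E 0 0)
  rw [e1, e2] at h3
  have hpos := ramIdx_pos F E
  -- Multiplication by a uniformizer of F carries the pair (ball, lattice) to the next one and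
  -- preserves the index. Computing the index of the smaller ball in the larger lattice through
  -- either intermediate group gives q_E^e = q_F², after cancelling a finite index.
  have h4 : (ball E (a + ramIdx F E)).relIndex (lattice F E 0 0) =
      (ball E (a + ramIdx F E)).relIndex (lattice F E 1 1) * resCard F ^ 2 := by
    rw [← relIndex_lattice F E 0]
    refine (AddSubgroup.relIndex_mul_relIndex _ _ _ ?_ ?_).symm
    · rw [← e1, ← e2]; exact AddSubgroup.map_mono ha
    · exact fun x hx => ⟨ball_mono hx.1 (by norm_num), ball_mono hx.2 (by norm_num)⟩
  have h5 : (ball E (a + ramIdx F E)).relIndex (lattice F E 0 0) =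
      resCard E ^ (ramIdx F E).toNat * (ball E a).relIndex (lattice F E 0 0) := by
    have h6 := relIndex_ball_add E a (ramIdx F E).toNat
    rw [Int.toNat_of_nonneg (by linarith)] at h6
    rw [← h6]
    exact (AddSubgroup.relIndex_mul_relIndex _ _ _ (ball_anti (by linarith)) ha).symm
  have h7 : (ball E a).relIndex (lattice F E 0 0) ≠ 0 := by
    have h8 := lattice_le_ball (F := F) (E := E) 0
    have h9 : ball E a ≤ ball E (ramIdx F E * 0 + ord (trOne F E)) := ha.trans h8
    have h10 : (ball E a).relIndex (ball E (ramIdx F E * 0 + ord (trOne F E))) ≠ 0 := by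
      set r := ramIdx F E * 0 + ord (trOne F E)
      have h11 := relIndex_ball_add E (r - |r|) (a + |r| - r + |r|).toNat
      have : (0:ℤ) ≤ a + |r| - r + |r| := by linarith [le_abs_self r, abs_nonneg r]
      rw [Int.toNat_of_nonneg this] at h11
      have h12 : (ball E (r - |r| + (a + |r| - r + |r|))).relIndex (ball E (r - |r|)) ≠ 0 := by
        rw [h11]
        exact pow_ne_zero _ (by have := one_lt_resCard E; omega)
      have h13 : (ball E (a + |r|)).relIndex (ball E (r - |r|)) ≠ 0 := by
        convert h12 using 3; ring
      intro h0
      have h14 := AddSubgroup.relIndex_eq_zero_of_le_left (H := ball E (a + |r|)) (K := ball E a)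
        (ball_anti (by linarith [abs_nonneg r])) h0
      exact h13 (AddSubgroup.relIndex_eq_zero_of_le_right
        (ball_anti (by linarith [abs_nonneg r])) h14)
    intro h0
    exact h10 (AddSubgroup.relIndex_eq_zero_of_le_right h8 h0)
  rw [h3] at h4
  rw [h4, mul_comm] at h5
  exact (Nat.eq_of_mul_eq_mul_right (Nat.pos_of_ne_zero h7) h5).symm

/-- Compare squares: |a|_E² is a power of q_E with exponent e v_F(Nm a), and q_E^e = q_F². This is
why the derivative in s produces log q with the residue cardinality of F. -/
theorem normAbs_eq_normAbs_norm {a : E} (ha : a ≠ 0) :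
    normAbs a = normAbs (Algebra.norm F a) := by
  have h1 := resCard_pow_ramIdx F E
  have h2 := ramIdx_mul_ord_norm (F := F) ha
  have h3 := ramIdx_pos F E
  have hE : (0 : ℝ) < resCard E := by exact_mod_cast (one_lt_resCard E).le
  have hF : (0 : ℝ) < resCard F := by exact_mod_cast (one_lt_resCard F).le
  have h4 : ((resCard E : ℝ)) ^ ramIdx F E = (resCard F : ℝ) ^ (2 : ℤ) := by
    conv_lhs => rw [← Int.toNat_of_nonneg (by linarith : 0 ≤ ramIdx F E)]
    rw [zpow_natCast]
    exact_mod_cast h1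
  have h5 : normAbs a ^ (2 : ℤ) = normAbs (Algebra.norm F a) ^ (2 : ℤ) := by
    unfold normAbs
    rw [← _root_.zpow_mul, ← _root_.zpow_mul, mul_comm _ (2 : ℤ), mul_comm (-ord (Algebra.norm F a)) (2 : ℤ),
      _root_.zpow_mul _ 2 (-ord (Algebra.norm F a)), ← h4, ← _root_.zpow_mul]
    congr 1
    linarith
  have h6 : 0 ≤ normAbs a := by unfold normAbs; positivity
  have h7 : 0 ≤ normAbs (Algebra.norm F a) := by unfold normAbs; positivity
  exact (pow_left_inj₀ h6 h7 (by norm_num : (2 : ℕ) ≠ 0)).mp (by exact_mod_cast h5)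

end QuadraticLattice

section NormGroup

variable {F E : Type*} [Field F] [ValuativeRel F] [TopologicalSpace F]
  [IsNonarchimedeanLocalField F] [Field E] [ValuativeRel E] [TopologicalSpace E]
  [IsNonarchimedeanLocalField E] [Algebra F E] [ValuativeExtension F E]
  [Algebra.IsQuadraticExtension F E] [Algebra.IsSeparable F E]

/-! ### The norm group of a quadratic extension -/

variable (F E) in
/-- The norm on unit groups. -/
noncomputable def normU : Eˣ →* Fˣ := Units.map (Algebra.norm F)

@[simp] theorem normU_val (a : Eˣ) : ((normU F E a : Fˣ) : F) = Algebra.norm F (a : E) := rfl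

variable (F E) in
/-- Conjugation on the unit group. -/
noncomputable def conjU : Eˣ →* Eˣ := Units.map (conj F E : E →* E)

@[simp] theorem conjU_val (a : Eˣ) : ((conjU F E a : Eˣ) : E) = conj F E (a : E) := rfl

@[simp] theorem conjU_conjU (a : Eˣ) : conjU F E (conjU F E a) = a := by
  ext; simp [conj_conj]

@[simp] theorem incl_val (z : Fˣ) : ((incl F E z : Eˣ) : E) = algebraMap F E (z : F) := rfl

@[simp] theorem conjU_incl (z : Fˣ) : conjU F E (incl F E z) = incl F E z := by
  ext; simp

theorem incl_normU (a : Eˣ) : incl F E (normU F E a) = a * conjU F E a := by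
  ext; simp [norm_eq_mul_conj]

@[simp] theorem normU_conjU (a : Eˣ) : normU F E (conjU F E a) = normU F E a := by
  ext; simp [norm_conj]

theorem normU_incl (z : Fˣ) : normU F E (incl F E z) = z ^ 2 := by
  ext
  rw [normU_val, incl_val, norm_algebraMap_eq, Units.val_pow_eq_pow_val]

theorem incl_injective : Function.Injective (incl F E) := fun a b h => by
  ext
  exact (algebraMap F E).injective (congrArg Units.val h)

theorem exists_incl_of_conjU_eq {a : Eˣ} (h : conjU F E a = a) : ∃ z : Fˣ, incl F E z = a := by
  obtain ⟨z, hz⟩ := exists_of_conj_eq (F := F) (congrArg Units.val h)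
  have h0 : z ≠ 0 := by rintro rfl; exact a.ne_zero (by rw [← hz, map_zero])
  exact ⟨Units.mk0 z h0, by ext; simpa using hz⟩

@[simp] theorem ord_conjU (a : Eˣ) : ord ((conjU F E a : Eˣ) : E) = ord (a : E) := by simp

theorem ramIdx_mul_ord_normU (a : Eˣ) :
    ramIdx F E * ord ((normU F E a : Fˣ) : F) = 2 * ord (a : E) :=
  ramIdx_mul_ord_norm a.ne_zero

theorem ord_incl (z : Fˣ) : ord ((incl F E z : Eˣ) : E) = ramIdx F E * ord (z : F) :=
  ord_algebraMap z.ne_zero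

theorem ord_normU_eq_zero_iff (a : Eˣ) : ord ((normU F E a : Fˣ) : F) = 0 ↔ ord (a : E) = 0 := by
  have h1 := ramIdx_mul_ord_normU (F := F) a
  have h2 := ramIdx_pos F E
  constructor
  · intro h; rw [h] at h1; linarith
  · intro h
    rw [h, mul_zero] at h1
    exact (mul_eq_zero.mp h1).resolve_left (by linarith)

variable (F E) in
/-- The subgroup of norms. -/
noncomputable def normGroup : Subgroup Fˣ := (normU F E).range

theorem mem_normGroup {z : Fˣ} : z ∈ normGroup F E ↔ ∃ a : Eˣ, Algebra.norm F (a : E) = z := by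
  constructor
  · rintro ⟨a, rfl⟩; exact ⟨a, rfl⟩
  · rintro ⟨a, ha⟩; exact ⟨a, Units.ext ha⟩

theorem normU_mem (a : Eˣ) : normU F E a ∈ normGroup F E := ⟨a, rfl⟩

open Classical in
theorem eta_eq (z : Fˣ) : eta F E z = if z ∈ normGroup F E then 1 else -1 := by
  unfold eta
  congr 1
  rw [mem_normGroup]

/-- The group of the elements `1 + x`, where `x` is in a small stable lattice. -/
noncomputable def latticeUnits (n : ℤ) (hn : 0 ≤ n)
    (hn' : -ord (Algebra.norm F (trOne F E)) ≤ n) :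
    Subgroup (oneUnits E 0) where
  carrier := {u | ((u : Eˣ) : E) - 1 ∈ lattice F E n n}
  one_mem' := by simp [(lattice F E n n).zero_mem]
  mul_mem' := by
    intro a b ha hb
    have h := (lattice F E n n).add_mem ((lattice F E n n).add_mem
      (mul_mem_lattice hn hn' ha hb) ha) hb
    simp only [Set.mem_ofPred_eq, Subgroup.coe_mul, Units.val_mul]
    convert h using 1
    ring
  inv_mem' := by
    intro a ha
    have hc : conj F E (((a : Eˣ) : E) - 1) ∈ lattice F E n n := conj_mem_lattice ha
    have hN : (((a : Eˣ) : E)) * conj F E ((a : Eˣ) : E) - 1 ∈ lattice F E n n := by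
      have h := (lattice F E n n).add_mem ((lattice F E n n).add_mem
        (mul_mem_lattice hn hn' ha hc) ha) hc
      convert h using 1
      rw [map_sub, map_one]; ring
    rw [← norm_eq_mul_conj, ← map_one (algebraMap F E), ← map_sub,
      algebraMap_mem_lattice_iff] at hN
    set ν := Algebra.norm F ((a : Eˣ) : E) with hν
    have hν0 : ν ≠ 0 := norm_ne_zero (a : Eˣ).ne_zero
    have hνo : ord ν = 0 := (ord_normU_eq_zero_iff (a : Eˣ)).mpr a.2.2
    have hinv : ν⁻¹ - 1 ∈ ball F n := by
      have h : ν⁻¹ * -(ν - 1) ∈ ball F n :=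
        mul_mem_ball' (m := 0) (Or.inr (by rw [ord_inv, hνo, neg_zero])) ((ball F n).neg_mem hN)
          (by simp)
      convert h using 1
      field_simp; ring
    rw [← algebraMap_mem_lattice_iff (E := E)] at hinv
    have h := (lattice F E n n).add_mem ((lattice F E n n).add_mem
        (mul_mem_lattice hn hn' hinv hc) hinv) hc
    simp only [Set.mem_ofPred_eq, Subgroup.coe_inv]
    convert h using 1
    have hinv2 : (((a : Eˣ)⁻¹ : Eˣ) : E) = algebraMap F E ν⁻¹ * conj F E ((a : Eˣ) : E) := by
      rw [Units.val_inv_eq_inv_val, map_inv₀, hν, norm_eq_mul_conj]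
      have := (a : Eˣ).ne_zero
      have := (map_ne_zero (conj F E)).mpr (a : Eˣ).ne_zero
      field_simp
    rw [hinv2, map_sub, map_sub, map_one, map_one]
    ring

theorem mem_oneUnits_zero {K : Type*} [Field K] [ValuativeRel K] [TopologicalSpace K]
    [IsNonarchimedeanLocalField K] {u : Kˣ} : u ∈ oneUnits K 0 ↔ ord (u : K) = 0 := by
  refine ⟨fun h => h.2, fun h => ⟨?_, h⟩⟩
  exact (ball K _).sub_mem (Or.inr (by simp [h])) (Or.inr (by simp))

variable (F E) in
/-- Conjugation on the units of the ring of integers. -/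
noncomputable def conjO : oneUnits E 0 →* oneUnits E 0 :=
  ((conjU F E).comp (oneUnits E 0).subtype).codRestrict _ fun u =>
    mem_oneUnits_zero.mpr ((ord_conjU (F := F) (u : Eˣ)).trans u.2.2)

theorem conjO_val (u : oneUnits E 0) : ((conjO F E u : oneUnits E 0) : Eˣ) = conjU F E u := rfl

variable (F E) in
/-- If the ramification index is `1` then units are norms; otherwise products of two
units that are not norms are norms. -/
theorem unit_norms :
    (ramIdx F E = 1 → ∀ x : Fˣ, ord (x : F) = 0 → x ∈ normGroup F E) ∧
    ∀ x y : Fˣ, ord (x : F) = 0 → ord (y : F) = 0 → x ∉ normGroup F E → y ∉ normGroup F E →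
      x * y ∈ normGroup F E := by
  set σ := conjO F E
  set N : oneUnits E 0 →* oneUnits E 0 := MonoidHom.id _ * σ
  set f : oneUnits E 0 →* oneUnits E 0 := MonoidHom.id _ / σ
  have hN : ∀ g, N g = g * σ g := fun g => rfl
  have hf : ∀ g, f g = g / σ g := fun g => rfl
  have hσ : ∀ g, σ (σ g) = g := fun g => Subtype.ext (conjU_conjU (g : Eˣ))
  set ν := Algebra.norm F (trOne F E) with hν
  obtain ⟨m, hm⟩ : ∃ m : ℕ, 0 ≤ (m : ℤ) ∧ -ord ν ≤ m ∧ 1 ≤ ramIdx F E * m + ord (trOne F E) ∧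
      1 ≤ (m : ℤ) + ord ν := by
    refine ⟨(ord ν).natAbs + (ord (trOne F E)).natAbs + 1, by positivity, by omega, ?_, by omega⟩
    push_cast
    nlinarith [ramIdx_pos F E, neg_abs_le (ord (trOne F E)), abs_nonneg (ord ν),
      abs_nonneg (ord (trOne F E))]
  set V := latticeUnits (F := F) (E := E) m hm.1 hm.2.1
  have hVmem (v : oneUnits E 0) : v ∈ V ↔ ((v : Eˣ) : E) - 1 ∈ lattice F E m m := Iff.rfl
  have hfin : V.index ≠ 0 := by
    have hc : CompactSpace (oneUnits E 0) := isCompact_iff_compactSpace.mp (isCompact_oneUnits E 0)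
    have ho : IsOpen (V : Set (oneUnits E 0)) := by
      obtain ⟨a, ha⟩ := exists_ball_le_lattice F E m
      have h1 := (isOpen_oneUnits E a).preimage
        (continuous_subtype_val : Continuous (Subtype.val : oneUnits E 0 → Eˣ))
      refine Subgroup.isOpen_mono (H₁ := (oneUnits E a).subgroupOf (oneUnits E 0)) ?_ h1
      intro u hu
      exact ha hu.1
    have := Subgroup.quotient_finite_of_isOpen V ho
    exact Subgroup.index_ne_zero_of_finite
  have hVσ : ∀ v ∈ V, σ v ∈ V := by
    intro v hv
    have := conj_mem_lattice (F := F) ((hVmem v).mp hv)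
    rw [map_sub, map_one] at this
    exact this
  -- An invariant element of V is 1 + t with t ∈ 𝔭ᵐ, and `exists_norm_eq_one_add` writes it as the
  -- norm of 1 + sτ with s ∈ 𝔭ᵐ. Such an element lies in V because V is defined by coordinates with
  -- respect to τ and τ̄; this is the reason for using lattices instead of balls of E.
  have hV : ∀ v ∈ V, σ v = v → ∃ w ∈ V, N w = v := by
    intro v hv hv'
    obtain ⟨z, hz⟩ := exists_incl_of_conjU_eq (F := F) (a := (v : Eˣ)) (congrArg Subtype.val hv')
    have h1 : (z : F) - 1 ∈ ball F m := by
      have := (hVmem v).mp hv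
      rwa [← hz, incl_val, ← map_one (algebraMap F E), ← map_sub,
        algebraMap_mem_lattice_iff] at this
    obtain ⟨s, hs, hs'⟩ := exists_norm_eq_one_add (E := E) h1
      (mul_mem_ball' h1 (self_mem_ball _) hm.2.2.2)
    have h2 : algebraMap F E s * trOne F E ∈ lattice F E m m := by
      have := lin_mem_lattice (E := E) hs (ball F m).zero_mem
      simpa using this
    have h3 : algebraMap F E s * trOne F E ∈ ball E 1 :=
      ball_mono (lattice_le_ball _ h2) hm.2.2.1
    refine ⟨⟨oneAdd _ h3, mem_oneUnits_zero.mpr (ord_one_add h3)⟩, ?_, ?_⟩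
    · rw [hVmem]
      simpa [oneAdd] using h2
    · apply Subtype.ext
      rw [hN, Subgroup.coe_mul, conjO_val, ← incl_normU, ← hz]
      congr 1
      ext
      rw [normU_val]
      simp only [oneAdd, Units.val_mk0]
      rw [hs']; ring
  have hNr (x : Fˣ) (hx : ord (x : F) = 0) (hx' : incl F E x ∈ oneUnits E 0) :
      (⟨incl F E x, hx'⟩ : oneUnits E 0) ∈ N.range ↔ x ∈ normGroup F E := by
    constructor
    · rintro ⟨w, hw⟩
      refine ⟨w, incl_injective (E := E) ?_⟩
      rw [incl_normU]
      exact congrArg Subtype.val hw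
    · rintro ⟨w, rfl⟩
      refine ⟨⟨w, mem_oneUnits_zero.mpr ((ord_normU_eq_zero_iff w).mp hx)⟩, ?_⟩
      apply Subtype.ext
      rw [hN, Subgroup.coe_mul, conjO_val, ← incl_normU]
  have hxO (x : Fˣ) (hx : ord (x : F) = 0) : incl F E x ∈ oneUnits E 0 :=
    mem_oneUnits_zero.mpr (by rw [ord_incl, hx, mul_zero])
  have hker (x : Fˣ) (hx : ord (x : F) = 0) :
      (⟨incl F E x, hxO x hx⟩ : oneUnits E 0) ∈ f.ker := by
    rw [MonoidHom.mem_ker, hf, div_eq_one]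
    apply Subtype.ext
    rw [conjO_val, conjU_incl]
  have hkerN (u : oneUnits E 0) (hu : u ∈ N.ker) :
      ∃ w : Eˣ, (u : Eˣ) = w / conjU F E w := by
    rw [MonoidHom.mem_ker, hN] at hu
    have h1 : ((u : Eˣ) : E) * conj F E ((u : Eˣ) : E) = 1 :=
      congrArg (fun v : oneUnits E 0 => ((v : Eˣ) : E)) hu
    obtain ⟨w, hw, e⟩ := exists_eq_mul_conj h1
    refine ⟨Units.mk0 w hw, eq_div_of_mul_eq' ?_⟩
    ext
    exact e.symm
  have hrange (u : oneUnits E 0) (w : Eˣ) (z : Fˣ) (hu : (u : Eˣ) = w / conjU F E w)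
      (hz : ord (w : E) = ramIdx F E * ord (z : F)) : u ∈ f.range := by
    have h1 : ord ((w * (incl F E z)⁻¹ : Eˣ) : E) = 0 := by
      rw [unit_ord_mul, unit_ord_inv, ord_incl, hz]; ring
    refine ⟨⟨_, mem_oneUnits_zero.mpr h1⟩, Subtype.ext ?_⟩
    rw [hf, hu]
    change w * (incl F E z)⁻¹ / conjU F E (w * (incl F E z)⁻¹) = _
    rw [map_mul, map_inv, conjU_incl, mul_div_mul_right_eq_div]
  obtain he | he := ramIdx_eq F E
  -- Unramified case: a Hilbert 90 solution w can be scaled by an element of F to become a unit.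
  · have hy : f.range.relIndex N.ker = 1 := by
      rw [Subgroup.relIndex_eq_one]
      intro u hu
      obtain ⟨w, hw⟩ := hkerN u hu
      obtain ⟨z, hz⟩ := exists_ord_eq F (ord (w : E))
      exact hrange u w z hw (by rw [hz, he, one_mul])
    obtain ⟨h1, h2⟩ := norm_relIndex_le hσ hN hf V hVσ hV hfin (by rw [hy]; norm_num)
    have h3 : N.range.relIndex f.ker = 1 := by omega
    rw [Subgroup.relIndex_eq_one] at h3
    have h4 : ∀ x : Fˣ, ord (x : F) = 0 → x ∈ normGroup F E := fun x hx =>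
      (hNr x hx (hxO x hx)).mp (h3 (hker x hx))
    exact ⟨fun _ => h4, fun x y hx _ hx' => absurd (h4 x hx) hx'⟩
  · refine ⟨fun h => by omega, fun x y hx hy hxN hyN => ?_⟩
    obtain ⟨p, hp⟩ := exists_ord_eq E 1
    -- Ramified case: scaling by F changes v(w) only by even numbers. The parity of v(w) is the
    -- whole obstruction, and p/p̄ with v(p) = 1 represents the other class.
    have hdvd : f.range.relIndex N.ker ∣ 2 := by
      rw [Subgroup.relIndex_dvd_two_iff]
      have ha : p / conjU F E p ∈ oneUnits E 0 := mem_oneUnits_zero.mpr (by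
        rw [div_eq_mul_inv, unit_ord_mul, unit_ord_inv, ord_conjU]; ring)
      refine ⟨⟨_, ha⟩, ?_, fun u hu => ?_⟩
      · rw [MonoidHom.mem_ker, hN]
        apply Subtype.ext
        change p / conjU F E p * conjU F E (p / conjU F E p) = 1
        rw [map_div, conjU_conjU, div_mul_div_cancel, div_self']
      · obtain ⟨w, hw⟩ := hkerN u hu
        obtain h | h := Int.even_or_odd (ord (w : E))
        · right
          obtain ⟨k, hk⟩ := h
          obtain ⟨z, hz⟩ := exists_ord_eq F k
          exact hrange u w z hw (by rw [hz, he, hk]; ring)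
        · left
          obtain ⟨k, hk⟩ := h
          obtain ⟨z, hz⟩ := exists_ord_eq F (k + 1)
          refine hrange _ (w * p) z ?_ (by rw [unit_ord_mul, hp, hk, hz, he]; ring)
          rw [Subgroup.coe_mul, hw, map_mul]
          exact div_mul_div_comm _ _ _ _
    have hy0 : f.range.relIndex N.ker ≠ 0 := by
      intro h; rw [h] at hdvd; omega
    have hy2 : f.range.relIndex N.ker ≤ 2 := Nat.le_of_dvd (by norm_num) hdvd
    obtain ⟨h1, h2⟩ := norm_relIndex_le hσ hN hf V hVσ hV hfin hy0
    have h3 : N.range.relIndex f.ker ∣ 2 := by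
      have : N.range.relIndex f.ker = 1 ∨ N.range.relIndex f.ker = 2 := by omega
      rcases this with h | h <;> rw [h]; norm_num
    rw [Subgroup.relIndex_dvd_two_iff] at h3
    obtain ⟨a, ha, hab⟩ := h3
    -- The representative a is fixed by σ, so its square is its norm; hence xa and ya being norms
    -- makes xy one.
    have haN : a * a ∈ N.range := by
      refine ⟨a, ?_⟩
      rw [MonoidHom.mem_ker, hf, div_eq_one] at ha
      rw [hN, ← ha]
    have h4 := (hab _ (hker x hx)).resolve_right fun h => hxN ((hNr x hx _).mp h)
    have h5 := (hab _ (hker y hy)).resolve_right fun h => hyN ((hNr y hy _).mp h)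
    have h6 := N.range.mul_mem (N.range.mul_mem h4 h5) (N.range.inv_mem haN)
    refine (hNr (x * y) (by rw [unit_ord_mul, hx, hy, add_zero]) ?_).mp ?_
    · rw [map_mul]; exact (oneUnits E 0).mul_mem (hxO x hx) (hxO y hy)
    · convert h6 using 1
      apply Subtype.ext
      simp only [map_mul, Subgroup.coe_mul, Subgroup.coe_inv]
      group
      rw [mul_right_comm _ _ (incl F E y)]
      group

/-- In the unramified case norms are exactly the elements of even valuation. In the ramified case
the norm of a uniformizer of E is a uniformizer of F; dividing by its powers reduces to units, where
`unit_norms` applies. This is the multiplicativity of η. -/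
theorem mul_mem_normGroup {x y : Fˣ} (hx : x ∉ normGroup F E) (hy : y ∉ normGroup F E) :
    x * y ∈ normGroup F E := by
  obtain he | he := ramIdx_eq F E
  · have hu := (unit_norms F E).1 he
    have key (z : Fˣ) : z ∈ normGroup F E ↔ Even (ord (z : F)) := by
      constructor
      · rintro ⟨w, rfl⟩
        have := ramIdx_mul_ord_normU (F := F) w
        rw [he, one_mul] at this
        rw [this]
        exact even_two_mul _
      · rintro ⟨k, hk⟩
        obtain ⟨p, hp⟩ := exists_ord_eq F k
        have h1 := hu (z * (p ^ 2)⁻¹) (by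
          rw [unit_ord_mul, unit_ord_inv, Units.val_pow_eq_pow_val, ord_pow _ p.ne_zero, hp, hk]
          push_cast; ring)
        have h2 := (normGroup F E).mul_mem h1 (normU_mem (incl F E p))
        rwa [normU_incl, inv_mul_cancel_right] at h2
    rw [key, Int.not_even_iff_odd] at hx hy
    rw [key, unit_ord_mul]
    exact hx.add_odd hy
  · obtain ⟨p, hp⟩ := exists_ord_eq E 1
    have h1 : ord ((normU F E p : Fˣ) : F) = 1 := by
      have := ramIdx_mul_ord_normU (F := F) p
      rw [he, hp] at this
      linarith
    have h2 (z : Fˣ) : ord ((z * (normU F E p ^ ord (z : F))⁻¹ : Fˣ) : F) = 0 := by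
      rw [unit_ord_mul, unit_ord_inv, unit_ord_zpow, h1]; ring
    have h3 (z : Fˣ) : z * (normU F E p ^ ord (z : F))⁻¹ ∈ normGroup F E ↔ z ∈ normGroup F E :=
      (normGroup F E).mul_mem_cancel_right
        ((normGroup F E).inv_mem ((normGroup F E).zpow_mem (normU_mem p) _))
    have h4 := (unit_norms F E).2 _ _ (h2 x) (h2 y) (by rwa [h3]) (by rwa [h3])
    have h5 := (normGroup F E).mul_mem h4 ((normGroup F E).mul_mem
      ((normGroup F E).zpow_mem (normU_mem p) (ord (x : F)))
      ((normGroup F E).zpow_mem (normU_mem p) (ord (y : F))))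
    convert h5 using 1
    rw [mul_mul_mul_comm, inv_mul_cancel_right, inv_mul_cancel_right]

/-! ### The quadratic character -/

theorem eta_of_mem {z : Fˣ} (h : z ∈ normGroup F E) : eta F E z = 1 := by
  rw [eta_eq, if_pos h]

theorem eta_of_notMem {z : Fˣ} (h : z ∉ normGroup F E) : eta F E z = -1 := by
  rw [eta_eq, if_neg h]

theorem eta_mul (x y : Fˣ) : eta F E (x * y) = eta F E x * eta F E y := by
  by_cases hx : x ∈ normGroup F E
  · rw [eta_of_mem hx, one_mul, eta_eq, eta_eq, (normGroup F E).mul_mem_cancel_left hx]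
  by_cases hy : y ∈ normGroup F E
  · rw [eta_of_mem hy, mul_one, eta_eq, eta_eq, (normGroup F E).mul_mem_cancel_right hy]
  · rw [eta_of_mem (mul_mem_normGroup hx hy), eta_of_notMem hx, eta_of_notMem hy]; ring

theorem eta_sq (x : Fˣ) : eta F E x * eta F E x = 1 := by
  rw [eta_eq]; split_ifs <;> ring

theorem eta_inv (x : Fˣ) : eta F E x⁻¹ = eta F E x := by
  rw [eta_eq, eta_eq, (normGroup F E).inv_mem_iff]

@[simp] theorem eta_normU (a : Eˣ) : eta F E (normU F E a) = 1 := eta_of_mem (normU_mem a)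

variable (F E) in
/-- The character `η` is trivial on a small congruence subgroup. -/
theorem exists_eta_trivial : ∃ n : ℕ, 1 ≤ n ∧ ∀ u ∈ oneUnits F n, u ∈ normGroup F E := by
  set ν := Algebra.norm F (trOne F E)
  refine ⟨(ord ν).natAbs + 1, by omega, fun u hu => ?_⟩
  obtain ⟨s, hs, hs'⟩ := exists_norm_eq_one_add (E := E) hu.1
    (mul_mem_ball' hu.1 (self_mem_ball ν) (by push_cast; linarith [neg_abs_le (ord ν)]))
  have h0 : 1 + algebraMap F E s * trOne F E ≠ 0 := by
    intro h
    rw [h, Algebra.norm_zero] at hs'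
    exact u.ne_zero (by linear_combination -hs')
  refine mem_normGroup.mpr ⟨Units.mk0 _ h0, ?_⟩
  rw [Units.val_mk0, hs']; ring

end NormGroup

/-! ### Haar measures on the multiplicative group -/

section HaarUnits

variable {K : Type*} [Field K] [ValuativeRel K] [TopologicalSpace K]
  [IsNonarchimedeanLocalField K] [MeasurableSpace K] [BorelSpace K]
  (μ : Measure Kˣ) [μ.IsHaarMeasure]

theorem isInvInvariant_units : μ.IsInvInvariant := by
  let := TopologicalSpace.metrizableSpaceMetric Kˣ
  have : μ.Regular := inferInstance
  infer_instance

instance : μ.IsInvInvariant := isInvInvariant_units μ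

theorem integral_div_left_units {V : Type*} [NormedAddCommGroup V] [NormedSpace ℝ V]
    (f : Kˣ → V) (x : Kˣ) : ∫ z, f (x / z) ∂μ = ∫ z, f z ∂μ :=
  integral_div_left_eq_self f μ x

variable (K) in
/-- The units of valuation `k`. -/
def shell (k : ℤ) : Set Kˣ := {z | ord (z : K) = k}

@[simp] theorem mem_shell {k : ℤ} {z : Kˣ} : z ∈ shell K k ↔ ord (z : K) = k := Iff.rfl

variable (K) in
theorem isClopen_shell (k : ℤ) : IsClopen (shell K k) :=
  isLocallyConstant_ord.isClopen_fiber k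

variable (K) in
theorem measurableSet_shell (k : ℤ) : MeasurableSet (shell K k) :=
  (isClopen_shell K k).1.measurableSet

variable (K) in
theorem isCompact_shell (k : ℤ) : IsCompact (shell K k) :=
  (isCompact_shells K k k).of_isClosed_subset (isClopen_shell K k).1 fun _ hz => ⟨hz.ge, hz.le⟩

/-- The integral over the units decomposed into shells. -/
theorem integral_eq_sum_shell {H : Kˣ → ℂ} (hH : Continuous H) (a b : ℤ)
    (hs : ∀ z, H z ≠ 0 → a ≤ ord (z : K) ∧ ord (z : K) ≤ b) :
    ∫ z, H z ∂μ = ∑ k ∈ Finset.Icc a b, ∫ z in shell K k, H z ∂μ := by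
  rw [← integral_biUnion_finset]
  · symm
    apply setIntegral_eq_integral_of_forall_compl_eq_zero
    intro z hz
    by_contra h
    exact hz (Set.mem_biUnion (Finset.mem_coe.mpr (Finset.mem_Icc.mpr (hs z h))) rfl)
  · exact fun k _ => measurableSet_shell K k
  · intro i _ j _ hij
    exact Set.disjoint_left.mpr fun z hz hz' => hij (hz.symm.trans hz')
  · exact fun k _ => hH.continuousOn.integrableOn_compact (isCompact_shell K k)

theorem setIntegral_shell_mul (f : Kˣ → ℂ) (x : Kˣ) (k : ℤ) :
    ∫ z in shell K k, f (x * z) ∂μ = ∫ z in shell K (ord (x : K) + k), f z ∂μ := by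
  rw [← integral_indicator (measurableSet_shell K _), ← integral_indicator (measurableSet_shell K _),
    ← integral_mul_left_eq_self ((shell K (ord (x : K) + k)).indicator f) x]
  congr 1
  ext z
  by_cases h : z ∈ shell K k
  · rw [Set.indicator_of_mem h, Set.indicator_of_mem (by rw [mem_shell, unit_ord_mul, h])]
  · rw [Set.indicator_of_notMem h, Set.indicator_of_notMem]
    rw [mem_shell, unit_ord_mul]
    intro h'
    exact h (by rw [mem_shell]; linarith)

theorem setIntegral_shell_div (f : Kˣ → ℂ) (x : Kˣ) (k : ℤ) :
    ∫ z in shell K k, f (x / z) ∂μ = ∫ z in shell K (ord (x : K) - k), f z ∂μ := by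
  rw [← integral_indicator (measurableSet_shell K _), ← integral_indicator (measurableSet_shell K _),
    ← integral_div_left_units μ ((shell K (ord (x : K) - k)).indicator f) x]
  congr 1
  ext z
  have hz : ord ((x / z : Kˣ) : K) = ord (x : K) - ord (z : K) := by
    rw [div_eq_mul_inv, unit_ord_mul, unit_ord_inv, sub_eq_add_neg]
  by_cases h : z ∈ shell K k
  · rw [Set.indicator_of_mem h, Set.indicator_of_mem (by rw [mem_shell, hz, h])]
  · rw [Set.indicator_of_notMem h, Set.indicator_of_notMem]
    rw [mem_shell, hz]
    intro h'
    exact h (by rw [mem_shell]; linarith)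

variable (K) in
theorem measureReal_shell_zero_pos : 0 < μ.real (shell K 0) := by
  refine ENNReal.toReal_pos ?_ (isCompact_shell K 0).measure_lt_top.ne
  exact ((isClopen_shell K 0).2.measure_pos μ ⟨1, by simp⟩).ne'

end HaarUnits

/-! ### Alternating sums -/

theorem sum_alternating (n : ℕ) :
    (∑ i ∈ Finset.range (n + 1), (-1 : ℂ) ^ i = if Even n then 1 else 0) ∧
    ∑ i ∈ Finset.range (n + 1), (-1 : ℂ) ^ i * (n - 2 * i) = if Even n then 0 else n + 1 := by
  have h1 : ∀ n : ℕ, ∑ i ∈ Finset.range (n + 1), (-1 : ℂ) ^ i = if Even n then 1 else 0 := by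
    intro n
    induction n with
    | zero => simp
    | succ n ih =>
      rw [Finset.sum_range_succ, ih]
      rcases Nat.even_or_odd n with h | h
      · rw [if_pos h, if_neg (by simpa [Nat.even_add_one] using h), (h.add_one).neg_one_pow]; ring
      · rw [if_neg (Nat.not_even_iff_odd.mpr h), if_pos (by simpa [Nat.even_add_one] using h),
          (h.add_one).neg_one_pow]; ring
  refine ⟨h1 n, ?_⟩
  induction n with
  | zero => simp
  | succ n ih =>
    have h2 : ∑ i ∈ Finset.range (n + 1), (-1 : ℂ) ^ i * (((n + 1 : ℕ) : ℂ) - 2 * i) =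
        ∑ i ∈ Finset.range (n + 1), (-1 : ℂ) ^ i * ((n : ℂ) - 2 * i) +
          ∑ i ∈ Finset.range (n + 1), (-1 : ℂ) ^ i := by
      rw [← Finset.sum_add_distrib]
      refine Finset.sum_congr rfl fun i _ => ?_
      push_cast; ring
    rw [Finset.sum_range_succ, h2, ih, h1]
    rcases Nat.even_or_odd n with h | h
    · rw [if_pos h, if_pos h, if_neg (by simpa [Nat.even_add_one] using h),
        (h.add_one).neg_one_pow]; push_cast; ring
    · rw [if_neg (Nat.not_even_iff_odd.mpr h), if_neg (Nat.not_even_iff_odd.mpr h),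
        if_pos (by simpa [Nat.even_add_one] using h), (h.add_one).neg_one_pow]; push_cast; ring

theorem sum_Icc_shift (f : ℤ → ℂ) (a : ℤ) (n : ℕ) :
    ∑ k ∈ Finset.Icc a (a + n), f k = ∑ i ∈ Finset.range (n + 1), f (a + i) := by
  induction n with
  | zero => simp
  | succ n ih =>
    rw [Finset.sum_range_succ, ← ih]
    have : Finset.Icc a (a + (n + 1 : ℕ)) = insert (a + (n + 1 : ℕ)) (Finset.Icc a (a + n)) := by
      ext k
      simp only [Finset.mem_Icc, Finset.mem_insert]
      push_cast
      omega
    rw [this, Finset.sum_insert (by simp), add_comm]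

/-! ### Weighted integrals over Fˣ and their growth -/

section OneVariable

variable {F E : Type*} [Field F] [ValuativeRel F] [TopologicalSpace F]
  [IsNonarchimedeanLocalField F] [MeasurableSpace F] [BorelSpace F]
  [Field E] [ValuativeRel E] [TopologicalSpace E]
  [IsNonarchimedeanLocalField E] [Algebra F E] [ValuativeExtension F E]
  [Algebra.IsQuadraticExtension F E] [Algebra.IsSeparable F E]

variable (F E) in
theorem eta_oneUnits_mul : ∃ n : ℕ, ∀ z, ∀ u ∈ oneUnits F n, eta F E (z * u) = eta F E z := by
  obtain ⟨n, -, hn⟩ := exists_eta_trivial F E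
  exact ⟨n, fun z u hu => by rw [eta_mul, eta_of_mem (hn u hu), mul_one]⟩

variable (μF : Measure Fˣ) [μF.IsHaarMeasure]

theorem mem_normGroup_iff_even (he : ramIdx F E = 1) (z : Fˣ) :
    z ∈ normGroup F E ↔ Even (ord (z : F)) := by
  constructor
  · rintro ⟨w, rfl⟩
    have := ramIdx_mul_ord_normU (F := F) w
    rw [he, one_mul] at this
    rw [this]
    exact even_two_mul _
  · rintro ⟨k, hk⟩
    obtain ⟨p, hp⟩ := exists_ord_eq F k
    have h1 := (unit_norms F E).1 he (z * (p ^ 2)⁻¹) (by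
      rw [unit_ord_mul, unit_ord_inv, Units.val_pow_eq_pow_val, ord_pow _ p.ne_zero, hp, hk]
      push_cast; ring)
    have h2 := (normGroup F E).mul_mem h1 (normU_mem (incl F E p))
    rwa [normU_incl, inv_mul_cancel_right] at h2

theorem nonNormRep_notMem {ϖ ε₀ : Fˣ} (hϖ : ord (ϖ : F) = 1) (h : IsNonNormRep E ϖ ε₀) :
    ε₀ ∉ normGroup F E := by
  have h1 := ord_algebraMap (E := E) ϖ.ne_zero
  rw [hϖ, mul_one] at h1
  by_cases h2 : ord (algebraMap F E ϖ) = 1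
  · rw [h.1 h2, mem_normGroup_iff_even (h1.symm.trans h2), hϖ]
    decide
  · rw [mem_normGroup]
    exact (h.2 h2).2

/-- In the ramified case ε₀ is a unit with η(ε₀) = -1, and multiplication by it changes the sign of
the integral. In the unramified case η only sees the parity of the valuation. The later asymptotics
use nothing else about ramification. -/
theorem shell_eta_dichotomy {ϖ ε₀ : Fˣ} (hϖ : ord (ϖ : F) = 1) (h : IsNonNormRep E ϖ ε₀) :
    ∫ z in shell F 0, eta F E z ∂μF = 0 ∨
      ∀ z : Fˣ, eta F E z = if Even (ord (z : F)) then 1 else -1 := by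
  have h1 := ord_algebraMap (E := E) ϖ.ne_zero
  rw [hϖ, mul_one] at h1
  by_cases h2 : ord (algebraMap F E ϖ) = 1
  · right
    intro z
    rw [eta_eq]
    congr 1
    rw [mem_normGroup_iff_even (h1.symm.trans h2)]
  · left
    have h3 := setIntegral_shell_mul μF (eta F E) ε₀ 0
    rw [(h.2 h2).1, add_zero] at h3
    simp only [eta_mul, eta_of_notMem (nonNormRep_notMem hϖ h)] at h3
    rw [integral_const_mul] at h3
    linear_combination (-1 / 2) * h3

/-- Functions on `F × F` that are supported in `𝔭 ^ (-M) × 𝔭 ^ (-M)` and invariant under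
translation by `𝔭 ^ M × 𝔭 ^ M`. -/
structure IsTestPair (g : F → F → ℂ) (M : ℕ) : Prop where
  supp : ∀ {x y}, g x y ≠ 0 → x ∈ ball F (-M) ∧ y ∈ ball F (-M)
  inv : ∀ {x y x' y'}, x' - x ∈ ball F M → y' - y ∈ ball F M → g x' y' = g x y

theorem mul_oneUnits_sub_mem {K : Type*} [Field K] [ValuativeRel K] [TopologicalSpace K]
    [IsNonarchimedeanLocalField K] {x : K} {M : ℕ} (hx : x ∈ ball K (-M)) {n : ℕ} (hn : 2 * M ≤ n)
    {u : Kˣ} (hu : u ∈ oneUnits K n) : x * u - x ∈ ball K M := by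
  have : x * u - x = x * (u - 1) := by ring
  rw [this]
  exact mul_mem_ball' hx hu.1 (by omega)

theorem mul_oneUnits_mem_ball {K : Type*} [Field K] [ValuativeRel K] [TopologicalSpace K]
    [IsNonarchimedeanLocalField K] {x : K} {k : ℤ} {n : ℕ}
    {u : Kˣ} (hu : u ∈ oneUnits K n) : x * u ∈ ball K k ↔ x ∈ ball K k := by
  rw [mul_comm, mul_mem_ball_iff u.ne_zero, hu.2, sub_zero]

/-- On the support, multiplication by an element of 1 + 𝔭^(2M) moves a point of 𝔭^(-M) by an element
of 𝔭^M. Off the support, such multiplication preserves the balls and hence the vanishing. -/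
theorem IsTestPair.mul_inv {g : F → F → ℂ} {M : ℕ} (hg : IsTestPair g M) {n : ℕ} (hn : 2 * M ≤ n)
    {u v : Fˣ} (hu : u ∈ oneUnits F n) (hv : v ∈ oneUnits F n) (x y : F) :
    g (x * u) (y * v) = g x y := by
  by_cases h : x ∈ ball F (-M) ∧ y ∈ ball F (-M)
  · exact hg.inv (mul_oneUnits_sub_mem h.1 hn hu) (mul_oneUnits_sub_mem h.2 hn hv)
  · have h1 : g x y = 0 := by
      by_contra h0; exact h (hg.supp h0)
    have h2 : g (x * u) (y * v) = 0 := by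
      by_contra h0
      have := hg.supp h0
      rw [mul_oneUnits_mem_ball hu, mul_oneUnits_mem_ball hv] at this
      exact h this
    rw [h1, h2]

variable (E) in
/-- The integral of `g (X / z) z η(z)` with weight `w (v (z))`. -/
noncomputable def pairInt (g : F → F → ℂ) (w : ℤ → ℂ) (X : Fˣ) : ℂ :=
  ∫ z : Fˣ, g ((X / z : Fˣ) : F) z * eta F E z * w (ord (z : F)) ∂μF

theorem pairInt_eq_sum {g : F → F → ℂ} {M : ℕ} (hg : IsTestPair g M) (w : ℤ → ℂ) (X : Fˣ) :
    pairInt E μF g w X = ∑ k ∈ Finset.Icc (-M : ℤ) (ord (X : F) + M),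
      w k * ∫ z in shell F k, g ((X / z : Fˣ) : F) z * eta F E z ∂μF := by
  obtain ⟨m, hm⟩ := eta_oneUnits_mul F E
  have hdiv (z : Fˣ) : ord ((X / z : Fˣ) : F) = ord (X : F) - ord (z : F) := by
    rw [div_eq_mul_inv, unit_ord_mul, unit_ord_inv, sub_eq_add_neg]
  have hc : Continuous fun z : Fˣ => g ((X / z : Fˣ) : F) z * eta F E z * w (ord (z : F)) := by
    refine (isLocallyConstant_of_oneUnits (max m (2 * M)) fun z u hu => ?_).continuous
    have h1 := oneUnits_anti (le_max_left m (2 * M)) hu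
    have h2 := oneUnits_anti (le_max_right m (2 * M)) hu
    have h3 : ((X / (z * u) : Fˣ) : F) = ((X / z : Fˣ) : F) * ((u⁻¹ : Fˣ) : F) := by
      rw [← Units.val_mul, div_mul_eq_div_div, div_eq_mul_inv (X / z)]
    rw [hm z u h1, unit_ord_mul, h1.2, add_zero, h3, Units.val_mul,
      hg.mul_inv le_rfl ((oneUnits F _).inv_mem h2) h2]
  unfold pairInt
  rw [integral_eq_sum_shell μF hc (-M) (ord (X : F) + M)]
  · refine Finset.sum_congr rfl fun k _ => ?_
    rw [← integral_const_mul]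
    refine setIntegral_congr_fun (measurableSet_shell F k) fun z hz => ?_
    rw [mem_shell] at hz
    simp only [hz]
    ring
  · intro z hz
    have h := hg.supp (left_ne_zero_of_mul (left_ne_zero_of_mul hz))
    rw [mem_ball_unit, mem_ball_unit, hdiv] at h
    omega

/-- The basic evaluation of `pairInt` when `v(X)` is large. -/
theorem pairInt_eval {g : F → F → ℂ} {M : ℕ} (hg : IsTestPair g M) (w : ℤ → ℂ) (X : Fˣ)
    (hX : 2 * (M : ℤ) ≤ ord (X : F)) (hη : ∫ z in shell F 0, eta F E z ∂μF = 0 ∨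
      ∀ z : Fˣ, eta F E z = if Even (ord (z : F)) then 1 else -1) :
    pairInt E μF g w X =
      ∑ k ∈ Finset.Ico (-M : ℤ) M, w k * ∫ z in shell F k, g 0 z * eta F E z ∂μF +
      eta F E X * ∑ k ∈ Finset.Ico (-M : ℤ) M,
        w (ord (X : F) - k) * ∫ z in shell F k, g z 0 * eta F E z ∂μF +
      g 0 0 * (∫ z in shell F 0, eta F E z ∂μF) *
        ∑ k ∈ Finset.Icc (M : ℤ) (ord (X : F) - M), w k * (if Even k then 1 else -1) := by
  have hS (k : ℤ) : ∫ z in shell F k, eta F E z ∂μF =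
      (∫ z in shell F 0, eta F E z ∂μF) * (if Even k then 1 else -1) := by
    obtain ⟨p, hp⟩ := exists_ord_eq F k
    have h3 := setIntegral_shell_mul μF (eta F E) p 0
    rw [hp, add_zero] at h3
    simp only [eta_mul] at h3
    rw [integral_const_mul] at h3
    rw [← h3]
    rcases hη with h | h
    · rw [h]; ring
    · rw [h p, hp]; ring
  set V := ord (X : F) with hV
  have hdiv (z : Fˣ) : ord ((X / z : Fˣ) : F) = V - ord (z : F) := by
    rw [div_eq_mul_inv, unit_ord_mul, unit_ord_inv, sub_eq_add_neg]
  -- For v(z) ≤ v(X) - M the first argument X/z lies in 𝔭^M and may be replaced by 0.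
  have s1 (k : ℤ) (hk : k ≤ V - M) : ∫ z in shell F k, g ((X / z : Fˣ) : F) z * eta F E z ∂μF =
      ∫ z in shell F k, g 0 z * eta F E z ∂μF := by
    refine setIntegral_congr_fun (measurableSet_shell F k) fun z hz => ?_
    rw [mem_shell] at hz
    rw [hg.inv (x := 0) (y := (z : F)) _ (by simp [(ball F _).zero_mem])]
    rw [sub_zero, mem_ball_unit, hdiv, hz]
    linarith
  have s2 (k : ℤ) (hk : M ≤ k) : ∫ z in shell F k, g 0 z * eta F E z ∂μF =
      g 0 0 * ∫ z in shell F k, eta F E z ∂μF := by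
    rw [← integral_const_mul]
    refine setIntegral_congr_fun (measurableSet_shell F k) fun z hz => ?_
    rw [mem_shell] at hz
    rw [hg.inv (x := 0) (y := 0) (by simp [(ball F _).zero_mem])]
    rw [sub_zero, mem_ball_unit, hz]
    exact hk
  -- For v(z) ≥ M the second argument may be replaced by 0; the reflection z ↦ X/z then takes the
  -- shell to one of valuation v(X) - k at the cost of the sign η(X).
  have s3 (k : ℤ) (hk : M ≤ k) : ∫ z in shell F k, g ((X / z : Fˣ) : F) z * eta F E z ∂μF =
      eta F E X * ∫ z in shell F (V - k), g z 0 * eta F E z ∂μF := by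
    rw [← setIntegral_shell_div, ← integral_const_mul]
    refine setIntegral_congr_fun (measurableSet_shell F k) fun z hz => ?_
    rw [mem_shell] at hz
    rw [hg.inv (x := ((X / z : Fˣ) : F)) (y := 0) (by simp [(ball F _).zero_mem])
      (by rw [sub_zero, mem_ball_unit, hz]; exact hk), div_eq_mul_inv, eta_mul, eta_inv]
    linear_combination -(g ((X * z⁻¹ : Fˣ) : F) 0 * eta F E z) * eta_sq (E := E) X
  rw [pairInt_eq_sum μF hg]
  -- The assumption v(X) ≥ 2M separates the two ends of the range; in between both arguments are
  -- negligible.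
  have hsplit : Finset.Icc (-M : ℤ) (V + M) =
      (Finset.Ico (-M : ℤ) M ∪ Finset.Icc (M : ℤ) (V - M)) ∪ Finset.Ioc (V - M) (V + M) := by
    ext k
    simp only [Finset.mem_Icc, Finset.mem_union, Finset.mem_Ico, Finset.mem_Ioc]
    omega
  rw [hsplit, Finset.sum_union, Finset.sum_union]
  · have t1 : ∑ k ∈ Finset.Ico (-M : ℤ) M,
        w k * ∫ z in shell F k, g ((X / z : Fˣ) : F) z * eta F E z ∂μF =
        ∑ k ∈ Finset.Ico (-M : ℤ) M, w k * ∫ z in shell F k, g 0 z * eta F E z ∂μF := by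
      refine Finset.sum_congr rfl fun k hk => ?_
      rw [Finset.mem_Ico] at hk
      rw [s1 k (by linarith)]
    have t2 : ∑ k ∈ Finset.Icc (M : ℤ) (V - M),
        w k * ∫ z in shell F k, g ((X / z : Fˣ) : F) z * eta F E z ∂μF =
        g 0 0 * (∫ z in shell F 0, eta F E z ∂μF) *
          ∑ k ∈ Finset.Icc (M : ℤ) (V - M), w k * (if Even k then 1 else -1) := by
      rw [Finset.mul_sum]
      refine Finset.sum_congr rfl fun k hk => ?_
      rw [Finset.mem_Icc] at hk
      rw [s1 k hk.2, s2 k hk.1, hS k]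
      ring
    have t3 : ∑ k ∈ Finset.Ioc (V - M) (V + M),
        w k * ∫ z in shell F k, g ((X / z : Fˣ) : F) z * eta F E z ∂μF =
        eta F E X * ∑ k ∈ Finset.Ico (-M : ℤ) M,
          w (V - k) * ∫ z in shell F k, g z 0 * eta F E z ∂μF := by
      rw [Finset.mul_sum]
      refine Finset.sum_bij' (fun k _ => V - k) (fun k _ => V - k) ?_ ?_ ?_ ?_ ?_
      · intro k hk; rw [Finset.mem_Ioc] at hk; rw [Finset.mem_Ico]; omega
      · intro k hk; rw [Finset.mem_Ico] at hk; rw [Finset.mem_Ioc]; omega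
      · intro k _; ring
      · intro k _; ring
      · intro k hk
        rw [Finset.mem_Ioc] at hk
        rw [s3 k (by linarith), sub_sub_cancel]
        ring
    rw [t1, t2, t3]
    ring
  · rw [Finset.disjoint_left]
    intro k hk hk'
    rw [Finset.mem_Ico] at hk
    rw [Finset.mem_Icc] at hk'
    linarith
  · rw [Finset.disjoint_left]
    intro k hk hk'
    rw [Finset.mem_union, Finset.mem_Ico, Finset.mem_Icc] at hk
    rw [Finset.mem_Ioc] at hk'
    omega

/-- These are the middle-range sums when η = (-1)^v. The unweighted sum is nonzero for even b only,
the weighted one for odd b only, with slope 1 in b up to the sign (-1)^a. This is the interchange of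
norm classes in the unramified case. -/
theorem sum_parity (a b : ℤ) (h : 2 * a ≤ b) :
    (∑ k ∈ Finset.Icc a (b - a), (if Even k then (1 : ℂ) else -1) =
      (if Even a then 1 else -1) * if Even b then 1 else 0) ∧
    ∑ k ∈ Finset.Icc a (b - a), ((b : ℂ) - 2 * k) * (if Even k then (1 : ℂ) else -1) =
      (if Even a then 1 else -1) * if Even b then 0 else (b : ℂ) - 2 * a + 1 := by
  obtain ⟨n, hn⟩ : ∃ n : ℕ, b = 2 * a + n := ⟨(b - 2 * a).toNat, by omega⟩
  have e : b - a = a + n := by omega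
  have hb : Even b ↔ Even n := by
    rw [hn, Int.even_add]
    simp [Int.even_coe_nat]
  have hs (i : ℕ) : (if Even (a + (i : ℤ)) then (1 : ℂ) else -1) =
      (if Even a then 1 else -1) * (-1) ^ i := by
    rcases Nat.even_or_odd i with hi | hi
    · rw [hi.neg_one_pow, mul_one]
      congr 1
      rw [Int.even_add]
      simp [Int.even_coe_nat, hi]
    · rw [hi.neg_one_pow]
      have : ¬ Even i := Nat.not_even_iff_odd.mpr hi
      have h2 : Even (a + (i : ℤ)) ↔ ¬ Even a := by
        rw [Int.even_add]
        simp [Int.even_coe_nat, this]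
      by_cases h3 : Even a
      · rw [if_neg (by rw [h2]; exact not_not.mpr h3), if_pos h3]; ring
      · rw [if_pos (h2.mpr h3), if_neg h3]; ring
  obtain ⟨h1, h2⟩ := sum_alternating n
  rw [e, sum_Icc_shift, sum_Icc_shift]
  constructor
  · simp only [hs, hb]
    rw [← Finset.mul_sum, h1]
  · simp only [hs, hb]
    have : ∀ i : ℕ, ((b : ℂ) - 2 * ((a + (i : ℤ) : ℤ) : ℂ)) *
        ((if Even a then 1 else -1) * (-1) ^ i) =
        (if Even a then 1 else -1) * ((-1 : ℂ) ^ i * (n - 2 * i)) := by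
      intro i
      rw [hn]; push_cast; ring
    simp only [this]
    rw [← Finset.mul_sum, h2]
    congr 2
    rw [hn]; push_cast; ring_nf

/-- Differences of weighted integrals on one norm class in terms of the unweighted integral on the
other norm class. -/
theorem pairInt_sub {g : F → F → ℂ} {M : ℕ} (hg : IsTestPair g M)
    (hη : ∫ z in shell F 0, eta F E z ∂μF = 0 ∨
      ∀ z : Fˣ, eta F E z = if Even (ord (z : F)) then 1 else -1) {X₁ X₂ X' : Fˣ}
    (h₁ : 2 * (M : ℤ) ≤ ord (X₁ : F)) (h₂ : 2 * (M : ℤ) ≤ ord (X₂ : F))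
    (h' : 2 * (M : ℤ) ≤ ord (X' : F)) (e₁ : eta F E X₁ = -eta F E X')
    (e₂ : eta F E X₂ = -eta F E X') :
    pairInt E μF g (fun k => ord (X₁ : F) - 2 * k) X₁ -
      pairInt E μF g (fun k => ord (X₂ : F) - 2 * k) X₂ =
      (ord (X₁ : F) - ord (X₂ : F)) * pairInt E μF g (fun _ => 1) X' := by
  rw [pairInt_eval μF hg _ X₁ h₁ hη, pairInt_eval μF hg _ X₂ h₂ hη, pairInt_eval μF hg _ X' h' hη,
    e₁, e₂]
  simp only [one_mul]
  have p₁ := (sum_parity _ _ h₁).2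
  have p₂ := (sum_parity _ _ h₂).2
  have p' := (sum_parity _ _ h').1
  rw [p₁, p₂, p']
  set a : ℤ → ℂ := fun k => ∫ z in shell F k, g 0 z * eta F E z ∂μF
  set b : ℤ → ℂ := fun k => ∫ z in shell F k, g z 0 * eta F E z ∂μF
  have qa : ∑ k ∈ Finset.Ico (-M : ℤ) M, ((ord (X₁ : F) : ℂ) - 2 * k) * a k -
      ∑ k ∈ Finset.Ico (-M : ℤ) M, ((ord (X₂ : F) : ℂ) - 2 * k) * a k =
      ((ord (X₁ : F) : ℂ) - ord (X₂ : F)) * ∑ k ∈ Finset.Ico (-M : ℤ) M, a k := by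
    rw [← Finset.sum_sub_distrib, Finset.mul_sum]
    exact Finset.sum_congr rfl fun k _ => by ring
  -- After the reflection the weight becomes 2k - v(X), so the second end contributes with the
  -- opposite slope. This sign turns η(X₁) into η(X').
  have qb : ∑ k ∈ Finset.Ico (-M : ℤ) M,
        ((ord (X₁ : F) : ℂ) - 2 * ((ord (X₁ : F) - k : ℤ) : ℂ)) * b k -
      ∑ k ∈ Finset.Ico (-M : ℤ) M,
        ((ord (X₂ : F) : ℂ) - 2 * ((ord (X₂ : F) - k : ℤ) : ℂ)) * b k =
      -((ord (X₁ : F) : ℂ) - ord (X₂ : F)) * ∑ k ∈ Finset.Ico (-M : ℤ) M, b k := by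
    rw [← Finset.sum_sub_distrib, Finset.mul_sum]
    exact Finset.sum_congr rfl fun k _ => by push_cast; ring
  -- Either the shell integral vanishes, or the norm classes are the parities of the valuation and
  -- v(X₁), v(X₂) both have the parity opposite to v(X').
  have key : (∫ z in shell F 0, eta F E z ∂μF) *
      ((if Even (ord (X₁ : F)) then 0 else (ord (X₁ : F) : ℂ) - 2 * (M : ℤ) + 1) -
        (if Even (ord (X₂ : F)) then 0 else (ord (X₂ : F) : ℂ) - 2 * (M : ℤ) + 1)) =
      (∫ z in shell F 0, eta F E z ∂μF) * (((ord (X₁ : F) : ℂ) - ord (X₂ : F)) *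
        if Even (ord (X' : F)) then 1 else 0) := by
    rcases hη with h | h
    · rw [h, zero_mul, zero_mul]
    · rw [h, h] at e₁ e₂
      by_cases hp : Even (ord (X' : F))
      · rw [if_pos hp] at e₁ e₂
        have n₁ : ¬ Even (ord (X₁ : F)) := fun hh => by rw [if_pos hh] at e₁; norm_num at e₁
        have n₂ : ¬ Even (ord (X₂ : F)) := fun hh => by rw [if_pos hh] at e₂; norm_num at e₂
        rw [if_neg n₁, if_neg n₂, if_pos hp]; ring
      · rw [if_neg hp] at e₁ e₂
        have n₁ : Even (ord (X₁ : F)) := by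
          by_contra hh; rw [if_neg hh] at e₁; norm_num at e₁
        have n₂ : Even (ord (X₂ : F)) := by
          by_contra hh; rw [if_neg hh] at e₂; norm_num at e₂
        rw [if_pos n₁, if_pos n₂, if_neg hp]; ring
  push_cast at qa qb key ⊢
  linear_combination qa - eta F E X' * qb + g 0 0 * (if Even (M : ℤ) then 1 else -1) * key

end OneVariable

section HermitianIntegrals

variable {F E : Type*} [Field F] [ValuativeRel F] [TopologicalSpace F]
  [IsNonarchimedeanLocalField F] [MeasurableSpace F] [BorelSpace F]
  [Field E] [ValuativeRel E] [TopologicalSpace E]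
  [IsNonarchimedeanLocalField E] [MeasurableSpace E] [BorelSpace E]
  [Algebra F E] [ValuativeExtension F E]
  [Algebra.IsQuadraticExtension F E] [Algebra.IsSeparable F E]

/-! ### Locally constant functions of two multiplicative variables -/

/-- Functions on `Eˣ × Fˣ` that are uniformly locally constant and have bounded support. -/
structure IsNice (k : Eˣ → Fˣ → ℂ) : Prop where
  inv : ∃ n : ℕ, ∀ c z, ∀ u ∈ oneUnits E n, ∀ v ∈ oneUnits F n, k (c * u) (z * v) = k c z
  bdd : ∃ M : ℕ, ∀ c z, k c z ≠ 0 → |ord (c : E)| ≤ M ∧ |ord (z : F)| ≤ M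

theorem IsNice.continuous {k : Eˣ → Fˣ → ℂ} (hk : IsNice k) : Continuous (Function.uncurry k) := by
  obtain ⟨n, hn⟩ := hk.inv
  refine IsLocallyConstant.continuous ((IsLocallyConstant.iff_eventually_eq _).mpr ?_)
  rintro ⟨c, z⟩
  rw [nhds_prod_eq]
  filter_upwards [(eventually_div_mem_oneUnits c n).prod_mk (eventually_div_mem_oneUnits z n)]
    with p hp
  have := hn c z _ hp.1 _ hp.2
  rw [mul_inv_cancel_left, mul_inv_cancel_left] at this
  exact this

theorem IsNice.hasCompactSupport {k : Eˣ → Fˣ → ℂ} (hk : IsNice k) :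
    HasCompactSupport (Function.uncurry k) := by
  obtain ⟨M, hM⟩ := hk.bdd
  refine HasCompactSupport.of_support_subset_isCompact
    ((isCompact_shells E (-M) M).prod (isCompact_shells F (-M) M)) ?_
  rintro ⟨c, z⟩ h
  obtain ⟨h1, h2⟩ := hM c z h
  exact ⟨abs_le.mp h1, abs_le.mp h2⟩

variable (F E) in
theorem continuous_incl : Continuous (incl F E) :=
  Continuous.units_map _ (continuous_algebraMap_local F E)

variable (F E) in
/-- The shear `(a, z) ↦ (a z, z)`. -/
noncomputable def shear : Eˣ × Fˣ ≃ₜ Eˣ × Fˣ where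
  toFun p := (p.1 * incl F E p.2, p.2)
  invFun p := (p.1 * (incl F E p.2)⁻¹, p.2)
  left_inv p := by simp
  right_inv p := by simp
  continuous_toFun := by
    have := continuous_incl F E
    fun_prop
  continuous_invFun := by
    have := continuous_incl F E
    fun_prop

variable (μF : Measure Fˣ) [μF.IsHaarMeasure] (μE : Measure Eˣ) [μE.IsHaarMeasure]

theorem IsNice.integrable {k : Eˣ → Fˣ → ℂ} (hk : IsNice k) :
    Integrable (Function.uncurry k) (μE.prod μF) :=
  hk.continuous.integrable_of_hasCompactSupport hk.hasCompactSupport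

/-- By Fubini the integral over Eˣ can be taken first; for fixed z the substitution is then a
translation. -/
theorem IsNice.integral_shear {k : Eˣ → Fˣ → ℂ} (hk : IsNice k) :
    ∫ a : Eˣ, ∫ z : Fˣ, k (a * incl F E z) z ∂μF ∂μE = ∫ c, ∫ z, k c z ∂μF ∂μE := by
  have h1 : Integrable (Function.uncurry fun (a : Eˣ) (z : Fˣ) => k (a * incl F E z) z)
      (μE.prod μF) :=
    (hk.continuous.comp (shear F E).continuous).integrable_of_hasCompactSupport
      (hk.hasCompactSupport.comp_homeomorph (shear F E))
  rw [integral_integral_swap h1, integral_integral_swap (hk.integrable μF μE)]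
  congr 1
  ext z
  exact integral_mul_right_eq_self (fun a => k a z) (incl F E z)

/-- Differentiation of an integral with a complex power of a positive function. -/
theorem hasDerivAt_integral_cpow {k : Eˣ → Fˣ → ℂ} (hk : IsNice k) (r : Eˣ × Fˣ → ℝ)
    (hr : Continuous r) (hr0 : ∀ p, 0 < r p) :
    HasDerivAt (fun s : ℂ => ∫ p, Function.uncurry k p * (r p : ℂ) ^ s ∂(μE.prod μF))
      (∫ p, Function.uncurry k p * (Real.log (r p) : ℂ) ∂(μE.prod μF)) 0 := by
  set K : Eˣ × Fˣ → ℂ := Function.uncurry k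
  have hK : Continuous K := hk.continuous
  have hKc : HasCompactSupport K := hk.hasCompactSupport
  have hrC : Continuous fun p => (r p : ℂ) := Complex.continuous_ofReal.comp hr
  have hl : Continuous fun p => (Real.log (r p) : ℂ) :=
    Complex.continuous_ofReal.comp (hr.log fun p => (hr0 p).ne')
  have hpow (s : ℂ) : Continuous fun p => (r p : ℂ) ^ s :=
    hrC.cpow continuous_const fun p => Complex.ofReal_mem_slitPlane.mpr (hr0 p)
  have hF' : ∀ s : ℂ, Continuous fun p => K p * (Real.log (r p) * (r p : ℂ) ^ s) :=
    fun s => hK.mul (hl.mul (hpow s))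
  have key := (hasDerivAt_integral_of_dominated_loc_of_deriv_le (μ := μE.prod μF)
    (F := fun (s : ℂ) p => K p * (r p : ℂ) ^ s)
    (F' := fun (s : ℂ) p => K p * (Real.log (r p) * (r p : ℂ) ^ s)) (x₀ := 0)
    -- For |Re s| < 1 the power r^(Re s) is at most r + r⁻¹, whichever side of 1 the number r lies
    -- on.
    (bound := fun p => ‖K p‖ * (|Real.log (r p)| * (r p + (r p)⁻¹)))
    (Metric.ball_mem_nhds (0 : ℂ) one_pos) (Filter.Eventually.of_forall fun s => ?_) ?_ ?_ ?_ ?_ ?_).2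
  · simpa using key
  · exact (hK.mul (hpow s)).aestronglyMeasurable
  · exact (hK.mul (hpow 0)).integrable_of_hasCompactSupport hKc.mul_right
  · exact (hF' 0).aestronglyMeasurable
  · refine Filter.Eventually.of_forall fun p s hs => ?_
    rw [norm_mul, norm_mul, Complex.norm_real, Real.norm_eq_abs,
      Complex.norm_cpow_eq_rpow_re_of_pos (hr0 p)]
    have h1 : |s.re| < 1 := (Complex.abs_re_le_norm s).trans_lt (by simpa using hs)
    rw [abs_lt] at h1
    gcongr
    rcases le_total 1 (r p) with h | h
    · have := Real.rpow_le_rpow_of_exponent_le h h1.2.le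
      rw [Real.rpow_one] at this
      exact this.trans (le_add_of_nonneg_right (inv_pos.mpr (hr0 p)).le)
    · have := Real.rpow_le_rpow_of_exponent_ge (hr0 p) h h1.1.le
      rw [Real.rpow_neg_one] at this
      exact this.trans (le_add_of_nonneg_left (hr0 p).le)
  · refine Continuous.integrable_of_hasCompactSupport ?_ ?_
    · have := hr.log fun p => (hr0 p).ne'
      exact hK.norm.mul (this.abs.mul (hr.add (hr.inv₀ fun p => (hr0 p).ne')))
    · exact (hKc.norm).mul_right
  · refine Filter.Eventually.of_forall fun p s _ => ?_
    have h0 : (r p : ℂ) ≠ 0 := Complex.ofReal_ne_zero.mpr (hr0 p).ne'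
    have h1 := ((hasDerivAt_id s).const_cpow (c := (r p : ℂ)) (Or.inl h0)).const_mul (K p)
    refine h1.congr_deriv ?_
    rw [Complex.ofReal_log (hr0 p).le]
    simp only [id, mul_one]
    ring

/-! ### Test functions on Hermitian matrices -/

/-- Locally constant functions with compact support on the invertible Hermitian matrices, in the
coordinates `[α, β; β̄, γ]`, with a uniform bound `M`. -/
structure IsTest (Φ : F → E → F → ℂ) (M : ℕ) : Prop where
  supp : ∀ {α β γ}, Φ α β γ ≠ 0 → α ∈ ball F (-M) ∧ β ∈ ball E (-M) ∧ γ ∈ ball F (-M) ∧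
    ord (α * γ - Algebra.norm F β) ≤ M
  inv : ∀ {α β γ α' β' γ'}, α' - α ∈ ball F M → β' - β ∈ ball E M → γ' - γ ∈ ball F M →
    Φ α' β' γ' = Φ α β γ

theorem IsTest.pair {Φ : F → E → F → ℂ} {M : ℕ} (h : IsTest Φ M) (β : E) :
    IsTestPair (fun α γ => Φ α β γ) M where
  supp h0 := ⟨(h.supp h0).1, (h.supp h0).2.2.1⟩
  inv h1 h2 := h.inv h1 (by simp [(ball E _).zero_mem]) h2

theorem IsTest.mul_inv {Φ : F → E → F → ℂ} {M : ℕ} (h : IsTest Φ M) {n : ℕ} (hn : 2 * M ≤ n)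
    {u v : Fˣ} {w : Eˣ} (hu : u ∈ oneUnits F n) (hw : w ∈ oneUnits E n) (hv : v ∈ oneUnits F n)
    (α : F) (β : E) (γ : F) : Φ (α * u) (β * w) (γ * v) = Φ α β γ := by
  by_cases h0 : α ∈ ball F (-M) ∧ β ∈ ball E (-M) ∧ γ ∈ ball F (-M)
  · exact h.inv (mul_oneUnits_sub_mem h0.1 hn hu) (mul_oneUnits_sub_mem h0.2.1 hn hw)
      (mul_oneUnits_sub_mem h0.2.2 hn hv)
  · have h1 : Φ α β γ = 0 := by
      by_contra h2
      exact h0 ⟨(h.supp h2).1, (h.supp h2).2.1, (h.supp h2).2.2.1⟩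
    have h2 : Φ (α * u) (β * w) (γ * v) = 0 := by
      by_contra h2
      have h3 := h.supp h2
      rw [mul_oneUnits_mem_ball hu, mul_oneUnits_mem_ball hv, mul_oneUnits_mem_ball hw] at h3
      exact h0 ⟨h3.1, h3.2.1, h3.2.2.1⟩
    rw [h1, h2]

/-- The difference Nm(u) - 1 lies in 𝔭_E^(2n), and the factor 2 covers the ramified case, where the
embedding of F doubles valuations. -/
theorem normU_mem_oneUnits {n : ℕ} {u : Eˣ} (hu : u ∈ oneUnits E (2 * n)) :
    normU F E u ∈ oneUnits F n := by
  refine ⟨?_, (ord_normU_eq_zero_iff u).mpr hu.2⟩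
  rw [← algebraMap_mem_ball_iff (E := E), map_sub, normU_val, norm_eq_mul_conj, map_one]
  have h1 : (u : E) * (conj F E (u : E) - 1) ∈ ball E (2 * n : ℕ) := by
    refine mul_mem_ball' (m := 0) (Or.inr hu.2.ge) ?_ (zero_add _).ge
    have := conj_mem_ball (F := F).mpr hu.1
    rwa [map_sub, map_one] at this
  have h2 := (ball E _).add_mem h1 hu.1
  have h3 : (u : E) * conj F E (u : E) - 1 = u * (conj F E (u : E) - 1) + (u - 1) := by ring
  rw [h3]
  refine ball_mono h2 ?_
  push_cast
  rcases ramIdx_eq F E with h | h <;> rw [h] <;> linarith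

variable (Ω : Eˣ →* ℂˣ)

/-- The integrand of the Hermitian orbital integral after the substitution `c = z a`. -/
noncomputable def hermKer (Φ : F → E → F → ℂ) (x : Fˣ) (c : Eˣ) (z : Fˣ) : ℂ :=
  Φ ((normU F E c * x / z : Fˣ) : F) c z * eta F E z * ((Ω c)⁻¹ : ℂˣ)

theorem unit_ord_div {K : Type*} [Field K] [ValuativeRel K] [TopologicalSpace K]
    [IsNonarchimedeanLocalField K] (x y : Kˣ) :
    ord ((x / y : Kˣ) : K) = ord (x : K) - ord (y : K) := by
  rw [div_eq_mul_inv, unit_ord_mul, unit_ord_inv, sub_eq_add_neg]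

/-- The bounds on valuations on the support of `hermKer`. -/
theorem IsTest.hermKer_supp {Φ : F → E → F → ℂ} {M : ℕ} (h : IsTest Φ M) {x : Fˣ} {c : Eˣ}
    {z : Fˣ} (h0 : Φ ((normU F E c * x / z : Fˣ) : F) c z ≠ 0) :
    -(M : ℤ) ≤ ord (z : F) ∧
    ord (z : F) ≤ ord ((normU F E c : Fˣ) : F) + ord (x : F) + M ∧
    -(M : ℤ) ≤ ord (c : E) ∧
    ((x : F) ≠ 1 → ord ((normU F E c : Fˣ) : F) + ord ((x : F) - 1) ≤ M) := by
  obtain ⟨h1, h2, h3, h4⟩ := h.supp h0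
  rw [mem_ball_unit] at h1 h2 h3
  rw [unit_ord_div, unit_ord_mul] at h1
  refine ⟨h3, by linarith, h2, fun hx => ?_⟩
  have e : ((normU F E c * x / z : Fˣ) : F) * z - Algebra.norm F (c : E) =
      ((normU F E c : Fˣ) : F) * ((x : F) - 1) := by
    rw [← Units.val_mul, div_mul_cancel, Units.val_mul, normU_val]; ring
  rwa [e, ord_mul (Units.ne_zero _) (sub_ne_zero.mpr hx)] at h4

theorem abs_ord_le (c : Eˣ) : |ord (c : E)| ≤ |ord ((normU F E c : Fˣ) : F)| := by
  have h := ramIdx_mul_ord_normU (F := F) c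
  rcases ramIdx_eq F E with he | he <;> rw [he] at h
  · rw [one_mul] at h
    rw [h, abs_mul]
    have := abs_nonneg (ord (c : E))
    norm_num
    linarith
  · have : ord ((normU F E c : Fˣ) : F) = ord (c : E) := by linarith
    rw [this]

/-- The entries are bounded, which bounds v(c) and v(z) from below and v(z) from above in terms of
v(Nm c). The determinant is Nm(c)(x - 1) and must stay away from 0, so v(Nm c) is bounded above
exactly because x ≠ 1. -/
theorem IsTest.isNice (hΩ : Continuous Ω) {Φ : F → E → F → ℂ} {M : ℕ} (h : IsTest Φ M) {x : Fˣ}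
    (hx : (x : F) ≠ 1) (w : ℤ → ℤ → ℂ) :
    IsNice fun c z => hermKer Ω Φ x c z * w (ord ((normU F E c : Fˣ) : F)) (ord (z : F)) where
  inv := by
    obtain ⟨m, -, hm⟩ := exists_trivial_on_oneUnits Ω hΩ
    obtain ⟨l, hl⟩ := eta_oneUnits_mul F E
    refine ⟨2 * (m + l + 2 * M), fun c z u hu v hv => ?_⟩
    have hNu := normU_mem_oneUnits (F := F) hu
    have hv' := oneUnits_anti (show m + l + 2 * M ≤ 2 * (m + l + 2 * M) by omega) hv
    have hu' := oneUnits_anti (show m + l + 2 * M ≤ 2 * (m + l + 2 * M) by omega) hu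
    have e1 : normU F E (c * u) * x / (z * v) = normU F E c * x / z * (normU F E u / v) := by
      rw [map_mul, ← mul_div_mul_comm, mul_right_comm]
    unfold hermKer
    rw [e1, Units.val_mul, Units.val_mul c u, Units.val_mul z v,
      h.mul_inv (show 2 * M ≤ m + l + 2 * M by omega) ((oneUnits F _).div_mem hNu hv') hu' hv',
      hl z v (oneUnits_anti (by omega) hv'), map_mul Ω, hm u (oneUnits_anti (by omega) hu'), mul_one,
      map_mul (normU F E), ← Units.val_mul z v, unit_ord_mul, unit_ord_mul, hNu.2, hv.2, add_zero,
      add_zero]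
  bdd := by
    refine ⟨2 * M + (ord (x : F)).natAbs + (ord ((x : F) - 1)).natAbs +
      (M + (ord (x : F)).natAbs + M), fun c z h0 => ?_⟩
    have h1 := h.hermKer_supp (left_ne_zero_of_mul (left_ne_zero_of_mul (left_ne_zero_of_mul h0)))
    have h2 := h1.2.2.2 hx
    have h3 := abs_ord_le (F := F) c
    have h4 : |ord ((normU F E c : Fˣ) : F)| ≤
        2 * M + (ord (x : F)).natAbs + (ord ((x : F) - 1)).natAbs := by
      rw [abs_le]; omega
    have h6 := h3.trans h4
    rw [abs_le] at h4 h6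
    rw [abs_le, abs_le]
    simp only [Nat.cast_add, Nat.cast_mul, Nat.cast_ofNat]
    omega

/-- The orbital integral with a weight depending on valuations. -/
noncomputable def hermInt (Φ : F → E → F → ℂ) (w : ℤ → ℤ → ℂ) (x : Fˣ) : ℂ :=
  ∫ c : Eˣ, ∫ z : Fˣ, hermKer Ω Φ x c z * w (ord ((normU F E c : Fˣ) : F)) (ord (z : F)) ∂μF ∂μE

theorem IsTest.hermInt_eq_pairInt {Φ : F → E → F → ℂ} (w : ℤ → ℤ → ℂ) (x : Fˣ) :
    hermInt μF μE Ω Φ w x = ∫ c : Eˣ, ((Ω c)⁻¹ : ℂˣ) *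
      pairInt E μF (fun α γ => Φ α c γ) (w (ord ((normU F E c : Fˣ) : F))) (normU F E c * x) ∂μE := by
  unfold hermInt
  congr 1
  ext c
  unfold pairInt
  rw [← integral_const_mul]
  congr 1
  ext z
  unfold hermKer
  ring

/-- The weight `v(X) - 2 v(z)`, where `X = Nm(c) x`. -/
noncomputable def stdWeight (x : Fˣ) (a k : ℤ) : ℂ := a + ord (x : F) - 2 * k

/-- The variable x enters only through the first diagonal entry, where Φ is insensitive to such
factors, and through v(x) in the weight. -/
theorem hermInt_stdWeight_mul {Φ : F → E → F → ℂ} {M : ℕ} (h : IsTest Φ M) {x u : Fˣ}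
    (hu : u ∈ oneUnits F (2 * M)) :
    hermInt μF μE Ω Φ (stdWeight (x * u)) (x * u) = hermInt μF μE Ω Φ (stdWeight x) x := by
  unfold hermInt hermKer stdWeight
  congr 1
  ext c
  congr 1
  ext z
  have e : normU F E c * (x * u) / z = normU F E c * x / z * u := by
    rw [← mul_assoc, mul_div_right_comm]
  have := h.mul_inv le_rfl hu (oneUnits E _).one_mem (oneUnits F _).one_mem
    ((normU F E c * x / z : Fˣ) : F) (c : E) (z : F)
  rw [Units.val_one, Units.val_one, mul_one, mul_one, ← Units.val_mul] at this
  rw [e, this, unit_ord_mul, hu.2, add_zero]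

/-- The bounds on the entries force v(Nm c) ≥ -2M, the bound on the determinant then forces v(x - 1)
≤ 3M. The integrand is identically zero beyond this. -/
theorem hermInt_eq_zero_near_one {Φ : F → E → F → ℂ} {M : ℕ} (h : IsTest Φ M) {x : Fˣ}
    (hx : (x : F) ≠ 1) (hx' : 5 * (M : ℤ) < ord ((x : F) - 1)) (hx0 : ord (x : F) = 0)
    (w : ℤ → ℤ → ℂ) :
    hermInt μF μE Ω Φ w x = 0 := by
  have : ∀ (c : Eˣ) (z : Fˣ), hermKer Ω Φ x c z = 0 := by
    intro c z
    unfold hermKer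
    have : Φ ((normU F E c * x / z : Fˣ) : F) c z = 0 := by
      by_contra h0
      have h1 := h.hermKer_supp h0
      have h2 := h1.2.2.2 hx
      rw [hx0] at h1
      linarith [h1.1, h1.2.1]
    rw [this, zero_mul, zero_mul]
  unfold hermInt
  simp [this]

/-- This is `pairInt_sub` integrated over c. On the support v(Nm c) ≥ -2M, so v(x) > 4M places X =
Nm(c)x in the range v(X) ≥ 2M uniformly in c. -/
theorem hermInt_stdWeight_sub (hΩ : Continuous Ω) {Φ : F → E → F → ℂ} {M : ℕ} (h : IsTest Φ M)
    (hη : ∫ z in shell F 0, eta F E z ∂μF = 0 ∨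
      ∀ z : Fˣ, eta F E z = if Even (ord (z : F)) then 1 else -1) {x₁ x₂ x' : Fˣ}
    (h₁ : 4 * (M : ℤ) < ord (x₁ : F)) (h₂ : 4 * (M : ℤ) < ord (x₂ : F))
    (h' : 4 * (M : ℤ) < ord (x' : F)) (e₁ : eta F E x₁ = -eta F E x')
    (e₂ : eta F E x₂ = -eta F E x') :
    hermInt μF μE Ω Φ (stdWeight x₁) x₁ - hermInt μF μE Ω Φ (stdWeight x₂) x₂ =
      (ord (x₁ : F) - ord (x₂ : F)) * hermInt μF μE Ω Φ (fun _ _ => 1) x' := by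
  have hne {x : Fˣ} (hx : 4 * (M : ℤ) < ord (x : F)) : (x : F) ≠ 1 := by
    intro h1; rw [h1, ord_one] at hx; omega
  have int1 (x : Fˣ) (hx : (x : F) ≠ 1) (w : ℤ → ℤ → ℂ) : Integrable (fun c : Eˣ => ∫ z : Fˣ,
      hermKer Ω Φ x c z * w (ord ((normU F E c : Fˣ) : F)) (ord (z : F)) ∂μF) μE :=
    ((h.isNice Ω hΩ hx w).integrable μF μE).integral_prod_left
  unfold hermInt
  rw [← integral_sub (int1 _ (hne h₁) _) (int1 _ (hne h₂) _), ← integral_const_mul]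
  congr 1
  ext c
  have conv (w : ℤ → ℤ → ℂ) (x : Fˣ) : ∫ z : Fˣ,
      hermKer Ω Φ x c z * w (ord ((normU F E c : Fˣ) : F)) (ord (z : F)) ∂μF =
      ((Ω c)⁻¹ : ℂˣ) *
      pairInt E μF (fun α γ => Φ α c γ) (w (ord ((normU F E c : Fˣ) : F))) (normU F E c * x) := by
    unfold pairInt
    rw [← integral_const_mul]
    congr 1
    ext z
    unfold hermKer
    ring
  have conv1 := conv (fun _ _ => 1) x'
  beta_reduce at conv1
  rw [conv, conv, conv1]
  by_cases hc : (c : E) ∈ ball E (-M)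
  · have hV : -2 * (M : ℤ) ≤ ord ((normU F E c : Fˣ) : F) := by
      have h1 := ramIdx_mul_ord_normU (F := F) c
      rw [mem_ball_unit] at hc
      rcases ramIdx_eq F E with he | he <;> rw [he] at h1 <;> omega
    have key := pairInt_sub μF (h.pair (c : E)) hη (X₁ := normU F E c * x₁)
      (X₂ := normU F E c * x₂) (X' := normU F E c * x') (by rw [unit_ord_mul]; linarith)
      (by rw [unit_ord_mul]; linarith) (by rw [unit_ord_mul]; linarith)
      (by rw [eta_mul, eta_mul, e₁]; ring) (by rw [eta_mul, eta_mul, e₂]; ring)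
    rw [unit_ord_mul, unit_ord_mul] at key
    have hw (x : Fˣ) : stdWeight x (ord ((normU F E c : Fˣ) : F)) = fun k : ℤ =>
        ((ord ((normU F E c : Fˣ) : F) + ord (x : F) : ℤ) : ℂ) - 2 * k := by
      ext k; unfold stdWeight; push_cast; ring
    rw [hw, hw]
    generalize (((Ω c)⁻¹ : ℂˣ) : ℂ) = t
    push_cast at key ⊢
    linear_combination t * key
  · have hz (w : ℤ → ℂ) (X : Fˣ) : pairInt E μF (fun α γ => Φ α c γ) w X = 0 := by
      unfold pairInt
      have : ∀ α γ, Φ α c γ = 0 := fun α γ => by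
        by_contra h0; exact hc (h.supp h0).2.1
      simp [this]
    rw [hz, hz, hz]
    ring

/-- The behavior of the weighted integral for large `x`. -/
theorem exists_hermInt_large {Φ : F → E → F → ℂ} {M : ℕ} (h : IsTest Φ M) (ε : Fˣ) :
    ∃ C : ℂ, ∀ b : Eˣ, ord ((ε * normU F E b : Fˣ) : F) ≤ -(4 * (M : ℤ)) →
      hermInt μF μE Ω Φ (stdWeight (ε * normU F E b)) (ε * normU F E b) = Ω b * C := by
  set H : Eˣ → ℂ := fun c => ∫ z : Fˣ, Φ ((normU F E c * ε / z : Fˣ) : F) 0 z * eta F E z *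
    ((Ω c)⁻¹ : ℂˣ) * stdWeight ε (ord ((normU F E c : Fˣ) : F)) (ord (z : F)) ∂μF
  refine ⟨∫ c, H c ∂μE, fun b hb => ?_⟩
  rw [← integral_mul_right_eq_self H b, ← integral_const_mul]
  unfold hermInt
  congr 1
  ext c
  simp only [H]
  rw [← integral_const_mul]
  congr 1
  ext z
  have eX : normU F E (c * b) * ε / z = normU F E c * (ε * normU F E b) / z := by
    rw [map_mul]; congr 1; rw [mul_assoc, mul_comm (normU F E b)]
  -- Either c lies in 𝔭_E^M and may be replaced by 0, or the product of the diagonal entries,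
  -- Nm(c)x, has valuation below -2M and both values vanish. With β = 0 the integrand depends on c
  -- and b only through Nm(cb), apart from the character, so b is absorbed by a translation.
  have eΦ : Φ ((normU F E c * (ε * normU F E b) / z : Fˣ) : F) 0 z =
      Φ ((normU F E c * (ε * normU F E b) / z : Fˣ) : F) c z := by
    by_cases hc : (M : ℤ) ≤ ord (c : E)
    · symm
      exact h.inv (by simp [(ball F _).zero_mem]) (by rw [sub_zero, mem_ball_unit]; exact hc)
        (by simp [(ball F _).zero_mem])
    · have hz (β : E) : Φ ((normU F E c * (ε * normU F E b) / z : Fˣ) : F) β z = 0 := by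
        by_contra h0
        obtain ⟨h1, -, h3, -⟩ := h.supp h0
        rw [mem_ball_unit] at h1 h3
        rw [unit_ord_div, unit_ord_mul] at h1
        have h4 := ramIdx_mul_ord_normU (F := F) c
        rcases ramIdx_eq F E with he | he <;> rw [he] at h4 <;> omega
      rw [hz, hz]
  rw [eX, eΦ]
  unfold hermKer stdWeight
  have o1 := unit_ord_mul ε (normU F E b)
  have o2 : ord ((normU F E (c * b) : Fˣ) : F) =
      ord ((normU F E c : Fˣ) : F) + ord ((normU F E b : Fˣ) : F) := by
    rw [map_mul, unit_ord_mul]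
  have o3 : (((Ω (c * b))⁻¹ : ℂˣ) : ℂ) = ((Ω c)⁻¹ : ℂˣ) * ((Ω b)⁻¹ : ℂˣ) := by
    rw [map_mul, mul_inv, Units.val_mul]
  have hΩb : (Ω b : ℂ) * ((Ω b)⁻¹ : ℂˣ) = 1 := by simp
  rw [o1, o2, o3]
  simp only [Int.cast_add]
  linear_combination (-(Φ ((normU F E c * (ε * normU F E b) / z : Fˣ) : F) c z * eta F E z *
    ((Ω c)⁻¹ : ℂˣ) * (ord ((normU F E c : Fˣ) : F) + (ord (ε : F) + ord ((normU F E b : Fˣ) : F)) -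
      2 * ord (z : F)))) * hΩb

end HermitianIntegrals

section HermitianOrbital

variable {F E : Type*} [Field F] [ValuativeRel F] [TopologicalSpace F]
  [IsNonarchimedeanLocalField F] [MeasurableSpace F] [BorelSpace F]
  [Field E] [ValuativeRel E] [TopologicalSpace E]
  [IsNonarchimedeanLocalField E] [MeasurableSpace E] [BorelSpace E]
  [Algebra F E] [ValuativeExtension F E]
  [Algebra.IsQuadraticExtension F E] [Algebra.IsSeparable F E]

/-! ### The derivative of the Hermitian orbital integral -/

/-- The Hermitian matrix `[α, β; β̄, γ]`. -/
noncomputable def hermMat (α : F) (β : E) (γ : F) : Matrix (Fin 2) (Fin 2) E :=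
  !![algebraMap F E α, β; conj F E β, algebraMap F E γ]

/-- A function on Hermitian matrices in coordinates. -/
noncomputable def hermCoord (Φ : Matrix (Fin 2) (Fin 2) E → ℂ) (α : F) (β : E) (γ : F) : ℂ :=
  Φ (hermMat α β γ)

theorem smul_gamma_eq (x : F) (a : Eˣ) (z : Fˣ) :
    algebraMap F E z •
        (!![(a : E), 0; 0, 1] * !![algebraMap F E x, 1; 1, 1] * !![conj F E a, 0; 0, 1]) =
      hermMat (Algebra.norm F (a : E) * z * x) (a * algebraMap F E z) z := by
  unfold hermMat
  rw [map_mul (algebraMap F E), map_mul (algebraMap F E), norm_eq_mul_conj]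
  ext i j
  fin_cases i <;> fin_cases j <;> simp <;> ring

variable (F) in
/-- The weight `|c / z|_E ^ s` in terms of `v(Nm c)` and `v(z)`. -/
noncomputable def cpowWeight (s : ℂ) (a k : ℤ) : ℂ := (((resCard F : ℝ) ^ (-(a - 2 * k)) : ℝ) : ℂ) ^ s

theorem normAbs_eq_zpow (a : Eˣ) (z : Fˣ) : normAbs (a : E) =
    (resCard F : ℝ) ^ (-(ord ((normU F E (a * incl F E z) : Fˣ) : F) - 2 * ord (z : F))) := by
  rw [normAbs_eq_normAbs_norm (F := F) a.ne_zero, normAbs, map_mul, normU_incl, unit_ord_mul,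
    ← normU_val]
  congr 2
  rw [pow_two, unit_ord_mul]
  ring

variable (F E) in
theorem continuous_normU : Continuous (normU F E) :=
  Continuous.units_map _ (continuous_norm_local F E)

variable (μF : Measure Fˣ) [μF.IsHaarMeasure] (μE : Measure Eˣ) [μE.IsHaarMeasure]
  (Ω : Eˣ →* ℂˣ)

/-- With c = az the characters combine to Ω⁻¹(c) and the matrix has entries Nm(c)x/z, c, z. Also
|a|_E = |Nm(c)/z²|_F, which puts s into a weight in v(Nm c) and v(z). -/
theorem hermOrb_eq_hermInt (hΩ : Continuous Ω) {Φ : Matrix (Fin 2) (Fin 2) E → ℂ} {M : ℕ}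
    (h : IsTest (hermCoord (F := F) Φ) M) {x : Fˣ} (hx : (x : F) ≠ 1) (s : ℂ) :
    hermOrb μF μE Ω Φ (x : F) s = hermInt μF μE Ω (hermCoord Φ) (cpowWeight F s) x := by
  unfold hermInt
  rw [← (h.isNice Ω hΩ hx (cpowWeight F s)).integral_shear μF μE]
  unfold hermOrb
  congr 1
  ext a
  congr 1
  ext z
  rw [smul_gamma_eq, hermKer, hermCoord, cpowWeight, ← normAbs_eq_zpow, map_mul Ω, mul_inv,
    Units.val_mul]
  have e : ((normU F E (a * incl F E z) * x / z : Fˣ) : F) = Algebra.norm F (a : E) * z * x := by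
    rw [map_mul, normU_incl, pow_two, ← normU_val, ← Units.val_mul, ← Units.val_mul]
    congr 1
    rw [← mul_assoc, mul_right_comm _ z x, mul_div_assoc, div_self', mul_one]
  rw [e, Units.val_mul (Ω a)⁻¹]
  simp only [incl_val]
  ring

theorem hermOrb_zero (hΩ : Continuous Ω) {Φ : Matrix (Fin 2) (Fin 2) E → ℂ} {M : ℕ}
    (h : IsTest (hermCoord (F := F) Φ) M) {x : Fˣ} (hx : (x : F) ≠ 1) :
    hermOrb μF μE Ω Φ (x : F) 0 = hermInt μF μE Ω (hermCoord Φ) (fun _ _ => 1) x := by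
  rw [hermOrb_eq_hermInt μF μE Ω hΩ h hx]
  congr 1
  ext a k
  simp [cpowWeight]

theorem hermInt_eq_prod (hΩ : Continuous Ω) {Φ : F → E → F → ℂ} {M : ℕ} (h : IsTest Φ M) {x : Fˣ}
    (hx : (x : F) ≠ 1) (w : ℤ → ℤ → ℂ) :
    hermInt μF μE Ω Φ w x = ∫ p : Eˣ × Fˣ, hermKer Ω Φ x p.1 p.2 *
      w (ord ((normU F E p.1 : Fˣ) : F)) (ord (p.2 : F)) ∂(μE.prod μF) :=
  (integral_prod _ ((h.isNice Ω hΩ hx w).integrable μF μE)).symm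

/-- The derivative at `0` of the orbital integral, when its value vanishes. -/
theorem hermOrb_hasDerivAt (hΩ : Continuous Ω) {Φ : Matrix (Fin 2) (Fin 2) E → ℂ} {M : ℕ}
    (h : IsTest (hermCoord (F := F) Φ) M) {x : Fˣ} (hx : (x : F) ≠ 1)
    (h0 : hermOrb μF μE Ω Φ (x : F) 0 = 0) :
    HasDerivAt (hermOrb μF μE Ω Φ (x : F))
      (-Real.log (resCard F) * hermInt μF μE Ω (hermCoord Φ) (stdWeight x) x) 0 := by
  have hq : (0 : ℝ) < resCard F := by exact_mod_cast (one_lt_resCard F).le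
  set r : Eˣ × Fˣ → ℝ := fun p =>
    (resCard F : ℝ) ^ (-(ord ((normU F E p.1 : Fˣ) : F) - 2 * ord (p.2 : F)))
  have hr : Continuous r := by
    have h1 : Continuous fun p : Eˣ × Fˣ => ord ((normU F E p.1 : Fˣ) : F) :=
      ((isLocallyConstant_ord (K := F)).continuous.comp (continuous_normU F E)).comp continuous_fst
    have h2 : Continuous fun p : Eˣ × Fˣ => ord (p.2 : F) :=
      (isLocallyConstant_ord (K := F)).continuous.comp continuous_snd
    exact (continuous_of_discreteTopology (f := fun q : ℤ × ℤ =>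
      (resCard F : ℝ) ^ (-(q.1 - 2 * q.2)))).comp (h1.prodMk h2)
  have key := hasDerivAt_integral_cpow μF μE (h.isNice Ω hΩ hx fun _ _ => 1) r hr
    fun p => by positivity
  have e1 : hermOrb μF μE Ω Φ (x : F) = fun s => ∫ p, Function.uncurry (fun c z =>
      hermKer Ω (hermCoord Φ) x c z * 1) p * (r p : ℂ) ^ s ∂(μE.prod μF) := by
    ext s
    rw [hermOrb_eq_hermInt μF μE Ω hΩ h hx, hermInt_eq_prod μF μE Ω hΩ h hx]
    simp [Function.uncurry, r, cpowWeight]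
  rw [e1]
  refine key.congr_deriv ?_
  rw [hermOrb_zero μF μE Ω hΩ h hx, hermInt_eq_prod μF μE Ω hΩ h hx] at h0
  rw [hermInt_eq_prod μF μE Ω hΩ h hx]
  have i1 := (h.isNice Ω hΩ hx (stdWeight x)).integrable μF μE
  have i2 := (h.isNice Ω hΩ hx (fun _ _ => 1)).integrable μF μE
  -- The logarithm gives v(Nm c) - 2v(z). The missing v(x) multiplies the value at s = 0, which
  -- vanishes by assumption.
  have e2 : ∀ p : Eˣ × Fˣ, Function.uncurry (fun c z => hermKer Ω (hermCoord Φ) x c z * 1) p *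
      (Real.log (r p) : ℂ) = -Real.log (resCard F) *
      (hermKer Ω (hermCoord Φ) x p.1 p.2 *
        stdWeight x (ord ((normU F E p.1 : Fˣ) : F)) (ord (p.2 : F)) -
      ord (x : F) * (hermKer Ω (hermCoord Φ) x p.1 p.2 * 1)) := by
    rintro ⟨c, z⟩
    simp only [Function.uncurry, r, Real.log_zpow, stdWeight]
    push_cast
    ring
  simp only [e2]
  rw [integral_const_mul, integral_sub, integral_const_mul, h0]
  · simp
  · exact i1
  · exact i2.const_mul _

end HermitianOrbital

/-! ### The topology of `GL₂` of a local field -/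

section GLTopology

variable {K : Type*} [Field K] [ValuativeRel K] [TopologicalSpace K]
  [IsNonarchimedeanLocalField K]

theorem gl_inv_apply (g : GL (Fin 2) K) (i j : Fin 2) :
    (g⁻¹).val i j = g.val.det⁻¹ * g.val.adjugate i j := by
  rw [Matrix.coe_units_inv, Matrix.inv_def]
  simp [Ring.inverse_eq_inv']

theorem gl_det_ne_zero (g : GL (Fin 2) K) : g.val.det ≠ 0 :=
  ((Matrix.isUnit_iff_isUnit_det _).mp g.isUnit).ne_zero

variable (K) in
theorem isEmbedding_val_gl : Topology.IsEmbedding (Units.val : GL (Fin 2) K → Matrix (Fin 2) (Fin 2) K) := by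
  refine Units.isEmbedding_val_mk' (f := fun m => m⁻¹) ?_ fun u => (Matrix.coe_units_inv u).symm
  intro m hm
  have h0 : m.det ≠ 0 := ((Matrix.isUnit_iff_isUnit_det m).mp hm).ne_zero
  have h1 : (fun m : Matrix (Fin 2) (Fin 2) K => m⁻¹) = fun m => m.det⁻¹ • m.adjugate := by
    ext m
    rw [Matrix.inv_def, Ring.inverse_eq_inv']
  rw [h1]
  have hd : ContinuousAt (fun m : Matrix (Fin 2) (Fin 2) K => m.det) m :=
    (Continuous.matrix_det continuous_id).continuousAt
  have ha : ContinuousAt (fun m : Matrix (Fin 2) (Fin 2) K => m.adjugate) m :=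
    (Continuous.matrix_adjugate continuous_id).continuousAt
  exact ((hd.inv₀ h0).smul ha).continuousWithinAt

variable (K) in
/-- The matrices with entries in `p ^ (-a)` and determinant of valuation at most `b`. -/
def glBox (a b : ℕ) : Set (GL (Fin 2) K) :=
  {g | (∀ i j, g.val i j ∈ ball K (-a)) ∧ ord g.val.det ≤ b}

variable (K) in
theorem glBox_eq_preimage (a b : ℕ) : glBox K a b = Units.val ⁻¹'
    {m : Matrix (Fin 2) (Fin 2) K | (∀ i j, m i j ∈ ball K (-a)) ∧ m.det ∉ ball K (b + 1)} := by
  ext g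
  simp only [glBox, Set.mem_ofPred_eq, Set.mem_preimage, mem_ball_of_ne (gl_det_ne_zero g), not_le,
    Int.lt_add_one_iff]

variable (K) in
theorem isClopen_box (a b : ℕ) : IsClopen
    {m : Matrix (Fin 2) (Fin 2) K | (∀ i j, m i j ∈ ball K (-a)) ∧ m.det ∉ ball K (b + 1)} := by
  have h1 : IsClopen {m : Matrix (Fin 2) (Fin 2) K | ∀ i j, m i j ∈ ball K (-a)} := by
    have : {m : Matrix (Fin 2) (Fin 2) K | ∀ i j, m i j ∈ ball K (-a)} =
        ⋂ i, ⋂ j, (fun m => m i j) ⁻¹' (ball K (-a) : Set K) := by ext; simp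
    rw [this]
    refine isClopen_iInter_of_finite fun i => isClopen_iInter_of_finite fun j => ?_
    exact IsClopen.preimage ⟨isClosed_ball K _, isOpen_ball K _⟩ (continuous_id.matrix_elem i j)
  have h2 : IsClopen {m : Matrix (Fin 2) (Fin 2) K | m.det ∈ ball K (b + 1)} :=
    IsClopen.preimage ⟨isClosed_ball K _, isOpen_ball K _⟩ (Continuous.matrix_det continuous_id)
  exact h1.inter h2.compl

variable (K) in
theorem isClopen_glBox (a b : ℕ) : IsClopen (glBox K a b) := by
  rw [glBox_eq_preimage]
  exact (isClopen_box K a b).preimage Units.continuous_val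

variable (K) in
theorem isCompact_glBox (a b : ℕ) : IsCompact (glBox K a b) := by
  rw [(isEmbedding_val_gl K).isCompact_iff, glBox_eq_preimage, Set.image_preimage_eq_of_subset]
  · have h1 : IsCompact {m : Matrix (Fin 2) (Fin 2) K | ∀ i j, m i j ∈ ball K (-a)} := by
      have := isCompact_univ_pi (X := fun _ : Fin 2 => Fin 2 → K) (s := fun _ =>
        Set.univ.pi fun _ => (ball K (-a) : Set K)) fun _ => isCompact_univ_pi fun _ =>
          isCompact_ball K (-a)
      have e : {m : Matrix (Fin 2) (Fin 2) K | ∀ i j, m i j ∈ ball K (-a)} =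
          Set.univ.pi fun _ : Fin 2 => Set.univ.pi fun _ : Fin 2 => (ball K (-a) : Set K) := by
        ext m
        exact ⟨fun h i _ j _ => h i j, fun h i j => h i trivial j trivial⟩
      rw [e]
      exact this
    exact h1.of_isClosed_subset (isClopen_box K a b).1 fun m hm => hm.1
  · rintro m ⟨-, hm⟩
    exact ⟨Matrix.GeneralLinearGroup.mkOfDetNeZero m (ne_zero_of_ord_lt hm), rfl⟩

theorem exists_subset_glBox {S : Set (GL (Fin 2) K)} (hS : IsCompact S) :
    ∃ a b : ℕ, S ⊆ glBox K a b := by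
  have h1 (i j : Fin 2) : ∃ n : ℕ, (fun g : GL (Fin 2) K => g.val i j) '' S ⊆ ball K (-n) :=
    (hS.image (Units.continuous_val.matrix_elem i j)).exists_subset_ball
  choose n hn using h1
  obtain ⟨b, hb⟩ := exists_ord_bound
    (hS.image (Matrix.GeneralLinearGroup.continuous_det (n := Fin 2) (R := K)))
  refine ⟨n 0 0 + n 0 1 + n 1 0 + n 1 1, b, fun g hg => ⟨fun i j => ?_, (hb _ ⟨g, hg, rfl⟩).2⟩⟩
  refine ball_mono (hn i j ⟨g, hg, rfl⟩) ?_
  fin_cases i <;> fin_cases j <;> simp <;> omega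

theorem glBox_inv_mem {a b : ℕ} {g : GL (Fin 2) K} (hg : g ∈ glBox K a b) (i j : Fin 2) :
    (g⁻¹).val i j ∈ ball K (-((a + b : ℕ) : ℤ)) := by
  rw [gl_inv_apply]
  have h1 : g.val.det⁻¹ ∈ ball K (-b) := Or.inr (by rw [ord_inv]; linarith [hg.2])
  refine mul_mem_ball' h1 (n := -a) ?_ (by push_cast; linarith)
  rw [Matrix.adjugate_fin_two]
  fin_cases i <;> fin_cases j <;> simp [hg.1]

/-- Neighborhoods of `1` in `GL₂` contain congruence subgroups. -/
theorem exists_ball_subset_of_mem_nhds_one {V : Set (GL (Fin 2) K)} (hV : V ∈ nhds 1) :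
    ∃ N : ℕ, ∀ k : GL (Fin 2) K,
      (∀ i j, k.val i j - (1 : Matrix (Fin 2) (Fin 2) K) i j ∈ ball K N) → k ∈ V := by
  rw [(isEmbedding_val_gl K).nhds_eq_comap, Filter.mem_comap] at hV
  obtain ⟨W, hW, hWV⟩ := hV
  obtain ⟨W', hW', hWo, h1W⟩ := mem_nhds_iff.mp hW
  obtain ⟨u, hu, huW⟩ := isOpen_pi_iff'.mp hWo _ h1W
  have h2 (i : Fin 2) := isOpen_pi_iff'.mp (hu i).1 _ (hu i).2
  choose v hv hvu using h2
  have h3 (i j : Fin 2) : ∃ N : ℕ, ∀ x : K,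
      x - (1 : Matrix (Fin 2) (Fin 2) K) i j ∈ ball K N → x ∈ v i j := by
    have hc : ContinuousAt (fun x : K => x + (1 : Matrix (Fin 2) (Fin 2) K) i j) 0 := by fun_prop
    have := hc.preimage_mem_nhds (by simpa using (hv i j).1.mem_nhds (hv i j).2)
    obtain ⟨n, -, hn⟩ := (hasBasis_nhds_zero K).mem_iff.mp this
    refine ⟨n.toNat, fun x hx => ?_⟩
    have := hn (ball_mono hx (Int.self_le_toNat n))
    simpa using this
  choose N hN using h3
  refine ⟨N 0 0 + N 0 1 + N 1 0 + N 1 1, fun k hk => hWV (hW' (huW ?_))⟩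
  refine fun i _ => hvu i fun j _ => hN i j _ (ball_mono (hk i j) ?_)
  fin_cases i <;> fin_cases j <;> simp <;> omega

end GLTopology

/-! ### Uniform invariance of smooth functions -/

/-- Compactness of the support makes local constancy uniform at its points. A point outside the
support whose translate lies inside is handled by applying the same statement to u⁻¹. -/
theorem IsSmoothCompact.eventually_mul_left {G : Type*} [Group G] [TopologicalSpace G]
    [IsTopologicalGroup G] {f : G → ℂ} (hf : IsSmoothCompact f) :
    ∀ᶠ u in nhds (1 : G), ∀ g, f (u * g) = f g := by
  have hc : IsCompact (tsupport f) := hf.2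
  have h1 : ∀ᶠ u in nhds (1 : G), ∀ g ∈ tsupport f, f (u * g) = f g := by
    refine hc.eventually_forall_of_forall_eventually fun g _ => ?_
    have e1 : Filter.Tendsto (fun p : G × G => p.1 * p.2) (nhds (1, g)) (nhds g) := by
      have : Continuous fun p : G × G => p.1 * p.2 := by fun_prop
      simpa using this.tendsto (1, g)
    have e2 : Filter.Tendsto (fun p : G × G => p.2) (nhds (1, g)) (nhds g) :=
      continuous_snd.tendsto (1, g)
    have e3 := (IsLocallyConstant.iff_eventually_eq f).mp hf.1 g
    filter_upwards [e1.eventually e3, e2.eventually e3] with p h1 h2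
    rw [h1, h2]
  have h2 : ∀ᶠ u in nhds (1 : G), ∀ g ∈ tsupport f, f (u⁻¹ * g) = f g := by
    have : Filter.Tendsto (fun u : G => u⁻¹) (nhds 1) (nhds 1) := by
      simpa using (continuous_inv (G := G)).tendsto 1
    exact this.eventually h1
  filter_upwards [h1, h2] with u hu1 hu2 g
  by_cases hg : g ∈ tsupport f
  · exact hu1 g hg
  by_cases hg' : u * g ∈ tsupport f
  · have := hu2 _ hg'
    rw [inv_mul_cancel_left] at this
    exact this.symm
  · rw [image_eq_zero_of_notMem_tsupport hg, image_eq_zero_of_notMem_tsupport hg']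

/-! ### The orbit of `w` -/

section HermitianOrbit

variable {F E : Type*} [Field F] [Field E] [Algebra F E]
  [Algebra.IsQuadraticExtension F E] [Algebra.IsSeparable F E]

variable (F) in
/-- The Hermitian matrix `g w ḡᵗ`. -/
noncomputable def gact (g : GL (Fin 2) E) : Matrix (Fin 2) (Fin 2) E :=
  g.val * wMat E * conjTr F E g.val

theorem gact_apply (g : GL (Fin 2) E) (i j : Fin 2) :
    gact F g i j = g.val i 1 * conj F E (g.val j 0) + g.val i 0 * conj F E (g.val j 1) := by
  simp [gact, wMat, conjTr, Matrix.mul_apply, Fin.sum_univ_two]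

theorem gact_mul (g h : GL (Fin 2) E) :
    gact F (g * h) = g.val * gact F h * conjTr F E g.val := by
  simp only [gact, Units.val_mul, conjTr_mul, Matrix.mul_assoc]

theorem mem_unitaryW {h : GL (Fin 2) E} : h ∈ unitaryW F E ↔ gact F h = wMat E := Iff.rfl

theorem gact_mul_unitary (g : GL (Fin 2) E) (h : unitaryW F E) : gact F (g * h.val) = gact F g := by
  rw [gact_mul, mem_unitaryW.mp h.2, gact]

theorem conjTr_mul_inv (g : GL (Fin 2) E) : conjTr F E g.val * conjTr F E (g⁻¹).val = 1 := by
  rw [← conjTr_mul, Units.inv_mul, conjTr_one]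

theorem exists_unitary_of_gact_eq {g g' : GL (Fin 2) E} (h : gact F g' = gact F g) :
    ∃ k : unitaryW F E, g' = g * k.val := by
  refine ⟨⟨g⁻¹ * g', mem_unitaryW.mpr ?_⟩, (mul_inv_cancel_left _ _).symm⟩
  rw [gact_mul, h, ← gact_mul, inv_mul_cancel]
  simp [gact, conjTr_one]

/-- The diagonal entry of a Hermitian matrix as an element of `F`. -/
noncomputable def diagEntry (s : Matrix (Fin 2) (Fin 2) E) (i : Fin 2) : F :=
  Algebra.trace F E (trOne F E * s i i)

theorem eq_hermMat {s : Matrix (Fin 2) (Fin 2) E} (h : ∀ i j, conj F E (s j i) = s i j) :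
    s = hermMat (F := F) (diagEntry s 0) (s 0 1) (diagEntry s 1) := by
  have hd (i : Fin 2) : algebraMap F E (diagEntry s i) = s i i := by
    obtain ⟨z, hz⟩ := exists_of_conj_eq (h i i)
    rw [diagEntry, ← hz, trace_trOne_mul]
  ext i j
  fin_cases i <;> fin_cases j <;> simp [hermMat, hd, h]

@[simp] theorem diagEntry_hermMat_zero (α : F) (β : E) (γ : F) :
    diagEntry (hermMat α β γ) 0 = α := by
  simp [diagEntry, hermMat, trace_trOne_mul]

@[simp] theorem diagEntry_hermMat_one (α : F) (β : E) (γ : F) :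
    diagEntry (hermMat α β γ) 1 = γ := by
  simp [diagEntry, hermMat, trace_trOne_mul]

theorem det_hermMat (α : F) (β : E) (γ : F) :
    (hermMat α β γ).det = algebraMap F E (α * γ - Algebra.norm F β) := by
  rw [hermMat, Matrix.det_fin_two_of, map_sub, map_mul, norm_eq_mul_conj]

theorem det_gact (g : GL (Fin 2) E) :
    (gact F g).det = -algebraMap F E (Algebra.norm F g.val.det) := by
  have h1 : (conjTr F E g.val).det = conj F E g.val.det := by
    rw [conjTr, Matrix.det_transpose, Matrix.det_fin_two, Matrix.det_fin_two]
    simp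
  rw [gact, Matrix.det_mul, Matrix.det_mul, h1, norm_eq_mul_conj]
  simp [wMat]

theorem hermMat_sub_apply {α α' : F} {β β' : E} {γ γ' : F} (i j : Fin 2) :
    hermMat α' β' γ' i j - hermMat α β γ i j = hermMat (α' - α) (β' - β) (γ' - γ) i j := by
  fin_cases i <;> fin_cases j <;> simp [hermMat]

variable [MeasurableSpace (unitaryW F E)] (μH : Measure (unitaryW F E))

theorem hermFun_of_not (f : GL (Fin 2) E → ℂ) {s : Matrix (Fin 2) (Fin 2) E}
    (h : ¬ ∃ g : GL (Fin 2) E, gact F g = s) : hermFun μH f s = 0 := dif_neg h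

theorem exists_of_hermFun_ne_zero {f : GL (Fin 2) E → ℂ} {s : Matrix (Fin 2) (Fin 2) E}
    (h : hermFun μH f s ≠ 0) : ∃ g, gact F g = s ∧ f g ≠ 0 := by
  by_cases hs : ∃ g : GL (Fin 2) E, gact F g = s
  · have e : hermFun μH f s = ∫ h : unitaryW F E, f (hs.choose * h.val) ∂μH := dif_pos hs
    rw [e] at h
    obtain ⟨k, hk⟩ : ∃ k : unitaryW F E, f (hs.choose * k.val) ≠ 0 := by
      by_contra! h0
      exact h (by simp [h0])
    exact ⟨_, (gact_mul_unitary _ _).trans hs.choose_spec, hk⟩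
  · exact absurd (hermFun_of_not μH f hs) h

/-- The chosen representative differs from g by an element of the stabilizer of w, which left
invariance of the measure absorbs. -/
theorem hermFun_gact [TopologicalSpace E] [IsTopologicalRing E] [BorelSpace (unitaryW F E)]
    [μH.IsHaarMeasure] (f : GL (Fin 2) E → ℂ) (g : GL (Fin 2) E) :
    hermFun μH f (gact F g) = ∫ h : unitaryW F E, f (g * h.val) ∂μH := by
  have hs : ∃ g' : GL (Fin 2) E, gact F g' = gact F g := ⟨g, rfl⟩
  have e : hermFun μH f (gact F g) = ∫ h : unitaryW F E, f (hs.choose * h.val) ∂μH := dif_pos hs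
  obtain ⟨k, hk⟩ := exists_unitary_of_gact_eq hs.choose_spec
  rw [e, hk, ← integral_mul_left_eq_self (fun h : unitaryW F E => f (g * h.val)) k]
  simp [mul_assoc]

end HermitianOrbit

/-! ### A local section of the orbit map, and smoothness of Φ_f -/

section HermitianTest

variable {F E : Type*} [Field F] [ValuativeRel F] [TopologicalSpace F]
  [IsNonarchimedeanLocalField F]
  [Field E] [ValuativeRel E] [TopologicalSpace E]
  [IsNonarchimedeanLocalField E]
  [Algebra F E] [ValuativeExtension F E]
  [Algebra.IsQuadraticExtension F E] [Algebra.IsSeparable F E]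

/-- An explicit section of the orbit map `k ↦ k w k̄ᵗ` on Hermitian matrices `[α, β; β̄, γ]` for which
`αγ / Nm β` is small. -/
theorem exists_section {α γ : F} {β : E} (hβ : β ≠ 0)
    (ht : α * γ * Algebra.norm F (trOne F E) / Algebra.norm F β ∈ ball F 1)
    (hd : α * γ - Algebra.norm F β ≠ 0) :
    ∃ (k : GL (Fin 2) E) (σ : F), ord σ = 0 ∧ gact F k = hermMat α β γ ∧ k.val 0 0 = β ∧
      k.val 0 1 = trOne F E * algebraMap F E α / conj F E β ∧
      k.val 1 0 = trOne F E * algebraMap F E (γ * σ) ∧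
      k.val 1 1 - 1 =
        -algebraMap F E (α * γ * Algebra.norm F (trOne F E) / Algebra.norm F β * σ) := by
  obtain ⟨σ, h1, h0, h2⟩ := exists_quadratic_root ht
  set t := α * γ * Algebra.norm F (trOne F E) / Algebra.norm F β
  set τ := trOne F E
  have hN := norm_ne_zero (F := F) hβ
  have hβ' : conj F E β ≠ 0 := (map_ne_zero _).mpr hβ
  -- In m w m̄ᵗ the trace 1 of τ makes the first diagonal entry α, and t is the value for which the
  -- two terms off the diagonal add up to β. The last entry is γ(σ - tσ²), so σ must solve tσ² - σ +
  -- 1 = 0.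
  set m : Matrix (Fin 2) (Fin 2) E := !![β, τ * algebraMap F E α / conj F E β;
    τ * algebraMap F E (γ * σ), 1 - algebraMap F E (t * σ)]
  have htE : algebraMap F E t = algebraMap F E α * algebraMap F E γ * (τ * conj F E τ) /
      (β * conj F E β) := by
    rw [← norm_eq_mul_conj, ← norm_eq_mul_conj, ← map_mul, ← map_mul, ← map_div₀]
  have hτ : conj F E τ = 1 - τ := conj_trOne F E
  have h2E : algebraMap F E t * algebraMap F E σ ^ 2 - algebraMap F E σ + 1 = 0 := by
    rw [← map_pow, ← map_mul, ← map_sub, ← map_one (algebraMap F E), ← map_add, h2, map_zero]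
  have hm : m * wMat E * conjTr F E m = hermMat α β γ := by
    have h3 : algebraMap F E α * algebraMap F E γ * (τ * (1 - τ)) * algebraMap F E σ ^ 2 =
        β * conj F E β * (algebraMap F E σ - 1) := by
      rw [htE, hτ] at h2E
      field_simp at h2E
      linear_combination h2E
    ext i j
    fin_cases i <;> fin_cases j <;>
      simp [m, wMat, conjTr, Matrix.mul_apply, Fin.sum_univ_two, hermMat, conj_conj, htE, hτ] <;>
      field_simp
    on_goal 4 => linear_combination (-algebraMap F E γ) * h3
    all_goals ring
  have hdet : m.det ≠ 0 := by
    intro h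
    have h3 := congrArg Matrix.det hm
    rw [Matrix.det_mul, Matrix.det_mul, h, zero_mul, zero_mul, det_hermMat] at h3
    exact hd ((map_eq_zero _).mp h3.symm)
  refine ⟨Matrix.GeneralLinearGroup.mkOfDetNeZero m hdet, σ, h1, hm, ?_⟩
  simp [m, Matrix.GeneralLinearGroup.mkOfDetNeZero]

theorem mem_ball_of_algebraMap {x : F} {n : ℕ} (h : algebraMap F E x ∈ ball E (2 * n)) :
    x ∈ ball F n := by
  rw [← algebraMap_mem_ball_iff (E := E)]
  refine ball_mono h ?_
  rcases ramIdx_eq F E with he | he <;> rw [he] <;> omega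

theorem mem_ball_of_algebraMap_neg {x : F} {n : ℕ} (h : algebraMap F E x ∈ ball E (-n)) :
    x ∈ ball F (-n) := by
  rw [← algebraMap_mem_ball_iff (E := E)]
  refine ball_mono h ?_
  rcases ramIdx_eq F E with he | he <;> rw [he] <;> omega

theorem hermMat_mem_ball {α : F} {β : E} {γ : F} {n : ℕ} (hα : α ∈ ball F n) (hβ : β ∈ ball E n)
    (hγ : γ ∈ ball F n) (i j : Fin 2) : hermMat α β γ i j ∈ ball E n := by
  fin_cases i <;> fin_cases j
  · exact algebraMap_mem_ball' hα
  · exact hβ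
  · exact conj_mem_ball.mpr hβ
  · exact algebraMap_mem_ball' hγ

variable (F) in
/-- Hermitian matrices close to `w` are of the form `k w k̄ᵗ` with `k` close to `1`. -/
theorem exists_gact_near_w {V : Set (GL (Fin 2) E)} (hV : V ∈ nhds 1) :
    ∃ N : ℕ, ∀ s : Matrix (Fin 2) (Fin 2) E, (∀ i j, conj F E (s j i) = s i j) →
      (∀ i j, s i j - wMat E i j ∈ ball E N) → ∃ k ∈ V, gact F k = s := by
  obtain ⟨n, hn⟩ := exists_ball_subset_of_mem_nhds_one hV
  obtain ⟨l, hl⟩ := exists_mem_ball (trOne F E)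
  obtain ⟨l', hl'⟩ := exists_mem_ball (Algebra.norm F (trOne F E))
  set N := n + l + l' + 1 with hN
  refine ⟨2 * N, fun s hs hsw => ?_⟩
  have e := eq_hermMat (F := F) hs
  set α : F := diagEntry s 0
  set γ : F := diagEntry s 1
  set β := s 0 1
  have hα : α ∈ ball F N := by
    refine mem_ball_of_algebraMap (E := E) ?_
    have := hsw 0 0
    rw [e] at this
    simpa [hermMat, wMat] using this
  have hγ : γ ∈ ball F N := by
    refine mem_ball_of_algebraMap (E := E) ?_
    have := hsw 1 1
    rw [e] at this
    simpa [hermMat, wMat] using this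
  have hβ : β - 1 ∈ ball E ((2 * N : ℕ) : ℤ) := hsw 0 1
  have hβ1 : β - 1 ∈ ball E 1 := ball_mono hβ (by omega)
  have hβo : ord β = 0 := by simpa using ord_one_add hβ1
  have hβ0 : β ≠ 0 := by simpa using one_add_ne_zero hβ1
  have hβ' : (conj F E β)⁻¹ ∈ ball E 0 := Or.inr (by rw [ord_inv, ord_conj, hβo, neg_zero])
  have hNβ : ord (Algebra.norm F β) = 0 := by
    have := ramIdx_mul_ord_norm (F := F) hβ0
    rw [hβo, mul_zero] at this
    exact (mul_eq_zero.mp this).resolve_left (by linarith [ramIdx_pos F E])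
  have hNβ0 := norm_ne_zero (F := F) hβ0
  have ht : α * γ * Algebra.norm F (trOne F E) / Algebra.norm F β ∈ ball F N := by
    rw [div_eq_mul_inv]
    refine mul_mem_ball' (mul_mem_ball (mul_mem_ball hα hγ) hl')
      (Or.inr (by rw [ord_inv, hNβ, neg_zero] : (0 : ℤ) ≤ _)) (by omega)
  have hd : α * γ - Algebra.norm F β ≠ 0 := by
    intro h0
    have h1 := mul_mem_ball hα hγ
    rw [sub_eq_zero.mp h0, mem_ball_of_ne hNβ0, hNβ] at h1
    omega
  obtain ⟨k, σ, hσ, hk, h00, h01, h10, h11⟩ :=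
    exists_section hβ0 (ball_mono ht (by omega)) hd
  refine ⟨k, hn k fun i j => ?_, hk.trans e.symm⟩
  have hσ' : σ ∈ ball F 0 := Or.inr hσ.ge
  fin_cases i <;> fin_cases j
  · simp only [Fin.zero_eta, h00, Matrix.one_apply_eq]
    exact ball_mono hβ (by omega)
  · simp only [Fin.zero_eta, Fin.mk_one, h01, ne_eq, zero_ne_one, not_false_eq_true,
      Matrix.one_apply_ne, sub_zero, div_eq_mul_inv]
    exact mul_mem_ball' (mul_mem_ball hl (algebraMap_mem_ball' hα)) hβ' (by omega)
  · simp only [Fin.zero_eta, Fin.mk_one, h10, ne_eq, one_ne_zero, not_false_eq_true,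
      Matrix.one_apply_ne, sub_zero]
    exact mul_mem_ball' hl (algebraMap_mem_ball' (mul_mem_ball' hγ hσ' (add_zero _).ge)) (by omega)
  · simp only [Fin.mk_one, h11, Matrix.one_apply_eq]
    exact (ball E _).neg_mem (ball_mono (algebraMap_mem_ball' (mul_mem_ball' ht hσ'
      (add_zero _).ge)) (by omega))

variable [MeasurableSpace (unitaryW F E)] [BorelSpace (unitaryW F E)]
  (μH : Measure (unitaryW F E)) [μH.IsHaarMeasure]

/-- The function `Φ_f` attached to a smooth function `f` of compact support is itself locally constant
of compact support. -/
theorem exists_isTest_hermFun {f : GL (Fin 2) E → ℂ} (hf : IsSmoothCompact f) :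
    ∃ M, IsTest (hermCoord (F := F) (hermFun μH f)) M := by
  obtain ⟨a, b, hab⟩ := exists_subset_glBox hf.2.isCompact
  have hsupp {s : Matrix (Fin 2) (Fin 2) E} (h : hermFun μH f s ≠ 0) :
      ∃ g ∈ tsupport f, gact F g = s := by
    obtain ⟨g, hg, hg'⟩ := exists_of_hermFun_ne_zero μH h
    exact ⟨g, subset_tsupport f hg', hg⟩
  -- A representative of a nearby Hermitian matrix will be gk with g in the support and k near 1.
  -- Writing gk = (gkg⁻¹)g requires uniform invariance under the conjugates gkg⁻¹ as g runs through
  -- a compact set.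
  have hV : ∀ᶠ k in nhds (1 : GL (Fin 2) E), ∀ g ∈ tsupport f, ∀ x, f (g * k * g⁻¹ * x) = f x := by
    refine hf.2.isCompact.eventually_forall_of_forall_eventually fun g _ => ?_
    have e1 : Filter.Tendsto (fun p : GL (Fin 2) E × GL (Fin 2) E => p.2 * p.1 * p.2⁻¹)
        (nhds (1, g)) (nhds 1) := by
      have : Continuous fun p : GL (Fin 2) E × GL (Fin 2) E => p.2 * p.1 * p.2⁻¹ := by fun_prop
      simpa using this.tendsto (1, g)
    exact e1.eventually hf.eventually_mul_left
  obtain ⟨N, hN⟩ := exists_gact_near_w F hV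
  have key {α β γ α' β' γ'} (h0 : hermFun μH f (hermMat (F := F) α β γ) ≠ 0)
      (hα : α' - α ∈ ball F (N + 2 * (a + b) : ℕ)) (hβ : β' - β ∈ ball E (N + 2 * (a + b) : ℕ))
      (hγ : γ' - γ ∈ ball F (N + 2 * (a + b) : ℕ)) :
      hermFun μH f (hermMat α' β' γ') = hermFun μH f (hermMat α β γ) := by
    obtain ⟨g, hg, hgs⟩ := hsupp h0
    have hg' := glBox_inv_mem (hab hg)
    -- Transport by g⁻¹ reduces to matrices near w. Its entries are bounded by a + b on the compact
    -- support and occur twice, whence the loss of 2(a + b).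
    set s : Matrix (Fin 2) (Fin 2) E := (g⁻¹).val * hermMat α' β' γ' * conjTr F E (g⁻¹).val with hs
    have hs_apply (m : Matrix (Fin 2) (Fin 2) E) (i j : Fin 2) :
        ((g⁻¹).val * m * conjTr F E (g⁻¹).val) i j =
        ((g⁻¹).val i 0 * m 0 0 + (g⁻¹).val i 1 * m 1 0) * conj F E ((g⁻¹).val j 0) +
        ((g⁻¹).val i 0 * m 0 1 + (g⁻¹).val i 1 * m 1 1) * conj F E ((g⁻¹).val j 1) := by
      simp only [conjTr, Matrix.mul_apply, Fin.sum_univ_two, Matrix.transpose_apply, Matrix.map_apply]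
    have hw : (g⁻¹).val * hermMat α β γ * conjTr F E (g⁻¹).val = wMat E := by
      rw [← hgs, ← gact_mul, inv_mul_cancel]
      simp [gact, conjTr_one]
    obtain ⟨k, hk, hks⟩ := hN s (fun i j => by
      rw [hs, hs_apply, hs_apply]
      simp only [hermMat, map_add, map_mul, conj_conj, Matrix.of_apply, Matrix.cons_val', Matrix.cons_val_zero,
        Matrix.cons_val_one, Matrix.cons_val_fin_one, AlgEquiv.commutes]
      ring) (fun i j => by
      have e : s i j - wMat E i j = ((g⁻¹).val * hermMat (α' - α) (β' - β) (γ' - γ) *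
          conjTr F E (g⁻¹).val) i j := by
        rw [← hw, hs, hs_apply, hs_apply, hs_apply]
        simp only [← hermMat_sub_apply (α := α) (α' := α')]
        ring
      rw [e, hs_apply]
      have hm := hermMat_mem_ball hα hβ hγ
      have h1 (i j l : Fin 2) := mul_mem_ball (hg' i j) (hm j l)
      have h2 (i l : Fin 2) := conj_mem_ball (F := F).mpr (hg' i l)
      exact (ball E _).add_mem
        (mul_mem_ball' ((ball E _).add_mem (h1 i 0 0) (h1 i 1 0)) (h2 j 0) (by push_cast; linarith))
        (mul_mem_ball' ((ball E _).add_mem (h1 i 0 1) (h1 i 1 1)) (h2 j 1) (by push_cast; linarith)))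
    have e1 : hermMat α' β' γ' = gact F (g * k) := by
      rw [gact_mul, hks, hs]
      have := conjTr_mul_inv (F := F) (g⁻¹)
      rw [inv_inv] at this
      calc hermMat α' β' γ' = (g.val * (g⁻¹).val) * hermMat α' β' γ' *
            (conjTr F E (g⁻¹).val * conjTr F E g.val) := by rw [this, Units.mul_inv]; simp
        _ = _ := by simp only [Matrix.mul_assoc]
    rw [e1, ← hgs, hermFun_gact, hermFun_gact]
    congr 1
    ext h
    rw [← hk g hg (g * h.val)]
    congr 1
    group
  refine ⟨(N + 2 * (a + b)) + 2 * a + 2 * b, fun {α β γ} h0 => ?_, fun {α β γ α' β' γ'} hα hβ hγ => ?_⟩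
  · obtain ⟨g, hg, hgs⟩ := hsupp h0
    have h1 := hab hg
    have h2 (i j : Fin 2) : hermMat α β γ i j ∈ ball E (-((2 * a : ℕ) : ℤ)) := by
      rw [← hgs, gact_apply]
      have h3 (i j : Fin 2) := conj_mem_ball (F := F).mpr (h1.1 i j)
      exact (ball E _).add_mem (mul_mem_ball' (h1.1 i 1) (h3 j 0) (by push_cast; linarith))
        (mul_mem_ball' (h1.1 i 0) (h3 j 1) (by push_cast; linarith))
    refine ⟨ball_mono (mem_ball_of_algebraMap_neg (E := E) (h2 0 0)) (by push_cast; linarith),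
      ball_mono (h2 0 1) (by push_cast; linarith),
      ball_mono (mem_ball_of_algebraMap_neg (E := E) (h2 1 1)) (by push_cast; linarith), ?_⟩
    have h4 : α * γ - Algebra.norm F β = -Algebra.norm F g.val.det := by
      apply (algebraMap F E).injective
      rw [← det_hermMat, ← hgs, det_gact, map_neg]
    have h5 := ramIdx_mul_ord_norm (F := F) (gl_det_ne_zero g)
    rw [h4, ord_neg]
    have h6 := h1.2
    rcases ramIdx_eq F E with he | he <;> rw [he] at h5 <;> push_cast <;> omega
  · have hm : ((N + 2 * (a + b) : ℕ) : ℤ) ≤ ((N + 2 * (a + b)) + 2 * a + 2 * b : ℕ) := by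
      push_cast; linarith
    replace hα := ball_mono hα hm
    replace hβ := ball_mono hβ hm
    replace hγ := ball_mono hγ hm
    unfold hermCoord
    by_cases h0 : hermFun μH f (hermMat (F := F) α β γ) = 0
    · by_contra h1
      rw [h0] at h1
      refine h1 ((key h1 ?_ ?_ ?_).symm.trans h0)
      · rw [← neg_sub]; exact (ball F _).neg_mem hα
      · rw [← neg_sub]; exact (ball E _).neg_mem hβ
      · rw [← neg_sub]; exact (ball F _).neg_mem hγ
    · exact key h0 hα hβ hγ

end HermitianTest

/-! ### Realizing test functions on Hermitian matrices as Φ_f -/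

theorem isLocallyConstant_indicator {X : Type*} [TopologicalSpace X] {S : Set X} (hS : IsClopen S)
    {f : X → ℂ} (hf : IsLocallyConstant f) : IsLocallyConstant (S.indicator f) := by
  rw [IsLocallyConstant.iff_eventually_eq] at hf ⊢
  intro x
  by_cases hx : x ∈ S
  · filter_upwards [hf x, hS.2.mem_nhds hx] with y h1 h2
    rw [Set.indicator_of_mem h2, Set.indicator_of_mem hx, h1]
  · filter_upwards [hS.compl.2.mem_nhds hx] with y h2
    rw [Set.indicator_of_notMem h2, Set.indicator_of_notMem hx]

theorem isSmoothCompact_indicator {X : Type*} [TopologicalSpace X] {S : Set X} (hS : IsClopen S)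
    (hS' : IsCompact S) {f : X → ℂ} (hf : IsLocallyConstant f) : IsSmoothCompact (S.indicator f) :=
  ⟨isLocallyConstant_indicator hS hf, hS'.of_isClosed_subset (isClosed_tsupport _)
    (closure_minimal Set.support_indicator_subset hS.1)⟩

section Lifting

variable {F E : Type*} [Field F] [ValuativeRel F] [TopologicalSpace F]
  [IsNonarchimedeanLocalField F]
  [Field E] [ValuativeRel E] [TopologicalSpace E]
  [IsNonarchimedeanLocalField E]
  [Algebra F E] [ValuativeExtension F E]
  [Algebra.IsQuadraticExtension F E] [Algebra.IsSeparable F E]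

theorem IsTest.isLocallyConstant {Φ : F → E → F → ℂ} {M : ℕ} (h : IsTest Φ M) :
    IsLocallyConstant fun p : F × E × F => Φ p.1 p.2.1 p.2.2 := by
  rw [IsLocallyConstant.iff_eventually_eq]
  rintro ⟨α, β, γ⟩
  rw [nhds_prod_eq, nhds_prod_eq]
  filter_upwards [(eventually_sub_mem_ball α M).prod_mk
    ((eventually_sub_mem_ball β M).prod_mk (eventually_sub_mem_ball γ M))] with p hp
  exact h.inv hp.1 hp.2.1 hp.2.2

variable (F E) in
theorem continuous_gact : Continuous (gact F : GL (Fin 2) E → Matrix (Fin 2) (Fin 2) E) := by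
  have h1 : Continuous fun g : GL (Fin 2) E => g.val := Units.continuous_val
  have h2 : Continuous fun g : GL (Fin 2) E => conjTr F E g.val :=
    (h1.matrix_map (continuous_conj F E)).matrix_transpose
  exact (h1.matrix_mul continuous_const).matrix_mul h2

variable (F E) in
theorem isClosed_unitaryW : IsClosed (unitaryW F E : Set (GL (Fin 2) E)) :=
  isClosed_singleton.preimage (continuous_gact F E)

variable [MeasurableSpace (unitaryW F E)] [BorelSpace (unitaryW F E)]
  (μH : Measure (unitaryW F E)) [μH.IsHaarMeasure]

/-- The value is the volume of {h : gh ∈ Q}, which is open, contains 1, and is compact because H₀ is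
closed. -/
theorem hermFun_indicator_ne_zero {Q : Set (GL (Fin 2) E)} (hQ : IsClopen Q) (hQ' : IsCompact Q)
    {g : GL (Fin 2) E} (hg : g ∈ Q) : hermFun μH (Q.indicator 1) (gact F g) ≠ 0 := by
  rw [hermFun_gact]
  set S : Set (unitaryW F E) := {h | g * h.val ∈ Q}
  have hc : Continuous fun h : unitaryW F E => g * h.val := by fun_prop
  have hS : IsClopen S := hQ.preimage hc
  have hSc : IsCompact S := by
    have e : Topology.IsClosedEmbedding fun h : unitaryW F E => g * h.val :=
      (Homeomorph.mulLeft g).isClosedEmbedding.comp (isClosed_unitaryW F E).isClosedEmbedding_subtypeVal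
    exact e.isCompact_preimage hQ'
  have e : (fun h : unitaryW F E => Q.indicator (1 : GL (Fin 2) E → ℂ) (g * h.val)) =
      S.indicator fun _ => 1 := by
    ext h
    by_cases hh : g * h.val ∈ Q
    · rw [Set.indicator_of_mem hh, Set.indicator_of_mem (show h ∈ S from hh)]; rfl
    · rw [Set.indicator_of_notMem hh, Set.indicator_of_notMem (show h ∉ S from hh)]
  rw [e, integral_indicator hS.1.measurableSet]
  simp only [integral_const, MeasurableSet.univ, measureReal_restrict_apply, Set.univ_inter,
    Complex.real_smul, mul_one, ne_eq, Complex.ofReal_eq_zero]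
  refine (ENNReal.toReal_pos ?_ hSc.measure_lt_top.ne).ne'
  exact (hS.2.measure_pos μH ⟨1, by simpa [S] using hg⟩).ne'

/-- Functions supported in the image of a compact set are of the form `Φ_f`. -/
theorem exists_lift {Φ : F → E → F → ℂ} {M : ℕ} (h : IsTest Φ M) {a b : ℕ}
    (hsec : ∀ α β γ, Φ α β γ ≠ 0 → ∃ k ∈ glBox E a b, gact F k = hermMat α β γ) :
    ∃ f : GL (Fin 2) E → ℂ, IsSmoothCompact f ∧ hermCoord (hermFun μH f) = Φ := by
  have hQ := isClopen_glBox E a b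
  have hQ' := isCompact_glBox E a b
  set Q := glBox E a b
  have h1Q : IsSmoothCompact (Q.indicator (1 : GL (Fin 2) E → ℂ)) :=
    isSmoothCompact_indicator hQ hQ' (IsLocallyConstant.const 1)
  set I := hermCoord (F := F) (hermFun μH (Q.indicator 1))
  obtain ⟨M', hI⟩ : ∃ M', IsTest I M' := exists_isTest_hermFun μH h1Q
  -- The function f is Φ/I pulled back by the orbit map and cut off to Q, where I belongs to the
  -- indicator of Q. The quotient is constant on cosets of H₀ and leaves the integral, so Φ_f =
  -- (Φ/I)·I. Where Φ ≠ 0 the orbit meets Q and I ≠ 0.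
  set R : F × E × F → ℂ := fun p => Φ p.1 p.2.1 p.2.2 / I p.1 p.2.1 p.2.2
  have hR : IsLocallyConstant R := h.isLocallyConstant.div hI.isLocallyConstant
  set co : GL (Fin 2) E → F × E × F := fun g =>
    (diagEntry (gact F g) 0, gact F g 0 1, diagEntry (gact F g) 1)
  have hco : Continuous co := by
    have h1 := continuous_gact F E
    have h2 := continuous_trace_local F E
    have h3 (i j : Fin 2) : Continuous fun g : GL (Fin 2) E => gact F g i j := h1.matrix_elem i j
    unfold co diagEntry
    exact (h2.comp ((continuous_const).mul (h3 0 0))).prodMk ((h3 0 1).prodMk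
      (h2.comp ((continuous_const).mul (h3 1 1))))
  refine ⟨Q.indicator (R ∘ co), isSmoothCompact_indicator hQ hQ' (hR.comp_continuous hco), ?_⟩
  have hgact (g : GL (Fin 2) E) :
      hermFun μH (Q.indicator (R ∘ co)) (gact F g) = R (co g) * hermFun μH (Q.indicator 1) (gact F g) := by
    rw [hermFun_gact, hermFun_gact, ← integral_const_mul]
    congr 1
    ext k
    have e : co (g * k.val) = co g := by simp only [co, gact_mul_unitary]
    by_cases hh : g * k.val ∈ Q
    · rw [Set.indicator_of_mem hh, Set.indicator_of_mem hh, Function.comp_apply, e]; simp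
    · rw [Set.indicator_of_notMem hh, Set.indicator_of_notMem hh, mul_zero]
  ext α β γ
  unfold hermCoord
  by_cases hs : ∃ g : GL (Fin 2) E, gact F g = hermMat α β γ
  · obtain ⟨g, hg⟩ := hs
    have e : co g = (α, β, γ) := by simp only [co, hg, diagEntry_hermMat_zero, diagEntry_hermMat_one]; simp [hermMat]
    rw [← hg, hgact, e, hg]
    change Φ α β γ / I α β γ * I α β γ = _
    by_cases h0 : Φ α β γ = 0
    · simp [h0]
    obtain ⟨k, hk, hk'⟩ := hsec α β γ h0
    refine div_mul_cancel₀ _ ?_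
    have := hermFun_indicator_ne_zero (F := F) μH hQ hQ' hk
    rwa [hk'] at this
  · rw [hermFun_of_not μH _ hs]
    by_contra h0
    obtain ⟨k, -, hk'⟩ := hsec α β γ (Ne.symm h0)
    exact hs ⟨k, hk'⟩

end Lifting

/-! ### Coordinates on the quaternion groups -/

section QuatAlgebra

variable {F E : Type*} [Field F] [Field E] [Algebra F E]
  [Algebra.IsQuadraticExtension F E] [Algebra.IsSeparable F E] {ε : Fˣ}

theorem quat_apply_one_one (g : quat F E ε) : g.val.val 1 1 = conj F E (g.val.val 0 0) := g.2.1

theorem quat_apply_zero_one (g : quat F E ε) :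
    g.val.val 0 1 = conj F E (g.val.val 1 0) * algebraMap F E ε := g.2.2

theorem quat_ext {g h : quat F E ε} (h0 : g.val.val 0 0 = h.val.val 0 0)
    (h1 : g.val.val 1 0 = h.val.val 1 0) : g = h := by
  apply Subtype.ext
  apply Units.ext
  ext i j
  fin_cases i <;> fin_cases j <;>
    simp [quat_apply_one_one, quat_apply_zero_one, h0, h1]

/-- The reduced norm of an element of `G_ε`. -/
noncomputable def qdet (g : quat F E ε) : F :=
  Algebra.norm F (g.val.val 0 0) - ε * Algebra.norm F (g.val.val 1 0)

theorem algebraMap_qdet (g : quat F E ε) : algebraMap F E (qdet g) = g.val.val.det := by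
  rw [Matrix.det_fin_two, quat_apply_one_one, quat_apply_zero_one, qdet, map_sub, map_mul,
    norm_eq_mul_conj, norm_eq_mul_conj]
  ring

theorem qdet_ne_zero (g : quat F E ε) : qdet g ≠ 0 := by
  intro h
  have h1 := algebraMap_qdet g
  rw [h, map_zero] at h1
  exact ((Matrix.isUnit_iff_isUnit_det _).mp g.val.isUnit).ne_zero h1.symm

theorem qdet_mul (g h : quat F E ε) : qdet (g * h) = qdet g * qdet h := by
  apply (algebraMap F E).injective
  rw [map_mul, algebraMap_qdet, algebraMap_qdet, algebraMap_qdet]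
  simp

@[simp] theorem torus_apply_zero_zero (t : Eˣ) : (torus (F := F) ε t).val.val 0 0 = t := rfl

@[simp] theorem torus_apply_one_zero (t : Eˣ) : (torus (F := F) ε t).val.val 1 0 = 0 :=
  map_zero (conj F E)

theorem quat_mul_zero_zero (g h : quat F E ε) : (g * h).val.val 0 0 =
    g.val.val 0 0 * h.val.val 0 0 + conj F E (g.val.val 1 0) * algebraMap F E ε * h.val.val 1 0 := by
  simp [Matrix.mul_apply, Fin.sum_univ_two, quat_apply_zero_one]

theorem quat_mul_one_zero (g h : quat F E ε) : (g * h).val.val 1 0 =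
    g.val.val 1 0 * h.val.val 0 0 + conj F E (g.val.val 0 0) * h.val.val 1 0 := by
  simp [Matrix.mul_apply, Fin.sum_univ_two, quat_apply_one_one]

variable (F ε) in
theorem torus_mul (s t : Eˣ) : torus (F := F) ε (s * t) = torus ε s * torus ε t := by
  apply quat_ext
  · rw [quat_mul_zero_zero]; simp
  · rw [quat_mul_one_zero]; simp

variable (F ε) in
theorem torus_one : torus (F := F) ε (1 : Eˣ) = 1 := by
  apply quat_ext <;> simp

variable (F ε) in
theorem torus_inv (t : Eˣ) : (torus (F := F) ε t)⁻¹ = torus ε t⁻¹ := by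
  rw [inv_eq_iff_mul_eq_one, ← torus_mul, mul_inv_cancel, torus_one]

theorem qdet_torus (t : Eˣ) : qdet (torus (F := F) ε t) = Algebra.norm F (t : E) := by
  simp [qdet]

theorem mem_torusSet {g : quat F E ε} : g ∈ torusSet ε ↔ g.val.val 1 0 = 0 := by
  constructor
  · rintro ⟨t, rfl⟩; simp
  · intro h
    have h0 : g.val.val 0 0 ≠ 0 := by
      intro h0
      exact qdet_ne_zero g (by simp [qdet, h, h0])
    exact ⟨Units.mk0 _ h0, quat_ext (by simp) (by simp [h])⟩

/-- The element `h₁⁻¹ δ(x) h₁ r` of the orbit of `δ(x)`. -/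
noncomputable def orbPt (ε : Fˣ) (b : Eˣ) (hb : (ε : F) * Algebra.norm F (b : E) ≠ 1) (h₁ r : Eˣ) :
    quat F E ε := (torus ε h₁)⁻¹ * delta ε b hb * torus ε (h₁ * r)

variable {b : Eˣ} (hb : (ε : F) * Algebra.norm F (b : E) ≠ 1) (h₁ r : Eˣ)

@[simp] theorem orbPt_zero_zero : (orbPt ε b hb h₁ r).val.val 0 0 = r := by
  have h1 : (delta ε b hb).val.val 0 0 = 1 := rfl
  have h2 : (delta ε b hb).val.val 1 0 = conj F E b := rfl
  rw [orbPt, torus_inv, quat_mul_zero_zero, quat_mul_zero_zero, h1, h2]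
  simp

@[simp] theorem orbPt_one_zero :
    (orbPt ε b hb h₁ r).val.val 1 0 = conj F E b * (h₁ * (conj F E h₁)⁻¹) * r := by
  have h1 : (delta ε b hb).val.val 0 0 = 1 := rfl
  have h2 : (delta ε b hb).val.val 1 0 = conj F E b := rfl
  rw [orbPt, torus_inv, quat_mul_one_zero, quat_mul_one_zero, h1, h2]
  simp
  ring

theorem orbPt_notMem_torusSet : orbPt ε b hb h₁ r ∉ torusSet ε := by
  rw [mem_torusSet, orbPt_one_zero]
  simp

theorem norm_orbPt_one_zero : Algebra.norm F ((orbPt ε b hb h₁ r).val.val 1 0) =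
    Algebra.norm F (b : E) * Algebra.norm F (r : E) := by
  have h1 : Algebra.norm F ((h₁ : E) * (conj F E h₁)⁻¹) = 1 := by
    have h2 : (conj F E h₁ : E) ≠ 0 := (map_ne_zero _).mpr h₁.ne_zero
    apply mul_right_cancel₀ (norm_ne_zero (F := F) h2)
    rw [← map_mul, inv_mul_cancel_right₀ h2, norm_conj, one_mul]
  rw [orbPt_one_zero, map_mul, map_mul, h1, mul_one, norm_conj]

theorem qdet_orbPt : qdet (orbPt ε b hb h₁ r) =
    Algebra.norm F (r : E) * (1 - ε * Algebra.norm F (b : E)) := by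
  rw [qdet, norm_orbPt_one_zero, orbPt_zero_zero]
  ring

/-- Both numerator and reduced norm scale by Nm(r), and h₁ only contributes an element of norm 1.
Hence the logarithmic factor of a multiplicity function is constant along an orbit and comes out of
the orbital integral. -/
theorem invPrime_orbPt : invPrime (orbPt ε b hb h₁ r) =
    ε * Algebra.norm F (b : E) / (1 - ε * Algebra.norm F (b : E)) := by
  have h1 := norm_ne_zero (F := F) r.ne_zero
  have h2 : invPrime (orbPt ε b hb h₁ r) =
      ε * Algebra.norm F ((orbPt ε b hb h₁ r).val.val 1 0) / qdet (orbPt ε b hb h₁ r) := rfl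
  rw [h2, norm_orbPt_one_zero, qdet_orbPt, mul_comm (Algebra.norm F (b : E)), mul_left_comm,
    mul_div_mul_left _ _ h1]

theorem orbPt_eq_mul_torus : orbPt ε b hb h₁ r = orbPt ε b hb h₁ 1 * torus ε r := by
  simp only [orbPt, torus_mul, mul_one, mul_assoc]

theorem central_mul_apply (z : Fˣ) (g : quat F E ε) :
    (central ε z * g).val.val 0 0 = algebraMap F E z * g.val.val 0 0 ∧
      (central ε z * g).val.val 1 0 = algebraMap F E z * g.val.val 1 0 := by
  rw [central, quat_mul_zero_zero, quat_mul_one_zero]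
  simp [incl]

end QuatAlgebra

/-! ### Compactness in G_ε and neighborhoods of the torus -/

section QuatTopology

variable {F E : Type*} [Field F] [ValuativeRel F] [TopologicalSpace F]
  [IsNonarchimedeanLocalField F]
  [Field E] [ValuativeRel E] [TopologicalSpace E]
  [IsNonarchimedeanLocalField E]
  [Algebra F E] [ValuativeExtension F E]
  [Algebra.IsQuadraticExtension F E] [Algebra.IsSeparable F E] {ε : Fˣ}

theorem continuous_quat_apply (i j : Fin 2) : Continuous fun g : quat F E ε => g.val.val i j :=
  (Units.continuous_val.comp continuous_subtype_val).matrix_elem i j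

theorem continuous_qdet : Continuous (qdet : quat F E ε → F) := by
  have h := continuous_norm_local F E
  exact (h.comp (continuous_quat_apply 0 0)).sub
    (continuous_const.mul (h.comp (continuous_quat_apply 1 0)))

theorem isLocallyConstant_ord_qdet : IsLocallyConstant fun g : quat F E ε => ord (qdet g) := by
  rw [IsLocallyConstant.iff_eventually_eq]
  intro g
  exact continuous_qdet.continuousAt.eventually (eventually_ord_eq (qdet_ne_zero g))

theorem isClosed_quat : IsClosed (quat F E ε : Set (GL (Fin 2) E)) := by
  have h (i j : Fin 2) : Continuous fun g : GL (Fin 2) E => g.val i j :=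
    Units.continuous_val.matrix_elem i j
  have hc := continuous_conj F E
  exact (isClosed_eq (h 1 1) (hc.comp (h 0 0))).inter
    (isClosed_eq (h 0 1) ((hc.comp (h 1 0)).mul continuous_const))

theorem continuous_quat_iff {X : Type*} [TopologicalSpace X] {f : X → quat F E ε} :
    Continuous f ↔ Continuous (fun x => (f x).val.val 0 0) ∧
      Continuous fun x => (f x).val.val 1 0 := by
  refine ⟨fun h => ⟨(continuous_quat_apply 0 0).comp h, (continuous_quat_apply 1 0).comp h⟩,
    fun ⟨h0, h1⟩ => ?_⟩
  have hc := continuous_conj F E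
  rw [Topology.IsEmbedding.subtypeVal.continuous_iff, (isEmbedding_val_gl E).continuous_iff]
  refine continuous_matrix fun i j => ?_
  fin_cases i <;> fin_cases j
  · exact h0
  · simpa [quat_apply_zero_one, Function.comp_def, Pi.mul_def] using! (hc.comp h1).mul (continuous_const (y := algebraMap F E ε))
  · exact h1
  · simpa [quat_apply_one_one, Function.comp_def] using hc.comp h0

theorem continuous_torus : Continuous (torus (F := F) (E := E) ε) := by
  rw [continuous_quat_iff]
  simp only [torus_apply_zero_zero, torus_apply_one_zero]
  exact ⟨Units.continuous_val, continuous_const⟩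

variable (F E ε) in
/-- The elements of `G_ε` with coordinates in `p ^ (-a)` and reduced norm of valuation `≤ b`. -/
def qBox (a b : ℕ) : Set (quat F E ε) :=
  {g | g.val.val 0 0 ∈ ball E (-a) ∧ g.val.val 1 0 ∈ ball E (-a) ∧ ord (qdet g) ≤ b}

theorem isCompact_qBox (a b : ℕ) : IsCompact (qBox F E ε a b) := by
  have h1 : IsCompact {g : quat F E ε | g.val ∈ glBox E (a + (ord (algebraMap F E ε)).natAbs) (2 * b)} :=
    isClosed_quat.isClosedEmbedding_subtypeVal.isCompact_preimage (isCompact_glBox E _ _)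
  refine h1.of_isClosed_subset ?_ fun g hg => ⟨?_, ?_⟩
  · have h2 : IsClosed {g : quat F E ε | ord (qdet g) ≤ b} :=
      (isClosed_discrete (Set.Iic (b : ℤ))).preimage isLocallyConstant_ord_qdet.continuous
    exact ((isClosed_ball E _).preimage (continuous_quat_apply 0 0)).inter
      (((isClosed_ball E _).preimage (continuous_quat_apply 1 0)).inter h2)
  · have h00 := ball_mono hg.1 (show -((a + (ord (algebraMap F E ε)).natAbs : ℕ) : ℤ) ≤ -a by omega)
    have h10 := ball_mono hg.2.1 (show -((a + (ord (algebraMap F E ε)).natAbs : ℕ) : ℤ) ≤ -a by omega)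
    intro i j
    fin_cases i <;> fin_cases j
    · exact h00
    · simp only [Fin.zero_eta, Fin.mk_one, quat_apply_zero_one]
      exact mul_mem_ball' (conj_mem_ball.mpr hg.2.1) (self_mem_ball _) (by omega)
    · exact h10
    · simp only [Fin.mk_one, quat_apply_one_one]
      exact conj_mem_ball.mpr h00
  · rw [← algebraMap_qdet, ord_algebraMap (qdet_ne_zero g)]
    have := hg.2.2
    rcases ramIdx_eq F E with he | he <;> rw [he] <;> push_cast <;> omega

theorem exists_subset_qBox {S : Set (quat F E ε)} (hS : IsCompact S) :
    ∃ M : ℕ, S ⊆ qBox F E ε M M ∧ ∀ g ∈ S, -(M : ℤ) ≤ ord (qdet g) := by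
  obtain ⟨a, ha⟩ := (hS.image (continuous_quat_apply 0 0)).exists_subset_ball
  obtain ⟨b, hb⟩ := (hS.image (continuous_quat_apply 1 0)).exists_subset_ball
  have h1 := (hS.image isLocallyConstant_ord_qdet.continuous).finite_of_discrete
  obtain ⟨c, hc⟩ := (h1.image Int.natAbs).bddAbove
  have hc' (g : quat F E ε) (hg : g ∈ S) : (ord (qdet g)).natAbs ≤ c :=
    hc ⟨_, ⟨g, hg, rfl⟩, rfl⟩
  refine ⟨a + b + c, fun g hg => ⟨?_, ?_, ?_⟩, fun g hg => ?_⟩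
  · exact ball_mono (ha ⟨g, hg, rfl⟩) (by push_cast; omega)
  · exact ball_mono (hb ⟨g, hg, rfl⟩) (by push_cast; omega)
  · have := hc' g hg; omega
  · have := hc' g hg; omega

theorem exists_mem_nhds_one_quat {V : Set (quat F E ε)} (hV : V ∈ nhds 1) :
    ∃ N : ℕ, ∀ g : quat F E ε, g.val.val 0 0 = 1 → g.val.val 1 0 ∈ ball E N → g ∈ V := by
  rw [nhds_induced, Filter.mem_comap] at hV
  obtain ⟨W, hW, hWV⟩ := hV
  obtain ⟨N, hN⟩ := exists_ball_subset_of_mem_nhds_one hW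
  refine ⟨N + (ord (algebraMap F E ε)).natAbs, fun g h0 h1 => hWV (hN _ fun i j => ?_)⟩
  fin_cases i <;> fin_cases j
  · simp [h0, (ball E _).zero_mem]
  · simp only [Fin.zero_eta, Fin.mk_one, quat_apply_zero_one, ne_eq, zero_ne_one,
      not_false_eq_true, Matrix.one_apply_ne, sub_zero]
    exact mul_mem_ball' (conj_mem_ball.mpr h1) (self_mem_ball _) (by omega)
  · simp only [Fin.zero_eta, Fin.mk_one, ne_eq, one_ne_zero,
      not_false_eq_true, Matrix.one_apply_ne, sub_zero]
    exact ball_mono h1 (by omega)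
  · simp [quat_apply_one_one, h0, (ball E _).zero_mem]

/-- On the orbit of `δ(x)` with `x` close to `0`, a smooth function is given by its values on the
torus. -/
theorem IsSmoothCompact.exists_orbPt_eq {f : quat F E ε → ℂ} (hf : IsSmoothCompact f) :
    ∃ N : ℕ, ∀ (b : Eˣ) (hb : (ε : F) * Algebra.norm F (b : E) ≠ 1), (N : ℤ) ≤ ord (b : E) →
      ∀ h₁ r, f (orbPt ε b hb h₁ r) = f (torus ε r) := by
  obtain ⟨N, hN⟩ := exists_mem_nhds_one_quat hf.eventually_mul_left
  refine ⟨N, fun b hb h h₁ r => ?_⟩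
  rw [orbPt_eq_mul_torus]
  refine hN _ (by simp) ?_ _
  -- The second coordinate is b̄h₁/h̄₁, of valuation v(b) for all h₁, so the closeness to the torus
  -- is uniform in h₁.
  rw [orbPt_one_zero, Units.val_one, mul_one]
  refine mul_mem_ball' (m := N) (n := 0) (conj_mem_ball.mpr (Or.inr h)) (Or.inr ?_) (by simp)
  rw [ord_mul h₁.ne_zero (inv_ne_zero ((map_ne_zero _).mpr h₁.ne_zero)), ord_inv, ord_conj]
  simp

theorem exists_small_ne_one (ε : Fˣ) (N : ℕ) : ∃ b : Eˣ, (N : ℤ) ≤ ord (b : E) ∧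
    (ε : F) * Algebra.norm F (b : E) ≠ 1 := by
  obtain ⟨b, hb⟩ := exists_ord_eq E (N + (ord (ε : F)).natAbs + 1)
  refine ⟨b, by omega, fun h => ?_⟩
  have h1 := ord_mul ε.ne_zero (norm_ne_zero (F := F) b.ne_zero)
  have h2 := ramIdx_mul_ord_norm (F := F) b.ne_zero
  rw [h, ord_one] at h1
  rcases ramIdx_eq F E with he | he <;> rw [he] at h2 <;> omega

/-- A locally constant function on `G_ε` that vanishes outside the torus is zero. -/
theorem IsLocallyConstant.eq_zero_of_compl_torusSet {f : quat F E ε → ℂ} (hf : IsLocallyConstant f)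
    (h : ∀ g, g ∉ torusSet ε → f g = 0) (g : quat F E ε) : f g = 0 := by
  by_cases hg : g ∈ torusSet ε
  swap
  · exact h g hg
  have h1 : Filter.Tendsto (fun u => u * g) (nhds 1) (nhds g) := by
    have : Continuous fun u => u * g := by fun_prop
    simpa using this.tendsto 1
  obtain ⟨N, hN⟩ := exists_mem_nhds_one_quat
    (h1.eventually ((IsLocallyConstant.iff_eventually_eq f).mp hf g))
  -- The complement of the torus is dense: a torus element multiplied by an element 1 + bj close to
  -- 1, with b ≠ 0, leaves the torus.
  obtain ⟨b, hb, hb'⟩ := exists_small_ne_one (E := E) ε N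
  have h2 := hN (orbPt ε b hb' 1 1) (by simp) (by
    simpa using conj_mem_ball.mpr (show (b : E) ∈ ball E N from Or.inr hb))
  rw [Set.mem_ofPred_eq] at h2
  rw [← h2]
  refine h _ ?_
  obtain ⟨t, rfl⟩ := hg
  rw [mem_torusSet, quat_mul_one_zero]
  simp

end QuatTopology

section ToricIntegrals

variable {F E : Type*} [Field F] [ValuativeRel F] [TopologicalSpace F]
  [IsNonarchimedeanLocalField F] [MeasurableSpace F] [BorelSpace F]
  [Field E] [ValuativeRel E] [TopologicalSpace E]
  [IsNonarchimedeanLocalField E] [MeasurableSpace E] [BorelSpace E]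
  [Algebra F E] [ValuativeExtension F E]
  [Algebra.IsQuadraticExtension F E] [Algebra.IsSeparable F E] {ε : Fˣ}

/-! ### Toric orbital integrals -/

theorem orbit_eq_orbPt {b : Eˣ} (hb : (ε : F) * Algebra.norm F (b : E) ≠ 1) (h₁ h₂ : Eˣ) :
    (torus ε h₁)⁻¹ * delta ε b hb * torus ε h₂ = orbPt ε b hb h₁ (h₁⁻¹ * h₂) := by
  rw [orbPt, mul_inv_cancel_left]

/-- In terms of r = h₁⁻¹h₂ the two characters combine to Ω⁻¹(r), so only the point of the orbit
still depends on h₁. -/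
theorem orbIntegrand_eq (Ω : Eˣ →* ℂˣ) {b : Eˣ} (hb : (ε : F) * Algebra.norm F (b : E) ≠ 1)
    (f : quat F E ε → ℂ) (h₁ h₂ : Eˣ) : orbIntegrand Ω (delta ε b hb) f h₁ h₂ =
      f (orbPt ε b hb h₁ (h₁⁻¹ * h₂)) * ((Ω (h₁⁻¹ * h₂))⁻¹ : ℂˣ) := by
  rw [orbIntegrand, orbit_eq_orbPt, map_mul, mul_inv, map_inv, inv_inv, Units.val_mul, mul_assoc]

variable (F E) in
theorem isClopen_fundDom : IsClopen (fundDom F E) := by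
  have h : IsLocallyConstant fun t : Eˣ => ord ((normU F E t : Fˣ) : F) :=
    (isLocallyConstant_ord (K := F)).comp_continuous (continuous_normU F E)
  exact (isClopen_discrete ({0, 1} : Set ℤ)).preimage h.continuous

variable (F E) in
theorem isCompact_fundDom : IsCompact (fundDom F E) := by
  refine (isCompact_shells E 0 1).of_isClosed_subset (isClopen_fundDom F E).1 fun t ht => ?_
  have h1 := ramIdx_mul_ord_norm (F := F) t.ne_zero
  rw [fundDom, Set.mem_ofPred_eq] at ht
  rw [Set.mem_ofPred_eq]
  rcases ramIdx_eq F E with he | he <;> rw [he] at h1 <;> omega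

variable (μF : Measure Fˣ) [μF.IsHaarMeasure] (μE : Measure Eˣ) [μE.IsHaarMeasure]
  (Ω : Eˣ →* ℂˣ)

variable (F E) in
/-- The volume of `Eˣ / Fˣ`. -/
noncomputable def orbVol : ℂ := ((μF.real (shell F 0) : ℝ) : ℂ)⁻¹ * (μE.real (fundDom F E) : ℝ)

theorem orbVol_ne_zero : orbVol F E μF μE ≠ 0 := by
  refine mul_ne_zero (inv_ne_zero ?_) ?_
  · exact_mod_cast (measureReal_shell_zero_pos F μF).ne'
  · rw [Complex.ofReal_ne_zero]
    refine (ENNReal.toReal_pos ?_ (isCompact_fundDom F E).measure_lt_top.ne).ne'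
    exact ((isClopen_fundDom F E).2.measure_pos μE ⟨1, by simp [fundDom]⟩).ne'

theorem integral_orbIntegrand {b : Eˣ} (hb : (ε : F) * Algebra.norm F (b : E) ≠ 1)
    (f : quat F E ε → ℂ) (h₁ : Eˣ) : ∫ h₂, orbIntegrand Ω (delta ε b hb) f h₁ h₂ ∂μE =
      ∫ r, f (orbPt ε b hb h₁ r) * ((Ω r)⁻¹ : ℂˣ) ∂μE := by
  simp only [orbIntegrand_eq]
  exact integral_mul_left_eq_self (fun r => f (orbPt ε b hb h₁ r) * ((Ω r)⁻¹ : ℂˣ)) h₁⁻¹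

theorem quotInt_univ (φ : Eˣ → ℂ) : quotInt μF μE Set.univ φ =
    ((μF.real (shell F 0) : ℝ) : ℂ)⁻¹ * ∫ t in fundDom F E, φ t ∂μE := by
  simp [quotInt, shell]

theorem orbInt_eq_of_forall {b : Eˣ} (hb : (ε : F) * Algebra.norm F (b : E) ≠ 1)
    (f : quat F E ε → ℂ) {A : ℂ}
    (h : ∀ h₁, ∫ r, f (orbPt ε b hb h₁ r) * ((Ω r)⁻¹ : ℂˣ) ∂μE = A) :
    orbInt μF μE Ω (delta ε b hb) f = orbVol F E μF μE * A := by
  rw [orbInt, quotInt_univ]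
  simp only [integral_orbIntegrand, h]
  rw [orbVol, setIntegral_const, Complex.real_smul, mul_assoc]

theorem orbIntegrand_congr {b : Eˣ} (hb : (ε : F) * Algebra.norm F (b : E) ≠ 1)
    {f g : quat F E ε → ℂ} (h : ∀ h₁ r, f (orbPt ε b hb h₁ r) = g (orbPt ε b hb h₁ r)) :
    orbIntegrand Ω (delta ε b hb) f = orbIntegrand Ω (delta ε b hb) g := by
  ext h₁ h₂
  rw [orbIntegrand_eq, orbIntegrand_eq, h]

/-- The outer variable runs over a compact set. For the inner one, r is a coordinate of a point of
the support, which bounds v(r) below, and the reduced norm Nm(r)(1 - x) bounds it above because x ≠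
1. -/
theorem integrable_orbIntegrand (hΩ : Continuous Ω) {b : Eˣ}
    (hb : (ε : F) * Algebra.norm F (b : E) ≠ 1) {f : quat F E ε → ℂ} (hf : IsSmoothCompact f) :
    Integrable (Function.uncurry (orbIntegrand Ω (delta ε b hb) f))
      ((μE.restrict (fundDom F E)).prod μE) := by
  have ht := continuous_torus (F := F) (E := E) (ε := ε)
  have hc : Continuous (Function.uncurry (orbIntegrand Ω (delta ε b hb) f)) := by
    have h1 : Continuous fun p : Eˣ × Eˣ => f ((torus ε p.1)⁻¹ * delta ε b hb * torus ε p.2) :=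
      hf.1.continuous.comp ((((ht.comp continuous_fst).inv).mul continuous_const).mul
        (ht.comp continuous_snd))
    have h2 : Continuous fun p : Eˣ × Eˣ => (Ω p.1 : ℂ) :=
      Units.continuous_val.comp (hΩ.comp continuous_fst)
    have h3 : Continuous fun p : Eˣ × Eˣ => (((Ω p.2)⁻¹ : ℂˣ) : ℂ) :=
      Units.continuous_val.comp (hΩ.comp continuous_snd).inv
    exact (h1.mul h2).mul h3
  obtain ⟨M, hM, -⟩ := exists_subset_qBox hf.2.isCompact
  set B : ℤ := M + (ord (1 - (ε : F) * Algebra.norm F (b : E))).natAbs + 1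
  have hKc := (isCompact_fundDom F E).prod (isCompact_shells E (-M) (B + 1))
  have e1 : (μE.restrict (fundDom F E)).prod μE =
      (μE.prod μE).restrict (fundDom F E ×ˢ Set.univ) := by
    rw [← Measure.prod_restrict, Measure.restrict_univ]
  rw [e1]
  refine IntegrableOn.of_forall_sdiff_eq_zero (hc.continuousOn.integrableOn_compact hKc)
    ((isClopen_fundDom F E).1.measurableSet.prod MeasurableSet.univ) ?_
  rintro ⟨h₁, h₂⟩ ⟨⟨hh, -⟩, hn⟩
  change h₁ ∈ fundDom F E at hh
  have hh' : ord (h₁ : E) = 0 ∨ ord (h₁ : E) = 1 := by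
    have h1 := ramIdx_mul_ord_norm (F := F) h₁.ne_zero
    rw [fundDom, Set.mem_ofPred_eq] at hh
    rcases ramIdx_eq F E with he | he <;> rw [he] at h1 <;> omega
  simp only [Function.uncurry, orbIntegrand_eq]
  by_contra h0
  have h1 := hM (subset_tsupport f (left_ne_zero_of_mul h0))
  set r := h₁⁻¹ * h₂
  have hr : ord (h₂ : E) = ord (h₁ : E) + ord (r : E) := by rw [← unit_ord_mul]; simp [r]
  have h2 := h1.1
  have h3 := h1.2.2
  rw [orbPt_zero_zero, mem_ball_unit] at h2
  rw [qdet_orbPt, ord_mul (norm_ne_zero r.ne_zero) (sub_ne_zero.mpr (Ne.symm hb))] at h3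
  have h4 := ramIdx_mul_ord_norm (F := F) r.ne_zero
  refine hn ⟨hh, ?_⟩
  change -(M : ℤ) ≤ ord (h₂ : E) ∧ ord (h₂ : E) ≤ B + 1
  rcases ramIdx_eq F E with he | he <;> rw [he] at h4 <;> omega

theorem orbInt_eq_prod {b : Eˣ} (hb : (ε : F) * Algebra.norm F (b : E) ≠ 1) {f : quat F E ε → ℂ}
    (hf : Integrable (Function.uncurry (orbIntegrand Ω (delta ε b hb) f))
      ((μE.restrict (fundDom F E)).prod μE)) :
    orbInt μF μE Ω (delta ε b hb) f = ((μF.real (shell F 0) : ℝ) : ℂ)⁻¹ *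
      ∫ p, Function.uncurry (orbIntegrand Ω (delta ε b hb) f) p
        ∂((μE.restrict (fundDom F E)).prod μE) := by
  rw [orbInt, quotInt_univ, integral_prod _ hf]
  rfl

theorem orbIntegrand_linear {b : Eˣ} (hb : (ε : F) * Algebra.norm F (b : E) ≠ 1)
    (f g : quat F E ε → ℂ) (c d : ℂ) :
    Function.uncurry (orbIntegrand Ω (delta ε b hb) fun x => c * f x + d * g x) =
      fun p => c * Function.uncurry (orbIntegrand Ω (delta ε b hb) f) p +
        d * Function.uncurry (orbIntegrand Ω (delta ε b hb) g) p := by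
  ext ⟨h₁, h₂⟩
  simp only [Function.uncurry, orbIntegrand]
  ring

theorem orbInt_linear {b : Eˣ} (hb : (ε : F) * Algebra.norm F (b : E) ≠ 1) {f g : quat F E ε → ℂ}
    (hf : Integrable (Function.uncurry (orbIntegrand Ω (delta ε b hb) f))
      ((μE.restrict (fundDom F E)).prod μE))
    (hg : Integrable (Function.uncurry (orbIntegrand Ω (delta ε b hb) g))
      ((μE.restrict (fundDom F E)).prod μE)) (c d : ℂ) :
    orbInt μF μE Ω (delta ε b hb) (fun x => c * f x + d * g x) =
      c * orbInt μF μE Ω (delta ε b hb) f + d * orbInt μF μE Ω (delta ε b hb) g := by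
  have hfg := (hf.const_mul c).add (hg.const_mul d)
  rw [orbInt_eq_prod μF μE Ω hb hf, orbInt_eq_prod μF μE Ω hb hg, orbInt_eq_prod,
    orbIntegrand_linear, integral_add (hf.const_mul c) (hg.const_mul d), integral_const_mul,
    integral_const_mul]
  · ring
  · rw [orbIntegrand_linear]; exact hfg

theorem IsSmoothCompact.linear {X : Type*} [TopologicalSpace X] {f g : X → ℂ}
    (hf : IsSmoothCompact f) (hg : IsSmoothCompact g) (c d : ℂ) :
    IsSmoothCompact fun x => c * f x + d * g x :=
  ⟨((IsLocallyConstant.const c).mul hf.1).add ((IsLocallyConstant.const d).mul hg.1),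
    (hf.2.mul_left (f := fun _ => c)).add (hg.2.mul_left (f := fun _ => d))⟩

/-! ### Functions with prescribed orbital integrals -/

theorem isLocallyConstant_indicator_of {X : Type*} [TopologicalSpace X] {S : Set X}
    (hS : IsClopen S) {f : X → ℂ} (hf : ∀ x ∈ S, ∀ᶠ y in nhds x, f y = f x) :
    IsLocallyConstant (S.indicator f) := by
  rw [IsLocallyConstant.iff_eventually_eq]
  intro x
  by_cases hx : x ∈ S
  · filter_upwards [hf x hx, hS.2.mem_nhds hx] with y h1 h2
    rw [Set.indicator_of_mem h2, Set.indicator_of_mem hx, h1]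
  · filter_upwards [hS.compl.2.mem_nhds hx] with y h2
    rw [Set.indicator_of_notMem h2, Set.indicator_of_notMem hx]

theorem isClopen_preimage_ball {X K : Type*} [TopologicalSpace X] [Field K] [ValuativeRel K]
    [TopologicalSpace K] [IsNonarchimedeanLocalField K] {f : X → K} (hf : Continuous f) (n : ℤ) :
    IsClopen {x | f x ∈ ball K n} :=
  IsClopen.preimage ⟨isClosed_ball K n, isOpen_ball K n⟩ hf

theorem integral_indicator_oneUnits {n : ℕ} (hΩn : ∀ u ∈ oneUnits E n, Ω u = 1) (A : ℂ) :
    ∫ r, (oneUnits E n : Set Eˣ).indicator (fun _ => A) r * ((Ω r)⁻¹ : ℂˣ) ∂μE =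
      (μE.real (oneUnits E n : Set Eˣ) : ℂ) * A := by
  have e : (fun r => (oneUnits E n : Set Eˣ).indicator (fun _ => A) r * (((Ω r)⁻¹ : ℂˣ) : ℂ)) =
      (oneUnits E n : Set Eˣ).indicator fun _ => A := by
    ext r
    by_cases hr : r ∈ (oneUnits E n : Set Eˣ)
    · rw [Set.indicator_of_mem hr, hΩn r hr]; simp
    · rw [Set.indicator_of_notMem hr, zero_mul]
  rw [e, integral_indicator (isClosed_oneUnits E n).measurableSet, setIntegral_const,
    Complex.real_smul]

/-- The functions on `G_ε` that are invariant under the central elements congruent to `1`. -/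
def CentralInv (n : ℕ) (f : quat F E ε → ℂ) : Prop :=
  ∀ z : Fˣ, incl F E z ∈ oneUnits E n → ∀ g, f (central ε z * g) = f g

theorem mul_sub_one_mem_ball {K : Type*} [Field K] [ValuativeRel K] [TopologicalSpace K]
    [IsNonarchimedeanLocalField K] {n : ℕ} {u : Kˣ} (hu : u ∈ oneUnits K n) {x : K} :
    u * x - 1 ∈ ball K n ↔ x - 1 ∈ ball K n := by
  have e : (u : K) * x - 1 = u * (x - 1) + (u - 1) := by ring
  rw [e, (ball K n).add_mem_cancel_right hu.1, mul_mem_ball_iff u.ne_zero, hu.2, sub_zero]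

/-- Take f(g) = P of the conjugate of the ratio of the first-column entries, cut off to upper left
entry in 1 + 𝔭_Eⁿ. On the orbit of δ(x) that ratio is b up to an element of norm 1, which P ignores,
and the cutoff turns the integral over r into the volume of the congruence subgroup. -/
theorem exists_bump {n : ℕ} (hn : 1 ≤ n) (hΩn : ∀ u ∈ oneUnits E n, Ω u = 1) {P : E → ℂ}
    (hP : IsLocallyConstant P) {R : ℕ}
    (hPs : ∀ y, P y ≠ 0 → y ∈ ball E (-R) ∧ ord (1 - (ε : F) * Algebra.norm F y) ≤ R)
    (hPθ : ∀ b θ : Eˣ, normU F E θ = 1 → P (b * θ : Eˣ) = P b) :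
    ∃ f : quat F E ε → ℂ, IsSmoothCompact f ∧ CentralInv n f ∧
      ∀ (b : Eˣ) (hb : (ε : F) * Algebra.norm F (b : E) ≠ 1),
        orbInt μF μE Ω (delta ε b hb) f =
          orbVol F E μF μE * ((μE.real (oneUnits E n : Set Eˣ) : ℂ) * P b) := by
  set S : Set (quat F E ε) := {g | g.val.val 0 0 - 1 ∈ ball E n}
  have hS : IsClopen S := isClopen_preimage_ball ((continuous_quat_apply 0 0).sub continuous_const) n
  have hS1 {x : E} (hx : x - 1 ∈ ball E n) : x - 1 ∈ ball E 1 := ball_mono hx (by exact_mod_cast hn)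
  have hS0 {x : E} (hx : x - 1 ∈ ball E n) : x ≠ 0 := by
    simpa using one_add_ne_zero (hS1 hx)
  have hSo {x : E} (hx : x - 1 ∈ ball E n) : ord x = 0 := by
    simpa using ord_one_add (hS1 hx)
  have hc := continuous_conj F E
  set f : quat F E ε → ℂ :=
    S.indicator fun g => P (conj F E (g.val.val 1 0 / g.val.val 0 0))
  have hloc : IsLocallyConstant f := by
    refine isLocallyConstant_indicator_of hS fun g hg => ?_
    have h1 : ContinuousAt (fun g : quat F E ε => conj F E (g.val.val 1 0 / g.val.val 0 0)) g :=
      hc.continuousAt.comp ((continuous_quat_apply 1 0).continuousAt.div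
        (continuous_quat_apply 0 0).continuousAt (hS0 hg))
    exact h1.eventually ((IsLocallyConstant.iff_eventually_eq P).mp hP _)
  refine ⟨f, ⟨hloc, ?_⟩, ?_, fun b hb => ?_⟩
  · refine HasCompactSupport.of_support_subset_isCompact (isCompact_qBox R R) fun g hg => ?_
    have hgS : g ∈ S := Set.mem_of_indicator_ne_zero hg
    simp only [f, Function.mem_support, Set.indicator_of_mem hgS] at hg
    obtain ⟨h1, h2⟩ := hPs _ hg
    rw [conj_mem_ball] at h1
    have h00 := hS0 hgS
    have h00' := hSo hgS
    refine ⟨Or.inr (by omega), ?_, ?_⟩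
    · have h3 := mul_mem_ball' h1 (self_mem_ball (g.val.val 0 0)) (k := -R) (by omega)
      rwa [div_mul_cancel₀ _ h00] at h3
    · have h3 : qdet g = Algebra.norm F (g.val.val 0 0) *
          (1 - ε * Algebra.norm F (conj F E (g.val.val 1 0 / g.val.val 0 0))) := by
        have h4 : Algebra.norm F (g.val.val 1 0 / g.val.val 0 0) * Algebra.norm F (g.val.val 0 0) =
            Algebra.norm F (g.val.val 1 0) := by rw [← map_mul, div_mul_cancel₀ _ h00]
        rw [norm_conj, qdet, ← h4]
        ring
      have h5 : (1 - (ε : F) * Algebra.norm F (conj F E (g.val.val 1 0 / g.val.val 0 0))) ≠ 0 := by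
        intro h0; rw [h0, mul_zero] at h3; exact qdet_ne_zero g h3
      have h6 := ramIdx_mul_ord_norm (F := F) h00
      rw [h3, ord_mul (norm_ne_zero h00) h5]
      rw [h00'] at h6
      rcases ramIdx_eq F E with he | he <;> rw [he] at h6 <;> omega
  · intro z hz g
    obtain ⟨e0, e1⟩ := central_mul_apply z g
    have hm : central ε z * g ∈ S ↔ g ∈ S := by
      change (central ε z * g).val.val 0 0 - 1 ∈ ball E n ↔ _
      rw [e0]
      exact mul_sub_one_mem_ball hz
    by_cases hg : g ∈ S
    · simp only [f]
      rw [Set.indicator_of_mem hg, Set.indicator_of_mem (hm.mpr hg), e0, e1,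
        mul_div_mul_left _ _ ((map_ne_zero _).mpr z.ne_zero)]
    · simp only [f]
      rw [Set.indicator_of_notMem hg, Set.indicator_of_notMem (hm.not.mpr hg)]
  · refine orbInt_eq_of_forall μF μE Ω hb f fun h₁ => ?_
    rw [← integral_indicator_oneUnits μE Ω hΩn]
    congr 1
    ext r
    congr 1
    have hm : orbPt ε b hb h₁ r ∈ S ↔ r ∈ (oneUnits E n : Set Eˣ) := by
      change (orbPt ε b hb h₁ r).val.val 0 0 - 1 ∈ ball E n ↔ _
      rw [orbPt_zero_zero]
      exact (mem_oneUnits_of_one_le hn).symm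
    by_cases hr : r ∈ (oneUnits E n : Set Eˣ)
    · simp only [f]
      rw [Set.indicator_of_mem hr, Set.indicator_of_mem (hm.mpr hr), orbPt_one_zero,
        orbPt_zero_zero, mul_div_cancel_right₀ _ r.ne_zero, ← hPθ b (conjU F E h₁ * h₁⁻¹)
          (by rw [map_mul, normU_conjU, ← map_mul, mul_inv_cancel, map_one])]
      simp [conj_conj]
    · simp only [f]
      rw [Set.indicator_of_notMem hr, Set.indicator_of_notMem (hm.not.mpr hr)]

/-- The support is near the nontrivial coset of the torus: lower left entry in 1 + 𝔭_Eⁿ and upper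
left entry small. The orbit of δ(x) meets it only for large b, when r is close to the inverse of
b̄h₁/h̄₁. This brings in Ω(b) up to Ω of an element of norm 1, hence the condition on C. -/
theorem exists_bump_infty {n : ℕ} (hn : 1 ≤ n) (hΩn : ∀ u ∈ oneUnits E n, Ω u = 1) {C : ℂ}
    (hC : C = 0 ∨ ∀ θ : Eˣ, normU F E θ = 1 → Ω θ = 1) {R : ℕ} (hR : ord (ε : F) < R) :
    ∃ f : quat F E ε → ℂ, IsSmoothCompact f ∧ CentralInv n f ∧
      ∀ (b : Eˣ) (hb : (ε : F) * Algebra.norm F (b : E) ≠ 1),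
        orbInt μF μE Ω (delta ε b hb) f = orbVol F E μF μE *
          ((μE.real (oneUnits E n : Set Eˣ) : ℂ) * if ord (b : E) ≤ -R then C * Ω b else 0) := by
  set S : Set (quat F E ε) := {g | g.val.val 1 0 - 1 ∈ ball E n} ∩ {g | g.val.val 0 0 ∈ ball E R}
  have hS : IsClopen S :=
    (isClopen_preimage_ball ((continuous_quat_apply 1 0).sub continuous_const) n).inter
      (isClopen_preimage_ball (continuous_quat_apply 0 0) R)
  have hSc : IsCompact S := by
    refine (isCompact_qBox 0 (ord (ε : F)).natAbs).of_isClosed_subset hS.1 fun g hg => ?_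
    have h1 : g.val.val 1 0 - 1 ∈ ball E 1 := ball_mono hg.1 (by exact_mod_cast hn)
    have h2 : ord (g.val.val 1 0) = 0 := by simpa using ord_one_add h1
    have h3 : g.val.val 1 0 ≠ 0 := by simpa using one_add_ne_zero h1
    refine ⟨ball_mono hg.2 (by omega), Or.inr (by omega), ?_⟩
    have h4 := ramIdx_mul_ord_norm (F := F) h3
    have h5 : ord ((ε : F) * Algebra.norm F (g.val.val 1 0)) = ord (ε : F) := by
      rw [ord_mul ε.ne_zero (norm_ne_zero h3)]
      rw [h2] at h4
      rcases ramIdx_eq F E with he | he <;> rw [he] at h4 <;> omega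
    have h6 : Algebra.norm F (g.val.val 0 0) ∈ ball F R := by
      by_cases h0 : g.val.val 0 0 = 0
      · simp [h0, (ball F _).zero_mem]
      · have h7 := ramIdx_mul_ord_norm (F := F) h0
        have h8 := hg.2
        rw [Set.mem_ofPred_eq, mem_ball_of_ne h0] at h8
        rw [mem_ball_of_ne (norm_ne_zero h0)]
        rcases ramIdx_eq F E with he | he <;> rw [he] at h7 <;> omega
    have h7 : ord (qdet g) = ord (ε : F) := by
      have h8 : qdet g = -(ε * Algebra.norm F (g.val.val 1 0)) + Algebra.norm F (g.val.val 0 0) := by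
        rw [qdet]; ring
      rw [h8, ord_add_eq (neg_ne_zero.mpr (mul_ne_zero ε.ne_zero (norm_ne_zero h3)))
        (ball_mono h6 (by rw [ord_neg, h5]; omega)), ord_neg, h5]
    omega
  refine ⟨S.indicator fun _ => C, isSmoothCompact_indicator hS hSc (IsLocallyConstant.const C), ?_,
    fun b hb => ?_⟩
  · intro z hz g
    obtain ⟨e0, e1⟩ := central_mul_apply z g
    have hm : central ε z * g ∈ S ↔ g ∈ S := by
      change (_ ∧ _) ↔ (_ ∧ _)
      rw [Set.mem_ofPred_eq, Set.mem_ofPred_eq, e0, e1]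
      refine and_congr (mul_sub_one_mem_ball hz) ?_
      rw [← incl_val, mul_mem_ball_iff (Units.ne_zero _), hz.2, sub_zero]
      rfl
    by_cases hg : g ∈ S
    · rw [Set.indicator_of_mem hg, Set.indicator_of_mem (hm.mpr hg)]
    · rw [Set.indicator_of_notMem hg, Set.indicator_of_notMem (hm.not.mpr hg)]
  · refine orbInt_eq_of_forall μF μE Ω hb _ fun h₁ => ?_
    obtain ⟨c, hc⟩ : ∃ c : Eˣ, c = conjU F E b * (h₁ * (conjU F E h₁)⁻¹) := ⟨_, rfl⟩
    have hcE : (c : E) = conj F E b * (h₁ * (conj F E h₁)⁻¹) := by simp [hc]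
    have hco : ord (c : E) = ord (b : E) := by
      rw [hc, unit_ord_mul, unit_ord_mul, unit_ord_inv]
      simp
    have hcΩ : C * Ω c = C * Ω b := by
      rcases hC with h | h
      · simp [h]
      · have h1 := h (c * b⁻¹) (by simp [hc])
        have h2 : c = c * b⁻¹ * b := by simp
        rw [h2, map_mul, h1, one_mul]
    rw [← integral_indicator_oneUnits μE Ω hΩn, ← integral_mul_left_eq_self _ c⁻¹]
    congr 1
    ext r
    have hm : orbPt ε b hb h₁ (c⁻¹ * r) ∈ S ↔ r ∈ (oneUnits E n : Set Eˣ) ∧ ord (b : E) ≤ -R := by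
      change (_ ∧ _) ↔ _
      rw [Set.mem_ofPred_eq, Set.mem_ofPred_eq, orbPt_one_zero, orbPt_zero_zero, ← hcE,
        Units.val_mul, ← mul_assoc, Units.mul_inv, one_mul, ← Units.val_mul, mem_ball_unit,
        unit_ord_mul, unit_ord_inv, hco]
      constructor
      · rintro ⟨h1, h2⟩
        have h3 := (mem_oneUnits_of_one_le hn).mpr h1
        exact ⟨h3, by rw [h3.2] at h2; omega⟩
      · rintro ⟨h1, h2⟩
        exact ⟨h1.1, by rw [h1.2]; omega⟩
    by_cases hr : r ∈ (oneUnits E n : Set Eˣ)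
    · rw [Set.indicator_of_mem hr]
      split_ifs with hbR
      · rw [Set.indicator_of_mem (hm.mpr ⟨hr, hbR⟩), ← hcΩ, map_mul, mul_inv, map_inv, inv_inv,
          Units.val_mul, mul_assoc]
      · rw [Set.indicator_of_notMem (fun h => hbR (hm.mp h).2), zero_mul, zero_mul]
    · rw [Set.indicator_of_notMem hr, Set.indicator_of_notMem (fun h => hr (hm.mp h).1), zero_mul,
        zero_mul]

end ToricIntegrals

/-- Invariance under a congruence subgroup gives local constancy away from 0, and constancy on a
punctured ball gives it at 0. -/
theorem isLocallyConstant_extend {K : Type*} [Field K] [ValuativeRel K] [TopologicalSpace K]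
    [IsNonarchimedeanLocalField K] {p : Kˣ → ℂ} {l : ℕ}
    (hp : ∀ x, ∀ u ∈ oneUnits K l, p (x * u) = p x) {c : ℂ} {N : ℤ}
    (hN : ∀ x : Kˣ, N ≤ ord (x : K) → p x = c) {P : K → ℂ} (h0 : P 0 = c)
    (hP : ∀ x : Kˣ, P x = p x) : IsLocallyConstant P := by
  rw [IsLocallyConstant.iff_eventually_eq]
  intro y
  by_cases hy : y = 0
  · filter_upwards [eventually_sub_mem_ball y N] with z hz
    rw [hy, sub_zero] at hz
    rw [hy, h0]
    by_cases hz0 : z = 0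
    · rw [hz0, h0]
    · have := hP (Units.mk0 z hz0)
      rw [Units.val_mk0] at this
      rw [this]
      exact hN _ ((mem_ball_of_ne hz0).mp hz)
  · filter_upwards [eventually_sub_mem_ball y (ord y + ((l + 1 : ℕ) : ℤ))] with z hz
    have h1 : z - y ∈ ball K (ord y + 1) := ball_mono hz (by push_cast; linarith)
    have hz0 : z ≠ 0 := by simpa using add_ne_zero_of_mem hy h1
    set x : Kˣ := Units.mk0 y hy
    set x' : Kˣ := Units.mk0 z hz0
    have hu : x⁻¹ * x' ∈ oneUnits K (l + 1) := by
      rw [mem_oneUnits_of_one_le (by omega)]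
      have e : ((x⁻¹ * x' : Kˣ) : K) - 1 = y⁻¹ * (z - y) := by
        simp [x, x']; field_simp
      rw [e, mul_mem_ball_iff (inv_ne_zero hy), ord_inv]
      exact ball_mono hz (by linarith)
    have h2 := hp x _ (oneUnits_anti (Nat.le_succ l) hu)
    rw [mul_inv_cancel_left, ← hP, ← hP] at h2
    exact h2

/-- Applied to inv' = x/(1 - x): cutoffs v(inv') ≥ N and v(x) ≥ N agree for N ≥ 1, with equal
valuations there. -/
theorem ord_div_one_sub {K : Type*} [Field K] [ValuativeRel K] [TopologicalSpace K]
    [IsNonarchimedeanLocalField K] {x : K} (hx : x ≠ 0) (hx1 : x ≠ 1) :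
    (1 ≤ ord x → ord (x / (1 - x)) = ord x) ∧ (ord x ≤ 0 → ord (x / (1 - x)) ≤ 0) := by
  have h1 : 1 - x ≠ 0 := sub_ne_zero.mpr hx1.symm
  rw [ord_div hx h1]
  constructor
  · intro h
    have := ord_one_add (t := -x) ((ball K 1).neg_mem (Or.inr h))
    rw [← sub_eq_add_neg] at this
    omega
  · intro h
    have : 1 - x ∈ ball K (ord x) :=
      (ball K _).sub_mem (ball_mono one_mem_ball h) (self_mem_ball x)
    rw [mem_ball_of_ne h1] at this
    omega

section Core

variable {F E : Type*} [Field F] [ValuativeRel F] [TopologicalSpace F]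
  [IsNonarchimedeanLocalField F] [MeasurableSpace F] [BorelSpace F]
  [Field E] [ValuativeRel E] [TopologicalSpace E]
  [IsNonarchimedeanLocalField E] [MeasurableSpace E] [BorelSpace E]
  [Algebra F E] [ValuativeExtension F E]
  [Algebra.IsQuadraticExtension F E] [Algebra.IsSeparable F E] {ε ε' : Fˣ}

variable (μF : Measure Fˣ) [μF.IsHaarMeasure] (μE : Measure Eˣ) [μE.IsHaarMeasure]
  (Ω : Eˣ →* ℂˣ)

/-! ### The logarithmic part of a multiplicity function -/

theorem continuous_invPrime : Continuous (invPrime : quat F E ε → F) :=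
  (continuous_const.mul ((continuous_norm_local F E).comp (continuous_quat_apply 1 0))).div
    continuous_qdet qdet_ne_zero

/-- A function with a logarithmic singularity along the torus: its orbital integral is that of a
smooth function, up to a logarithmic term near `0`. -/
theorem exists_orbInt_log (hΩ : Continuous Ω) {n : ℕ} (hΩn : ∀ u ∈ oneUnits E n, Ω u = 1)
    {S : Set (quat F E ε)} (hS : IsClopen S) (hSc : IsCompact S)
    (hST : ∀ t, torus ε t ∈ S ↔ t ∈ oneUnits E n) {φ m : quat F E ε → ℂ} (hφ : IsSmoothCompact φ)
    (hm : ∀ g, g ∉ torusSet ε → m g = (ord (invPrime g) : ℂ) / 2 * S.indicator 1 g + φ g) :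
    ∃ N₀ : ℕ, ∀ N : ℕ, N₀ ≤ N → ∃ ψ : quat F E ε → ℂ, IsSmoothCompact ψ ∧
      (CentralInv n φ → CentralInv n (S.indicator 1) → CentralInv n ψ) ∧
      ∀ (b : Eˣ) (hb : (ε : F) * Algebra.norm F (b : E) ≠ 1),
        Integrable (Function.uncurry (orbIntegrand Ω (delta ε b hb) m))
          ((μE.restrict (fundDom F E)).prod μE) ∧
        orbInt μF μE Ω (delta ε b hb) m = orbInt μF μE Ω (delta ε b hb) ψ +
          if (N : ℤ) ≤ ord ((ε * normU F E b : Fˣ) : F) then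
            (ord ((ε * normU F E b : Fˣ) : F) : ℂ) / 2 *
              (orbVol F E μF μE * (μE.real (oneUnits E n : Set Eˣ) : ℂ)) else 0 := by
  have h1S : IsSmoothCompact (S.indicator (1 : quat F E ε → ℂ)) :=
    isSmoothCompact_indicator hS hSc (IsLocallyConstant.const 1)
  obtain ⟨N₁, hN₁⟩ := h1S.exists_orbPt_eq
  refine ⟨2 * N₁ + (ord (ε : F)).natAbs + 1, fun N hN => ?_⟩
  -- Removing the elements with v(inv') ≥ N leaves a compact open set away from the torus, on which
  -- v(inv') is locally constant. That part of the logarithm is smooth and goes into ψ.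
  set S' : Set (quat F E ε) := S ∩ {g | invPrime g ∈ ball F N}ᶜ with hS'def
  have hS' : IsClopen S' := hS.inter (isClopen_preimage_ball continuous_invPrime N).compl
  have hS'c : IsCompact S' := hSc.of_isClosed_subset hS'.1 Set.inter_subset_left
  set lo : quat F E ε → ℂ := fun g => (ord (invPrime g) : ℂ) / 2
  have hlo : IsSmoothCompact (S'.indicator lo) := by
    refine ⟨isLocallyConstant_indicator_of hS' fun g hg => ?_, ?_⟩
    · filter_upwards [continuous_invPrime.continuousAt.eventually
        (eventually_ord_eq (ne_zero_of_ord_lt hg.2))] with g' h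
      simp only [lo, h]
    · exact hS'c.of_isClosed_subset (isClosed_tsupport _)
        (closure_minimal Set.support_indicator_subset hS'.1)
  set ψ : quat F E ε → ℂ := fun g => 1 * φ g + 1 * S'.indicator lo g
  have hψ : IsSmoothCompact ψ := hφ.linear hlo 1 1
  refine ⟨ψ, hψ, fun hφi hSi z hz g => ?_, fun b hb => ?_⟩
  · have hz1 := hSi z hz g
    have hiS : central ε z * g ∈ S ↔ g ∈ S := by
      by_cases h1 : central ε z * g ∈ S <;> by_cases h2 : g ∈ S <;>
        simp [h1, h2] at hz1 ⊢
    have hinv : invPrime (central ε z * g) = invPrime g := by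
      obtain ⟨e0, e1⟩ := central_mul_apply z g
      have hz0 : (z : F) ^ 2 ≠ 0 := pow_ne_zero _ z.ne_zero
      unfold invPrime
      rw [e0, e1, map_mul, map_mul, norm_algebraMap_eq, mul_left_comm (ε : F), ← mul_sub,
        mul_div_mul_left _ _ hz0]
    have hiS' : central ε z * g ∈ S' ↔ g ∈ S' := by
      simp only [hS'def, Set.mem_inter_iff, hiS, Set.mem_compl_iff, Set.mem_ofPred_eq, hinv]
    simp only [ψ, hφi z hz g, one_mul]
    congr 1
    by_cases h2 : g ∈ S'
    · rw [Set.indicator_of_mem h2, Set.indicator_of_mem (hiS'.mpr h2)]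
      simp only [lo, hinv]
    · rw [Set.indicator_of_notMem h2, Set.indicator_of_notMem (hiS'.not.mpr h2)]
  · set x : Fˣ := ε * normU F E b
    have hxe : (ε : F) * Algebra.norm F (b : E) = x := rfl
    have hx1 : (x : F) ≠ 1 := hb
    have hinv (h₁ r : Eˣ) : invPrime (orbPt ε b hb h₁ r) = x / (1 - x) := by
      rw [invPrime_orbPt, hxe]
    have hdiv0 : (x : F) / (1 - x) ≠ 0 := div_ne_zero x.ne_zero (sub_ne_zero.mpr hx1.symm)
    obtain ⟨ho1, ho2⟩ := ord_div_one_sub x.ne_zero hx1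
    have i1 := integrable_orbIntegrand μE Ω hΩ hb hψ
    by_cases hNx : (N : ℤ) ≤ ord (x : F)
    -- For v(x) ≥ N the orbit avoids S', and the rest is v(x)/2 times the indicator of S. Its
    -- orbital integral near 0 only sees S ∩ T, that is, the congruence subgroup of level n.
    · have e (h₁ r : Eˣ) : m (orbPt ε b hb h₁ r) =
          (fun g => 1 * ψ g + ((ord (x : F) : ℂ) / 2) * S.indicator 1 g) (orbPt ε b hb h₁ r) := by
        have hb1 : orbPt ε b hb h₁ r ∉ S' := by
          rintro ⟨-, h⟩
          refine h ?_
          rw [Set.mem_ofPred_eq, hinv, mem_ball_of_ne hdiv0, ho1 (by omega)]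
          exact hNx
        rw [hm _ (orbPt_notMem_torusSet hb h₁ r), hinv, ho1 (by omega)]
        simp only [ψ, Set.indicator_of_notMem hb1]
        ring
      have i2 := integrable_orbIntegrand μE Ω hΩ hb h1S
      rw [if_pos hNx, orbInt, orbIntegrand_congr Ω hb (g := fun g => 1 * ψ g +
        ((ord (x : F) : ℂ) / 2) * S.indicator 1 g) e, ← orbInt]
      refine ⟨?_, ?_⟩
      · rw [orbIntegrand_linear]
        exact (i1.const_mul _).add (i2.const_mul _)
      · rw [orbInt_linear μF μE Ω hb i1 i2, one_mul]
        congr 2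
        refine orbInt_eq_of_forall μF μE Ω hb _ fun h₁ => ?_
        have hbo : (N₁ : ℤ) ≤ ord (b : E) := by
          have h1 : ord (x : F) = ord (ε : F) + ord ((normU F E b : Fˣ) : F) := unit_ord_mul _ _
          have h2 := ramIdx_mul_ord_normU (F := F) b
          rcases ramIdx_eq F E with he | he <;> rw [he] at h2 <;> omega
        rw [← mul_one (μE.real (oneUnits E n : Set Eˣ) : ℂ), ← integral_indicator_oneUnits μE Ω hΩn 1]
        congr 1
        ext r
        rw [hN₁ b hb hbo]
        congr 1
        by_cases hr : r ∈ (oneUnits E n : Set Eˣ)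
        · rw [Set.indicator_of_mem hr, Set.indicator_of_mem ((hST r).mpr hr)]; rfl
        · rw [Set.indicator_of_notMem hr, Set.indicator_of_notMem ((hST r).not.mpr hr)]
    · have e (h₁ r : Eˣ) : m (orbPt ε b hb h₁ r) = ψ (orbPt ε b hb h₁ r) := by
        have hb1 : orbPt ε b hb h₁ r ∈ S' ↔ orbPt ε b hb h₁ r ∈ S := by
          refine ⟨fun h => h.1, fun h => ⟨h, ?_⟩⟩
          rw [Set.mem_compl_iff, Set.mem_ofPred_eq, hinv, mem_ball_of_ne hdiv0]
          rcases le_or_gt (ord (x : F)) 0 with h | h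
          · have := ho2 h; omega
          · rw [ho1 h]; exact hNx
        rw [hm _ (orbPt_notMem_torusSet hb h₁ r)]
        simp only [ψ, lo]
        by_cases hs : orbPt ε b hb h₁ r ∈ S
        · rw [Set.indicator_of_mem hs, Set.indicator_of_mem (hb1.mpr hs), Pi.one_apply]; ring
        · rw [Set.indicator_of_notMem hs, Set.indicator_of_notMem (hb1.not.mpr hs)]; ring
      rw [if_neg hNx, orbInt, orbIntegrand_congr Ω hb e, ← orbInt, add_zero]
      exact ⟨i1, rfl⟩

/-! ### The derivative as an orbital integral -/

theorem measureReal_oneUnits_ne_zero (n : ℕ) : (μE.real (oneUnits E n : Set Eˣ) : ℂ) ≠ 0 := by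
  rw [Complex.ofReal_ne_zero]
  refine (ENNReal.toReal_pos ?_ (isCompact_oneUnits E n).measure_lt_top.ne).ne'
  exact ((isOpen_oneUnits E n).measure_pos μE ⟨1, (oneUnits E n).one_mem⟩).ne'

/-- Up to a logarithmic term near `0`, the weighted Hermitian orbital integral is the orbital
integral of a smooth function on `G_ε'`. -/
theorem exists_orbInt_hermInt (hΩ : Continuous Ω)
    (hη : ∫ z in shell F 0, eta F E z ∂μF = 0 ∨
      ∀ z : Fˣ, eta F E z = if Even (ord (z : F)) then 1 else -1)
    (hεε' : eta F E ε' = -eta F E ε) {n : ℕ} (hn : 1 ≤ n) (hΩn : ∀ u ∈ oneUnits E n, Ω u = 1)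
    {Φ : F → E → F → ℂ} {M : ℕ} (hΦ : IsTest Φ M) {κ : ℂ} {N₁ : ℕ}
    (hκ : ∀ b : Eˣ, ((ε * normU F E b : Fˣ) : F) ≠ 1 → (N₁ : ℤ) ≤ ord (b : E) →
      hermInt μF μE Ω Φ (fun _ _ => 1) (ε * normU F E b) = κ) {N : ℕ} (hN : 4 * M < N) :
    ∃ ψ : quat F E ε' → ℂ, IsSmoothCompact ψ ∧ CentralInv n ψ ∧
      ∀ (b : Eˣ) (hb : (ε' : F) * Algebra.norm F (b : E) ≠ 1),
        orbInt μF μE Ω (delta ε' b hb) ψ =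
          (if (N : ℤ) ≤ ord ((ε' * normU F E b : Fˣ) : F) then
            (ord ((ε' * normU F E b : Fˣ) : F) : ℂ) * κ else 0) -
          hermInt μF μE Ω Φ (stdWeight (ε' * normU F E b)) (ε' * normU F E b) := by
  set κ₀ : ℂ := orbVol F E μF μE * (μE.real (oneUnits E n : Set Eˣ) : ℂ)
  have hκ₀ : κ₀ ≠ 0 := mul_ne_zero (orbVol_ne_zero μF μE) (measureReal_oneUnits_ne_zero μE n)
  set W : Fˣ → ℂ := fun x => (if (N : ℤ) ≤ ord (x : F) then (ord (x : F) : ℂ) * κ else 0) -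
    hermInt μF μE Ω Φ (stdWeight x) x with hW
  set X : Eˣ → Fˣ := fun b => ε' * normU F E b with hX
  have hXo (b : Eˣ) : ord (X b : F) = ord (ε' : F) + ord ((normU F E b : Fˣ) : F) := unit_ord_mul _ _
  obtain ⟨C₀, hC₀⟩ := exists_hermInt_large μF μE Ω hΦ ε'
  -- Large enough for two purposes: v(b) ≤ -R reaches the range of `exists_hermInt_large`, and v(1 -
  -- x) > R reaches that of `hermInt_eq_zero_near_one`.
  set R : ℕ := 5 * M + (ord (ε' : F)).natAbs + 1
  have hRX (b : Eˣ) (h : ord (b : E) ≤ -(R : ℤ)) : ord (X b : F) ≤ -(4 * (M : ℤ)) - 1 := by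
    have h1 := hXo b
    have h2 := ramIdx_mul_ord_normU (F := F) b
    rcases ramIdx_eq F E with he | he <;> rw [he] at h2 <;> omega
  have hWR (b : Eˣ) (h : ord (b : E) ≤ -(R : ℤ)) : W (X b) = -C₀ * Ω b := by
    have h1 := hRX b h
    simp only [hW]
    rw [if_neg (by omega), hC₀ b (by simp only [hX] at h1; omega)]
    ring
  -- The function of b depends on Nm(b) only, whereas it equals -C₀Ω(b) for large b. So C₀ = 0 or Ω
  -- is trivial on elements of norm 1.
  have hC : -C₀ / κ₀ = 0 ∨ ∀ θ : Eˣ, normU F E θ = 1 → Ω θ = 1 := by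
    by_cases h0 : C₀ = 0
    · left; simp [h0]
    right
    intro θ hθ
    obtain ⟨b, hb⟩ := exists_ord_eq E (-(R : ℤ))
    have hθo : ord (θ : E) = 0 := (ord_normU_eq_zero_iff (F := F) θ).mp (by rw [hθ]; simp)
    have h1 := hWR b hb.le
    have h2 := hWR (b * θ) (by rw [unit_ord_mul, hθo]; omega)
    have h3 : X (b * θ) = X b := by simp only [hX, map_mul, hθ, mul_one]
    rw [h3, h1, map_mul, Units.val_mul] at h2
    ext
    have h4 : (-C₀ * Ω b : ℂ) ≠ 0 := mul_ne_zero (neg_ne_zero.mpr h0) (Units.ne_zero _)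
    apply mul_left_cancel₀ h4
    rw [Units.val_one, mul_one, mul_assoc, ← h2]
  have hWu (x u : Fˣ) (hu : u ∈ oneUnits F (2 * M)) : W (x * u) = W x := by
    simp only [hW]
    rw [hermInt_stdWeight_mul μF μE Ω hΦ hu, unit_ord_mul, hu.2, add_zero]
  obtain ⟨b', hb', hb'1⟩ := exists_small_ne_one (E := E) ε
    (N₁ + 4 * M + (ord (ε : F)).natAbs + 1)
  obtain ⟨b₁, hb₁, -⟩ := exists_small_ne_one (E := E) ε' (N + (ord (ε' : F)).natAbs)
  have hηX (b : Eˣ) : eta F E (X b) = -eta F E (ε * normU F E b') := by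
    simp only [hX]
    rw [eta_mul, eta_mul, eta_normU, eta_normU, mul_one, mul_one, hεε']
  have hoX {b : Eˣ} (h : (N + (ord (ε' : F)).natAbs : ℕ) ≤ ord (b : E)) :
      (N : ℤ) ≤ ord (X b : F) := by
    have h1 := hXo b
    have h2 := ramIdx_mul_ord_normU (F := F) b
    rcases ramIdx_eq F E with he | he <;> rw [he] at h2 <;> omega
  have hob' : 4 * (M : ℤ) < ord ((ε * normU F E b' : Fˣ) : F) := by
    have h1 := unit_ord_mul ε (normU F E b')
    have h2 := ramIdx_mul_ord_normU (F := F) b'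
    rcases ramIdx_eq F E with he | he <;> rw [he] at h2 <;> omega
  -- Near x = 0 the slope of the weighted integral is the unweighted integral on the class of ε,
  -- namely κ; the term κ v(x) cancels it and leaves a constant.
  have hW0 (b : Eˣ) (h : (N + (ord (ε' : F)).natAbs : ℕ) ≤ ord (b : E)) : W (X b) = W (X b₁) := by
    have h1 := hoX h
    have h2 := hoX hb₁
    have h3 := hermInt_stdWeight_sub μF μE Ω hΩ hΦ hη (x₁ := X b) (x₂ := X b₁)
      (x' := ε * normU F E b') (by omega) (by omega) hob' (hηX b) (hηX b₁)
    rw [hκ b' hb'1 (by omega)] at h3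
    simp only [hW]
    rw [if_pos h1, if_pos h2]
    linear_combination -h3
  -- Subtracting the part at infinity leaves a function of bounded support in b. It extends to b = 0
  -- and is realized by `exists_bump`, the subtracted part by `exists_bump_infty`.
  set p : Eˣ → ℂ := fun b => W (X b) / κ₀ - if ord (b : E) ≤ -R then -C₀ / κ₀ * Ω b else 0
    with hp
  classical
  set P : E → ℂ := fun y => if h : y = 0 then W (X b₁) / κ₀ else p (Units.mk0 y h)
  have hP0 : P 0 = W (X b₁) / κ₀ := dif_pos rfl
  have hPp (b : Eˣ) : P b = p b := by
    simp only [P]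
    rw [dif_neg b.ne_zero, Units.mk0_val]
  have hPl : IsLocallyConstant P := by
    refine isLocallyConstant_extend (l := 2 * (2 * M) + n) (N := N + (ord (ε' : F)).natAbs)
      (fun b u hu => ?_) (fun b hb => ?_) hP0 hPp
    · have h1 := hWu (X b) _ (normU_mem_oneUnits (F := F) (oneUnits_anti (by omega) hu))
      have h2 : X (b * u) = X b * normU F E u := by simp only [hX, map_mul, mul_assoc]
      have h3 : ord ((b * u : Eˣ) : E) = ord (b : E) := by rw [unit_ord_mul, hu.2, add_zero]
      simp only [hp]
      rw [h2, h1, h3, map_mul Ω, hΩn u (oneUnits_anti (by omega) hu), mul_one]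
    · simp only [hp]
      rw [hW0 b (by omega), if_neg (by omega), sub_zero]
  obtain ⟨f₁, hf₁, hi₁, ho₁⟩ := exists_bump μF μE Ω hn hΩn (ε := ε') hPl (R := R) (fun y hy => by
    by_cases hy0 : y = 0
    · rw [hy0]; simp [(ball E _).zero_mem]
    obtain ⟨b, rfl⟩ : ∃ b : Eˣ, (b : E) = y := ⟨Units.mk0 y hy0, rfl⟩
    rw [hPp] at hy
    have hXb : (ε' : F) * Algebra.norm F (b : E) = X b := rfl
    rw [hXb]
    by_contra hcon
    rw [not_and_or] at hcon
    apply hy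
    simp only [hp]
    rcases hcon with h | h
    · rw [mem_ball_unit] at h
      rw [hWR b (by omega), if_pos (by omega)]
      ring
    · rw [not_le] at h
      have h1 : (1 : F) - X b ≠ 0 := fun h0 => by rw [h0, ord_zero] at h; omega
      have h2 : (X b : F) ≠ 1 := fun h0 => h1 (by rw [h0, sub_self])
      have h3 : ord ((X b : F) - 1) = ord (1 - (X b : F)) := by rw [← ord_neg]; congr 1; ring
      have h4 : ord (X b : F) = 0 := by
        have := ord_one_add (t := -(1 - (X b : F))) ((ball F 1).neg_mem (Or.inr (by omega)))
        simpa using this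
      have h5 : W (X b) = 0 := by
        simp only [hW]
        rw [hermInt_eq_zero_near_one μF μE Ω hΦ h2 (by omega) h4, if_neg (by omega), sub_zero]
      rw [h5, if_neg (fun h6 => by have := hRX b h6; omega)]
      simp) (fun b θ hθ => by
    rw [hPp, hPp]
    have hθo : ord (θ : E) = 0 := (ord_normU_eq_zero_iff (F := F) θ).mp (by rw [hθ]; simp)
    have h3 : X (b * θ) = X b := by simp only [hX, map_mul, hθ, mul_one]
    simp only [hp]
    rw [h3, unit_ord_mul, hθo, add_zero, map_mul]
    rcases hC with h | h
    · rw [h]; simp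
    · rw [h θ hθ, mul_one])
  obtain ⟨f₂, hf₂, hi₂, ho₂⟩ := exists_bump_infty μF μE Ω hn hΩn (ε := ε') hC (R := R) (by omega)
  refine ⟨fun g => 1 * f₁ g + 1 * f₂ g, hf₁.linear hf₂ 1 1, fun z hz g => by
    simp only [hi₁ z hz g, hi₂ z hz g], fun b hb => ?_⟩
  rw [orbInt_linear μF μE Ω hb (integrable_orbIntegrand μE Ω hΩ hb hf₁)
    (integrable_orbIntegrand μE Ω hΩ hb hf₂), ho₁, ho₂, hPp]
  change _ = W (X b)
  have e : W (X b) = κ₀ * (W (X b) / κ₀) := (mul_div_cancel₀ _ hκ₀).symm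
  rw [e]
  simp only [hp, κ₀]
  ring

/-- The arithmetic fundamental identity for functions with a logarithmic singularity. -/
theorem exists_arith_matching (hΩ : Continuous Ω)
    (hη : ∫ z in shell F 0, eta F E z ∂μF = 0 ∨
      ∀ z : Fˣ, eta F E z = if Even (ord (z : F)) then 1 else -1)
    (hεε' : eta F E ε' = -eta F E ε) {n : ℕ} (hn : 1 ≤ n) (hΩn : ∀ u ∈ oneUnits E n, Ω u = 1)
    {Φ : Matrix (Fin 2) (Fin 2) E → ℂ} {M : ℕ} (hΦ : IsTest (hermCoord (F := F) Φ) M)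
    {lam : ℂ} (hlam : lam ≠ 0) {N₁ : ℕ}
    (hκ : ∀ b : Eˣ, (ε : F) * Algebra.norm F (b : E) ≠ 1 → (N₁ : ℤ) ≤ ord (b : E) →
      hermOrb μF μE Ω Φ ((ε : F) * Algebra.norm F (b : E)) 0 =
        lam * (orbVol F E μF μE * (μE.real (oneUnits E n : Set Eˣ) : ℂ)))
    (h0 : ∀ b : Eˣ, (ε' : F) * Algebra.norm F (b : E) ≠ 1 →
      hermOrb μF μE Ω Φ ((ε' : F) * Algebra.norm F (b : E)) 0 = 0)
    {S : Set (quat F E ε')} (hS : IsClopen S) (hSc : IsCompact S)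
    (hST : ∀ t, torus ε' t ∈ S ↔ t ∈ oneUnits E n) {φ m : quat F E ε' → ℂ} (hφ : IsSmoothCompact φ)
    (hm : ∀ g, g ∉ torusSet ε' → m g = (ord (invPrime g) : ℂ) / 2 * S.indicator 1 g + φ g) :
    ∃ fbar : quat F E ε' → ℂ, IsSmoothCompact fbar ∧
      (CentralInv n φ → CentralInv n (S.indicator 1) → CentralInv n fbar) ∧
      ∀ (b : Eˣ) (hb : (ε' : F) * Algebra.norm F (b : E) ≠ 1),
        Integrable (Function.uncurry (orbIntegrand Ω (delta ε' b hb) m))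
          ((μE.restrict (fundDom F E)).prod μE) ∧
        ∃ D : ℂ, HasDerivAt (hermOrb μF μE Ω Φ ((ε' : F) * Algebra.norm F (b : E))) D 0 ∧
          2 * (lam * orbInt μF μE Ω (delta ε' b hb) m) * (-Real.log (resCard F) : ℂ) =
            D + lam * orbInt μF μE Ω (delta ε' b hb) fbar := by
  obtain ⟨N₀, hN₀⟩ := exists_orbInt_log μF μE Ω hΩ hΩn hS hSc hST hφ hm
  -- The same cutoff is used on both sides, so that the logarithmic terms cancel exactly and not
  -- just near 0.
  obtain ⟨ψ₁, hψ₁, hi₁, ho₁⟩ := hN₀ (N₀ + 4 * M + 1) (by omega)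
  obtain ⟨ψ₂, hψ₂, hi₂, ho₂⟩ := exists_orbInt_hermInt μF μE Ω hΩ hη hεε' hn hΩn hΦ
    (κ := lam * (orbVol F E μF μE * (μE.real (oneUnits E n : Set Eˣ) : ℂ))) (N₁ := N₁)
    (fun b hb1 hb2 => (hermOrb_zero μF μE Ω hΩ hΦ hb1).symm.trans (hκ b hb1 hb2))
    (N := N₀ + 4 * M + 1) (by omega)
  set L : ℂ := (-Real.log (resCard F) : ℂ)
  -- The derivative is L times the weighted integral; dividing its smooth correction by lam matches
  -- the factor in front of the orbital integrals. That factor is 1 in part (1) and an inverse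
  -- volume in part (2).
  refine ⟨fun g => 2 * L * ψ₁ g + L / lam * ψ₂ g, hψ₁.linear hψ₂ _ _, fun h1 h2 z hz g => by
    simp only [hi₁ h1 h2 z hz g, hi₂ z hz g], fun b hb => ⟨(ho₁ b hb).1, _,
      hermOrb_hasDerivAt μF μE Ω hΩ hΦ (x := ε' * normU F E b) hb (h0 b hb), ?_⟩⟩
  rw [orbInt_linear μF μE Ω hb (integrable_orbIntegrand μE Ω hΩ hb hψ₁)
    (integrable_orbIntegrand μE Ω hΩ hb hψ₂), (ho₁ b hb).2, ho₂]
  change _ = L * _ + _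
  split_ifs
  · field_simp
    ring
  · field_simp
    ring

end Core

section Principal

variable {F E : Type*} [Field F] [ValuativeRel F] [TopologicalSpace F]
  [IsNonarchimedeanLocalField F] [Field E] [ValuativeRel E] [TopologicalSpace E]
  [IsNonarchimedeanLocalField E] [Algebra F E] [ValuativeExtension F E]
  [Algebra.IsQuadraticExtension F E] [Algebra.IsSeparable F E] {ε : Fˣ}

/-! ### Principal congruence subgroups -/

theorem ord_qdet_eq_zero (hε : 0 ≤ ord (ε : F)) {n : ℕ} (hn : 1 ≤ n) {g : quat F E ε}
    (h0 : g.val.val 0 0 - 1 ∈ ball E n) (h1 : g.val.val 1 0 ∈ ball E n) : ord g.val.val.det = 0 := by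
  have h2 : g.val.val 0 0 - 1 ∈ ball E 1 := ball_mono h0 (by exact_mod_cast hn)
  have h3 : ord (g.val.val 0 0) = 0 := by simpa using ord_one_add h2
  have h4 : g.val.val 0 0 ≠ 0 := by simpa using one_add_ne_zero h2
  have h5 : algebraMap F E ε ∈ ball E 0 := (algebraMap_mem_ball_zero _).mpr (Or.inr hε)
  rw [Matrix.det_fin_two, quat_apply_one_one, quat_apply_zero_one, sub_eq_add_neg, ord_add_eq,
    ord_mul h4 ((map_ne_zero _).mpr h4), ord_conj, h3, add_zero]
  · exact mul_ne_zero h4 ((map_ne_zero _).mpr h4)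
  · rw [ord_mul h4 ((map_ne_zero _).mpr h4), ord_conj, h3]
    refine (ball E _).neg_mem (mul_mem_ball' (mul_mem_ball (conj_mem_ball.mpr h1) h5) h1 ?_)
    omega

/-- The second column is determined by the first through conjugation and the integral element ε, and
the determinant is a unit, so integrality of the inverse is automatic. -/
theorem mem_principal (hε : 0 ≤ ord (ε : F)) {n : ℕ} (hn : 1 ≤ n) {g : quat F E ε} :
    g ∈ principal E ε n ↔ g.val.val 0 0 - 1 ∈ ball E n ∧ g.val.val 1 0 ∈ ball E n := by
  constructor
  · intro h
    refine ⟨h.2 0 0, ?_⟩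
    have := h.2 1 0
    rwa [Matrix.one_apply_ne (by decide), sub_zero] at this
  · rintro ⟨h0, h1⟩
    have h5 : algebraMap F E ε ∈ ball E 0 := (algebraMap_mem_ball_zero _).mpr (Or.inr hε)
    have h11 : g.val.val 1 1 - 1 ∈ ball E n := by
      have := conj_mem_ball (F := F).mpr h0
      rwa [map_sub, map_one, ← quat_apply_one_one] at this
    have h01 : g.val.val 0 1 ∈ ball E n := by
      rw [quat_apply_zero_one]
      exact mul_mem_ball' (conj_mem_ball.mpr h1) h5 (add_zero _).ge
    have hd (i j : Fin 2) : g.val.val i j - (1 : Matrix (Fin 2) (Fin 2) E) i j ∈ ball E n := by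
      fin_cases i <;> fin_cases j <;> simpa
    have hbox : g.val ∈ glBox E 0 0 := by
      refine ⟨fun i j => ?_, by rw [ord_qdet_eq_zero hε hn h0 h1]; simp⟩
      have h6 : (1 : Matrix (Fin 2) (Fin 2) E) i j ∈ ball E 0 := by
        fin_cases i <;> fin_cases j <;> simp [one_mem_ball, (ball E 0).zero_mem]
      have := (ball E 0).add_mem (ball_mono (hd i j) (by omega)) h6
      simpa using this
    refine ⟨fun i j => ⟨mem_integer_iff.mpr (by simpa using hbox.1 i j), mem_integer_iff.mpr ?_⟩, hd⟩
    have := glBox_inv_mem hbox i j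
    rw [Subgroup.coe_inv]
    simpa using this

theorem orbPt_mem_principal (hε : 0 ≤ ord (ε : F)) {n : ℕ} (hn : 1 ≤ n) {b : Eˣ}
    (hb : (ε : F) * Algebra.norm F (b : E) ≠ 1) (h₁ r : Eˣ) :
    orbPt ε b hb h₁ r ∈ principal E ε n ↔ r ∈ oneUnits E n ∧ (n : ℤ) ≤ ord (b : E) := by
  rw [mem_principal hε hn, orbPt_zero_zero, orbPt_one_zero, mem_oneUnits_of_one_le hn]
  refine and_congr_right fun h => ?_
  have h1 : ord (r : E) = 0 := ((mem_oneUnits_of_one_le hn).mpr h).2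
  have h2 : conj F E (b : E) * (h₁ * (conj F E h₁)⁻¹) * r =
      ((conjU F E b * (h₁ * (conjU F E h₁)⁻¹) * r : Eˣ) : E) := by simp
  rw [h2, mem_ball_unit, unit_ord_mul, unit_ord_mul, unit_ord_mul, unit_ord_inv, h1]
  simp

end Principal

section PureMatching

variable {F E : Type*} [Field F] [ValuativeRel F] [TopologicalSpace F]
  [IsNonarchimedeanLocalField F] [MeasurableSpace F] [BorelSpace F]
  [Field E] [ValuativeRel E] [TopologicalSpace E]
  [IsNonarchimedeanLocalField E] [MeasurableSpace E] [BorelSpace E]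
  [Algebra F E] [ValuativeExtension F E]
  [Algebra.IsQuadraticExtension F E] [Algebra.IsSeparable F E] {ε ε' : Fˣ}

variable (μF : Measure Fˣ) [μF.IsHaarMeasure] (μE : Measure Eˣ) [μE.IsHaarMeasure]
  (Ω : Eˣ →* ℂˣ)

theorem orbInt_principal (hε : 0 ≤ ord (ε : F)) {n : ℕ} (hn : 1 ≤ n)
    (hΩn : ∀ u ∈ oneUnits E n, Ω u = 1) {b : Eˣ} (hb : (ε : F) * Algebra.norm F (b : E) ≠ 1) :
    orbInt μF μE Ω (delta ε b hb) ((principal E ε n).indicator 1) =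
      orbVol F E μF μE * ((μE.real (oneUnits E n : Set Eˣ) : ℂ) *
        if (n : ℤ) ≤ ord (b : E) then 1 else 0) := by
  refine orbInt_eq_of_forall μF μE Ω hb _ fun h₁ => ?_
  rw [← integral_indicator_oneUnits μE Ω hΩn]
  congr 1
  ext r
  congr 1
  have hm := orbPt_mem_principal hε hn hb h₁ r
  by_cases hr : r ∈ (oneUnits E n : Set Eˣ)
  · rw [Set.indicator_of_mem hr]
    split_ifs with hbn
    · rw [Set.indicator_of_mem (hm.mpr ⟨hr, hbn⟩)]; rfl
    · rw [Set.indicator_of_notMem (fun h => hbn (hm.mp h).2)]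
  · rw [Set.indicator_of_notMem hr, Set.indicator_of_notMem (fun h => hr (hm.mp h).1)]

/-! ### Explicit pure matching -/

open Classical in
variable (E) in
/-- The character `η` restricted to the units and extended by zero. -/
noncomputable def unitEta (γ : F) : ℂ :=
  if h : γ ≠ 0 ∧ ord γ = 0 then eta F E (Units.mk0 γ h.1) else 0

theorem unitEta_val (z : Fˣ) : unitEta E (z : F) = if ord (z : F) = 0 then eta F E z else 0 := by
  unfold unitEta
  by_cases h : ord (z : F) = 0
  · rw [dif_pos ⟨z.ne_zero, h⟩, if_pos h, Units.mk0_val]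
  · rw [dif_neg (fun h' => h h'.2), if_neg h]

theorem unitEta_ne_zero {γ : F} (h : unitEta E γ ≠ 0) : γ ≠ 0 ∧ ord γ = 0 := by
  by_contra h'
  exact h (dif_neg h')

variable (F E) in
theorem exists_unitEta_inv : ∃ l : ℕ, ∀ γ γ' : F, γ' - γ ∈ ball F l → unitEta E γ' = unitEta E γ := by
  obtain ⟨l, hl⟩ := eta_oneUnits_mul F E
  have key (γ γ' : F) (h : γ' - γ ∈ ball F ((l + 1 : ℕ) : ℤ)) (h0 : unitEta E γ ≠ 0) :
      unitEta E γ' = unitEta E γ := by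
    obtain ⟨h1, h2⟩ := unitEta_ne_zero h0
    have h3 : γ' - γ ∈ ball F (ord γ + 1) := ball_mono h (by rw [h2]; push_cast; linarith)
    have h4 : γ' ≠ 0 := by simpa using add_ne_zero_of_mem h1 h3
    have h5 : ord γ' = 0 := by simpa [h2] using ord_add_eq h1 h3
    obtain ⟨z, rfl⟩ : ∃ z : Fˣ, (z : F) = γ := ⟨Units.mk0 γ h1, rfl⟩
    obtain ⟨z', rfl⟩ : ∃ z : Fˣ, (z : F) = γ' := ⟨Units.mk0 γ' h4, rfl⟩
    have hu : z⁻¹ * z' ∈ oneUnits F (l + 1) := by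
      rw [mem_oneUnits_of_one_le (by omega)]
      have e : ((z⁻¹ * z' : Fˣ) : F) - 1 = (z⁻¹ : Fˣ) * ((z' : F) - z) := by
        rw [mul_sub, Units.inv_mul, Units.val_mul]
      rw [e, mul_mem_ball_iff (Units.ne_zero _), unit_ord_inv, h2, neg_zero, sub_zero]
      exact h
    have h6 := hl z _ (oneUnits_anti (Nat.le_succ l) hu)
    rw [mul_inv_cancel_left] at h6
    rw [unitEta_val, unitEta_val, if_pos h2, if_pos h5, h6]
  refine ⟨l + 1, fun γ γ' h => ?_⟩
  by_cases h0 : unitEta E γ = 0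
  · by_contra h1
    rw [h0] at h1
    refine h1 ((key γ' γ ?_ h1).symm.trans h0)
    rw [← neg_sub]
    exact (ball F _).neg_mem h
  · exact key γ γ' h h0

open Classical in
variable (ε) in
/-- The Hermitian test function matching the congruence subgroup of level `n`. -/
noncomputable def hermTest (n : ℕ) (i : ℤ) (c : ℂ) (α : F) (β : E) (γ : F) : ℂ :=
  if β - 1 ∈ ball E n then
    c * ((if α ∈ ball F i then unitEta E γ else 0) +
      eta F E ε * if γ ∈ ball F i then unitEta E α else 0)
  else 0

theorem hermTest_ne_zero {n : ℕ} {i : ℤ} {c : ℂ} {α : F} {β : E} {γ : F} (hn : 1 ≤ n) (hi : 1 ≤ i)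
    (h : hermTest ε n i c α β γ ≠ 0) : β - 1 ∈ ball E n ∧ α * γ ∈ ball F i ∧ α ∈ ball F 0 ∧
      γ ∈ ball F 0 ∧ β ≠ 0 ∧ ord β = 0 ∧ ord (Algebra.norm F β) = 0 ∧
      α * γ - Algebra.norm F β ≠ 0 ∧ ord (α * γ - Algebra.norm F β) = 0 := by
  classical
  have h1 : β - 1 ∈ ball E n := by
    by_contra h1; exact h (if_neg h1)
  rw [hermTest, if_pos h1] at h
  have h2 : (α ∈ ball F i ∧ γ ∈ ball F 0) ∨ (α ∈ ball F 0 ∧ γ ∈ ball F i) := by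
    by_contra h2
    rw [not_or] at h2
    apply h
    have e1 : (if α ∈ ball F i then unitEta E γ else 0) = 0 := by
      split_ifs with h3
      · by_contra h4; exact h2.1 ⟨h3, Or.inr (unitEta_ne_zero h4).2.ge⟩
      · rfl
    have e2 : (if γ ∈ ball F i then unitEta E α else 0) = 0 := by
      split_ifs with h3
      · by_contra h4; exact h2.2 ⟨Or.inr (unitEta_ne_zero h4).2.ge, h3⟩
      · rfl
    rw [e1, e2]; simp
  have h3 : β - 1 ∈ ball E 1 := ball_mono h1 (by exact_mod_cast hn)
  have h4 : ord β = 0 := by simpa using ord_one_add h3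
  have h5 : β ≠ 0 := by simpa using one_add_ne_zero h3
  have h6 : ord (Algebra.norm F β) = 0 := by
    have := ramIdx_mul_ord_norm (F := F) h5
    rw [h4, mul_zero] at this
    exact (mul_eq_zero.mp this).resolve_left (by linarith [ramIdx_pos F E])
  have h7 : α * γ ∈ ball F i := by
    rcases h2 with h2 | h2
    · exact mul_mem_ball' h2.1 h2.2 (by omega)
    · exact mul_mem_ball' h2.1 h2.2 (by omega)
  have h8 : -Algebra.norm F β ≠ 0 := neg_ne_zero.mpr (norm_ne_zero h5)
  have h9 : α * γ ∈ ball F (ord (-Algebra.norm F β) + 1) := ball_mono h7 (by rw [ord_neg, h6]; omega)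
  have h10 : α * γ - Algebra.norm F β = -Algebra.norm F β + α * γ := by ring
  refine ⟨h1, h7, ?_, ?_, h5, h4, h6, ?_, ?_⟩
  · rcases h2 with h2 | h2
    · exact ball_mono h2.1 (by omega)
    · exact h2.1
  · rcases h2 with h2 | h2
    · exact h2.2
    · exact ball_mono h2.2 (by omega)
  · rw [h10]; exact add_ne_zero_of_mem h8 h9
  · rw [h10, ord_add_eq h8 h9, ord_neg, h6]

theorem exists_isTest_hermTest {n : ℕ} {i : ℤ} (c : ℂ) (hn : 1 ≤ n) (hi : 1 ≤ i) :
    ∃ M, IsTest (hermTest (E := E) ε n i c) M := by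
  obtain ⟨l, hl⟩ := exists_unitEta_inv F E
  classical
  refine ⟨l + n + i.toNat, fun {α β γ} h => ?_, fun {α β γ α' β' γ'} hα hβ hγ => ?_⟩
  · obtain ⟨-, -, h1, h2, -, h3, -, -, h4⟩ := hermTest_ne_zero hn hi h
    exact ⟨ball_mono h1 (by omega), Or.inr (by omega), ball_mono h2 (by omega), by omega⟩
  · have e1 : β' - 1 ∈ ball E n ↔ β - 1 ∈ ball E n := by
      have e : β' - 1 = (β' - β) + (β - 1) := by ring
      rw [e, (ball E n).add_mem_cancel_left (ball_mono hβ (by omega))]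
    have e2 : α' ∈ ball F i ↔ α ∈ ball F i := by
      have e : α' = (α' - α) + α := by ring
      rw [e, (ball F i).add_mem_cancel_left (ball_mono hα (by omega))]
    have e3 : γ' ∈ ball F i ↔ γ ∈ ball F i := by
      have e : γ' = (γ' - γ) + γ := by ring
      rw [e, (ball F i).add_mem_cancel_left (ball_mono hγ (by omega))]
    unfold hermTest
    simp only [e1, e2, e3, hl α α' (ball_mono hα (by omega)), hl γ γ' (ball_mono hγ (by omega))]

theorem measureReal_shell (k : ℤ) : μF.real (shell F k) = μF.real (shell F 0) := by
  obtain ⟨x, hx⟩ := exists_ord_eq F k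
  have h := setIntegral_shell_mul μF (fun _ => (1 : ℂ)) x 0
  rw [hx, add_zero, setIntegral_const, setIntegral_const, Complex.real_smul, Complex.real_smul,
    mul_one, mul_one] at h
  exact_mod_cast h.symm

/-- The two summands live on v(z) = 0 and v(z) = v(X). On the first η(z)² = 1, on the second
η(X/z)η(z) = η(X). The resulting factor 1 + η(ε)η(X) is 2 on the class of ε and 0 on the other one.
-/
theorem pairInt_hermTest {n : ℕ} {i : ℤ} (c : ℂ) {β : E} (hβ : β - 1 ∈ ball E n) (X : Fˣ) :
    pairInt E μF (fun α γ => hermTest ε n i c α β γ) (fun _ => 1) X =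
      if i ≤ ord (X : F) then c * (1 + eta F E ε * eta F E X) * (μF.real (shell F 0) : ℂ) else 0 := by
  classical
  have e (z : Fˣ) : hermTest ε n i c ((X / z : Fˣ) : F) β z * eta F E z * 1 =
      (shell F 0).indicator (fun _ => if i ≤ ord (X : F) then c else 0) z +
      (shell F (ord (X : F))).indicator
        (fun _ => if i ≤ ord (X : F) then c * (eta F E ε * eta F E X) else 0) z := by
    have hz := eta_sq (E := E) z
    have hXz : eta F E (X / z) * eta F E z = eta F E X := by rw [← eta_mul, div_mul_cancel]
    rw [hermTest, if_pos hβ, unitEta_val, unitEta_val, mem_ball_unit, mem_ball_unit, unit_ord_div]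
    simp only [Set.indicator_apply, mem_shell]
    have h1 : ord (X : F) - ord (z : F) = 0 ↔ ord (z : F) = ord (X : F) := by omega
    simp only [h1]
    have p1 : (if i ≤ ord (X : F) - ord (z : F) then
        (if ord (z : F) = 0 then eta F E z else 0) else 0) * eta F E z =
        if ord (z : F) = 0 then (if i ≤ ord (X : F) then (1 : ℂ) else 0) else 0 := by
      by_cases h : ord (z : F) = 0
      · simp only [h, sub_zero, if_true]
        split_ifs
        · exact hz
        · simp
      · simp [h]
    have p2 : (if i ≤ ord (z : F) then
        (if ord (z : F) = ord (X : F) then eta F E (X / z) else 0) else 0) * eta F E z =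
        if ord (z : F) = ord (X : F) then (if i ≤ ord (X : F) then eta F E X else 0) else 0 := by
      by_cases h : ord (z : F) = ord (X : F)
      · simp only [h, if_true]
        split_ifs
        · exact hXz
        · simp
      · simp [h]
    have q1 : (if ord (z : F) = 0 then (if i ≤ ord (X : F) then c else 0) else 0) =
        c * if ord (z : F) = 0 then (if i ≤ ord (X : F) then (1 : ℂ) else 0) else 0 := by
      split_ifs <;> simp
    have q2 : (if ord (z : F) = ord (X : F) then
        (if i ≤ ord (X : F) then c * (eta F E ε * eta F E X) else 0) else 0) =
        c * eta F E ε * if ord (z : F) = ord (X : F) then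
          (if i ≤ ord (X : F) then eta F E X else 0) else 0 := by
      split_ifs <;> simp [mul_assoc]
    rw [q1, q2, ← p1, ← p2]
    ring_nf
  have hint (k : ℤ) (A : ℂ) : Integrable ((shell F k).indicator fun _ => A) μF :=
    (integrable_indicator_iff (measurableSet_shell F k)).mpr
      (integrableOn_const (isCompact_shell F k).measure_lt_top.ne)
  unfold pairInt
  simp only [e]
  rw [integral_add (hint _ _) (hint _ _), integral_indicator (measurableSet_shell F _),
    integral_indicator (measurableSet_shell F _), setIntegral_const, setIntegral_const,
    measureReal_shell μF (ord (X : F)), Complex.real_smul, Complex.real_smul]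
  split_ifs <;> ring

theorem hermInt_hermTest {n : ℕ} {i : ℤ} (c : ℂ) (hΩn : ∀ u ∈ oneUnits E n, Ω u = 1) (hn : 1 ≤ n)
    (x : Fˣ) :
    hermInt μF μE Ω (hermTest ε n i c) (fun _ _ => 1) x = if i ≤ ord (x : F) then
      c * (1 + eta F E ε * eta F E x) * (μF.real (shell F 0) : ℂ) *
        (μE.real (oneUnits E n : Set Eˣ) : ℂ) else 0 := by
  rw [IsTest.hermInt_eq_pairInt]
  have e (a : Eˣ) : (((Ω a)⁻¹ : ℂˣ) : ℂ) * pairInt E μF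
        (fun α γ => hermTest ε n i c α (a : E) γ)
      (fun _ => 1) (normU F E a * x) = (oneUnits E n : Set Eˣ).indicator (fun _ =>
        if i ≤ ord (x : F) then c * (1 + eta F E ε * eta F E x) * (μF.real (shell F 0) : ℂ)
          else 0) a * ((Ω a)⁻¹ : ℂˣ) := by
    by_cases ha : a ∈ (oneUnits E n : Set Eˣ)
    · have h1 : ord ((normU F E a : Fˣ) : F) = 0 := (ord_normU_eq_zero_iff a).mpr ha.2
      rw [pairInt_hermTest μF c ha.1, Set.indicator_of_mem ha, eta_mul, eta_normU, one_mul,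
        unit_ord_mul, h1, zero_add, mul_comm]
    · have h0 : ¬ ((a : E) - 1 ∈ ball E n) := fun h => ha ((mem_oneUnits_of_one_le hn).mpr h)
      rw [Set.indicator_of_notMem ha, zero_mul]
      unfold pairInt hermTest
      simp [h0]
  simp only [e]
  rw [integral_indicator_oneUnits μE Ω hΩn]
  split_ifs <;> ring

/-- On the support β is a unit and αγ ∈ 𝔭ⁱ. The lower bound on n puts αγ Nm(τ)/Nm(β) in the maximal
ideal, so `exists_section` gives representatives with uniformly bounded entries and unit
determinant. -/
theorem exists_lift_hermTest [MeasurableSpace (unitaryW F E)] [BorelSpace (unitaryW F E)]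
    (μH : Measure (unitaryW F E)) [μH.IsHaarMeasure] {n : ℕ} {i : ℤ} (c : ℂ) (hi : (n : ℤ) ≤ i)
    (hn : (ord (Algebra.norm F (trOne F E))).natAbs + 1 ≤ n) :
    ∃ f : GL (Fin 2) E → ℂ, IsSmoothCompact f ∧ hermCoord (hermFun μH f) = hermTest (F := F) ε n i c := by
  obtain ⟨M, hM⟩ := exists_isTest_hermTest (E := E) (ε := ε) (n := n) (i := i) c (by omega) (by omega)
  refine exists_lift μH hM (a := (ord (trOne F E)).natAbs) (b := 0) fun α β γ h => ?_
  obtain ⟨-, h1, hα, hγ, hβ, hβo, hN, hd, hd'⟩ := hermTest_ne_zero (by omega) (by omega) h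
  have ht : α * γ * Algebra.norm F (trOne F E) / Algebra.norm F β ∈ ball F 1 := by
    rw [div_eq_mul_inv]
    exact mul_mem_ball' (mul_mem_ball h1 (self_mem_ball _))
      (Or.inr (by rw [ord_inv, hN, neg_zero] : (0 : ℤ) ≤ _)) (by omega)
  obtain ⟨k, σ, hσ, hk, h00, h01, h10, h11⟩ := exists_section hβ ht hd
  have hσ' : σ ∈ ball F 0 := Or.inr hσ.ge
  have hint {x : F} (hx : x ∈ ball F 0) : algebraMap F E x ∈ ball E 0 := by
    simpa using algebraMap_mem_ball' (E := E) (n := 0) (by simpa using hx)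
  refine ⟨k, ⟨fun i j => ?_, ?_⟩, hk⟩
  · fin_cases i <;> fin_cases j
    · rw [Fin.zero_eta, h00]; exact Or.inr (by omega)
    · rw [Fin.zero_eta, Fin.mk_one, h01, div_eq_mul_inv]
      exact mul_mem_ball' (mul_mem_ball (self_mem_ball _) (hint hα))
        (Or.inr (by rw [ord_inv, ord_conj, hβo, neg_zero] : (0 : ℤ) ≤ _)) (by omega)
    · rw [Fin.zero_eta, Fin.mk_one, h10]
      exact mul_mem_ball' (self_mem_ball _) (hint (mul_mem_ball' hγ hσ' (by omega))) (by omega)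
    · rw [Fin.mk_one, sub_eq_iff_eq_add.mp h11]
      refine (ball E _).add_mem ((ball E _).neg_mem (ball_mono (hint
        (mul_mem_ball' ht hσ' (by omega))) (by omega))) (ball_mono one_mem_ball (by omega))
  · have h4 : α * γ - Algebra.norm F β = -Algebra.norm F k.val.det := by
      apply (algebraMap F E).injective
      rw [← det_hermMat, ← hk, det_gact, map_neg]
    have h5 := ramIdx_mul_ord_norm (F := F) (gl_det_ne_zero k)
    rw [h4, ord_neg] at hd'
    rw [hd'] at h5
    simp at h5
    simp [← h5]

/-- For every sufficiently deep congruence subgroup there is a purely matching function. -/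
theorem exists_pure_matching (hΩ : Continuous Ω) [MeasurableSpace (unitaryW F E)]
    [BorelSpace (unitaryW F E)] (μH : Measure (unitaryW F E)) [μH.IsHaarMeasure]
    (hεε' : eta F E ε' = -eta F E ε) (hε : 0 ≤ ord (ε : F)) {n : ℕ}
    (hn : (ord (Algebra.norm F (trOne F E))).natAbs + 1 ≤ n)
    (hΩn : ∀ u ∈ oneUnits E n, Ω u = 1) (lam : ℂ) :
    ∃ f : GL (Fin 2) E → ℂ, IsSmoothCompact f ∧
      (∀ b : Eˣ, (ε : F) * Algebra.norm F (b : E) ≠ 1 →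
        hermOrb μF μE Ω (hermFun μH f) ((ε : F) * Algebra.norm F (b : E)) 0 =
          lam * (orbVol F E μF μE * ((μE.real (oneUnits E n : Set Eˣ) : ℂ) *
            if (n : ℤ) ≤ ord (b : E) then 1 else 0))) ∧
      ∀ b : Eˣ, (ε' : F) * Algebra.norm F (b : E) ≠ 1 →
        hermOrb μF μE Ω (hermFun μH f) ((ε' : F) * Algebra.norm F (b : E)) 0 = 0 := by
  -- This ϖ has valuation n in E. The threshold i = v(ε Nm ϖ) makes v(ε Nm b) ≥ i equivalent to v(b)
  -- ≥ n.
  obtain ⟨ϖ, hϖ⟩ := exists_ord_eq E n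
  set i : ℤ := ord (ε : F) + ord ((normU F E ϖ : Fˣ) : F)
  have hϖ' := ramIdx_mul_ord_normU (F := F) ϖ
  have hi : (n : ℤ) ≤ i := by
    rcases ramIdx_eq F E with he | he <;> rw [he] at hϖ' <;> omega
  have hv : (μF.real (shell F 0) : ℂ) ≠ 0 := by
    exact_mod_cast (measureReal_shell_zero_pos F μF).ne'
  -- The denominator removes the factor 2 of the class of ε and the volume of a shell.
  set c : ℂ := lam * orbVol F E μF μE / (2 * (μF.real (shell F 0) : ℂ))
  obtain ⟨f, hf, hfc⟩ := exists_lift_hermTest (ε := ε) μH c hi hn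
  obtain ⟨M, hM⟩ := exists_isTest_hermTest (E := E) (ε := ε) (n := n) (i := i) c (by omega) (by omega)
  rw [← hfc] at hM
  refine ⟨f, hf, fun b hb => ?_, fun b hb => ?_⟩
  · have h1 := hermOrb_zero μF μE Ω hΩ hM (x := ε * normU F E b) hb
    rw [hfc, hermInt_hermTest μF μE Ω c hΩn (by omega), eta_mul, eta_normU, mul_one, eta_sq] at h1
    refine h1.trans ?_
    have h2 : i ≤ ord ((ε * normU F E b : Fˣ) : F) ↔ (n : ℤ) ≤ ord (b : E) := by
      rw [unit_ord_mul]
      have h3 := ramIdx_mul_ord_normU (F := F) b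
      rcases ramIdx_eq F E with he | he <;> rw [he] at h3 hϖ' <;> omega
    simp only [h2, c]
    split_ifs
    · field_simp; ring
    · simp
  · have h1 := hermOrb_zero μF μE Ω hΩ hM (x := ε' * normU F E b) hb
    rw [hfc, hermInt_hermTest μF μE Ω c hΩn (by omega), eta_mul, eta_normU, mul_one, hεε',
      mul_neg, eta_sq] at h1
    refine h1.trans ?_
    simp

end PureMatching

section Multiplicity

variable {F E : Type*} [Field F] [ValuativeRel F] [TopologicalSpace F]
  [IsNonarchimedeanLocalField F] [Field E] [ValuativeRel E] [TopologicalSpace E]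
  [IsNonarchimedeanLocalField E] [Algebra F E] [ValuativeExtension F E]
  [Algebra.IsQuadraticExtension F E] [Algebra.IsSeparable F E] {ε ε' : Fˣ}

/-! ### Extension of multiplicity functions -/

theorem isClopen_qBox (a b : ℕ) : IsClopen (qBox F E ε a b) :=
  (isClopen_preimage_ball (continuous_quat_apply 0 0) _).inter
    ((isClopen_preimage_ball (continuous_quat_apply 1 0) _).inter
      ((isClopen_discrete (Set.Iic (b : ℤ))).preimage isLocallyConstant_ord_qdet.continuous))

theorem qBox_mono {a b M : ℕ} (h : a ≤ M) (h' : b ≤ M) : qBox F E ε a b ⊆ qBox F E ε M M :=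
  fun _ hg => ⟨ball_mono hg.1 (by omega), ball_mono hg.2.1 (by omega), hg.2.2.trans (by omega)⟩

theorem exists_normU_eq (n : ℕ) (hn : 1 ≤ n) :
    ∃ k : ℕ, ∀ v ∈ oneUnits F k, ∃ a ∈ oneUnits E n, normU F E a = v := by
  refine ⟨n + (ord (trOne F E)).natAbs + (ord (Algebra.norm F (trOne F E))).natAbs + 1,
    fun v hv => ?_⟩
  obtain ⟨s, hs, h⟩ := exists_norm_eq_one_add (E := E) hv.1
    (mul_mem_ball' hv.1 (self_mem_ball _) (by omega))
  have h1 : algebraMap F E s * trOne F E ∈ ball E n :=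
    mul_mem_ball' (algebraMap_mem_ball' hs) (self_mem_ball _) (by omega)
  have h2 : algebraMap F E s * trOne F E ∈ ball E 1 := ball_mono h1 (by exact_mod_cast hn)
  refine ⟨oneAdd _ h2, (mem_oneUnits_of_one_le hn).mpr ?_, ?_⟩
  · change 1 + algebraMap F E s * trOne F E - 1 ∈ _
    rwa [add_sub_cancel_left]
  · ext
    change Algebra.norm F (1 + algebraMap F E s * trOne F E) = _
    rw [h, add_sub_cancel]

/-- The set is stable under changing the reduced norm by norms from 1 + 𝔭_Eⁿ, and these norms
contain an open subgroup of Fˣ. -/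
theorem isClopen_detSet {U : Set (quat F E ε)} {n : ℕ} (hn : 1 ≤ n)
    (hU : ∀ u ∈ U, ∀ a ∈ oneUnits E n, u * torus ε a ∈ U) : IsClopen (detSet ε' U) := by
  obtain ⟨k, hk⟩ := exists_normU_eq (F := F) (E := E) n hn
  have key (g g' : quat F E ε') (a : Eˣ) (ha : a ∈ oneUnits E n)
      (h : qdet g' = qdet g * normU F E a) (hg : g ∈ detSet ε' U) : g' ∈ detSet ε' U := by
    obtain ⟨u, hu, e⟩ := hg
    refine ⟨u * torus ε a, hU u hu a ha, ?_⟩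
    rw [← algebraMap_qdet, ← algebraMap_qdet] at e ⊢
    rw [h, qdet_mul, qdet_torus, map_mul, e, map_mul, normU_val]
  have h1 : IsLocallyConstant fun g : quat F E ε' => g ∈ detSet ε' U := by
    rw [IsLocallyConstant.iff_eventually_eq]
    intro g
    filter_upwards [continuous_qdet.continuousAt.eventually
      (eventually_sub_mem_ball (qdet g) (ord (qdet g) + (k + 1 : ℕ)))] with g' hg'
    set x : Fˣ := Units.mk0 _ (qdet_ne_zero g)
    set x' : Fˣ := Units.mk0 _ (qdet_ne_zero g')
    have h2 : x' / x ∈ oneUnits F (k + 1) := by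
      rw [mem_oneUnits_of_one_le (by omega)]
      have e : ((x' / x : Fˣ) : F) - 1 = (qdet g)⁻¹ * (qdet g' - qdet g) := by
        rw [Units.val_div_eq_div_val]
        change qdet g' / qdet g - 1 = _
        have := qdet_ne_zero g
        field_simp
      rw [e]
      exact mul_mem_ball' (self_mem_ball _) hg' (by rw [ord_inv]; omega)
    obtain ⟨a, ha, e⟩ := hk _ (oneUnits_anti (Nat.le_succ k) h2)
    apply propext
    constructor
    · refine key g' g a⁻¹ (inv_mem ha) ?_
      have : x = x' * normU F E a⁻¹ := by rw [map_inv, e]; simp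
      exact congrArg Units.val this
    · refine key g g' a ha ?_
      have : x' = x * normU F E a := by rw [e]; simp
      exact congrArg Units.val this
  exact ⟨⟨h1 {p | ¬p}⟩, h1 {p | p}⟩

/-- The values on the torus are controlled by density of its complement. This gives bounds on the
support of the smooth part of a multiplicity function, which is only known off the torus. -/
theorem IsLocallyConstant.eq_zero_of_notMem {f : quat F E ε → ℂ} (hf : IsLocallyConstant f)
    {C : Set (quat F E ε)} (hC : IsClopen C) (h : ∀ g, g ∉ torusSet ε → g ∉ C → f g = 0) :
    ∀ g, g ∉ C → f g = 0 := by
  intro g hg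
  have h1 := IsLocallyConstant.eq_zero_of_compl_torusSet (isLocallyConstant_indicator hC.compl hf)
    (fun g hgT => by
      by_cases h' : g ∈ C
      · exact Set.indicator_of_notMem (by simpa using h') _
      · rw [Set.indicator_of_mem (by simpa using h')]; exact h g hgT h') g
  rwa [Set.indicator_of_mem (by simpa using hg)] at h1

/-- Extension by zero from the clopen set of admissible determinants keeps local constancy; outside
that set both m and the indicator of U' vanish. -/
theorem HasLogSingularity.exists_extension {U : Set (quat F E ε)} {U' : Subgroup (quat F E ε')}
    {m : quat F E ε' → ℂ} (h : HasLogSingularity U U' m) (hU : IsClopen (detSet ε' U))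
    (hU' : (U' : Set (quat F E ε')) ⊆ detSet ε' U)
    (hm : ∀ g, g ∉ torusSet ε' → m g ≠ 0 → g ∈ detSet ε' U) :
    ∃ φ : quat F E ε' → ℂ, IsLocallyConstant φ ∧ ∀ g, g ∉ torusSet ε' →
      m g = (ord (invPrime g) : ℂ) / 2 * (U' : Set (quat F E ε')).indicator 1 g + φ g := by
  obtain ⟨φ, hφ, e⟩ := h
  classical
  refine ⟨(detSet ε' U).indicator fun g => if h : g ∈ detSet ε' U then φ ⟨g, h⟩ else 0,
    isLocallyConstant_indicator_of hU fun g hg => ?_, fun g hg => ?_⟩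
  · have h1 := (IsLocallyConstant.iff_eventually_eq φ).mp hφ ⟨g, hg⟩
    rw [nhds_subtype, Filter.eventually_comap] at h1
    filter_upwards [h1, hU.isOpen.mem_nhds hg] with g' h2 h3
    rw [dif_pos h3, dif_pos hg]
    exact h2 ⟨g', h3⟩ rfl
  · by_cases h : g ∈ detSet ε' U
    · rw [Set.indicator_of_mem h, dif_pos h, e ⟨g, h⟩ hg]
      ring
    · rw [Set.indicator_of_notMem h, Set.indicator_of_notMem fun h' => h (hU' h'), mul_zero,
        add_zero]
      by_contra h'
      exact h (hm g hg h')

theorem mem_ball_of_norm_mem {a : E} {k : ℕ} (h : Algebra.norm F a ∈ ball F (-k)) :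
    a ∈ ball E (-k) := by
  by_cases ha : a = 0
  · rw [ha]; exact (ball E _).zero_mem
  · rw [mem_ball_of_ne (norm_ne_zero ha)] at h
    rw [mem_ball_of_ne ha]
    have := ramIdx_mul_ord_norm (F := F) ha
    rcases ramIdx_eq F E with e | e <;> rw [e] at this <;> omega

/-- In the group of a division quaternion algebra the elements whose reduced norm is a unit form a
bounded set. -/
theorem exists_subset_qBox_of_ord_qdet (hε : ε ∉ normGroup F E) :
    ∃ M : ℕ, ∀ g : quat F E ε, ord (qdet g) = 0 → g ∈ qBox F E ε M M := by
  obtain ⟨k, hk, hη⟩ := exists_eta_trivial F E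
  -- One of the two terms of the reduced norm is a norm and the other is not. If their difference is
  -- a unit and one of them is very large, then their quotient is close to 1 and hence a norm, a
  -- contradiction.
  have aux (x y : Fˣ) (hx : x ∈ normGroup F E) (hy : y ∉ normGroup F E)
      (h0 : ord ((x : F) - y) = 0) (hne : (x : F) - y ≠ 0) :
      (x : F) ∈ ball F (-k) ∧ (y : F) ∈ ball F (-k) := by
    have h1 (z w : Fˣ) (hzw : ord ((z : F) - w) = 0) (hne : (z : F) - w ≠ 0)
        (hd : w / z ∉ normGroup F E) : (z : F) ∈ ball F (-k) := by
      rw [mem_ball_unit]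
      by_contra h
      apply hd
      apply hη
      rw [mem_oneUnits_of_one_le hk]
      have e : ((w / z : Fˣ) : F) - 1 = -((z : F)⁻¹ * (z - w)) := by
        rw [Units.val_div_eq_div_val]
        have := z.ne_zero
        field_simp
        ring
      rw [e]
      exact (ball F _).neg_mem
        (mul_mem_ball' (self_mem_ball _) (self_mem_ball _) (by rw [ord_inv, hzw]; omega))
    refine ⟨h1 x y h0 hne fun h => hy ?_, h1 y x ?_ ?_ fun h => hy ?_⟩
    · have := mul_mem h hx
      rwa [div_mul_cancel] at this
    · rw [← ord_neg, neg_sub]; exact h0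
    · rw [← neg_ne_zero, neg_sub]; exact hne
    · have := mul_mem (inv_mem h) hx
      rwa [inv_div, div_mul_cancel] at this
  refine ⟨k + (ord (ε : F)).natAbs, fun g hg => ?_⟩
  have hd := qdet_ne_zero g
  have hle : ord (qdet g) ≤ ((k + (ord (ε : F)).natAbs : ℕ) : ℤ) := by omega
  have hb (y : E) (h : (ε : F) * Algebra.norm F y ∈ ball F (-k)) :
      y ∈ ball E (-((k + (ord (ε : F)).natAbs : ℕ) : ℤ)) :=
    mem_ball_of_norm_mem (ball_mono ((mul_mem_ball_iff ε.ne_zero _).mp h) (by omega))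
  have ha (y : E) (h : Algebra.norm F y ∈ ball F (-k)) :
      y ∈ ball E (-((k + (ord (ε : F)).natAbs : ℕ) : ℤ)) :=
    ball_mono (mem_ball_of_norm_mem h) (by omega)
  unfold qdet at hg hd
  by_cases h0 : g.val.val 0 0 = 0
  · refine ⟨by rw [h0]; exact (ball E _).zero_mem, hb _ ?_, hle⟩
    rw [h0, Algebra.norm_zero, zero_sub] at hg
    right
    rw [← ord_neg, hg]; omega
  by_cases h1 : g.val.val 1 0 = 0
  · refine ⟨ha _ ?_, by rw [h1]; exact (ball E _).zero_mem, hle⟩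
    rw [h1, Algebra.norm_zero, mul_zero, sub_zero] at hg
    right
    rw [hg]; omega
  have hy : ε * normU F E (Units.mk0 _ h1) ∉ normGroup F E := fun h => hε (by
    have := mul_mem h (inv_mem (normU_mem (F := F) (Units.mk0 _ h1)))
    rwa [mul_inv_cancel_right] at this)
  have := aux (normU F E (Units.mk0 _ h0)) (ε * normU F E (Units.mk0 _ h1)) (normU_mem _) hy hg hd
  exact ⟨ha _ this.1, hb _ this.2, hle⟩

theorem isClopen_subgroup {G : Type*} [Group G] [TopologicalSpace G] [IsTopologicalGroup G]
    {H : Subgroup G} (h : IsOpen (H : Set G)) : IsClopen (H : Set G) :=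
  ⟨H.isClosed_of_isOpen h, h⟩

theorem mul_torus_mem_principal (hε : 0 ≤ ord (ε : F)) {n : ℕ} (hn : 1 ≤ n) {u : quat F E ε}
    (hu : u ∈ principal E ε n) {a : Eˣ} (ha : a ∈ oneUnits E n) :
    u * torus ε a ∈ principal E ε n := by
  rw [mem_principal hε hn] at hu ⊢
  rw [quat_mul_zero_zero, quat_mul_one_zero, torus_apply_zero_zero, torus_apply_one_zero, mul_zero,
    mul_zero, add_zero, add_zero, mul_comm, mul_sub_one_mem_ball ha]
  exact ⟨hu.1, mul_mem_ball' hu.2 (self_mem_ball _) (by rw [ha.2]; omega)⟩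

theorem ord_qdet_of_mem_detSet (hε : 0 ≤ ord (ε : F)) {n : ℕ} (hn : 1 ≤ n) {g : quat F E ε'}
    (hg : g ∈ detSet ε' (principal E ε n)) : ord (qdet g) = 0 := by
  obtain ⟨u, hu, e⟩ := hg
  rw [mem_principal hε hn] at hu
  have h := ord_qdet_eq_zero hε hn hu.1 hu.2
  rw [← e, ← algebraMap_qdet, ord_algebraMap (qdet_ne_zero g)] at h
  exact (mul_eq_zero.mp h).resolve_left (by linarith [ramIdx_pos F E])

theorem torus_mem_principal (hε : 0 ≤ ord (ε : F)) {n : ℕ} (hn : 1 ≤ n) (t : Eˣ) :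
    torus (F := F) ε t ∈ principal E ε n ↔ t ∈ oneUnits E n := by
  rw [mem_principal hε hn, torus_apply_zero_zero, torus_apply_one_zero, mem_oneUnits_of_one_le hn]
  exact and_iff_left (ball E _).zero_mem

/-- A special multiplicity function is the sum of a smooth function and a standard logarithmic
singularity along the torus. -/
theorem IsSpecialMultiplicity.exists_decomposition (hε : 0 ≤ ord (ε : F))
    (hε' : ε' = 1 ∨ ε' ∉ normGroup F E) {n : ℕ} (hn : 1 ≤ n) {m : quat F E ε' → ℂ}
    (hm : IsSpecialMultiplicity ε' (principal E ε n) m) :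
    ∃ (S : Set (quat F E ε')) (φ : quat F E ε' → ℂ), IsClopen S ∧ IsCompact S ∧
      (∀ t, torus ε' t ∈ S ↔ t ∈ oneUnits E n) ∧ IsSmoothCompact φ ∧
      ∀ g, g ∉ torusSet ε' → m g = (ord (invPrime g) : ℂ) / 2 * S.indicator 1 g + φ g := by
  obtain ⟨U', ho, hc, hd, hT, hs⟩ := hm.singularity
  obtain ⟨φ, hφ, e⟩ := hs.exists_extension
    (isClopen_detSet hn fun u hu a ha => mul_torus_mem_principal hε hn hu ha) hd hm.support
  refine ⟨U', φ, isClopen_subgroup ho, hc, fun t => (hT t).trans (torus_mem_principal hε hn t),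
    ⟨hφ, ?_⟩, e⟩
  -- For ε' = 1 the group is not compact modulo its center and boundedness comes from the support in
  -- K_ε'. Otherwise the quaternion algebra is a division algebra and a unit reduced norm suffices.
  obtain ⟨M, hM⟩ : ∃ M : ℕ, ∀ g, g ∉ torusSet ε' → m g ≠ 0 → g ∈ qBox F E ε' M M := by
    rcases hε' with h | h
    · refine ⟨0, fun g hg h0 => ?_⟩
      have h1 := hm.mem_maxCompact h g hg h0
      have h2 := ord_qdet_of_mem_detSet hε hn (hm.support g hg h0)
      exact ⟨by simpa using mem_integer_iff.mp (h1 0 0).1, by simpa using mem_integer_iff.mp (h1 1 0).1,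
        by simp [h2]⟩
    · obtain ⟨M, hM⟩ := exists_subset_qBox_of_ord_qdet h
      exact ⟨M, fun g hg h0 => hM g (ord_qdet_of_mem_detSet hε hn (hm.support g hg h0))⟩
  obtain ⟨N, hN, -⟩ := exists_subset_qBox hc
  refine HasCompactSupport.intro (isCompact_qBox (max M N) (max M N))
    (IsLocallyConstant.eq_zero_of_notMem hφ (isClopen_qBox _ _) fun g hg hg' => ?_)
  have h1 : m g = 0 := by
    by_contra h0
    exact hg' (qBox_mono (le_max_left _ _) (le_max_left _ _) (hM g hg h0))
  have h2 := e g hg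
  rw [h1, Set.indicator_of_notMem fun h => hg' (qBox_mono (le_max_right _ _) (le_max_right _ _) (hN h)),
    mul_zero, zero_add] at h2
  exact h2.symm

end Multiplicity

/-! ### The identity for U = K_{ε,n} -/

section CongruenceLevel

variable {F E : Type*} [Field F] [ValuativeRel F] [TopologicalSpace F]
  [IsNonarchimedeanLocalField F] [MeasurableSpace F] [BorelSpace F]
  [Field E] [ValuativeRel E] [TopologicalSpace E]
  [IsNonarchimedeanLocalField E] [MeasurableSpace E] [BorelSpace E]
  [Algebra F E] [ValuativeExtension F E]
  [Algebra.IsQuadraticExtension F E] [Algebra.IsSeparable F E] {ε ε' : Fˣ}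
  (μF : Measure Fˣ) [μF.IsHaarMeasure] (μE : Measure Eˣ) [μE.IsHaarMeasure]
  [MeasurableSpace (unitaryW F E)] [BorelSpace (unitaryW F E)]
  (μH : Measure (unitaryW F E)) [μH.IsHaarMeasure] (Ω : Eˣ →* ℂˣ)

/-- The arithmetic matching for the principal congruence subgroups. -/
theorem arith_matching_principal (hΩ : Continuous Ω)
    (hη : ∫ z in shell F 0, eta F E z ∂μF = 0 ∨
      ∀ z : Fˣ, eta F E z = if Even (ord (z : F)) then 1 else -1)
    (hεε' : eta F E ε' = -eta F E ε) (hε : 0 ≤ ord (ε : F)) (hε' : ε' = 1 ∨ ε' ∉ normGroup F E)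
    {n : ℕ} (hn : (ord (Algebra.norm F (trOne F E))).natAbs + 1 ≤ n)
    (hΩn : ∀ u ∈ oneUnits E n, Ω u = 1) :
    (∃ f : GL (Fin 2) E → ℂ, IsSmoothCompact f ∧
      PurelyMatches μF μE μH Ω ε' f ((principal E ε n).indicator 1)) ∧
    ∀ f : GL (Fin 2) E → ℂ, IsSmoothCompact f →
      PurelyMatches μF μE μH Ω ε' f ((principal E ε n).indicator 1) →
      ∀ m : quat F E ε' → ℂ, IsSpecialMultiplicity ε' (principal E ε n) m →
        ∃ fbar : quat F E ε' → ℂ, IsSmoothCompact fbar ∧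
          ∀ (b : Eˣ) (hb : (ε' : F) * Algebra.norm F (b : E) ≠ 1),
            Integrable (Function.uncurry (orbIntegrand Ω (delta ε' b hb) m))
              ((μE.restrict (fundDom F E)).prod μE) ∧
            ∃ D : ℂ,
              HasDerivAt
                (hermOrb μF μE Ω (hermFun μH f) ((ε' : F) * Algebra.norm F (b : E))) D 0 ∧
              2 * orbInt μF μE Ω (delta ε' b hb) m * (-Real.log (resCard F) : ℂ) =
                D + orbInt μF μE Ω (delta ε' b hb) fbar := by
  have hn1 : 1 ≤ n := by omega
  constructor
  · obtain ⟨f, hf, h1, h2⟩ := exists_pure_matching μF μE Ω hΩ μH hεε' hε hn hΩn 1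
    refine ⟨f, hf, fun b hb => ?_, h2⟩
    rw [h1 b hb, orbInt_principal μF μE Ω hε hn1 hΩn hb, one_mul]
  · intro f hf hmatch m hm
    obtain ⟨S, φ, hS, hSc, hST, hφ, e⟩ := hm.exists_decomposition hε hε' hn1
    obtain ⟨M, hM⟩ := exists_isTest_hermFun μH hf
    obtain ⟨fbar, h1, -, h2⟩ := exists_arith_matching μF μE Ω hΩ hη hεε' hn1 hΩn hM
      (lam := 1) one_ne_zero (N₁ := n) (fun b hb hb' => by
        rw [hmatch.1 b hb, orbInt_principal μF μE Ω hε hn1 hΩn hb, if_pos hb', mul_one, one_mul])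
      hmatch.2 hS hSc hST hφ e
    refine ⟨fbar, h1, fun b hb => ⟨(h2 b hb).1, ?_⟩⟩
    obtain ⟨D, hD, hD'⟩ := (h2 b hb).2
    exact ⟨D, hD, by simpa only [one_mul] using hD'⟩

end CongruenceLevel

section Periodic

variable {F E : Type*} [Field F] [ValuativeRel F] [TopologicalSpace F]
  [IsNonarchimedeanLocalField F] [Field E] [ValuativeRel E] [TopologicalSpace E]
  [IsNonarchimedeanLocalField E] [Algebra F E] [ValuativeExtension F E]
  [Algebra.IsQuadraticExtension F E] [Algebra.IsSeparable F E] {ε : Fˣ}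

/-! ### Functions invariant under powers of a uniformizer -/

theorem central_mul (z w : Fˣ) : central (E := E) ε (z * w) = central ε z * central ε w := by
  rw [central, map_mul, torus_mul]; rfl

theorem central_one : central (E := E) ε (1 : Fˣ) = 1 := by
  rw [central, map_one, torus_one]

theorem central_comm (z : Fˣ) (g : quat F E ε) : g * central ε z = central ε z * g := by
  apply quat_ext
  · rw [quat_mul_zero_zero, (central_mul_apply z g).1]
    simp [central, mul_comm]
  · rw [quat_mul_one_zero, (central_mul_apply z g).2]
    simp [central, mul_comm]

theorem qdet_central_mul (z : Fˣ) (g : quat F E ε) : qdet (central ε z * g) = z ^ 2 * qdet g := by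
  rw [qdet_mul, central, qdet_torus, incl_val, norm_algebraMap_eq]

theorem central_mul_mem_torusSet (z : Fˣ) (g : quat F E ε) :
    central ε z * g ∈ torusSet ε ↔ g ∈ torusSet ε := by
  rw [mem_torusSet, mem_torusSet, (central_mul_apply z g).2, mul_eq_zero, or_iff_right]
  simp

theorem invPrime_central_mul (z : Fˣ) (g : quat F E ε) :
    invPrime (central ε z * g) = invPrime g := by
  have e (g : quat F E ε) : invPrime g = ε * Algebra.norm F (g.val.val 1 0) / qdet g := rfl
  rw [e, e, qdet_central_mul, (central_mul_apply z g).2, map_mul, norm_algebraMap_eq, mul_left_comm,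
    mul_div_mul_left _ _ (pow_ne_zero 2 z.ne_zero)]

theorem orbPt_incl_mul {b : Eˣ} (hb : (ε : F) * Algebra.norm F (b : E) ≠ 1) (z : Fˣ) (h₁ r : Eˣ) :
    orbPt ε b hb h₁ (incl F E z * r) = central ε z * orbPt ε b hb h₁ r := by
  rw [orbPt_eq_mul_torus, torus_mul, orbPt_eq_mul_torus hb h₁ r, ← mul_assoc, ← mul_assoc]
  exact congrArg (· * torus ε r) (central_comm z _)

theorem ord_qdet_central_mul (z : Fˣ) (g : quat F E ε) :
    ord (qdet (central ε z * g)) = 2 * ord (z : F) + ord (qdet g) := by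
  rw [qdet_central_mul, ord_mul (pow_ne_zero 2 z.ne_zero) (qdet_ne_zero g), ord_pow 2 z.ne_zero]
  rfl

variable (F E ε) in
/-- The elements of `G_ε` whose reduced norm has valuation `0` or `1`. -/
def detDom : Set (quat F E ε) := {g | ord (qdet g) = 0 ∨ ord (qdet g) = 1}

theorem mem_detDom {g : quat F E ε} : g ∈ detDom F E ε ↔ ord (qdet g) = 0 ∨ ord (qdet g) = 1 :=
  Iff.rfl

theorem isClopen_detDom : IsClopen (detDom F E ε) :=
  (isClopen_discrete ({0, 1} : Set ℤ)).preimage isLocallyConstant_ord_qdet.continuous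

/-- The function invariant under `ϖ` that agrees with `f` on `detDom`. -/
noncomputable def periodize (ϖ : Fˣ) (f : quat F E ε → ℂ) (g : quat F E ε) : ℂ :=
  f (central ε (ϖ ^ (-(ord (qdet g) / 2))) * g)

theorem isLocallyConstant_periodize (ϖ : Fˣ) {f : quat F E ε → ℂ} (hf : IsLocallyConstant f) :
    IsLocallyConstant (periodize ϖ f) := by
  rw [IsLocallyConstant.iff_eventually_eq]
  intro g
  have h1 := (IsLocallyConstant.iff_eventually_eq _).mp
    (isLocallyConstant_ord_qdet (F := F) (E := E) (ε := ε)) g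
  have h2 := (IsLocallyConstant.iff_eventually_eq _).mp (hf.comp_continuous
    (continuous_const_mul (central (E := E) ε (ϖ ^ (-(ord (qdet g) / 2)))))) g
  filter_upwards [h1, h2] with g' h3 h4
  rw [periodize, h3]
  exact h4

theorem periodize_central_mul {ϖ : Fˣ} (hϖ : ord (ϖ : F) = 1) {n : ℕ} {f : quat F E ε → ℂ}
    (hf : CentralInv n f) {z : Fˣ} {k : ℤ} (hz : incl F E (ϖ ^ k * z) ∈ oneUnits E n)
    (g : quat F E ε) : periodize ϖ f (central ε z * g) = periodize ϖ f g := by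
  have h0 : k + ord (z : F) = 0 := by
    have := hz.2
    rw [ord_incl, unit_ord_mul, unit_ord_zpow, hϖ, mul_one] at this
    exact (mul_eq_zero.mp this).resolve_left (by linarith [ramIdx_pos F E])
  have h1 : -((2 * ord (z : F) + ord (qdet g)) / 2) = -(ord (qdet g) / 2) + k := by omega
  rw [periodize, ord_qdet_central_mul, h1, _root_.zpow_add, ← mul_assoc, ← central_mul, mul_assoc,
    mul_comm, central_mul, mul_assoc, hf _ hz]
  rfl

theorem indicator_periodize (ϖ : Fˣ) (f : quat F E ε → ℂ) :
    (detDom F E ε).indicator (periodize ϖ f) = (detDom F E ε).indicator f := by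
  ext g
  by_cases h : g ∈ detDom F E ε
  · rw [Set.indicator_of_mem h, Set.indicator_of_mem h, periodize]
    have h1 : -(ord (qdet g) / 2) = 0 := by
      rw [mem_detDom] at h
      omega
    rw [h1, zpow_zero, central_one, one_mul]
  · rw [Set.indicator_of_notMem h, Set.indicator_of_notMem h]

/-! ### The groups `K_{ε,n} ϖ^ℤ` -/

theorem mem_principalMod {ϖ : Fˣ} {n : ℕ} {g : quat F E ε} :
    g ∈ principalMod E ϖ ε n ↔ ∃ k : ℤ, central ε (ϖ ^ k) * g ∈ principal E ε n := by
  constructor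
  · rintro ⟨k, u, hu, rfl⟩
    refine ⟨-k, ?_⟩
    rwa [central_comm, ← mul_assoc, ← central_mul, _root_.zpow_neg, inv_mul_cancel, central_one, one_mul]
  · rintro ⟨k, hk⟩
    refine ⟨-k, _, hk, ?_⟩
    rw [central_comm, ← mul_assoc, ← central_mul, _root_.zpow_neg, inv_mul_cancel, central_one, one_mul]

theorem torus_mem_principalMod (hε : 0 ≤ ord (ε : F)) {ϖ : Fˣ} {n : ℕ} (hn : 1 ≤ n) {t : Eˣ} :
    torus ε t ∈ principalMod E ϖ ε n ↔ ∃ k : ℤ, incl F E (ϖ ^ k) * t ∈ oneUnits E n := by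
  rw [mem_principalMod]
  simp only [central, ← torus_mul, torus_mem_principal hε hn]

theorem mem_centralPart (hε : 0 ≤ ord (ε : F)) {ϖ : Fˣ} {n : ℕ} (hn : 1 ≤ n) {z : Fˣ} :
    z ∈ centralPart (principalMod E ϖ ε n) ↔ ∃ k : ℤ, incl F E (ϖ ^ k * z) ∈ oneUnits E n := by
  simp only [map_mul]
  exact torus_mem_principalMod hε hn

theorem zpow_mem_centralPart (hε : 0 ≤ ord (ε : F)) {ϖ : Fˣ} {n : ℕ} (hn : 1 ≤ n) (k : ℤ) :
    ϖ ^ k ∈ centralPart (principalMod E ϖ ε n) :=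
  (mem_centralPart hε hn).mpr ⟨-k, by rw [_root_.zpow_neg, inv_mul_cancel, map_one]; exact one_mem _⟩

theorem mem_centralPart_of_mem (hε : 0 ≤ ord (ε : F)) {ϖ : Fˣ} {n : ℕ} (hn : 1 ≤ n) {z : Fˣ}
    (hz : incl F E z ∈ oneUnits E n) : z ∈ centralPart (principalMod E ϖ ε n) :=
  (mem_centralPart hε hn).mpr ⟨0, by rwa [zpow_zero, one_mul]⟩

/-- A product ϖᵏz in 1 + 𝔭_Eⁿ with v(z) = 0 has k = 0. The set is therefore open and relatively
compact, and the normalizing volume in `quotInt` is finite and nonzero. -/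
theorem centralPart_inter (hε : 0 ≤ ord (ε : F)) {ϖ : Fˣ} (hϖ : ord (ϖ : F) = 1) {n : ℕ}
    (hn : 1 ≤ n) : {z : Fˣ | z ∈ centralPart (principalMod E ϖ ε n) ∧ ord (z : F) = 0} =
      incl F E ⁻¹' (oneUnits E n : Set Eˣ) := by
  ext z
  constructor
  · rintro ⟨h, h0⟩
    obtain ⟨k, hk⟩ := (mem_centralPart hε hn).mp h
    have h1 : k = 0 := by
      have := hk.2
      rw [ord_incl, unit_ord_mul, unit_ord_zpow, hϖ, mul_one, h0, add_zero] at this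
      exact (mul_eq_zero.mp this).resolve_left (by linarith [ramIdx_pos F E])
    rwa [h1, zpow_zero, one_mul] at hk
  · intro h
    refine ⟨mem_centralPart_of_mem hε hn h, ?_⟩
    have h1 : ord ((incl F E z : Eˣ) : E) = 0 := h.2
    rw [ord_incl] at h1
    exact (mul_eq_zero.mp h1).resolve_left (by linarith [ramIdx_pos F E])

theorem isClopen_principal (hε : 0 ≤ ord (ε : F)) {n : ℕ} (hn : 1 ≤ n) :
    IsClopen (principal E ε n) := by
  have e : principal E ε n = {g : quat F E ε | g.val.val 0 0 - 1 ∈ ball E n} ∩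
      {g | g.val.val 1 0 ∈ ball E n} := by
    ext g; exact mem_principal hε hn
  rw [e]
  exact (isClopen_preimage_ball ((continuous_quat_apply 0 0).sub continuous_const) _).inter
    (isClopen_preimage_ball (continuous_quat_apply 1 0) _)

theorem ord_qdet_of_mem_principal (hε : 0 ≤ ord (ε : F)) {n : ℕ} (hn : 1 ≤ n) {g : quat F E ε}
    (hg : g ∈ principal E ε n) : ord (qdet g) = 0 :=
  ord_qdet_of_mem_detSet hε hn ⟨g, hg, rfl⟩

/-- Elements of K_{ε,n} have unit reduced norm, so the power of ϖ that brings g into it can only be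
the one determined by v(det g). -/
theorem indicator_principalMod (hε : 0 ≤ ord (ε : F)) {ϖ : Fˣ} (hϖ : ord (ϖ : F) = 1) {n : ℕ}
    (hn : 1 ≤ n) : (principalMod E ϖ ε n).indicator (1 : quat F E ε → ℂ) =
      periodize ϖ ((principal E ε n).indicator 1) := by
  ext g
  have h : g ∈ principalMod E ϖ ε n ↔
      central ε (ϖ ^ (-(ord (qdet g) / 2))) * g ∈ principal E ε n := by
    refine mem_principalMod.trans ⟨fun ⟨k, hk⟩ => ?_, fun h => ⟨_, h⟩⟩
    have h1 := ord_qdet_of_mem_principal hε hn hk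
    rw [ord_qdet_central_mul, unit_ord_zpow, hϖ] at h1
    rwa [show -(ord (qdet g) / 2) = k by omega]
  by_cases hg : g ∈ principalMod E ϖ ε n
  · rw [Set.indicator_of_mem hg, periodize, Set.indicator_of_mem (h.mp hg)]; rfl
  · rw [Set.indicator_of_notMem hg, periodize, Set.indicator_of_notMem (fun h' => hg (h.mpr h'))]

theorem indicator_detDom_principal (hε : 0 ≤ ord (ε : F)) {n : ℕ} (hn : 1 ≤ n) :
    (detDom F E ε).indicator ((principal E ε n).indicator (1 : quat F E ε → ℂ)) =
      (principal E ε n).indicator 1 := by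
  rw [Set.indicator_indicator, Set.inter_eq_right.mpr]
  exact fun g hg => Or.inl (ord_qdet_of_mem_principal hε hn hg)

end Periodic

section Folding

variable {F E : Type*} [Field F] [ValuativeRel F] [TopologicalSpace F]
  [IsNonarchimedeanLocalField F] [MeasurableSpace F] [BorelSpace F]
  [Field E] [ValuativeRel E] [TopologicalSpace E]
  [IsNonarchimedeanLocalField E] [MeasurableSpace E] [BorelSpace E]
  [Algebra F E] [ValuativeExtension F E]
  [Algebra.IsQuadraticExtension F E] [Algebra.IsSeparable F E] {ε : Fˣ}
  (μF : Measure Fˣ) [μF.IsHaarMeasure] (μE : Measure Eˣ) [μE.IsHaarMeasure] (Ω : Eˣ →* ℂˣ)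

/-! ### Orbital integrals modulo the center -/

variable (F E) in
/-- The elements of `Eˣ` with norm of valuation in `P`. -/
def normShell (P : Set ℤ) : Set Eˣ := {t | ord ((normU F E t : Fˣ) : F) ∈ P}

theorem measurableSet_normShell (P : Set ℤ) : MeasurableSet (normShell F E P) := by
  have h : IsLocallyConstant fun t : Eˣ => ord ((normU F E t : Fˣ) : F) :=
    (isLocallyConstant_ord (K := F)).comp_continuous (continuous_normU F E)
  exact ((isOpen_discrete P).preimage h.continuous).measurableSet

theorem setIntegral_normShell_mul (ψ : Eˣ → ℂ) (x : Eˣ) (P : Set ℤ) :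
    ∫ t in normShell F E {k | k + ord ((normU F E x : Fˣ) : F) ∈ P}, ψ (x * t) ∂μE =
      ∫ t in normShell F E P, ψ t ∂μE := by
  rw [← integral_indicator (measurableSet_normShell _),
    ← integral_indicator (measurableSet_normShell _),
    ← integral_mul_left_eq_self ((normShell F E P).indicator ψ) x]
  congr 1
  ext t
  have h : t ∈ normShell F E {k | k + ord ((normU F E x : Fˣ) : F) ∈ P} ↔
      x * t ∈ normShell F E P := by
    simp only [normShell, Set.mem_ofPred_eq, map_mul, unit_ord_mul, add_comm]
  by_cases h' : x * t ∈ normShell F E P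
  · rw [Set.indicator_of_mem h', Set.indicator_of_mem (h.mpr h')]
  · rw [Set.indicator_of_notMem h', Set.indicator_of_notMem (fun h'' => h' (h.mp h''))]

theorem integrableOn_normShell {ψ : Eˣ → ℂ} (hψ : Continuous ψ) (k : ℤ) :
    IntegrableOn ψ (normShell F E {k}) μE := by
  refine (hψ.continuousOn.integrableOn_compact (isCompact_shells E (-|k|) |k|)).mono_set
    fun t ht => ?_
  have h1 := abs_ord_le (F := F) t
  rw [show ord ((normU F E t : Fˣ) : F) = k from ht] at h1
  exact abs_le.mp h1

/-- Multiplication by ϖ shifts v(Nm t) by 2 and preserves ψ, so any two consecutive shells form a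
fundamental domain for the powers of ϖ. -/
theorem setIntegral_normShell_pair {ψ : Eˣ → ℂ} (hψ : Continuous ψ) {ϖ : Fˣ}
    (hϖ : ord (ϖ : F) = 1) (hper : ∀ t, ψ (incl F E ϖ * t) = ψ t) (c : ℤ) :
    ∫ t in normShell F E {c, c + 1}, ψ t ∂μE = ∫ t in normShell F E {0, 1}, ψ t ∂μE := by
  have h1 (c : ℤ) : ∫ t in normShell F E {c, c + 1}, ψ t ∂μE =
      ∫ t in normShell F E {c}, ψ t ∂μE + ∫ t in normShell F E {c + 1}, ψ t ∂μE := by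
    have e : normShell F E {c, c + 1} = normShell F E {c} ∪ normShell F E {c + 1} := by
      ext t; simp [normShell]
    rw [e, setIntegral_union ?_ (measurableSet_normShell _) (integrableOn_normShell μE hψ _)
      (integrableOn_normShell μE hψ _)]
    rw [Set.disjoint_left]
    intro t ht ht'
    have h2 : ord ((normU F E t : Fˣ) : F) = c := ht
    have h3 : ord ((normU F E t : Fˣ) : F) = c + 1 := ht'
    omega
  have h2 (c : ℤ) : ∫ t in normShell F E {c + 2}, ψ t ∂μE = ∫ t in normShell F E {c}, ψ t ∂μE := by
    have h := setIntegral_normShell_mul (F := F) μE ψ (incl F E ϖ) {c + 2}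
    simp only [hper] at h
    rw [← h]
    congr 2
    ext k
    rw [normU_incl, Units.val_pow_eq_pow_val, ord_pow 2 ϖ.ne_zero, hϖ]
    simp
  have h3 (c : ℤ) : ∫ t in normShell F E {c + 1, c + 1 + 1}, ψ t ∂μE =
      ∫ t in normShell F E {c, c + 1}, ψ t ∂μE := by
    rw [h1, h1, add_assoc c 1 1, one_add_one_eq_two, h2, add_comm]
  induction c using Int.induction_on with
  | zero => rfl
  | succ k ih => rw [h3, ih]
  | pred k ih =>
    rw [← ih, ← h3 (-(k : ℤ) - 1), sub_add_cancel]

theorem fundDom_eq_normShell : fundDom F E = normShell F E {0, 1} := rfl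

/-- The orbital integral modulo the center of a function invariant under `ϖ`, as an orbital
integral. -/
theorem orbIntMod_eq {ϖ : Fˣ} (hϖ : ord (ϖ : F) = 1) (hΩϖ : Ω (incl F E ϖ) = 1)
    (hΩ : Continuous Ω) {b : Eˣ} (hb : (ε : F) * Algebra.norm F (b : E) ≠ 1) (Ξ : Set Fˣ)
    {f : quat F E ε → ℂ} (hf : ∀ h₁, Continuous fun r => f (orbPt ε b hb h₁ r))
    (hper : ∀ h₁ r, f (central ε ϖ * orbPt ε b hb h₁ r) = f (orbPt ε b hb h₁ r)) :
    orbIntMod μF μE Ω Ξ (delta ε b hb) f =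
      ((μF.real {z | z ∈ Ξ ∧ ord (z : F) = 0} : ℝ) : ℂ)⁻¹ *
        orbInt μF μE Ω (delta ε b hb) ((detDom F E ε).indicator f) := by
  have key (h₁ : Eˣ) : ∫ h₂ in fundDom F E, orbIntegrand Ω (delta ε b hb) f h₁ h₂ ∂μE =
      ∫ h₂, orbIntegrand Ω (delta ε b hb) ((detDom F E ε).indicator f) h₁ h₂ ∂μE := by
    set ψ : Eˣ → ℂ := fun r => f (orbPt ε b hb h₁ r) * ((Ω r)⁻¹ : ℂˣ) with hψ
    have hψc : Continuous ψ := (hf h₁).mul (Units.continuous_val.comp hΩ.inv)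
    have hψp (t : Eˣ) : ψ (incl F E ϖ * t) = ψ t := by
      simp only [hψ, orbPt_incl_mul, hper, map_mul, hΩϖ, one_mul]
    have hs := setIntegral_normShell_pair μE hψc hϖ hψp
    -- The reduced norm on the orbit is Nm(r)(1 - x), so the restriction to v(det) ∈ {0, 1} selects
    -- the shells -d and -d + 1 in r. Their integral equals that over the shells 0 and 1.
    set d := ord (1 - (ε : F) * Algebra.norm F (b : E))
    have hd (r : Eˣ) : orbPt ε b hb h₁ r ∈ detDom F E ε ↔ r ∈ normShell F E {-d, -d + 1} := by
      rw [mem_detDom, qdet_orbPt, ord_mul (norm_ne_zero r.ne_zero) (sub_ne_zero.mpr hb.symm)]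
      change _ ↔ ord (Algebra.norm F (r : E)) = -d ∨ ord (Algebra.norm F (r : E)) = -d + 1
      omega
    have e1 : ∫ h₂ in fundDom F E, orbIntegrand Ω (delta ε b hb) f h₁ h₂ ∂μE =
        ∫ t in normShell F E {0, 1}, ψ t ∂μE := by
      have h := setIntegral_normShell_mul (F := F) μE ψ h₁⁻¹
        {-ord ((normU F E h₁ : Fˣ) : F), -ord ((normU F E h₁ : Fˣ) : F) + 1}
      rw [hs] at h
      rw [← h]
      simp only [orbIntegrand_eq, hψ]
      congr 2
      rw [fundDom_eq_normShell]
      congr 1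
      ext k
      rw [map_inv, unit_ord_inv]
      simp only [Set.mem_insert_iff, Set.mem_singleton_iff, Set.mem_ofPred_eq]
      omega
    have e2 : ∫ h₂, orbIntegrand Ω (delta ε b hb) ((detDom F E ε).indicator f) h₁ h₂ ∂μE =
        ∫ t in normShell F E {-d, -d + 1}, ψ t ∂μE := by
      rw [integral_orbIntegrand, ← integral_indicator (measurableSet_normShell _)]
      congr 1
      ext r
      by_cases h : r ∈ normShell F E {-d, -d + 1}
      · rw [Set.indicator_of_mem h, Set.indicator_of_mem ((hd r).mpr h)]
      · rw [Set.indicator_of_notMem h, Set.indicator_of_notMem fun h' => h ((hd r).mp h'), zero_mul]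
    rw [e1, e2, hs]
  rw [orbIntMod, orbInt, quotInt_univ, quotInt_univ]
  simp only [quotInt, key]
  rw [integral_const_mul]
  ring

/-- A central translation multiplies r by z, and invariance of the measure removes it because Ω is
trivial on z. -/
theorem orbInt_central_mul {b : Eˣ} (hb : (ε : F) * Algebra.norm F (b : E) ≠ 1)
    (f : quat F E ε → ℂ) {z : Fˣ} (hz : Ω (incl F E z) = 1) :
    orbInt μF μE Ω (delta ε b hb) (fun g => f (central ε z * g)) =
      orbInt μF μE Ω (delta ε b hb) f := by
  rw [orbInt, orbInt]
  congr 1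
  ext h₁
  rw [integral_orbIntegrand, integral_orbIntegrand,
    ← integral_mul_left_eq_self (fun r => f (orbPt ε b hb h₁ r) * ((Ω r)⁻¹ : ℂˣ)) (incl F E z)]
  simp only [orbPt_incl_mul, map_mul, hz, one_mul]

theorem isSmoothCompact_sum {X ι : Type*} [TopologicalSpace X] (s : Finset ι) {f : ι → X → ℂ}
    (hf : ∀ i ∈ s, IsSmoothCompact (f i)) : IsSmoothCompact fun x => ∑ i ∈ s, f i x := by
  classical
  induction s using Finset.induction_on with
  | empty => exact ⟨IsLocallyConstant.const (0 : ℂ), HasCompactSupport.zero⟩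
  | insert i s hi ih =>
    have h := (hf i (Finset.mem_insert_self i s)).linear
      (ih fun j hj => hf j (Finset.mem_insert_of_mem hj)) 1 1
    simpa only [Finset.sum_insert hi, one_mul] using h

theorem orbInt_sum (hΩ : Continuous Ω) {b : Eˣ} (hb : (ε : F) * Algebra.norm F (b : E) ≠ 1)
    {ι : Type*} (s : Finset ι) {f : ι → quat F E ε → ℂ} (hf : ∀ i ∈ s, IsSmoothCompact (f i)) :
    orbInt μF μE Ω (delta ε b hb) (fun x => ∑ i ∈ s, f i x) =
      ∑ i ∈ s, orbInt μF μE Ω (delta ε b hb) (f i) := by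
  classical
  induction s using Finset.induction_on with
  | empty =>
    rw [Finset.sum_empty, orbInt_eq_of_forall μF μE Ω hb _ (A := 0), mul_zero]
    simp
  | insert i s hi ih =>
    have hs : ∀ j ∈ s, IsSmoothCompact (f j) := fun j hj => hf j (Finset.mem_insert_of_mem hj)
    have h := orbInt_linear μF μE Ω hb
      (integrable_orbIntegrand μE Ω hΩ hb (hf i (Finset.mem_insert_self i s)))
      (integrable_orbIntegrand μE Ω hΩ hb (isSmoothCompact_sum s hs)) 1 1
    simp only [one_mul] at h
    simp only [Finset.sum_insert hi]
    rw [h, ih hs]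

/-- Every smooth function of compact support can be folded into one that is supported on `detDom`,
without changing its orbital integrals. -/
theorem exists_folding (hΩ : Continuous Ω) {ϖ : Fˣ} (hϖ : ord (ϖ : F) = 1)
    (hΩϖ : Ω (incl F E ϖ) = 1) {n : ℕ} {f : quat F E ε → ℂ} (hf : IsSmoothCompact f)
    (hfn : CentralInv n f) : ∃ f' : quat F E ε → ℂ, IsSmoothCompact f' ∧ CentralInv n f' ∧
      (detDom F E ε).indicator f' = f' ∧
      ∀ (b : Eˣ) (hb : (ε : F) * Algebra.norm F (b : E) ≠ 1),
        orbInt μF μE Ω (delta ε b hb) f' = orbInt μF μE Ω (delta ε b hb) f := by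
  classical
  obtain ⟨M, hM, hM'⟩ := exists_subset_qBox hf.2.isCompact
  -- Cut f into slices by the integer part of v(det)/2 and move the i-th slice into `detDom` by ϖⁱ.
  -- Compact support leaves finitely many slices, and Ω(ϖ) = 1 preserves their orbital integrals.
  set fi : ℤ → quat F E ε → ℂ := fun i => {g | ord (qdet g) / 2 = i}.indicator f with hfi
  have hcl (i : ℤ) : IsClopen {g : quat F E ε | ord (qdet g) / 2 = i} :=
    (isClopen_discrete {k : ℤ | k / 2 = i}).preimage isLocallyConstant_ord_qdet.continuous
  have h1 (i : ℤ) : IsSmoothCompact (fi i) := by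
    refine ⟨isLocallyConstant_indicator (hcl i) hf.1,
      HasCompactSupport.intro hf.2.isCompact fun g hg => ?_⟩
    have : f g = 0 := image_eq_zero_of_notMem_tsupport hg
    simp [hfi, Set.indicator_apply, this]
  have hshift (i : ℤ) : IsSmoothCompact fun g => fi i (central ε (ϖ ^ i) * g) :=
    ⟨(h1 i).1.comp_continuous (continuous_const_mul _),
      (h1 i).2.comp_homeomorph (Homeomorph.mulLeft (central ε (ϖ ^ i)))⟩
  have hΩi (i : ℤ) : Ω (incl F E (ϖ ^ i)) = 1 := by rw [map_zpow, map_zpow, hΩϖ, _root_.one_zpow]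
  have hmem (i : ℤ) (g : quat F E ε) (h : g ∉ detDom F E ε) : fi i (central ε (ϖ ^ i) * g) = 0 := by
    apply Set.indicator_of_notMem
    rw [mem_detDom] at h
    rw [Set.mem_ofPred_eq, ord_qdet_central_mul, unit_ord_zpow, hϖ]
    omega
  set s := Finset.Icc (-(M : ℤ)) M
  have hsum : (fun g => ∑ i ∈ s, fi i g) = f := by
    ext g
    by_cases hg : f g = 0
    · rw [hg]
      exact Finset.sum_eq_zero fun i _ => by simp [hfi, Set.indicator_apply, hg]
    · have hg' : g ∈ tsupport f := subset_tsupport f hg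
      have h2 := (hM hg').2.2
      have h3 := hM' g hg'
      rw [Finset.sum_eq_single_of_mem (ord (qdet g) / 2) (Finset.mem_Icc.mpr (by omega))]
      · exact Set.indicator_of_mem (by rfl) _
      · intro i _ hi
        exact Set.indicator_of_notMem (s := {g : quat F E ε | ord (qdet g) / 2 = i})
          (fun h => hi (Eq.symm h)) f
  refine ⟨fun g => ∑ i ∈ s, fi i (central ε (ϖ ^ i) * g), isSmoothCompact_sum s fun i _ => hshift i,
    fun z hz g => Finset.sum_congr rfl fun i _ => ?_, ?_, fun b hb => ?_⟩
  · have h2 : ord (z : F) = 0 := by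
      have := hz.2
      rw [ord_incl] at this
      exact (mul_eq_zero.mp this).resolve_left (by linarith [ramIdx_pos F E])
    rw [← mul_assoc, ← central_mul, mul_comm, central_mul, mul_assoc]
    simp only [hfi, Set.indicator_apply, Set.mem_ofPred_eq, ord_qdet_central_mul z, h2, mul_zero,
      zero_add, hfn z hz]
  · ext g
    by_cases h : g ∈ detDom F E ε
    · rw [Set.indicator_of_mem h]
    · rw [Set.indicator_of_notMem h]
      exact (Finset.sum_eq_zero fun i _ => hmem i g h).symm
  · rw [orbInt_sum μF μE Ω hΩ hb s fun i _ => hshift i]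
    simp only [orbInt_central_mul μF μE Ω hb _ (hΩi _)]
    rw [← orbInt_sum μF μE Ω hΩ hb s fun i _ => h1 i, hsum]

end Folding

section MultiplicityMod

variable {F E : Type*} [Field F] [ValuativeRel F] [TopologicalSpace F]
  [IsNonarchimedeanLocalField F] [Field E] [ValuativeRel E] [TopologicalSpace E]
  [IsNonarchimedeanLocalField E] [Algebra F E] [ValuativeExtension F E]
  [Algebra.IsQuadraticExtension F E] [Algebra.IsSeparable F E] {ε ε' : Fˣ}

/-! ### Multiplicity functions modulo the center -/

/-- On `detDom` the reduced norm of g has bounded valuation, and so has that of its translate in the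
compact set; the central factor between them is then bounded too. -/
theorem IsCompactModCenter.exists_subset_qBox {S : Set (quat F E ε)} (hS : IsCompactModCenter S) :
    ∃ N : ℕ, ∀ g ∈ S, g ∈ detDom F E ε → g ∈ qBox F E ε N N := by
  obtain ⟨Q, hQ, h⟩ := hS
  obtain ⟨M, hM, hM'⟩ := ArithMatching.exists_subset_qBox hQ
  refine ⟨3 * M + 3, fun g hg hd => ?_⟩
  obtain ⟨z, hz⟩ := h g hg
  have h1 := (hM hz).2.2
  have h2 := hM' _ hz
  rw [ord_qdet_central_mul] at h1 h2
  rw [mem_detDom] at hd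
  have h0 : algebraMap F E z ≠ 0 := (map_ne_zero _).mpr z.ne_zero
  have h3 : ord (algebraMap F E z) ≤ M + 1 := by
    rw [ord_algebraMap z.ne_zero]
    rcases ramIdx_eq F E with e | e <;> rw [e] <;> omega
  have key (x : E) (hx : algebraMap F E z * x ∈ ball E (-M)) :
      x ∈ ball E (-((3 * M + 3 : ℕ) : ℤ)) :=
    ball_mono ((mul_mem_ball_iff h0 _).mp hx) (by omega)
  refine ⟨key _ ?_, key _ ?_, by omega⟩
  · rw [← (central_mul_apply z g).1]; exact (hM hz).1
  · rw [← (central_mul_apply z g).2]; exact (hM hz).2.1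

theorem mul_torus_mem_principalMod (hε : 0 ≤ ord (ε : F)) {ϖ : Fˣ} {n : ℕ} (hn : 1 ≤ n)
    {u : quat F E ε} (hu : u ∈ principalMod E ϖ ε n) {a : Eˣ} (ha : a ∈ oneUnits E n) :
    u * torus ε a ∈ principalMod E ϖ ε n := by
  rw [mem_principalMod] at hu ⊢
  obtain ⟨k, hk⟩ := hu
  refine ⟨k, ?_⟩
  rw [← mul_assoc]
  exact mul_torus_mem_principal hε hn hk ha

/-- A special multiplicity function modulo the center is the sum of a locally constant function and
a standard logarithmic singularity along the torus. -/
theorem IsSpecialMultiplicityMod.exists_decomposition (hε : 0 ≤ ord (ε : F)) {ϖ : Fˣ}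
    (hϖ : ord (ϖ : F) = 1) {n : ℕ} (hn : 1 ≤ n) {m : quat F E ε' → ℂ}
    (hm : IsSpecialMultiplicityMod ε' (principalMod E ϖ ε n) m) :
    ∃ (S : Set (quat F E ε')) (φ : quat F E ε' → ℂ), IsClopen S ∧ IsLocallyConstant φ ∧
      (∀ g, g ∉ torusSet ε' → m g = (ord (invPrime g) : ℂ) / 2 * S.indicator 1 g + φ g) ∧
      IsCompact (detDom F E ε' ∩ S) ∧
      (∀ t, torus ε' t ∈ detDom F E ε' ∩ S ↔ t ∈ oneUnits E n) ∧
      IsSmoothCompact ((detDom F E ε').indicator φ) ∧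
      CentralInv n ((detDom F E ε').indicator φ) ∧
      CentralInv n ((detDom F E ε' ∩ S).indicator (1 : quat F E ε' → ℂ)) := by
  obtain ⟨U', ho, hc, hd, hT, hs⟩ := hm.singularity
  obtain ⟨C, hC, hCd, hCm⟩ := hm.support
  obtain ⟨φ, hφ, e⟩ := hs.exists_extension
    (isClopen_detSet hn fun u hu a ha => mul_torus_mem_principalMod hε hn hu ha) hd
    fun g hg h0 => hCd (hCm g hg h0)
  obtain ⟨N₁, hN₁⟩ := hC.exists_subset_qBox
  obtain ⟨N₂, hN₂⟩ := hc.exists_subset_qBox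
  have hS := isClopen_subgroup ho
  have hord (z : Fˣ) (hz : incl F E z ∈ oneUnits E n) : ord (z : F) = 0 := by
    have := hz.2
    rw [ord_incl] at this
    exact (mul_eq_zero.mp this).resolve_left (by linarith [ramIdx_pos F E])
  have hdet (z : Fˣ) (hz : incl F E z ∈ oneUnits E n) (g : quat F E ε') :
      central ε' z * g ∈ detDom F E ε' ↔ g ∈ detDom F E ε' := by
    rw [mem_detDom, mem_detDom, ord_qdet_central_mul, hord z hz, mul_zero, zero_add]
  have hU (z : Fˣ) (hz : incl F E z ∈ oneUnits E n) (g : quat F E ε') :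
      central ε' z * g ∈ U' ↔ g ∈ U' :=
    U'.mul_mem_cancel_left ((hT _).mpr (mem_centralPart_of_mem hε hn hz))
  refine ⟨U', φ, hS, hφ, e, ?_, fun t => ?_,
    ⟨isLocallyConstant_indicator isClopen_detDom hφ, ?_⟩, fun z hz g => ?_, fun z hz g => ?_⟩
  · exact (isCompact_qBox N₂ N₂).of_isClosed_subset (isClopen_detDom.inter hS).1
      fun g hg => hN₂ g hg.2 hg.1
  · rw [Set.mem_inter_iff, SetLike.mem_coe, hT, torus_mem_principalMod hε hn, mem_detDom, qdet_torus]
    constructor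
    · rintro ⟨h, k, hk⟩
      have h1 := hk.2
      rw [unit_ord_mul, ord_incl, unit_ord_zpow, hϖ, mul_one] at h1
      have h2 := ramIdx_mul_ord_norm (F := F) t.ne_zero
      have h3 : k = 0 := by
        rcases ramIdx_eq F E with e | e <;> rw [e] at h1 h2 <;> omega
      rwa [h3, zpow_zero, map_one, one_mul] at hk
    · intro h
      exact ⟨Or.inl ((ord_normU_eq_zero_iff t).mpr h.2), 0, by rwa [zpow_zero, map_one, one_mul]⟩
  · refine HasCompactSupport.intro (isCompact_qBox (max N₁ N₂) (max N₁ N₂))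
      (IsLocallyConstant.eq_zero_of_notMem (isLocallyConstant_indicator isClopen_detDom hφ)
        (isClopen_qBox _ _) fun g hg hg' => ?_)
    by_cases h : g ∈ detDom F E ε'
    · rw [Set.indicator_of_mem h]
      have h1 : m g = 0 := by
        by_contra h0
        exact hg' (qBox_mono (le_max_left _ _) (le_max_left _ _) (hN₁ g (hCm g hg h0) h))
      have h2 := e g hg
      rw [h1, Set.indicator_of_notMem fun h' =>
        hg' (qBox_mono (le_max_right _ _) (le_max_right _ _) (hN₂ g h' h)), mul_zero, zero_add] at h2
      exact h2.symm
    · exact Set.indicator_of_notMem h _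
  -- Off the torus, invariance follows from that of m, of inv' and of U'. The difference is locally
  -- constant, so it vanishes on the torus as well.
  · have h1 : φ (central ε' z * g) - φ g = 0 := by
      refine IsLocallyConstant.eq_zero_of_compl_torusSet
        (f := fun g => φ (central ε' z * g) - φ g)
        ((hφ.comp_continuous (continuous_const_mul _)).sub hφ) (fun g hg => ?_) g
      have h2 := e _ ((central_mul_mem_torusSet z g).not.mpr hg)
      have h3 := e g hg
      rw [hm.invariant z (mem_centralPart_of_mem hε hn hz) g hg, h3, invPrime_central_mul] at h2
      have h4 : (U' : Set (quat F E ε')).indicator (1 : quat F E ε' → ℂ) (central ε' z * g) =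
          (U' : Set (quat F E ε')).indicator 1 g := by
        classical
        simp only [Set.indicator_apply, SetLike.mem_coe, hU z hz, Pi.one_apply]
      rw [h4] at h2
      exact sub_eq_zero.mpr (add_left_cancel h2).symm
    classical
    simp only [Set.indicator_apply, hdet z hz, sub_eq_zero.mp h1]
  · classical
    simp only [Set.indicator_apply, Set.mem_inter_iff, hdet z hz, SetLike.mem_coe, hU z hz,
      Pi.one_apply]

theorem isSmoothCompactMod_periodize (hε : 0 ≤ ord (ε : F)) {ϖ : Fˣ} (hϖ : ord (ϖ : F) = 1) {n : ℕ}
    (hn : 1 ≤ n) {f : quat F E ε' → ℂ} (hf : IsSmoothCompact f) (hfn : CentralInv n f) :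
    IsSmoothCompactMod (centralPart (principalMod E ϖ ε n)) (periodize ϖ f) := by
  refine ⟨isLocallyConstant_periodize ϖ hf.1, fun z hz g => ?_, tsupport f, hf.2, fun g hg =>
    ⟨_, zpow_mem_centralPart hε hn _, subset_tsupport f hg⟩⟩
  obtain ⟨k, hk⟩ := (mem_centralPart hε hn).mp hz
  exact periodize_central_mul hϖ hfn hk g

end MultiplicityMod

/-! ### The identity for U = K_{ε,n} ϖ^ℤ -/

section CongruenceLevelMod

variable {F E : Type*} [Field F] [ValuativeRel F] [TopologicalSpace F]
  [IsNonarchimedeanLocalField F] [MeasurableSpace F] [BorelSpace F]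
  [Field E] [ValuativeRel E] [TopologicalSpace E]
  [IsNonarchimedeanLocalField E] [MeasurableSpace E] [BorelSpace E]
  [Algebra F E] [ValuativeExtension F E]
  [Algebra.IsQuadraticExtension F E] [Algebra.IsSeparable F E] {ε ε' : Fˣ}
  (μF : Measure Fˣ) [μF.IsHaarMeasure] (μE : Measure Eˣ) [μE.IsHaarMeasure]
  (Ω : Eˣ →* ℂˣ)

theorem continuous_orbPt {b : Eˣ} (hb : (ε : F) * Algebra.norm F (b : E) ≠ 1) (h₁ : Eˣ) :
    Continuous (orbPt ε b hb h₁) :=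
  continuous_const.mul ((continuous_torus (F := F) (E := E) (ε := ε)).comp
    (continuous_const_mul h₁))

theorem orbIntMod_periodize {ϖ : Fˣ} (hϖ : ord (ϖ : F) = 1) (hΩϖ : Ω (incl F E ϖ) = 1)
    (hΩ : Continuous Ω) {b : Eˣ} (hb : (ε : F) * Algebra.norm F (b : E) ≠ 1) (Ξ : Set Fˣ)
    {f : quat F E ε → ℂ} (hf : IsLocallyConstant f) {n : ℕ} (hfn : CentralInv n f) :
    orbIntMod μF μE Ω Ξ (delta ε b hb) (periodize ϖ f) =
      ((μF.real {z | z ∈ Ξ ∧ ord (z : F) = 0} : ℝ) : ℂ)⁻¹ *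
        orbInt μF μE Ω (delta ε b hb) ((detDom F E ε).indicator f) := by
  rw [orbIntMod_eq μF μE Ω hϖ hΩϖ hΩ hb Ξ
    (fun h₁ => (isLocallyConstant_periodize ϖ hf).continuous.comp (continuous_orbPt hb h₁))
    (fun h₁ r => periodize_central_mul hϖ hfn (k := -1) (z := ϖ) (by
      rw [_root_.zpow_neg_one, inv_mul_cancel, map_one]; exact one_mem _) _), indicator_periodize]

theorem centralInv_principal (hε : 0 ≤ ord (ε : F)) {n : ℕ} (hn : 1 ≤ n) :
    CentralInv n ((principal E ε n).indicator (1 : quat F E ε → ℂ)) := by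
  intro z hz g
  have h : central ε z * g ∈ principal E ε n ↔ g ∈ principal E ε n := by
    rw [mem_principal hε hn, mem_principal hε hn, (central_mul_apply z g).1,
      (central_mul_apply z g).2, ← incl_val, mul_sub_one_mem_ball hz,
      mul_mem_ball_iff (incl F E z).ne_zero, hz.2, sub_zero]
  classical
  simp only [Set.indicator_apply, h, Pi.one_apply]

theorem measureReal_centralPart_ne_zero (hε : 0 ≤ ord (ε : F)) {ϖ : Fˣ} (hϖ : ord (ϖ : F) = 1)
    {n : ℕ} (hn : 1 ≤ n) :
    ((μF.real {z | z ∈ centralPart (principalMod E ϖ ε n) ∧ ord (z : F) = 0} : ℝ) : ℂ) ≠ 0 := by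
  rw [Complex.ofReal_ne_zero, Measure.real, ENNReal.toReal_ne_zero]
  constructor
  · rw [centralPart_inter hε hϖ hn]
    exact (((isOpen_oneUnits E n).preimage (continuous_incl F E)).measure_pos μF
      ⟨1, by rw [Set.mem_preimage, map_one]; exact one_mem _⟩).ne'
  · exact ((measure_mono fun z hz => hz.2).trans_lt (isCompact_shell F 0).measure_lt_top).ne

theorem orbIntMod_principalMod (hε : 0 ≤ ord (ε : F)) {ϖ : Fˣ} (hϖ : ord (ϖ : F) = 1)
    (hΩϖ : Ω (incl F E ϖ) = 1) (hΩ : Continuous Ω) {n : ℕ} (hn : 1 ≤ n)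
    (hΩn : ∀ u ∈ oneUnits E n, Ω u = 1) {b : Eˣ} (hb : (ε : F) * Algebra.norm F (b : E) ≠ 1)
    (Ξ : Set Fˣ) :
    orbIntMod μF μE Ω Ξ (delta ε b hb) ((principalMod E ϖ ε n).indicator 1) =
      ((μF.real {z | z ∈ Ξ ∧ ord (z : F) = 0} : ℝ) : ℂ)⁻¹ *
        (orbVol F E μF μE * ((μE.real (oneUnits E n : Set Eˣ) : ℂ) *
          if (n : ℤ) ≤ ord (b : E) then 1 else 0)) := by
  rw [indicator_principalMod hε hϖ hn, orbIntMod_periodize μF μE Ω hϖ hΩϖ hΩ hb Ξ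
    (f := (principal E ε n).indicator 1)
    (isLocallyConstant_indicator (isClopen_principal hε hn) (IsLocallyConstant.const 1))
    (centralInv_principal hε hn), indicator_detDom_principal hε hn,
    orbInt_principal μF μE Ω hε hn hΩn hb]

variable [MeasurableSpace (unitaryW F E)] [BorelSpace (unitaryW F E)]
  (μH : Measure (unitaryW F E)) [μH.IsHaarMeasure]

/-- The arithmetic matching for the groups `K_{ε,n} ϖ^ℤ`. -/
theorem arith_matching_principalMod (hΩ : Continuous Ω)
    (hη : ∫ z in shell F 0, eta F E z ∂μF = 0 ∨
      ∀ z : Fˣ, eta F E z = if Even (ord (z : F)) then 1 else -1)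
    (hεε' : eta F E ε' = -eta F E ε) (hε : 0 ≤ ord (ε : F)) {ϖ : Fˣ} (hϖ : ord (ϖ : F) = 1)
    (hΩϖ : Ω (incl F E ϖ) = 1)
    {n : ℕ} (hn : (ord (Algebra.norm F (trOne F E))).natAbs + 1 ≤ n)
    (hΩn : ∀ u ∈ oneUnits E n, Ω u = 1) :
    (∃ f : GL (Fin 2) E → ℂ, IsSmoothCompact f ∧
      PurelyMatchesMod μF μE μH Ω (centralPart (principalMod E ϖ ε n)) ε' f
        ((principalMod E ϖ ε n).indicator 1)) ∧
    ∀ f : GL (Fin 2) E → ℂ, IsSmoothCompact f →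
      PurelyMatchesMod μF μE μH Ω (centralPart (principalMod E ϖ ε n)) ε' f
        ((principalMod E ϖ ε n).indicator 1) →
      ∀ m : quat F E ε' → ℂ, IsSpecialMultiplicityMod ε' (principalMod E ϖ ε n) m →
        ∃ fbar : quat F E ε' → ℂ,
          IsSmoothCompactMod (centralPart (principalMod E ϖ ε n)) fbar ∧
          ∀ (b : Eˣ) (hb : (ε' : F) * Algebra.norm F (b : E) ≠ 1),
            Integrable (Function.uncurry (orbIntegrand Ω (delta ε' b hb) m))
              ((μE.restrict (fundDom F E)).prod (μE.restrict (fundDom F E))) ∧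
            ∃ D : ℂ,
              HasDerivAt
                (hermOrb μF μE Ω (hermFun μH f) ((ε' : F) * Algebra.norm F (b : E))) D 0 ∧
              2 * orbIntMod μF μE Ω (centralPart (principalMod E ϖ ε n)) (delta ε' b hb) m *
                  (-Real.log (resCard F) : ℂ) =
                D + orbIntMod μF μE Ω (centralPart (principalMod E ϖ ε n))
                  (delta ε' b hb) fbar := by
  have hn1 : 1 ≤ n := by omega
  have hO {b : Eˣ} (hb : (ε : F) * Algebra.norm F (b : E) ≠ 1) :=
    orbIntMod_principalMod μF μE Ω hε hϖ hΩϖ hΩ hn1 hΩn hb (centralPart (principalMod E ϖ ε n))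
  have hlam := inv_ne_zero (measureReal_centralPart_ne_zero (E := E) μF hε hϖ hn1)
  constructor
  · obtain ⟨f, hf, h1, h2⟩ := exists_pure_matching μF μE Ω hΩ μH hεε' hε hn hΩn
      ((μF.real {z | z ∈ centralPart (principalMod E ϖ ε n) ∧ ord (z : F) = 0} : ℝ) : ℂ)⁻¹
    exact ⟨f, hf, fun b hb => by rw [h1 b hb, hO hb], h2⟩
  intro f hf hmatch m hm
  obtain ⟨S, φ, hS, hφ, e, hSc, hST, hφc, hφn, hSn⟩ := hm.exists_decomposition hε hϖ hn1
  obtain ⟨M, hM⟩ := exists_isTest_hermFun μH hf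
  -- The compact case is applied to the restriction of m to `detDom`, with S and φ restricted
  -- accordingly. The factor lam is the inverse volume relating orbital integrals modulo Ξ to
  -- ordinary ones.
  obtain ⟨f₁, hf₁, hf₁n, h1⟩ := exists_arith_matching μF μE Ω hΩ hη hεε' hn1 hΩn hM
    hlam (N₁ := n) (fun b hb hb' => by
      rw [hmatch.1 b hb, hO hb, if_pos hb', mul_one])
    hmatch.2 (isClopen_detDom.inter hS) hSc hST (m := (detDom F E ε').indicator m) hφc (fun g hg => by
      by_cases h : g ∈ detDom F E ε'
      · rw [Set.indicator_of_mem h, Set.indicator_of_mem h, e g hg]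
        by_cases h' : g ∈ S
        · rw [Set.indicator_of_mem h', Set.indicator_of_mem (Set.mem_inter h h')]
        · rw [Set.indicator_of_notMem h', Set.indicator_of_notMem fun h'' => h' h''.2]
      · rw [Set.indicator_of_notMem h, Set.indicator_of_notMem h,
          Set.indicator_of_notMem fun h'' => h h''.1]
        ring)
  have hf₁n := hf₁n hφn hSn
  obtain ⟨f₂, hf₂, hf₂n, hf₂d, h2⟩ := exists_folding μF μE Ω hΩ hϖ hΩϖ hf₁ hf₁n
  refine ⟨periodize ϖ f₂, isSmoothCompactMod_periodize hε hϖ hn1 hf₂ hf₂n, fun b hb => ?_⟩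
  -- For fixed x the valuation of inv' is constant on the orbit; freezing it replaces m by a
  -- continuous function with the same values there, which settles integrability over compact
  -- domains and measurability.
  set A : quat F E ε' → ℂ := fun g =>
    (ord ((ε' : F) * Algebra.norm F (b : E) / (1 - ε' * Algebra.norm F (b : E))) : ℂ) / 2 *
      S.indicator 1 g + φ g with hA
  have hAc : Continuous A :=
    (continuous_const.mul
      (isLocallyConstant_indicator hS (IsLocallyConstant.const 1)).continuous).add hφ.continuous
  have hmA (h₁ r : Eˣ) : m (orbPt ε' b hb h₁ r) = A (orbPt ε' b hb h₁ r) := by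
    rw [e _ (orbPt_notMem_torusSet hb h₁ r), invPrime_orbPt]
  refine ⟨?_, ?_⟩
  · rw [orbIntegrand_congr Ω hb hmA, Measure.prod_restrict]
    refine ContinuousOn.integrableOn_compact ((isCompact_fundDom F E).prod (isCompact_fundDom F E))
      (Continuous.continuousOn ?_)
    have ht := continuous_torus (F := F) (E := E) (ε := ε')
    have h1 : Continuous fun p : Eˣ × Eˣ => A ((torus ε' p.1)⁻¹ * delta ε' b hb * torus ε' p.2) :=
      hAc.comp ((((ht.comp continuous_fst).inv).mul continuous_const).mul (ht.comp continuous_snd))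
    have h2 : Continuous fun p : Eˣ × Eˣ => (Ω p.1 : ℂ) :=
      Units.continuous_val.comp (hΩ.comp continuous_fst)
    have h3 : Continuous fun p : Eˣ × Eˣ => (((Ω p.2)⁻¹ : ℂˣ) : ℂ) :=
      Units.continuous_val.comp (hΩ.comp continuous_snd).inv
    exact (h1.mul h2).mul h3
  · obtain ⟨D, hD, hD'⟩ := (h1 b hb).2
    refine ⟨D, hD, ?_⟩
    rw [orbIntMod_periodize μF μE Ω hϖ hΩϖ hΩ hb _ hf₂.1 hf₂n, hf₂d, h2 b hb,
      orbIntMod_eq μF μE Ω hϖ hΩϖ hΩ hb, hD']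
    · intro h₁
      simp only [hmA]
      exact hAc.comp (continuous_orbPt hb h₁)
    · intro h₁ r
      have := zpow_mem_centralPart (E := E) (ϖ := ϖ) hε hn1 1
      rw [zpow_one] at this
      exact hm.invariant ϖ this _ (orbPt_notMem_torusSet hb h₁ r)

end CongruenceLevelMod

end ArithMatching

/-! ### The main theorem -/

open ArithMatching in
theorem proposition12 {F E : Type*}
    [Field F] [ValuativeRel F] [TopologicalSpace F] [IsNonarchimedeanLocalField F]
    [MeasurableSpace F] [BorelSpace F]
    [Field E] [ValuativeRel E] [TopologicalSpace E] [IsNonarchimedeanLocalField E]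
    [MeasurableSpace E] [BorelSpace E]
    [Algebra F E] [ValuativeExtension F E] [Algebra.IsQuadraticExtension F E]
    [Algebra.IsSeparable F E]
    (μF : Measure Fˣ) [μF.IsHaarMeasure] (μE : Measure Eˣ) [μE.IsHaarMeasure]
    [MeasurableSpace (unitaryW F E)] [BorelSpace (unitaryW F E)]
    (μH : Measure (unitaryW F E)) [μH.IsHaarMeasure]
    (Ω : Eˣ →* ℂˣ) (hΩ : Continuous Ω)
    (ϖ : Fˣ) (hϖ : ord (ϖ : F) = 1) (ε₀ : Fˣ) (hε₀ : IsNonNormRep E ϖ ε₀) :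
    -- the case `U = K_{ε,n}`
    (∀ ε ε' : Fˣ, (ε = 1 ∧ ε' = ε₀) ∨ (ε = ε₀ ∧ ε' = 1) →
      ∃ n₀ : ℕ, ∀ n ≥ n₀,
        (∃ f : GL (Fin 2) E → ℂ, IsSmoothCompact f ∧
          PurelyMatches μF μE μH Ω ε' f ((principal E ε n).indicator 1)) ∧
        ∀ f : GL (Fin 2) E → ℂ, IsSmoothCompact f →
          PurelyMatches μF μE μH Ω ε' f ((principal E ε n).indicator 1) →
          ∀ m : quat F E ε' → ℂ, IsSpecialMultiplicity ε' (principal E ε n) m →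
            ∃ fbar : quat F E ε' → ℂ, IsSmoothCompact fbar ∧
              ∀ (b : Eˣ) (hb : (ε' : F) * Algebra.norm F (b : E) ≠ 1),
                Integrable (Function.uncurry (orbIntegrand Ω (delta ε' b hb) m))
                  ((μE.restrict (fundDom F E)).prod μE) ∧
                ∃ D : ℂ,
                  HasDerivAt
                    (hermOrb μF μE Ω (hermFun μH f) ((ε' : F) * Algebra.norm F (b : E))) D 0 ∧
                  2 * orbInt μF μE Ω (delta ε' b hb) m * (-Real.log (resCard F) : ℂ) =
                    D + orbInt μF μE Ω (delta ε' b hb) fbar) ∧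
    -- the case `U = K_{ε,n} ϖ^ℤ`, with `ε ≠ 1`
    (Ω (incl F E ϖ) = 1 →
      ∃ n₀ : ℕ, ∀ n ≥ n₀,
        (∃ f : GL (Fin 2) E → ℂ, IsSmoothCompact f ∧
          PurelyMatchesMod μF μE μH Ω (centralPart (principalMod E ϖ ε₀ n)) 1 f
            ((principalMod E ϖ ε₀ n).indicator 1)) ∧
        ∀ f : GL (Fin 2) E → ℂ, IsSmoothCompact f →
          PurelyMatchesMod μF μE μH Ω (centralPart (principalMod E ϖ ε₀ n)) 1 f
            ((principalMod E ϖ ε₀ n).indicator 1) →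
          ∀ m : quat F E (1 : Fˣ) → ℂ, IsSpecialMultiplicityMod 1 (principalMod E ϖ ε₀ n) m →
            ∃ fbar : quat F E (1 : Fˣ) → ℂ,
              IsSmoothCompactMod (centralPart (principalMod E ϖ ε₀ n)) fbar ∧
              ∀ (b : Eˣ) (hb : ((1 : Fˣ) : F) * Algebra.norm F (b : E) ≠ 1),
                Integrable (Function.uncurry (orbIntegrand Ω (delta 1 b hb) m))
                  ((μE.restrict (fundDom F E)).prod (μE.restrict (fundDom F E))) ∧
                ∃ D : ℂ,
                  HasDerivAt
                    (hermOrb μF μE Ω (hermFun μH f) (((1 : Fˣ) : F) * Algebra.norm F (b : E))) D 0 ∧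
                  2 * orbIntMod μF μE Ω (centralPart (principalMod E ϖ ε₀ n)) (delta 1 b hb) m *
                      (-Real.log (resCard F) : ℂ) =
                    D + orbIntMod μF μE Ω (centralPart (principalMod E ϖ ε₀ n))
                      (delta 1 b hb) fbar) := by
  have hε₀n := nonNormRep_notMem hϖ hε₀
  have hε₀ord : 0 ≤ ord (ε₀ : F) := by
    by_cases h : ord (algebraMap F E ϖ) = 1
    · rw [hε₀.1 h, hϖ]; exact zero_le_one
    · exact (hε₀.2 h).1.ge
  have hη := shell_eta_dichotomy μF hϖ hε₀
  have h1 : (1 : Fˣ) ∈ normGroup F E := one_mem _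
  have hone : 0 ≤ ord ((1 : Fˣ) : F) := by simp
  obtain ⟨n₁, -, hn₁⟩ := exists_trivial_on_oneUnits Ω hΩ
  -- The level must exceed the conductor of Ω, so that Ω is trivial on U ∩ T, and |v(Nm τ)|, so that
  -- the section of the orbit map is available on the test function.
  refine ⟨fun ε ε' hεε' => ⟨n₁ + ((ord (Algebra.norm F (trOne F E))).natAbs + 1), fun n hn => ?_⟩,
    fun hΩϖ => ⟨n₁ + ((ord (Algebra.norm F (trOne F E))).natAbs + 1), fun n hn => ?_⟩⟩
  · have hΩn : ∀ u ∈ oneUnits E n, Ω u = 1 := fun u hu => hn₁ u (oneUnits_anti (by omega) hu)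
    rcases hεε' with ⟨rfl, rfl⟩ | ⟨rfl, rfl⟩
    · exact arith_matching_principal μF μE μH Ω hΩ hη (by rw [eta_of_mem h1, eta_of_notMem hε₀n])
        hone (Or.inr hε₀n) (by omega) hΩn
    · exact arith_matching_principal μF μE μH Ω hΩ hη
        (by rw [eta_of_mem h1, eta_of_notMem hε₀n, neg_neg]) hε₀ord (Or.inl rfl) (by omega) hΩn
  · exact arith_matching_principalMod μF μE Ω μH hΩ hη
      (by rw [eta_of_mem h1, eta_of_notMem hε₀n, neg_neg]) hε₀ord hϖ hΩϖ (by omega)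
      fun u hu => hn₁ u (oneUnits_anti (by omega) hu)
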